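/- Let $H>0$ be the height of the (rescaled) container. For $k\in\mathbb{R}\setminus\{0\}$ call a complex-valued function $w\in C^5([0,H])$ admissible if $$w=\frac{dw}{dz}=\Big(-\frac{d^2}{dz^2}+k^2\Big)^2w=0\qquad\text{for } z\in\{0,H\}.$$ A stable background profile is an absolutely continuous function $\tau:[0,H]\to\mathbb{R}$ with $\tau(0)=1$ and $\tau(H)=0$ whose slope $\xi=\frac{d\tau}{dz}$ satisfies, for all $k\in\mathbb{R}\setminus\{0\}$ and all admissible $w$, $$2\,\mathrm{Re}\int_0^H\xi\, w\Big(-\frac{d^2}{dz^2}+k^2\Big)^2\overline{w}\,dz+\int_0^H k^{-2}\Big|\frac{d}{dz}\Big(-\frac{d^2}{dz^2}+k^2\Big)^2w\Big|^2dz+\int_0^H\Big|\Big(-\frac{d^2}{dz^2}+k^2\Big)^2w\Big|^2dz\;\ge\;0.\qquad(\ast)$$ Let ${\rm Nu}_{\rm BF}(H)\in[0,\infty]$ be the infimum of $\int_0^H(\frac{d\tau}{dz})^2dz$ over all stable background profiles (with $\inf\emptyset=\infty$). **Theorem.** There are universal constants $c>0$ and $C<\infty$ such that the following holds. 1. For all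 $H\ge C$ and every stable background profile $\tau$ on $[0,H]$, $$\int_0^H\Big(\frac{d\tau}{dz}\Big)^2dz\;\ge\;c\,(\ln H)^{\frac1{15}}.$$ 2. In particular, for all $H\ge C$, ${\rm Nu}_{\rm BF}(H)\ge c\,(\ln H)^{\frac1{15}}$. 3. Equivalently, in a container of unit height at Rayleigh number ${\rm Ra}$ (so that $H={\rm Ra}^{1/3}$), let $\widetilde{\rm Nu}_{\rm BF}({\rm Ra})$ be the infimum of $\int_0^1(\frac{d\tau}{dz})^2dz$ over all absolutely continuous $\tau$ on $[0,1]$ with $\tau(0)=1$, $\tau(1)=0$ that satisfy $(\ast)$ with $H=1$ and with the two positive terms multiplied by ${\rm Ra}^{-1}$. Then for all ${\rm Ra}\ge C$, $$\widetilde{\rm Nu}_{\rm BF}({\rm Ra})\;\ge\;c\,{\rm Ra}^{\frac13}(\ln{\rm Ra})^{\frac1{15}}.$$ -/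

import Mathlib

open MeasureTheory intervalIntegral
open scoped ENNReal

noncomputable section

namespace BackgroundField

/-- The operator `-d²/dz² + k²` acting on complex-valued functions of the vertical variable. -/
def helmholtz (k : ℝ) (w : ℝ → ℂ) : ℝ → ℂ :=
  fun z => -iteratedDeriv 2 w z + (k : ℂ) ^ 2 * w z

/-- The operator `(-d²/dz² + k²)²`. -/
def helmholtzSq (k : ℝ) (w : ℝ → ℂ) : ℝ → ℂ :=
  helmholtz k (helmholtz k w)

/-- The admissible (horizontally Fourier transformed) vertical velocities of wavenumber `k` in the
layer `0 < z < h`: complex-valued functions that are five times continuously differentiable up to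
the boundary and satisfy `w = dw/dz = (-d²/dz² + k²)² w = 0` for `z ∈ {0, h}`.
(Every `C⁵` function on `[0, h]` is the restriction of a `C⁵` function on `ℝ`; only the values
on `[0, h]` matter.) -/
structure IsAdmissible (h k : ℝ) (w : ℝ → ℂ) : Prop where
  contDiff : ContDiff ℝ 5 w
  value_zero : w 0 = 0
  value_top : w h = 0
  deriv_zero : deriv w 0 = 0
  deriv_top : deriv w h = 0
  helmholtzSq_zero : helmholtzSq k w 0 = 0
  helmholtzSq_top : helmholtzSq k w h = 0

/-- The quadratic form
`2 Re ∫ ξ w (-d²/dz²+k²)² w̄ dz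
  + R⁻¹ (∫ k⁻² |d/dz (-d²/dz²+k²)² w|² dz + ∫ |(-d²/dz²+k²)² w|² dz)`
on the layer `0 < z < h`, where `R` is the coefficient of the buoyancy force in the Stokes
equation `-Δu + ∇p = R T e_z`. It equals `R k²` times
`∫ (2 ξ Re (w θ̄) + k² |θ|² + |dθ/dz|²) dz`, where `(k² - d²/dz²)² w = R k² θ`. -/
def stabilityForm (R h k : ℝ) (ξ : ℝ → ℝ) (w : ℝ → ℂ) : ℝ :=
  2 * (∫ z in (0 : ℝ)..h, (ξ z : ℂ) * w z * (starRingEnd ℂ) (helmholtzSq k w z)).re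
    + R⁻¹ * ((∫ z in (0 : ℝ)..h, (k ^ 2)⁻¹ * ‖deriv (helmholtzSq k w) z‖ ^ 2)
      + ∫ z in (0 : ℝ)..h, ‖helmholtzSq k w z‖ ^ 2)

/-- The slope `ξ` satisfies the stability condition: the quadratic form is non-negative for all
real wavenumbers `k ≠ 0` and all admissible `w`. -/
def StabilityCondition (R h : ℝ) (ξ : ℝ → ℝ) : Prop :=
  ∀ k : ℝ, k ≠ 0 → ∀ w : ℝ → ℂ, IsAdmissible h k w → 0 ≤ stabilityForm R h k ξ w

/-- A stable background temperature profile on `[0, h]`: an absolutely continuous `τ` with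
`τ 0 = 1`, `τ h = 0`, whose slope `dτ/dz` satisfies the stability condition. -/
structure IsStableProfile (R h : ℝ) (τ : ℝ → ℝ) : Prop where
  absolutelyContinuous : AbsolutelyContinuousOnInterval τ 0 h
  value_zero : τ 0 = 1
  value_top : τ h = 0
  stable : StabilityCondition R h (deriv τ)

/-- The Dirichlet energy `∫₀ʰ (dτ/dz)² dz ∈ [0, ∞]`. -/
def dirichletEnergy (h : ℝ) (τ : ℝ → ℝ) : ℝ≥0∞ :=
  ∫⁻ z in Set.Ioo 0 h, ENNReal.ofReal (deriv τ z ^ 2)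

/-- The Nusselt number associated to the background field method for the layer `0 < z < h` and
buoyancy coefficient `R`: the infimum of the Dirichlet energy over all stable profiles
(`∞` if there is none). The rescaled problem is `R = 1`, `h = H`; the problem in a container of
unit height at Rayleigh number `Ra` is `R = Ra`, `h = 1`. -/
def nusseltBF (R h : ℝ) : ℝ≥0∞ :=
  ⨅ (τ : ℝ → ℝ) (_ : IsStableProfile R h τ), dirichletEnergy h τ

end BackgroundField

end

/-! Write `L` for `(-d²/dz² + k²)²`. Stability bounds `∫ ξ w Lw` from below by minus a defect times
a positive energy of `w`. Slopes obeying such bounds form a convex cone that is compatible with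
dilations. The slope has total mass `-1`, so after a reflection the lower half of the layer carries
mass at most `-1/2`. The proof shows that this negative mass cannot be accommodated when `N = ∫ ξ²`
is too small compared with a power of `log H`. It has three stages.

Averaging over dilations. There is a test function `w` at unit wavenumber with `w Lw ≥ 0` supported
in `[1/2, 1]` (`exists_positive_test`). Averaging the dilates of `ξ` against this kernel gives a
slope `X` that is again approximately stable and satisfies the pointwise bound `X ≥ -A z⁻⁴`. Tests
of large wavenumber have `w Lw ≈ k⁴ w²`. They show that slowly varying squares see almost no
negative mass, so the negative mass survives in `X` (`exists_mollified`). By the pointwise bound it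
sits next to the wall, and the remainder of `X` is essentially positive.

Logarithmic monotonicity. If `w = z² f(log z)` with `f` slowly varying and `k z` small, then `w Lw ≈
-(f²)'(log z)`. Stability therefore says that the mass of `X` per unit of `log z` is almost
increasing (`win_step`). The test `z² arsinh z`, which satisfies the boundary conditions, links this
to the region near the wall (`win_base`). Since the mass is spread over a logarithmic range, only a
fraction of order `1 / log h` of the total mass lies in `1 < z < 4` (`boundary_mass_le`), and the
same holds at every larger scale `l` (`band_mass_le`).

Inner and outer tests. Take `k = 1/l` and test with `outer + ε inner`. Here `outer ≈ z²`, and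
`inner` is a regularised `-(1/2) z² log z`, for which `L inner ≈ z⁻²` on `δ < z < 1`. The mixed term
is then close to the mass `-m` near the wall. The error in `L²` is of order `√δ`, so `δ` of order
`1/N` suffices by Cauchy-Schwarz. The contribution of `outer` alone is controlled by the mass in the
band around `l`, and is `O(m l⁻³)` once `log h` exceeds `l³`. The `ε²` term is dominated by the
energy of `inner`, of order `k⁻² δ⁻⁵`, which is `l² N⁵`. Non-negativity in `ε` forces `m ≤ C l⁻³ l²
N⁵`, that is `l ≤ K N⁵` (`ReducedSlope.scale_le`). With `l³` comparable to `log H` this is `log H ≤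
C N¹⁵`, which explains the exponent `1/15`. -/

noncomputable section

namespace BackgroundField

/-! ### Real test functions and the symmetries of the stability condition -/

/-- The operator `(-d²/dz² + k²)²` on real-valued functions. -/
def Lop (k : ℝ) (w : ℝ → ℝ) (z : ℝ) : ℝ :=
  iteratedDeriv 4 w z - 2 * k ^ 2 * iteratedDeriv 2 w z + k ^ 4 * w z

/-- The derivative of `Lop k w`. -/
def dLop (k : ℝ) (w : ℝ → ℝ) (z : ℝ) : ℝ :=
  iteratedDeriv 5 w z - 2 * k ^ 2 * iteratedDeriv 3 w z + k ^ 4 * iteratedDeriv 1 w z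

/-- The positive part of the quadratic form. -/
def energy (h k : ℝ) (w : ℝ → ℝ) : ℝ :=
  (k ^ 2)⁻¹ * (∫ z in (0 : ℝ)..h, dLop k w z ^ 2) + ∫ z in (0 : ℝ)..h, Lop k w z ^ 2

/-- Approximate stability with defect `η`, tested with real functions vanishing above `h`. -/
def Stab (η h : ℝ) (X : ℝ → ℝ) : Prop :=
  ∀ k : ℝ, 0 < k → ∀ w : ℝ → ℝ, ContDiff ℝ 5 w → w 0 = 0 → deriv w 0 = 0 → Lop k w 0 = 0 →
    (∀ z, h ≤ z → w z = 0) →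
    -(η * energy h k w) ≤ ∫ z in (0 : ℝ)..h, X z * (w z * Lop k w z)

theorem iteratedDeriv_continuous {w : ℝ → ℝ} (hw : ContDiff ℝ 5 w) {n : ℕ} (hn : n ≤ 5) :
    Continuous (iteratedDeriv n w) :=
  hw.continuous_iteratedDeriv n (by exact_mod_cast hn)

theorem Lop_continuous (k : ℝ) {w : ℝ → ℝ} (hw : ContDiff ℝ 5 w) : Continuous (Lop k w) := by
  have h4 := iteratedDeriv_continuous hw (n := 4) (by norm_num)
  have h2 := iteratedDeriv_continuous hw (n := 2) (by norm_num)
  have h0 := hw.continuous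
  unfold Lop; fun_prop

theorem dLop_continuous (k : ℝ) {w : ℝ → ℝ} (hw : ContDiff ℝ 5 w) : Continuous (dLop k w) := by
  have h4 := iteratedDeriv_continuous hw (n := 5) (by norm_num)
  have h2 := iteratedDeriv_continuous hw (n := 3) (by norm_num)
  have h1 := iteratedDeriv_continuous hw (n := 1) (by norm_num)
  unfold dLop; fun_prop

theorem hasDerivAt_iteratedDeriv {w : ℝ → ℝ} (hw : ContDiff ℝ 5 w) {n : ℕ} (hn : n < 5) (z : ℝ) :
    HasDerivAt (iteratedDeriv n w) (iteratedDeriv (n + 1) w z) z := by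
  rw [iteratedDeriv_succ]
  exact ((hw.differentiable_iteratedDeriv n (by exact_mod_cast hn)) z).hasDerivAt

theorem Lop_hasDerivAt (k : ℝ) {w : ℝ → ℝ} (hw : ContDiff ℝ 5 w) (z : ℝ) :
    HasDerivAt (Lop k w) (dLop k w z) z := by
  have h4 := hasDerivAt_iteratedDeriv hw (n := 4) (by norm_num) z
  have h2 := hasDerivAt_iteratedDeriv hw (n := 2) (by norm_num) z
  have h0 := hasDerivAt_iteratedDeriv hw (n := 0) (by norm_num) z
  rw [iteratedDeriv_zero] at h0
  exact (h4.sub (h2.const_mul (2 * k ^ 2))).add (h0.const_mul (k ^ 4))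

theorem iteratedDeriv_ofReal {w : ℝ → ℝ} (hw : ContDiff ℝ 5 w) {n : ℕ} (hn : n ≤ 5) :
    iteratedDeriv n (fun z => (w z : ℂ)) = fun z => ((iteratedDeriv n w z : ℝ) : ℂ) := by
  induction n with
  | zero => simp
  | succ n ih =>
    rw [iteratedDeriv_succ, ih (by omega)]
    funext z
    exact (hasDerivAt_iteratedDeriv hw (by omega) z).ofReal_comp.deriv

theorem helmholtz_ofReal (k : ℝ) {w : ℝ → ℝ} (hw : ContDiff ℝ 5 w) :
    helmholtz k (fun z => (w z : ℂ)) = fun z => ((-iteratedDeriv 2 w z + k ^ 2 * w z : ℝ) : ℂ) := by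
  funext z
  simp [helmholtz, iteratedDeriv_ofReal hw (n := 2) (by norm_num)]

theorem helmholtzSq_ofReal (k : ℝ) {w : ℝ → ℝ} (hw : ContDiff ℝ 5 w) :
    helmholtzSq k (fun z => (w z : ℂ)) = fun z => ((Lop k w z : ℝ) : ℂ) := by
  have key : ∀ z, HasDerivAt (fun z => -iteratedDeriv 2 w z + k ^ 2 * w z)
      (-iteratedDeriv 3 w z + k ^ 2 * iteratedDeriv 1 w z) z := fun z => by
    have h2 := hasDerivAt_iteratedDeriv hw (n := 2) (by norm_num) z
    have h0 := hasDerivAt_iteratedDeriv hw (n := 0) (by norm_num) z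
    rw [iteratedDeriv_zero] at h0
    exact h2.neg.add (h0.const_mul (k ^ 2))
  have key2 : ∀ z, HasDerivAt (fun z => -iteratedDeriv 3 w z + k ^ 2 * iteratedDeriv 1 w z)
      (-iteratedDeriv 4 w z + k ^ 2 * iteratedDeriv 2 w z) z := fun z => by
    have h2 := hasDerivAt_iteratedDeriv hw (n := 3) (by norm_num) z
    have h0 := hasDerivAt_iteratedDeriv hw (n := 1) (by norm_num) z
    exact h2.neg.add (h0.const_mul (k ^ 2))
  unfold helmholtzSq
  rw [helmholtz_ofReal k hw]
  funext z
  have e1 : deriv (fun z => ((-iteratedDeriv 2 w z + k ^ 2 * w z : ℝ) : ℂ)) =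
      fun z => ((-iteratedDeriv 3 w z + k ^ 2 * iteratedDeriv 1 w z : ℝ) : ℂ) :=
    funext fun z => (key z).ofReal_comp.deriv
  have e2 : iteratedDeriv 2 (fun z => ((-iteratedDeriv 2 w z + k ^ 2 * w z : ℝ) : ℂ)) =
      fun z => ((-iteratedDeriv 4 w z + k ^ 2 * iteratedDeriv 2 w z : ℝ) : ℂ) := by
    rw [iteratedDeriv_succ, iteratedDeriv_one, e1]
    exact funext fun z => (key2 z).ofReal_comp.deriv
  simp only [helmholtz, e2, Lop]
  push_cast
  ring

/-- Real test functions are enough for a lower bound. On them the complex form is twice the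
interaction integral plus `R⁻¹` times the energy, and dividing by two produces the defect `R⁻¹ / 2`.
-/
theorem stability_real {R h : ℝ} {ξ : ℝ → ℝ} (hξ : StabilityCondition R h ξ) {k : ℝ} (hk : 0 < k)
    {w : ℝ → ℝ} (hw : ContDiff ℝ 5 w) (h0 : w 0 = 0) (hh : w h = 0) (h0' : deriv w 0 = 0)
    (hh' : deriv w h = 0) (hL0 : Lop k w 0 = 0) (hLh : Lop k w h = 0) :
    -(R⁻¹ / 2 * energy h k w) ≤ ∫ z in (0 : ℝ)..h, ξ z * (w z * Lop k w z) := by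
  have hd : ∀ z, deriv (fun z => (w z : ℂ)) z = ((deriv w z : ℝ) : ℂ) := fun z =>
    ((hw.differentiable (by norm_num)) z).hasDerivAt.ofReal_comp.deriv
  have hadm : IsAdmissible h k (fun z => (w z : ℂ)) :=
    { contDiff := Complex.ofRealCLM.contDiff.comp hw
      value_zero := by simp [h0]
      value_top := by simp [hh]
      deriv_zero := by rw [hd, h0']; simp
      deriv_top := by rw [hd, hh']; simp
      helmholtzSq_zero := by rw [helmholtzSq_ofReal k hw]; simp [hL0]
      helmholtzSq_top := by rw [helmholtzSq_ofReal k hw]; simp [hLh] }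
  have := hξ k hk.ne' _ hadm
  unfold stabilityForm at this
  rw [helmholtzSq_ofReal k hw] at this
  have e1 : (∫ z in (0 : ℝ)..h, (ξ z : ℂ) * (w z : ℂ) * (starRingEnd ℂ) ((Lop k w z : ℝ) : ℂ)) =
      ((∫ z in (0 : ℝ)..h, ξ z * (w z * Lop k w z) : ℝ) : ℂ) := by
    rw [← intervalIntegral.integral_ofReal]
    congr 1; funext z; simp; ring
  have e2 : ∀ z, deriv (fun z => ((Lop k w z : ℝ) : ℂ)) z = ((dLop k w z : ℝ) : ℂ) := fun z =>
    (Lop_hasDerivAt k hw z).ofReal_comp.deriv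
  simp only [e1, e2, Complex.ofReal_re, Complex.norm_real, Real.norm_eq_abs, sq_abs,
    intervalIntegral.integral_const_mul] at this
  unfold energy
  linarith

/-- Local constancy gives the claim for `z > h`. The endpoint `z = h` follows from continuity of the
derivatives up to order five, so a test that vanishes above `h` meets the boundary conditions at `h`
automatically. -/
theorem iteratedDeriv_eq_zero_of_vanish {w : ℝ → ℝ} (hw : ContDiff ℝ 5 w) {h : ℝ}
    (hv : ∀ z, h ≤ z → w z = 0) {n : ℕ} (hn : n ≤ 5) {z : ℝ} (hz : h ≤ z) :
    iteratedDeriv n w z = 0 := by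
  have h1 : ∀ z, h < z → iteratedDeriv n w z = 0 := fun z hz => by
    have : w =ᶠ[nhds z] fun _ => 0 := by
      filter_upwards [Ioi_mem_nhds hz] with y hy using hv y (le_of_lt hy)
    rw [this.iteratedDeriv_eq]
    simp
  have hc := iteratedDeriv_continuous hw hn
  have hcl : IsClosed {z | iteratedDeriv n w z = 0} := isClosed_eq hc continuous_const
  have : closure (Set.Ioi h) ⊆ {z | iteratedDeriv n w z = 0} :=
    hcl.closure_subset_iff.2 fun z hz => h1 z hz
  rw [closure_Ioi] at this
  exact this hz

theorem Lop_eq_zero_of_vanish {w : ℝ → ℝ} (hw : ContDiff ℝ 5 w) {h : ℝ} (k : ℝ)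
    (hv : ∀ z, h ≤ z → w z = 0) {z : ℝ} (hz : h ≤ z) : Lop k w z = 0 := by
  simp [Lop, iteratedDeriv_eq_zero_of_vanish hw hv (n := 4) (by norm_num) hz,
    iteratedDeriv_eq_zero_of_vanish hw hv (n := 2) (by norm_num) hz, hv z hz]

theorem dLop_eq_zero_of_vanish {w : ℝ → ℝ} (hw : ContDiff ℝ 5 w) {h : ℝ} (k : ℝ)
    (hv : ∀ z, h ≤ z → w z = 0) {z : ℝ} (hz : h ≤ z) : dLop k w z = 0 := by
  simp only [dLop, iteratedDeriv_eq_zero_of_vanish hw hv (n := 5) (by norm_num) hz,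
    iteratedDeriv_eq_zero_of_vanish hw hv (n := 3) (by norm_num) hz,
    iteratedDeriv_eq_zero_of_vanish hw hv (n := 1) (by norm_num) hz]
  ring

theorem StabilityCondition.stab {R h : ℝ} {ξ : ℝ → ℝ} (hξ : StabilityCondition R h ξ) :
    Stab (R⁻¹ / 2) h ξ := by
  intro k hk w hw h0 h0' hL0 hv
  refine stability_real hξ hk hw h0 (hv h le_rfl) h0' ?_ hL0 (Lop_eq_zero_of_vanish hw k hv le_rfl)
  have := iteratedDeriv_eq_zero_of_vanish hw hv (n := 1) (by norm_num) (le_refl h)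
  rwa [iteratedDeriv_one] at this

/-- Under `z ↦ h - z` the even derivatives are unchanged, and the odd ones change sign but enter
only through squares. The reflection is needed because the negative mass may lie near the upper
wall. -/
theorem StabilityCondition.stab_reflect {R h : ℝ} {ξ : ℝ → ℝ} (hξ : StabilityCondition R h ξ) :
    Stab (R⁻¹ / 2) h (fun z => ξ (h - z)) := by
  intro k hk w hw h0 h0' hL0 hv
  have hd0 := iteratedDeriv_eq_zero_of_vanish hw hv (n := 1) (by norm_num) (le_refl h)
  rw [iteratedDeriv_one] at hd0
  have hi : ∀ n z, iteratedDeriv n (fun z => w (h - z)) z = (-1 : ℝ) ^ n * iteratedDeriv n w (h - z) :=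
    fun n z => by rw [iteratedDeriv_comp_const_sub]; simp
  have hLr : ∀ z, Lop k (fun z => w (h - z)) z = Lop k w (h - z) := fun z => by
    simp only [Lop, hi]; ring
  have hdLr : ∀ z, dLop k (fun z => w (h - z)) z = -dLop k w (h - z) := fun z => by
    simp only [dLop, hi]; ring
  have hd : ∀ z, deriv (fun z => w (h - z)) z = -deriv w (h - z) := fun z => by
    have := hi 1 z
    simpa using this
  have := stability_real hξ hk (w := fun z => w (h - z)) (hw.comp (contDiff_const.sub contDiff_id))
    (by simpa using hv h le_rfl) (by simpa using h0) (by rw [hd]; simpa using hd0)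
    (by rw [hd]; simpa using h0') (by rw [hLr]; simpa using Lop_eq_zero_of_vanish hw k hv le_rfl)
    (by rw [hLr]; simpa using hL0)
  simp only [energy, hLr, hdLr, neg_sq] at this
  have r1 := intervalIntegral.integral_comp_sub_left (a := 0) (b := h) (fun z => dLop k w z ^ 2) h
  have r2 := intervalIntegral.integral_comp_sub_left (a := 0) (b := h) (fun z => Lop k w z ^ 2) h
  have r3 := intervalIntegral.integral_comp_sub_left (a := 0) (b := h)
    (fun z => ξ (h - z) * (w z * Lop k w z)) h
  simp only [sub_self, sub_zero, sub_sub_cancel] at r1 r2 r3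
  rw [r1, r2, r3] at this
  exact this

/-- A test supported below `h'` is also a test for the taller layer, and none of the integrals see
the difference. -/
theorem Stab.mono_height {η h h' : ℝ} {X : ℝ → ℝ} (hX : Stab η h X) (hh : h' ≤ h) (h0 : 0 ≤ h') :
    Stab η h' X := by
  intro k hk w hw w0 w0' hL0 hv
  have := hX k hk w hw w0 w0' hL0 fun z hz => hv z (hh.trans hz)
  have key : ∀ f : ℝ → ℝ, (∀ z, h' ≤ z → f z = 0) →
      ∫ z in (0 : ℝ)..h, f z = ∫ z in (0 : ℝ)..h', f z := fun f hf => by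
    rw [intervalIntegral.integral_of_le (h0.trans hh), intervalIntegral.integral_of_le h0]
    apply setIntegral_eq_of_subset_of_forall_sdiff_eq_zero measurableSet_Ioc
      (Set.Ioc_subset_Ioc_right hh)
    intro x hx
    apply hf
    by_contra hlt
    exact hx.2 ⟨hx.1.1, le_of_lt (not_le.1 hlt)⟩
  unfold energy at this ⊢
  rw [key, key, key] at this
  · exact this
  · intro z hz; simp [hv z hz]
  · intro z hz; simp [Lop_eq_zero_of_vanish hw k hv hz]
  · intro z hz; simp [dLop_eq_zero_of_vanish hw k hv hz]

theorem Stab.mono_defect {η η' h : ℝ} {X : ℝ → ℝ} (hX : Stab η h X) (hη : η ≤ η') (h0 : 0 ≤ h) :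
    Stab η' h X := by
  intro k hk w hw w0 w0' hL0 hv
  refine le_trans ?_ (hX k hk w hw w0 w0' hL0 hv)
  have : 0 ≤ energy h k w := by
    unfold energy
    have h1 : 0 ≤ ∫ z in (0 : ℝ)..h, dLop k w z ^ 2 :=
      intervalIntegral.integral_nonneg h0 fun _ _ => sq_nonneg _
    have h2 : 0 ≤ ∫ z in (0 : ℝ)..h, Lop k w z ^ 2 :=
      intervalIntegral.integral_nonneg h0 fun _ _ => sq_nonneg _
    positivity
  nlinarith

theorem iteratedDeriv_comp_mul_left {w : ℝ → ℝ} (hw : ContDiff ℝ 5 w) (c : ℝ) {n : ℕ} (hn : n ≤ 5)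
    (z : ℝ) : iteratedDeriv n (fun z => w (c * z)) z = c ^ n * iteratedDeriv n w (c * z) := by
  have := congrFun (iteratedDeriv_comp_const_mul (n := n) (hw.of_le (by exact_mod_cast hn)) c) z
  exact this

theorem Lop_comp_mul_left {w : ℝ → ℝ} (hw : ContDiff ℝ 5 w) (c k z : ℝ) :
    Lop (c * k) (fun z => w (c * z)) z = c ^ 4 * Lop k w (c * z) := by
  simp only [Lop, iteratedDeriv_comp_mul_left hw c (n := 4) (by norm_num),
    iteratedDeriv_comp_mul_left hw c (n := 2) (by norm_num)]
  ring

theorem dLop_comp_mul_left {w : ℝ → ℝ} (hw : ContDiff ℝ 5 w) (c k z : ℝ) :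
    dLop (c * k) (fun z => w (c * z)) z = c ^ 5 * dLop k w (c * z) := by
  simp only [dLop, iteratedDeriv_comp_mul_left hw c (n := 5) (by norm_num),
    iteratedDeriv_comp_mul_left hw c (n := 3) (by norm_num),
    iteratedDeriv_comp_mul_left hw c (n := 1) (by norm_num)]
  ring

/-- The dilation `X ↦ l X(l ·)` scales the defect by `l⁻³`. -/
theorem Stab.dilate {η h l : ℝ} {X : ℝ → ℝ} (hX : Stab η h X) (hl : 0 < l) :
    Stab (η * (l ^ 3)⁻¹) (h / l) (fun z => l * X (l * z)) := by
  intro k hk w hw w0 w0' hL0 hv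
  have hw' : ContDiff ℝ 5 (fun z => w (l⁻¹ * z)) := hw.comp (contDiff_const.mul contDiff_id)
  -- Function and wavenumber are stretched together. The energy then scales by `l⁻⁷` and the
  -- interaction by `l⁻⁴`, which leaves `l⁻³` for the defect.
  have key := hX (l⁻¹ * k) (by positivity) (fun z => w (l⁻¹ * z)) hw' (by simpa using w0)
    (by
      have := iteratedDeriv_comp_mul_left hw l⁻¹ (n := 1) (by norm_num) 0
      simp only [iteratedDeriv_one, mul_zero, w0'] at this
      exact this)
    (by rw [Lop_comp_mul_left hw]; simp [hL0])
    (fun z hz => hv _ (by rw [div_eq_inv_mul]; gcongr))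
  have hcv : ∀ f : ℝ → ℝ, ∫ z in (0 : ℝ)..h, f (l⁻¹ * z) = l * ∫ z in (0 : ℝ)..(h / l), f z :=
    fun f => by
      rw [intervalIntegral.integral_comp_mul_left f (inv_ne_zero hl.ne')]
      simp [div_eq_inv_mul]
  have e1 : ∫ z in (0 : ℝ)..h, dLop (l⁻¹ * k) (fun z => w (l⁻¹ * z)) z ^ 2 =
      l⁻¹ ^ 10 * (l * ∫ z in (0 : ℝ)..(h / l), dLop k w z ^ 2) := by
    rw [← hcv (fun z => dLop k w z ^ 2), ← intervalIntegral.integral_const_mul]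
    congr 1; funext z; rw [dLop_comp_mul_left hw]; ring
  have e2 : ∫ z in (0 : ℝ)..h, Lop (l⁻¹ * k) (fun z => w (l⁻¹ * z)) z ^ 2 =
      l⁻¹ ^ 8 * (l * ∫ z in (0 : ℝ)..(h / l), Lop k w z ^ 2) := by
    rw [← hcv (fun z => Lop k w z ^ 2), ← intervalIntegral.integral_const_mul]
    congr 1; funext z; rw [Lop_comp_mul_left hw]; ring
  have e3 : ∫ z in (0 : ℝ)..h, X z * (w (l⁻¹ * z) * Lop (l⁻¹ * k) (fun z => w (l⁻¹ * z)) z) =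
      l⁻¹ ^ 4 * ∫ z in (0 : ℝ)..(h / l), l * X (l * z) * (w z * Lop k w z) := by
    have := hcv (fun z => X (l * z) * (w z * Lop k w z))
    simp only [mul_inv_cancel_left₀ hl.ne'] at this
    have h2 : ∫ z in (0 : ℝ)..(h / l), l * X (l * z) * (w z * Lop k w z) =
        l * ∫ z in (0 : ℝ)..(h / l), X (l * z) * (w z * Lop k w z) := by
      rw [← intervalIntegral.integral_const_mul]; congr 1; funext z; ring
    rw [h2, ← this, ← intervalIntegral.integral_const_mul]
    congr 1; funext z; rw [Lop_comp_mul_left hw]; ring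
  have e4 : energy h (l⁻¹ * k) (fun z => w (l⁻¹ * z)) = l⁻¹ ^ 7 * energy (h / l) k w := by
    unfold energy
    rw [e1, e2, mul_pow, mul_inv]
    field_simp
  rw [e4, e3] at key
  have h4 : 0 < l ^ 4 := by positivity
  have key2 := mul_le_mul_of_nonneg_left key h4.le
  have e5 : l ^ 4 * (l⁻¹ ^ 4 * ∫ z in (0 : ℝ)..(h / l), l * X (l * z) * (w z * Lop k w z)) =
      ∫ z in (0 : ℝ)..(h / l), l * X (l * z) * (w z * Lop k w z) := by
    field_simp
  rw [e5] at key2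
  refine le_trans (le_of_eq ?_) key2
  field_simp

/-! ### Multiplicative averages of a slope -/

theorem abs_integral_mul_le_sqrt {α : Type*} [MeasurableSpace α] {μ : Measure α} {f g : α → ℝ}
    (hf : MemLp f 2 μ) (hg : MemLp g 2 μ) :
    |∫ x, f x * g x ∂μ| ≤ √(∫ x, f x ^ 2 ∂μ) * √(∫ x, g x ^ 2 ∂μ) := by
  have h := integral_mul_norm_le_Lp_mul_Lq (μ := μ) (f := f) (g := g)
    Real.HolderConjugate.two_two (by simpa using hf) (by simpa using hg)
  have h1 : |∫ x, f x * g x ∂μ| ≤ ∫ x, ‖f x‖ * ‖g x‖ ∂μ := by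
    refine (MeasureTheory.abs_integral_le_integral_abs).trans (le_of_eq ?_)
    simp only [abs_mul, Real.norm_eq_abs]
  refine h1.trans (h.trans (le_of_eq ?_))
  simp [Real.sqrt_eq_rpow]

/-- The multiplicative average `z ↦ ∫ φ(l) ξ(l z) dl` over `1/2 ≤ l ≤ 1`. -/
def mollify (φ ξ : ℝ → ℝ) (z : ℝ) : ℝ := ∫ l in (1 / 2 : ℝ)..1, φ l * ξ (l * z)

section
variable {φ ξ : ℝ → ℝ}

theorem integrable_mollify_kernel (hφ : Continuous φ) (hm : Measurable ξ) (hi : Integrable ξ)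
    {G : ℝ → ℝ} (hG : Measurable G) {M : ℝ} (hM : ∀ z, |G z| ≤ M) :
    Integrable (fun p : ℝ × ℝ => φ p.1 * ξ (p.1 * p.2) * G p.2)
      ((volume.restrict (Set.Ioc (1 / 2 : ℝ) 1)).prod volume) := by
  have hmeas : Measurable (fun p : ℝ × ℝ => φ p.1 * ξ (p.1 * p.2) * G p.2) :=
    ((hφ.measurable.comp measurable_fst).mul
      (hm.comp (measurable_fst.mul measurable_snd))).mul (hG.comp measurable_snd)
  have hsec : ∀ l : ℝ, l ≠ 0 → Integrable (fun z => φ l * ξ (l * z) * G z) := fun l hl => by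
    refine Integrable.mul_bdd (c := M) ((hi.comp_mul_left' hl).const_mul _)
      hG.aestronglyMeasurable (Filter.Eventually.of_forall fun z => ?_)
    simpa using hM z
  rw [integrable_prod_iff hmeas.aestronglyMeasurable]
  constructor
  · filter_upwards [ae_restrict_mem measurableSet_Ioc] with l hl
    exact hsec l (by linarith [hl.1])
  · have hM0 : 0 ≤ M := (abs_nonneg _).trans (hM 0)
    obtain ⟨P, hP⟩ := (isCompact_Icc (a := (1 / 2 : ℝ)) (b := 1)).exists_bound_of_continuousOn
      hφ.continuousOn
    have hP0 : 0 ≤ P := (norm_nonneg _).trans (hP 1 ⟨by norm_num, le_rfl⟩)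
    refine Integrable.mono' (g := fun _ => P * M * (2 * ∫ z, |ξ z|)) (integrable_const _)
      (hmeas.norm.stronglyMeasurable.integral_prod_right').aestronglyMeasurable ?_
    filter_upwards [ae_restrict_mem measurableSet_Ioc] with l hl
    have hl0 : 0 < l := by linarith [hl.1]
    rw [Real.norm_of_nonneg (integral_nonneg fun _ => norm_nonneg _)]
    calc ∫ z, ‖φ l * ξ (l * z) * G z‖ ≤ ∫ z, P * M * |ξ (l * z)| := by
          refine integral_mono (hsec l hl0.ne').norm
            (((hi.comp_mul_left' hl0.ne').abs).const_mul _) fun z => ?_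
          have h1 := hP l ⟨hl.1.le, hl.2⟩
          have h2 := hM z
          simp only [norm_mul, Real.norm_eq_abs] at h1 ⊢
          calc |φ l| * |ξ (l * z)| * |G z| ≤ P * |ξ (l * z)| * M := by gcongr
            _ = _ := by ring
      _ = P * M * (l⁻¹ * ∫ z, |ξ z|) := by
          rw [MeasureTheory.integral_const_mul, Measure.integral_comp_mul_left (fun z => |ξ z|)]
          simp [abs_of_pos (inv_pos.2 hl0)]
      _ ≤ _ := by
          have : l⁻¹ ≤ 2 := by
            rw [inv_le_comm₀ hl0 (by norm_num)]; linarith [hl.1]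
          have h3 : 0 ≤ ∫ z, |ξ z| := integral_nonneg fun _ => abs_nonneg _
          gcongr

theorem integrable_mollify (hφ : Continuous φ) (hm : Measurable ξ) (hi : Integrable ξ) :
    Integrable (mollify φ ξ) := by
  have := (integrable_mollify_kernel hφ hm hi (G := fun _ => 1) measurable_const (M := 1)
    (by simp)).integral_prod_right
  refine this.congr (Filter.Eventually.of_forall fun z => ?_)
  simp only [mollify, mul_one]
  rw [intervalIntegral.integral_of_le (by norm_num)]

theorem integral_mollify_mul (hφ : Continuous φ) (hm : Measurable ξ) (hi : Integrable ξ)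
    {G : ℝ → ℝ} (hG : Measurable G) {M : ℝ} (hM : ∀ z, |G z| ≤ M) :
    ∫ z, mollify φ ξ z * G z = ∫ l in (1 / 2 : ℝ)..1, φ l * ∫ z, ξ (l * z) * G z := by
  have h := integral_integral_swap (f := fun l z => φ l * ξ (l * z) * G z)
    (integrable_mollify_kernel hφ hm hi hG hM)
  rw [intervalIntegral.integral_of_le (by norm_num)]
  have e1 : ∀ l, φ l * ∫ z, ξ (l * z) * G z = ∫ z, φ l * ξ (l * z) * G z := fun l => by
    rw [← MeasureTheory.integral_const_mul]; congr 1; funext z; ring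
  simp only [e1]
  rw [h]
  congr 1; funext z
  rw [mollify, intervalIntegral.integral_of_le (by norm_num), ← MeasureTheory.integral_mul_const]

theorem integrable_mollify_inner (hφ : Continuous φ) (hm : Measurable ξ) (hi : Integrable ξ)
    {G : ℝ → ℝ} (hG : Measurable G) {M : ℝ} (hM : ∀ z, |G z| ≤ M) :
    IntervalIntegrable (fun l => φ l * ∫ z, ξ (l * z) * G z) volume (1 / 2 : ℝ) 1 := by
  rw [intervalIntegrable_iff_integrableOn_Ioc_of_le (by norm_num)]
  refine (integrable_mollify_kernel hφ hm hi hG hM).integral_prod_left.congr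
    (Filter.Eventually.of_forall fun l => ?_)
  simp only
  rw [← MeasureTheory.integral_const_mul]; congr 1; funext z; ring

theorem integral_indicator_interval {a b : ℝ} (hab : a ≤ b) (X g : ℝ → ℝ) :
    ∫ z, X z * (Set.Ioc a b).indicator g z = ∫ z in a..b, X z * g z := by
  rw [intervalIntegral.integral_of_le hab, ← MeasureTheory.integral_indicator measurableSet_Ioc]
  congr 1; funext z
  by_cases hz : z ∈ Set.Ioc a b <;> simp [hz]

theorem abs_indicator_le {a b M : ℝ} {g : ℝ → ℝ} (hM0 : 0 ≤ M)
    (hM : ∀ z ∈ Set.Ioc a b, |g z| ≤ M) (z : ℝ) : |(Set.Ioc a b).indicator g z| ≤ M := by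
  by_cases hz : z ∈ Set.Ioc a b <;> simp [hz, hM0, hM]

theorem exists_bound_Ioc {g : ℝ → ℝ} (hg : Continuous g) (a b : ℝ) :
    ∃ M, 0 ≤ M ∧ ∀ z ∈ Set.Icc a b, |g z| ≤ M := by
  obtain ⟨P, hP⟩ := (isCompact_Icc (a := a) (b := b)).exists_bound_of_continuousOn hg.continuousOn
  exact ⟨max P 0, le_max_right _ _, fun z hz => (hP z hz).trans (le_max_left _ _)⟩

theorem interval_integral_mollify_mul (hφ : Continuous φ) (hm : Measurable ξ) (hi : Integrable ξ)
    {a b : ℝ} (hab : a ≤ b) {g : ℝ → ℝ} (hg : Continuous g) :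
    ∫ z in a..b, mollify φ ξ z * g z =
      ∫ l in (1 / 2 : ℝ)..1, φ l * ∫ z in a..b, ξ (l * z) * g z := by
  obtain ⟨M, hM0, hM⟩ := exists_bound_Ioc hg a b
  have := integral_mollify_mul hφ hm hi (G := (Set.Ioc a b).indicator g)
    (hg.measurable.indicator measurableSet_Ioc) (M := M)
    (abs_indicator_le hM0 fun z hz => hM z ⟨hz.1.le, hz.2⟩)
  rw [integral_indicator_interval hab] at this
  rw [this]
  congr 1; funext l
  rw [integral_indicator_interval hab (fun z => ξ (l * z))]

theorem abs_interval_integral_dilate_mul_le (hm : Measurable ξ)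
    (hi2 : Integrable fun z => ξ z ^ 2) {N : ℝ} (hN : ∫ z, ξ z ^ 2 ≤ N) {l : ℝ} (hl : 1 / 2 ≤ l)
    {a b : ℝ} (hab : a ≤ b) {g : ℝ → ℝ} (hg : Continuous g) :
    |∫ z in a..b, ξ (l * z) * g z| ≤ √(2 * N) * √(∫ z in a..b, g z ^ 2) := by
  have hl0 : 0 < l := by linarith
  have hN0 : 0 ≤ N := (integral_nonneg fun _ => sq_nonneg _).trans hN
  have hi2' : Integrable fun z => ξ (l * z) ^ 2 := hi2.comp_mul_left' hl0.ne'
  have hf : MemLp (fun z => ξ (l * z)) 2 (volume.restrict (Set.Ioc a b)) := by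
    exact (memLp_two_iff_integrable_sq (hm.comp (measurable_const_mul l)).aestronglyMeasurable).2
      hi2'.integrableOn
  have hg' : MemLp g 2 (volume.restrict (Set.Ioc a b)) := by
    rw [memLp_two_iff_integrable_sq hg.aestronglyMeasurable]
    exact (hg.pow 2).integrableOn_Ioc
  rw [intervalIntegral.integral_of_le hab, intervalIntegral.integral_of_le hab]
  refine (abs_integral_mul_le_sqrt hf hg').trans ?_
  gcongr
  calc ∫ z in Set.Ioc a b, ξ (l * z) ^ 2 ≤ ∫ z, ξ (l * z) ^ 2 :=
        setIntegral_le_integral hi2' (Filter.Eventually.of_forall fun _ => sq_nonneg _)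
    _ = l⁻¹ * ∫ z, ξ z ^ 2 := by
        rw [Measure.integral_comp_mul_left (fun z => ξ z ^ 2)]
        simp [abs_of_pos hl0]
    _ ≤ 2 * N := by
        have : l⁻¹ ≤ 2 := by rw [inv_le_comm₀ hl0 (by norm_num)]; linarith
        have h0 : 0 ≤ ∫ z, ξ z ^ 2 := integral_nonneg fun _ => sq_nonneg _
        have := inv_pos.2 hl0
        gcongr

/-- Cauchy-Schwarz for the mollified slope. -/
theorem abs_integral_mollify_mul_le (hφ : Continuous φ) (hφ0 : ∀ l, 0 ≤ φ l) (hm : Measurable ξ)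
    (hi : Integrable ξ) (hi2 : Integrable fun z => ξ z ^ 2) {N : ℝ} (hN : ∫ z, ξ z ^ 2 ≤ N)
    {a b : ℝ} (hab : a ≤ b) {g : ℝ → ℝ} (hg : Continuous g) :
    |∫ z in a..b, mollify φ ξ z * g z| ≤
      (∫ l in (1 / 2 : ℝ)..1, φ l) * (√(2 * N) * √(∫ z in a..b, g z ^ 2)) := by
  rw [interval_integral_mollify_mul hφ hm hi hab hg, ← intervalIntegral.integral_mul_const,
    ← Real.norm_eq_abs]
  refine intervalIntegral.norm_integral_le_of_norm_le (by norm_num) ?_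
    ((hφ.mul continuous_const).intervalIntegrable _ _)
  refine Filter.Eventually.of_forall fun l hl => ?_
  rw [norm_mul, Real.norm_of_nonneg (hφ0 l)]
  exact mul_le_mul_of_nonneg_left
    (abs_interval_integral_dilate_mul_le hm hi2 hN hl.1.le hab hg) (hφ0 l)

/-- Stability passes to dilates and to positive combinations, and `mollify` is a positive
combination of dilates. Because `l ≤ 1`, the dilated layer of height `h / l` contains `[0, h]`. The
constant 16 bounds `l⁻³ · l⁻¹` for `l ≥ 1/2`. -/
theorem Stab.mollify (hφ : Continuous φ) (hφ0 : ∀ l, 0 ≤ φ l) (hm : Measurable ξ)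
    (hi : Integrable ξ) {η h : ℝ} (hη : 0 ≤ η) (hh : 0 ≤ h) (hS : Stab η h ξ) :
    Stab (16 * η * ∫ l in (1 / 2 : ℝ)..1, φ l) h (mollify φ ξ) := by
  intro k hk w hw w0 w0' hL0 hv
  have hg : Continuous fun z => w z * Lop k w z := hw.continuous.mul (Lop_continuous k hw)
  rw [interval_integral_mollify_mul hφ hm hi hh hg]
  have hE : 0 ≤ energy h k w := by
    unfold energy
    have h1 : 0 ≤ ∫ z in (0 : ℝ)..h, dLop k w z ^ 2 :=
      intervalIntegral.integral_nonneg hh fun _ _ => sq_nonneg _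
    have h2 : 0 ≤ ∫ z in (0 : ℝ)..h, Lop k w z ^ 2 :=
      intervalIntegral.integral_nonneg hh fun _ _ => sq_nonneg _
    positivity
  have hl : ∀ l ∈ Set.Icc (1 / 2 : ℝ) 1,
      φ l * (-(16 * η * energy h k w)) ≤ φ l * ∫ z in (0 : ℝ)..h, ξ (l * z) * (w z * Lop k w z) := by
    intro l hl
    have hl0 : 0 < l := by linarith [hl.1]
    refine mul_le_mul_of_nonneg_left ?_ (hφ0 l)
    have h1 := ((hS.dilate hl0).mono_height (h' := h)
      (by rw [le_div_iff₀ hl0]; nlinarith [hl.2]) hh) k hk w hw w0 w0' hL0 hv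
    have e : ∫ z in (0 : ℝ)..h, l * ξ (l * z) * (w z * Lop k w z) =
        l * ∫ z in (0 : ℝ)..h, ξ (l * z) * (w z * Lop k w z) := by
      rw [← intervalIntegral.integral_const_mul]; congr 1; funext z; ring
    rw [e] at h1
    have h2 : -(η * (l ^ 3)⁻¹ * energy h k w) / l ≤
        ∫ z in (0 : ℝ)..h, ξ (l * z) * (w z * Lop k w z) := by
      rw [div_le_iff₀ hl0]; linarith
    refine le_trans ?_ h2
    have h3 : (l ^ 4)⁻¹ ≤ 16 := by
      rw [inv_le_comm₀ (by positivity) (by norm_num)]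
      have : (1 / 2 : ℝ) ^ 4 ≤ l ^ 4 := by gcongr; exact hl.1
      linarith
    have h4 : η * energy h k w * (l ^ 4)⁻¹ ≤ η * energy h k w * 16 := by gcongr
    have h5 : -(η * (l ^ 3)⁻¹ * energy h k w) / l = -(η * energy h k w * (l ^ 4)⁻¹) := by
      field_simp
    rw [h5]; linarith
  obtain ⟨M, hM0, hM⟩ := exists_bound_Ioc hg 0 h
  have hint := integrable_mollify_inner hφ hm hi
    (G := (Set.Ioc 0 h).indicator fun z => w z * Lop k w z)
    (hg.measurable.indicator measurableSet_Ioc) (M := M)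
    (abs_indicator_le hM0 fun z hz => hM z ⟨hz.1.le, hz.2⟩)
  have e : ∀ l, ∫ z, ξ (l * z) * (Set.Ioc 0 h).indicator (fun z => w z * Lop k w z) z =
      ∫ z in (0 : ℝ)..h, ξ (l * z) * (w z * Lop k w z) := fun l =>
    integral_indicator_interval hh (fun z => ξ (l * z)) _
  simp only [e] at hint
  refine le_trans (le_of_eq ?_) (intervalIntegral.integral_mono_on (by norm_num)
    ((hφ.mul continuous_const).intervalIntegrable _ _) hint hl)
  have e2 := intervalIntegral.integral_mul_const (a := (1 / 2 : ℝ)) (b := 1) (μ := volume)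
    (-(16 * η * energy h k w)) φ
  simp only [Pi.mul_apply]
  rw [e2]
  ring

end

/-! ### A test function with non-negative kernel, and the pointwise lower bound -/

theorem contDiff_five {f : ℝ → ℝ} (hf : ContDiff ℝ (⊤ : ℕ∞) f) : ContDiff ℝ 5 f := by
  exact_mod_cast contDiff_infty.1 hf 5

theorem iteratedDeriv_mul_bound {w v : ℝ → ℝ} {z : ℝ} (hw : ContDiff ℝ 5 w) (hv : ContDiff ℝ 5 v)
    {A B : ℝ} (hA : ∀ i ≤ 5, |iteratedDeriv i w z| ≤ A) (hB : ∀ i ≤ 5, |iteratedDeriv i v z| ≤ B)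
    {n : ℕ} (hn : n ≤ 5) : |iteratedDeriv n (fun x => w x * v x) z| ≤ 32 * A * B := by
  have hn' : (n : WithTop ℕ∞) ≤ 5 := by exact_mod_cast hn
  have hA0 : 0 ≤ A := (abs_nonneg _).trans (hA 0 (by norm_num))
  have hB0 : 0 ≤ B := (abs_nonneg _).trans (hB 0 (by norm_num))
  have := iteratedDeriv_mul (n := n) (hw.contDiffAt.of_le hn') (hv.contDiffAt.of_le hn') (x := z)
  change |iteratedDeriv n (w * v) z| ≤ _
  rw [this]
  refine (Finset.abs_sum_le_sum_abs _ _).trans ?_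
  calc ∑ i ∈ Finset.range (n + 1), |(n.choose i : ℝ) * iteratedDeriv i w z * iteratedDeriv (n - i) v z|
      ≤ ∑ i ∈ Finset.range (n + 1), (n.choose i : ℝ) * (A * B) := by
        refine Finset.sum_le_sum fun i hi => ?_
        have h1 := hA i (by simp at hi; omega)
        have h2 := hB (n - i) (by omega)
        rw [abs_mul, abs_mul, Nat.abs_cast, mul_assoc]
        gcongr
    _ = 2 ^ n * (A * B) := by
        rw [← Finset.sum_mul]
        congr 1
        exact_mod_cast Nat.sum_range_choose n
    _ ≤ 2 ^ 5 * (A * B) := by gcongr; norm_num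
    _ = _ := by ring

theorem Lop_bound {w : ℝ → ℝ} {z A k : ℝ} (hk0 : 0 ≤ k) (hk : k ≤ 1)
    (hA : ∀ i ≤ 5, |iteratedDeriv i w z| ≤ A) : |Lop k w z| ≤ 4 * A ∧ |dLop k w z| ≤ 4 * A := by
  have hk2 : k ^ 2 ≤ 1 := pow_le_one₀ hk0 hk
  have hk4 : k ^ 4 ≤ 1 := pow_le_one₀ hk0 hk
  have hA0 : 0 ≤ A := (abs_nonneg _).trans (hA 0 (by norm_num))
  have key : ∀ a b c : ℝ, |a| ≤ A → |b| ≤ A → |c| ≤ A →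
      |a - 2 * k ^ 2 * b + k ^ 4 * c| ≤ 4 * A := fun a b c ha hb hc => by
    have h1 : |2 * k ^ 2 * b| ≤ 2 * 1 * A := by
      rw [abs_mul, abs_of_nonneg (by positivity : 0 ≤ 2 * k ^ 2)]; gcongr
    have h2 : |k ^ 4 * c| ≤ 1 * A := by
      rw [abs_mul, abs_of_nonneg (by positivity : 0 ≤ k ^ 4)]; gcongr
    calc |a - 2 * k ^ 2 * b + k ^ 4 * c| ≤ |a - 2 * k ^ 2 * b| + |k ^ 4 * c| := abs_add_le _ _
      _ ≤ |a| + |2 * k ^ 2 * b| + |k ^ 4 * c| := by gcongr; exact abs_sub _ _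
      _ ≤ 4 * A := by linarith
  have h0 := hA 0 (by norm_num)
  rw [iteratedDeriv_zero] at h0
  exact ⟨key _ _ _ (hA 4 (by norm_num)) (hA 2 (by norm_num)) h0,
    key _ _ _ (hA 5 (by norm_num)) (hA 3 (by norm_num)) (hA 1 (by norm_num))⟩

theorem exists_iteratedDeriv_bound {w : ℝ → ℝ} (hw : ContDiff ℝ 5 w) (a b : ℝ) :
    ∃ A, 0 ≤ A ∧ ∀ z ∈ Set.Icc a b, ∀ i ≤ 5, |iteratedDeriv i w z| ≤ A := by
  have : ∀ i, i ≤ 5 → ∃ A, 0 ≤ A ∧ ∀ z ∈ Set.Icc a b, |iteratedDeriv i w z| ≤ A := fun i hi =>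
    exists_bound_Ioc (iteratedDeriv_continuous hw hi) a b
  choose! A hA0 hA using this
  refine ⟨∑ i ∈ Finset.range 6, A i, Finset.sum_nonneg fun i hi => hA0 i (by simp at hi; omega),
    fun z hz i hi => (hA i hi z hz).trans ?_⟩
  exact Finset.single_le_sum (f := A) (fun i hi => hA0 i (by simp at hi; omega))
    (by simp; omega)

theorem iteratedDeriv_step {f g g' : ℝ → ℝ} {U : Set ℝ} (hU : IsOpen U) {n : ℕ}
    (h : ∀ z ∈ U, iteratedDeriv n f z = g z) (hg : ∀ z ∈ U, HasDerivAt g (g' z) z) :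
    ∀ z ∈ U, iteratedDeriv (n + 1) f z = g' z := fun z hz => by
  rw [iteratedDeriv_succ]
  have : iteratedDeriv n f =ᶠ[nhds z] g := by
    filter_upwards [hU.mem_nhds hz] with y hy using h y hy
  rw [this.deriv_eq]
  exact (hg z hz).deriv

theorem contDiff_integral_right {f : ℝ → ℝ} (hf : ContDiff ℝ (⊤ : ℕ∞) f) (a : ℝ) :
    ContDiff ℝ (⊤ : ℕ∞) fun x => ∫ t in a..x, f t := by
  have hd : ∀ x, HasDerivAt (fun x => ∫ t in a..x, f t) (f x) x := fun x =>
    (hf.continuous).integral_hasStrictDerivAt a x |>.hasDerivAt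
  refine contDiff_infty_iff_deriv.2 ⟨fun x => (hd x).differentiableAt, ?_⟩
  rwa [show deriv (fun x => ∫ t in a..x, f t) = f from funext fun x => (hd x).deriv]

theorem integral_right_hasDerivAt {f : ℝ → ℝ} (hf : Continuous f) (a x : ℝ) :
    HasDerivAt (fun x => ∫ t in a..x, f t) (f x) x :=
  (hf.integral_hasStrictDerivAt a x).hasDerivAt

/-- A smooth bump that is positive exactly on `(a, b)`. -/
def bump (a b x : ℝ) : ℝ := expNegInvGlue (x - a) * expNegInvGlue (b - x)

theorem bump_contDiff (a b : ℝ) : ContDiff ℝ (⊤ : ℕ∞) (bump a b) :=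
  (expNegInvGlue.contDiff.comp (contDiff_id.sub contDiff_const)).mul
    (expNegInvGlue.contDiff.comp (contDiff_const.sub contDiff_id))

theorem bump_nonneg (a b x : ℝ) : 0 ≤ bump a b x :=
  mul_nonneg (expNegInvGlue.nonneg _) (expNegInvGlue.nonneg _)

theorem bump_pos {a b x : ℝ} (h1 : a < x) (h2 : x < b) : 0 < bump a b x :=
  mul_pos (expNegInvGlue.pos_of_pos (by linarith)) (expNegInvGlue.pos_of_pos (by linarith))

theorem bump_zero_left {a b x : ℝ} (h : x ≤ a) : bump a b x = 0 := by
  simp [bump, expNegInvGlue.zero_of_nonpos (by linarith : x - a ≤ 0)]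

theorem bump_zero_right {a b x : ℝ} (h : b ≤ x) : bump a b x = 0 := by
  simp [bump, expNegInvGlue.zero_of_nonpos (by linarith : b - x ≤ 0)]

/-- There is a test function `w` on the half-line for which `w (1 - d²/dz²)² w` is a non-negative
bump supported in `[1/2, 1]`. -/
theorem exists_positive_test : ∃ w : ℝ → ℝ, ContDiff ℝ 5 w ∧ w 0 = 0 ∧ deriv w 0 = 0 ∧
    Lop 1 w 0 = 0 ∧ (∀ z, 0 ≤ w z * Lop 1 w z) ∧ (∀ z, z ≤ 1 / 2 → Lop 1 w z = 0) ∧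
    (∀ z, 1 ≤ z → Lop 1 w z = 0) ∧ (∀ z, 1 / 2 < z → z < 1 → 0 < w z * Lop 1 w z) ∧
    ∃ C, 0 ≤ C ∧ ∀ z, 0 ≤ z → ∀ i ≤ 5, |iteratedDeriv i w z| ≤ C * Real.exp (-(z / 2)) := by
  -- The factorisation `(1 - d²)² = (d - 1)² (d + 1)²` is inverted one factor at a time. With `w =
  -- e^{-x} p` one has `(d + 1)² w = e^{-x} p''`, and with `p'' = e^{2x} r` one has `(d - 1)² (e^x
  -- r) = e^x r'' = e^x θ`. Integrating `r` from the right makes it vanish beyond 1, which gives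
  -- decay. Integrating `p` from 0 gives the boundary conditions. Both integrations preserve
  -- positivity, hence `w > 0` for positive arguments.
  set θ : ℝ → ℝ := bump (1 / 2) 1 with hθ
  have cθ : ContDiff ℝ (⊤ : ℕ∞) θ := bump_contDiff _ _
  set r1 : ℝ → ℝ := fun x => ∫ t in (1 : ℝ)..x, θ t with hr1
  have cr1 : ContDiff ℝ (⊤ : ℕ∞) r1 := contDiff_integral_right cθ 1
  set r : ℝ → ℝ := fun x => ∫ t in (1 : ℝ)..x, r1 t with hr
  have cr : ContDiff ℝ (⊤ : ℕ∞) r := contDiff_integral_right cr1 1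
  set q : ℝ → ℝ := fun x => Real.exp (2 * x) * r x with hq
  have cq : ContDiff ℝ (⊤ : ℕ∞) q :=
    (Real.contDiff_exp.comp (contDiff_const.mul contDiff_id)).mul cr
  set p1 : ℝ → ℝ := fun x => ∫ t in (0 : ℝ)..x, q t with hp1
  have cp1 : ContDiff ℝ (⊤ : ℕ∞) p1 := contDiff_integral_right cq 0
  set p : ℝ → ℝ := fun x => ∫ t in (0 : ℝ)..x, p1 t with hp
  have cp : ContDiff ℝ (⊤ : ℕ∞) p := contDiff_integral_right cp1 0
  set w : ℝ → ℝ := fun x => Real.exp (-x) * p x with hw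
  have cw : ContDiff ℝ (⊤ : ℕ∞) w := (Real.contDiff_exp.comp contDiff_neg).mul cp
  have cw5 : ContDiff ℝ 5 w := contDiff_five cw
  -- derivatives
  have dr1 : ∀ x, HasDerivAt r1 (θ x) x := integral_right_hasDerivAt cθ.continuous 1
  have dr : ∀ x, HasDerivAt r (r1 x) x := integral_right_hasDerivAt cr1.continuous 1
  have dp1 : ∀ x, HasDerivAt p1 (q x) x := integral_right_hasDerivAt cq.continuous 0
  have dp : ∀ x, HasDerivAt p (p1 x) x := integral_right_hasDerivAt cp1.continuous 0
  have dE : ∀ x, HasDerivAt (fun x : ℝ => Real.exp (-x)) (-Real.exp (-x)) x := fun x => by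
    simpa using (hasDerivAt_neg x).exp
  have dE2 : ∀ x, HasDerivAt (fun x : ℝ => Real.exp (2 * x)) (2 * Real.exp (2 * x)) x := fun x => by
    have := ((hasDerivAt_id x).const_mul 2).exp
    simpa [mul_comm] using this
  have dq : ∀ x, HasDerivAt q (Real.exp (2 * x) * (2 * r x + r1 x)) x := fun x => by
    refine ((dE2 x).mul (dr x)).congr_deriv ?_; ring
  have dq1 : ∀ x, HasDerivAt (fun x => Real.exp (2 * x) * (2 * r x + r1 x))
      (Real.exp (2 * x) * (4 * r x + 4 * r1 x + θ x)) x := fun x => by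
    refine ((dE2 x).mul (((dr x).const_mul 2).add (dr1 x))).congr_deriv ?_
    simp only [Pi.add_apply]; ring
  have w1 : ∀ x ∈ Set.univ, iteratedDeriv 1 w x = Real.exp (-x) * (p1 x - p x) :=
    iteratedDeriv_step isOpen_univ (n := 0) (g := w) (fun z _ => by rw [iteratedDeriv_zero])
      fun x _ => by refine ((dE x).mul (dp x)).congr_deriv ?_; ring
  have w2 : ∀ x ∈ Set.univ, iteratedDeriv 2 w x = Real.exp (-x) * (q x - 2 * p1 x + p x) :=
    iteratedDeriv_step isOpen_univ w1
      fun x _ => by refine ((dE x).mul ((dp1 x).sub (dp x))).congr_deriv ?_; simp only [Pi.sub_apply]; ring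
  have w3 : ∀ x ∈ Set.univ, iteratedDeriv 3 w x =
      Real.exp (-x) * (Real.exp (2 * x) * (2 * r x + r1 x) - 3 * q x + 3 * p1 x - p x) :=
    iteratedDeriv_step isOpen_univ w2 fun x _ => by
      refine ((dE x).mul (((dq x).sub ((dp1 x).const_mul 2)).add (dp x))).congr_deriv ?_
      simp only [Pi.sub_apply, Pi.add_apply]; ring
  have w4 : ∀ x ∈ Set.univ, iteratedDeriv 4 w x = Real.exp (-x) * (Real.exp (2 * x) *
      (4 * r x + 4 * r1 x + θ x) - 4 * (Real.exp (2 * x) * (2 * r x + r1 x)) + 6 * q x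
        - 4 * p1 x + p x) :=
    iteratedDeriv_step isOpen_univ w3 fun x _ => by
      refine ((dE x).mul ((((dq1 x).sub ((dq x).const_mul 3)).add
        ((dp1 x).const_mul 3)).sub (dp x))).congr_deriv ?_
      simp only [Pi.sub_apply, Pi.add_apply]; ring
  have hL : ∀ x, Lop 1 w x = Real.exp x * θ x := fun x => by
    have e : Real.exp x = Real.exp (-x) * Real.exp (2 * x) := by rw [← Real.exp_add]; congr 1; ring
    rw [Lop, w4 x trivial, w2 x trivial, e]
    simp only [hw, hq]
    ring
  -- signs
  have hr1neg : ∀ x, x ≤ 1 → r1 x ≤ 0 := fun x hx => by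
    simp only [hr1]
    rw [intervalIntegral.integral_symm]
    have : 0 ≤ ∫ t in x..1, θ t := intervalIntegral.integral_nonneg hx fun t _ => bump_nonneg _ _ _
    linarith
  have hr1lt : ∀ x, x < 1 → r1 x < 0 := fun x hx => by
    have h1 : r1 (max x (1 / 2)) < 0 := by
      simp only [hr1]
      rw [intervalIntegral.integral_symm]
      have : 0 < ∫ t in (max x (1 / 2))..1, θ t :=
        intervalIntegral.intervalIntegral_pos_of_pos_on (cθ.continuous.intervalIntegrable _ _)
          (fun t ht => bump_pos ((le_max_right _ _).trans_lt ht.1) ht.2) (max_lt hx (by norm_num))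
      linarith
    have h2 : r1 x ≤ r1 (max x (1 / 2)) := by
      have mono : Monotone r1 := monotone_of_deriv_nonneg (fun x => (dr1 x).differentiableAt)
        fun x => by rw [(dr1 x).deriv]; exact bump_nonneg _ _ _
      exact mono (le_max_left _ _)
    linarith
  have hr1z : ∀ x, 1 ≤ x → r1 x = 0 := fun x hx => by
    simp only [hr1]
    rw [intervalIntegral.integral_congr (g := fun _ => 0)]
    · simp
    · intro t ht; rw [Set.uIcc_of_le hx] at ht; exact bump_zero_right ht.1
  have hrz : ∀ x, 1 ≤ x → r x = 0 := fun x hx => by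
    simp only [hr]
    rw [intervalIntegral.integral_congr (g := fun _ => 0)]
    · simp
    · intro t ht; rw [Set.uIcc_of_le hx] at ht; exact hr1z t ht.1
  have hrpos : ∀ x, x < 1 → 0 < r x := fun x hx => by
    simp only [hr]
    rw [intervalIntegral.integral_symm]
    have : 0 < ∫ t in x..1, -r1 t :=
      intervalIntegral.intervalIntegral_pos_of_pos_on (cr1.continuous.neg.intervalIntegrable _ _)
        (fun t ht => by have := hr1lt t ht.2; linarith) hx
    rw [intervalIntegral.integral_neg] at this
    linarith
  have hqnn : ∀ x, 0 ≤ q x := fun x => by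
    rcases lt_or_ge x 1 with h | h
    · exact mul_nonneg (Real.exp_pos _).le (hrpos x h).le
    · simp [hq, hrz x h]
  have hp1pos : ∀ x, 0 < x → 0 < p1 x := fun x hx => by
    have h1 : 0 < p1 (min x 1) :=
      intervalIntegral.intervalIntegral_pos_of_pos_on (cq.continuous.intervalIntegrable _ _)
        (fun t ht => mul_pos (Real.exp_pos _) (hrpos t (ht.2.trans_le (min_le_right _ _))))
        (lt_min hx one_pos)
    have mono : Monotone p1 := monotone_of_deriv_nonneg (fun x => (dp1 x).differentiableAt)
      fun x => by rw [(dp1 x).deriv]; exact hqnn x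
    exact h1.trans_le (mono (min_le_left _ _))
  have hppos : ∀ x, 0 < x → 0 < p x := fun x hx =>
    intervalIntegral.intervalIntegral_pos_of_pos_on (cp1.continuous.intervalIntegrable _ _)
      (fun t ht => hp1pos t ht.1) hx
  have hLl : ∀ z, z ≤ 1 / 2 → Lop 1 w z = 0 := fun z hz => by
    rw [hL, hθ, bump_zero_left hz, mul_zero]
  have hLr : ∀ z, 1 ≤ z → Lop 1 w z = 0 := fun z hz => by
    rw [hL, hθ, bump_zero_right hz, mul_zero]
  have hpos : ∀ z, 1 / 2 < z → z < 1 → 0 < w z * Lop 1 w z := fun z h1 h2 => by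
    rw [hL]
    exact mul_pos (mul_pos (Real.exp_pos _) (hppos z (by linarith)))
      (mul_pos (Real.exp_pos _) (bump_pos h1 h2))
  have hp0 : p 0 = 0 := by simp [hp]
  have hp10 : p1 0 = 0 := by simp [hp1]
  refine ⟨w, cw5, by simp [hw, hp0], ?_, hLl 0 (by norm_num), ?_, hLl, hLr, hpos, ?_⟩
  · rw [← iteratedDeriv_one, w1 0 trivial, hp0, hp10]; simp
  · intro z
    rcases le_or_gt z (1 / 2) with h | h
    · simp [hLl z h]
    rcases lt_or_ge z 1 with h' | h'
    · exact (hpos z h h').le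
    · simp [hLr z h']
  -- decay
  obtain ⟨A, hA0, hA⟩ := exists_iteratedDeriv_bound cw5 0 2
  have hqz : ∀ x, 1 ≤ x → q x = 0 := fun x hx => by simp [hq, hrz x hx]
  have hp1c : ∀ x, 1 ≤ x → p1 x = p1 1 := fun x hx => by
    have : p1 x - p1 1 = ∫ t in (1 : ℝ)..x, q t := by
      simp only [hp1]
      exact intervalIntegral.integral_interval_sub_left (cq.continuous.intervalIntegrable _ _)
        (cq.continuous.intervalIntegrable _ _)
    rw [intervalIntegral.integral_congr (g := fun _ => 0)] at this
    · simp at this; linarith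
    · intro t ht; rw [Set.uIcc_of_le hx] at ht; exact hqz t ht.1
  have hpc : ∀ x, 1 ≤ x → p x = p 1 + p1 1 * (x - 1) := fun x hx => by
    have : p x - p 1 = ∫ t in (1 : ℝ)..x, p1 t := by
      simp only [hp]
      exact intervalIntegral.integral_interval_sub_left (cp1.continuous.intervalIntegrable _ _)
        (cp1.continuous.intervalIntegrable _ _)
    rw [intervalIntegral.integral_congr (g := fun _ => p1 1)] at this
    · simp at this; linarith
    · intro t ht; rw [Set.uIcc_of_le hx] at ht; exact hp1c t ht.1
  -- Beyond 1 the function `q` vanishes, so `p` is affine and `w` is `e^{-x}` times an affine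
  -- function. The rate `1/2` in the final bound absorbs the linear factor.
  have htail : ∀ i : ℕ, i ≤ 5 → ∀ x ∈ Set.Ioi (1 : ℝ),
      iteratedDeriv i w x = (-1) ^ i * (Real.exp (-x) * (p x - i * p1 1)) := by
    intro i hi
    induction i with
    | zero => intro x _; simp [hw]
    | succ i ih =>
      refine iteratedDeriv_step isOpen_Ioi (ih (by omega)) fun x hx => ?_
      refine (((dE x).mul ((dp x).sub_const (i * p1 1))).const_mul ((-1) ^ i)).congr_deriv ?_
      rw [hp1c x (le_of_lt hx)]
      push_cast; ring
  set a := |p 1| + 6 * |p1 1| with ha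
  have ha0 : 0 ≤ a := by positivity
  refine ⟨A * Real.exp 1 + 3 * a, by positivity, fun z hz i hi => ?_⟩
  rcases le_or_gt z 2 with h2 | h2
  · refine (hA z ⟨hz, h2⟩ i hi).trans ?_
    have : 1 ≤ Real.exp 1 * Real.exp (-(z / 2)) := by
      rw [← Real.exp_add]; exact Real.one_le_exp (by linarith)
    have h3 := Real.exp_pos (-(z / 2))
    nlinarith
  · rw [htail i hi z (by simp; linarith), abs_mul, abs_pow, abs_neg, abs_one, one_pow, one_mul, abs_mul,
      abs_of_pos (Real.exp_pos _)]
    have h3 : |p z - i * p1 1| ≤ a * z := by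
      have hi' : (i : ℝ) ≤ 5 := by exact_mod_cast hi
      rw [hpc z (by linarith)]
      have h5 := abs_nonneg (p1 1)
      have h6 := abs_nonneg (p 1)
      calc |p 1 + p1 1 * (z - 1) - i * p1 1| = |p 1 + p1 1 * (z - 1 - i)| := by congr 1; ring
        _ ≤ |p 1| + |p1 1| * |z - 1 - i| := by rw [← abs_mul]; exact abs_add_le _ _
        _ ≤ |p 1| * z + |p1 1| * (6 * z) := by
          have : |z - 1 - i| ≤ 6 * z := by rw [abs_le]; constructor <;> linarith [(Nat.cast_nonneg i : (0:ℝ) ≤ i)]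
          gcongr
          nlinarith
        _ = a * z := by rw [ha]; ring
    have h4 : z ≤ 2 * Real.exp (z / 2) := by
      have := Real.add_one_le_exp (z / 2); linarith
    have h5 : Real.exp (-z) * Real.exp (z / 2) = Real.exp (-(z / 2)) := by
      rw [← Real.exp_add]; congr 1; ring
    calc Real.exp (-z) * |p z - i * p1 1| ≤ Real.exp (-z) * (a * (2 * Real.exp (z / 2))) := by
          gcongr; exact h3.trans (by gcongr)
      _ = 2 * a * Real.exp (-(z / 2)) := by rw [← h5]; ring
      _ ≤ _ := by
          have : 0 ≤ A * Real.exp 1 + a := by positivity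
          have := mul_nonneg this (Real.exp_pos (-(z / 2))).le
          linarith

/-- A smooth cutoff, equal to `1` for `x ≤ 1/2` and to `0` for `x ≥ 1`. -/
def cut (x : ℝ) : ℝ := 1 - Real.smoothTransition (2 * x - 1)

theorem cut_contDiff : ContDiff ℝ (⊤ : ℕ∞) cut :=
  contDiff_const.sub (Real.smoothTransition.contDiff.comp
    ((contDiff_const.mul contDiff_id).sub contDiff_const))

theorem cut_one {x : ℝ} (hx : x ≤ 1 / 2) : cut x = 1 := by
  simp [cut, Real.smoothTransition.zero_of_nonpos (by linarith : 2 * x - 1 ≤ 0)]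

theorem cut_zero {x : ℝ} (hx : 1 ≤ x) : cut x = 0 := by
  simp [cut, Real.smoothTransition.one_of_one_le (by linarith : 1 ≤ 2 * x - 1)]

theorem cut_nonneg (x : ℝ) : 0 ≤ cut x := by
  have := Real.smoothTransition.le_one (2 * x - 1); unfold cut; linarith

theorem cut_le_one (x : ℝ) : cut x ≤ 1 := by
  have := Real.smoothTransition.nonneg (2 * x - 1); unfold cut; linarith

theorem Lop_congr {w v : ℝ → ℝ} {z : ℝ} (h : w =ᶠ[nhds z] v) (k : ℝ) : Lop k w z = Lop k v z := by
  simp only [Lop, h.iteratedDeriv_eq, h.eq_of_nhds]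

theorem dLop_congr {w v : ℝ → ℝ} {z : ℝ} (h : w =ᶠ[nhds z] v) (k : ℝ) :
    dLop k w z = dLop k v z := by
  simp only [dLop, h.iteratedDeriv_eq]

/-- Pointwise lower bound on the mollified slope. -/
theorem mollify_lower_bound {w : ℝ → ℝ} (cw : ContDiff ℝ 5 w) (w0 : w 0 = 0) (w0' : deriv w 0 = 0)
    (hLl : ∀ z, z ≤ 1 / 2 → Lop 1 w z = 0) (hLr : ∀ z, 1 ≤ z → Lop 1 w z = 0)
    {C : ℝ} (hC0 : 0 ≤ C) (hC : ∀ z, 0 ≤ z → ∀ i ≤ 5, |iteratedDeriv i w z| ≤ C * Real.exp (-(z / 2))) :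
    ∃ C', 0 ≤ C' ∧ ∀ (ξ : ℝ → ℝ) (H η l : ℝ), 0 ≤ η → Integrable ξ → Stab η H ξ → 0 < l → 2 * l ≤ H →
      -(C' * (η * (l ^ 3)⁻¹ + Real.exp (-(H / (2 * l))) * ∫ z, |ξ z|)) ≤
        l * mollify (fun z => w z * Lop 1 w z) ξ l := by
  have c5 := contDiff_five cut_contDiff
  obtain ⟨B, hB0, hB⟩ := exists_iteratedDeriv_bound c5 0 1
  set D := 4 * (32 * C * B) with hD
  have hD0 : 0 ≤ D := by positivity
  refine ⟨2 * D ^ 2 + D ^ 2, by positivity, fun ξ H η l hη hi hS hl hlH => ?_⟩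
  -- In units of `l` the layer has height `Y ≥ 2`. The test is `w` cut off at `Y`, and the cutoff
  -- acts only above `Y / 2 ≥ 1`, which is outside the support of `Lop 1 w`.
  set Y := H / l with hY
  have hY2 : 2 ≤ Y := by rw [hY, le_div_iff₀ hl]; linarith
  have hY0 : 0 < Y := by linarith
  have cχ : ContDiff ℝ 5 (fun z => cut (Y⁻¹ * z)) := c5.comp (contDiff_const.mul contDiff_id)
  set V : ℝ → ℝ := fun z => w z * cut (Y⁻¹ * z) with hV
  have cV : ContDiff ℝ 5 V := cw.mul cχ
  have hVd : ∀ z ∈ Set.Icc 0 Y, ∀ i ≤ 5,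
      |iteratedDeriv i V z| ≤ 32 * C * B * Real.exp (-(z / 2)) := fun z hz i hi => by
    have h1 : ∀ i ≤ 5, |iteratedDeriv i (fun z => cut (Y⁻¹ * z)) z| ≤ B := fun i hi => by
      rw [iteratedDeriv_comp_mul_left c5 _ hi, abs_mul]
      have h2 : |Y⁻¹ ^ i| ≤ 1 := by
        rw [abs_of_nonneg (by positivity)]
        exact pow_le_one₀ (by positivity) (inv_le_one_of_one_le₀ (by linarith))
      have h3 := hB (Y⁻¹ * z) ⟨by have := hz.1; positivity, by
        rw [inv_mul_le_iff₀ hY0]; linarith [hz.2]⟩ i hi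
      calc _ ≤ 1 * B := by gcongr
        _ = B := one_mul B
    have := iteratedDeriv_mul_bound cw cχ (fun i hi => hC z hz.1 i hi) h1 hi
    exact this.trans (le_of_eq (by ring))
  have hVL : ∀ z ∈ Set.Icc 0 Y, |Lop 1 V z| ≤ D * Real.exp (-(z / 2)) ∧
      |dLop 1 V z| ≤ D * Real.exp (-(z / 2)) := fun z hz => by
    have := Lop_bound (k := 1) (w := V) zero_le_one le_rfl (hVd z hz)
    rw [hD]
    exact ⟨this.1.trans (le_of_eq (by ring)), this.2.trans (le_of_eq (by ring))⟩
  have hVw : ∀ z, z < Y / 2 → V =ᶠ[nhds z] w := fun z hz => by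
    filter_upwards [Iio_mem_nhds hz] with y hy
    simp only [hV]
    rw [cut_one, mul_one]
    rw [inv_mul_le_iff₀ hY0]
    have : y < Y / 2 := hy
    linarith
  have hS' := hS.dilate hl 1 one_pos V cV (by simp [hV, w0]) (by
      rw [(hVw 0 (by linarith)).deriv_eq, w0']) (by
      rw [Lop_congr (hVw 0 (by linarith)), hLl 0 (by norm_num)]) (fun z hz => by
      simp only [hV]
      rw [cut_zero, mul_zero]
      rw [← hY] at hz
      rw [le_inv_mul_iff₀ hY0]; linarith)
  rw [← hY] at hS'
  have hexp : ∫ z in (0 : ℝ)..Y, Real.exp (-z) ≤ 1 := by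
    have : ∫ z in (0 : ℝ)..Y, Real.exp (-z) = 1 - Real.exp (-Y) := by
      rw [intervalIntegral.integral_comp_neg (fun z => Real.exp z)]; simp
    rw [this]; linarith [Real.exp_pos (-Y)]
  have hen : ∀ g : ℝ → ℝ, Continuous g → (∀ z ∈ Set.Icc 0 Y, |g z| ≤ D * Real.exp (-(z / 2))) →
      ∫ z in (0 : ℝ)..Y, g z ^ 2 ≤ D ^ 2 := fun g hg hb => by
    calc ∫ z in (0 : ℝ)..Y, g z ^ 2 ≤ ∫ z in (0 : ℝ)..Y, D ^ 2 * Real.exp (-z) := by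
          refine intervalIntegral.integral_mono_on hY0.le ((hg.pow 2).intervalIntegrable _ _)
            ((by fun_prop : Continuous fun z : ℝ => D ^ 2 * Real.exp (-z)).intervalIntegrable _ _)
            fun z hz => ?_
          have h1 := hb z hz
          have h2 : Real.exp (-z) = Real.exp (-(z / 2)) ^ 2 := by
            rw [← Real.exp_nat_mul]; congr 1; push_cast; ring
          rw [h2, ← mul_pow, ← sq_abs]
          gcongr
      _ = D ^ 2 * ∫ z in (0 : ℝ)..Y, Real.exp (-z) := by rw [intervalIntegral.integral_const_mul]
      _ ≤ D ^ 2 * 1 := by gcongr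
      _ = D ^ 2 := mul_one _
  have hE : energy Y 1 V ≤ 2 * D ^ 2 := by
    have h1 := hen _ (dLop_continuous 1 cV) fun z hz => (hVL z hz).2
    have h2 := hen _ (Lop_continuous 1 cV) fun z hz => (hVL z hz).1
    unfold energy; norm_num; linarith
  have hil : Integrable fun z => ξ (l * z) := hi.comp_mul_left' hl.ne'
  have cg : Continuous fun z => V z * Lop 1 V z := cV.continuous.mul (Lop_continuous 1 cV)
  have cφ : Continuous fun z => w z * Lop 1 w z := cw.continuous.mul (Lop_continuous 1 cw)
  -- Above `Y / 2` the kernel of `w` is zero and that of the cut-off `V` is of order `e^{-z}`.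
  -- Exchanging the two costs at most `e^{-Y/2} ∫ |ξ|`.
  have hpt : ∫ z in (0 : ℝ)..Y, l * ξ (l * z) * (V z * Lop 1 V z) ≤
      ∫ z in (0 : ℝ)..Y, (l * ξ (l * z) * (w z * Lop 1 w z) +
        D ^ 2 * Real.exp (-(Y / 2)) * |l * ξ (l * z)|) := by
    have i1 : IntervalIntegrable (fun z => l * ξ (l * z)) volume 0 Y :=
      (hil.const_mul l).intervalIntegrable
    refine intervalIntegral.integral_mono_on hY0.le (i1.mul_continuousOn cg.continuousOn)
      ((i1.mul_continuousOn cφ.continuousOn).add (i1.abs.const_mul _)) fun z hz => ?_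
    rcases lt_or_ge z (Y / 2) with h | h
    · rw [Lop_congr (hVw z h), (hVw z h).eq_of_nhds]
      have : 0 ≤ D ^ 2 * Real.exp (-(Y / 2)) * |l * ξ (l * z)| := by positivity
      linarith
    · rw [hLr z (by linarith), mul_zero, mul_zero, zero_add]
      have h1 := (hVL z hz).1
      have h2 : |V z| ≤ D * Real.exp (-(z / 2)) := by
        have := hVd z hz 0 (by norm_num)
        rw [iteratedDeriv_zero] at this
        refine this.trans ?_
        have := Real.exp_pos (-(z / 2))
        have h0 : 0 ≤ C * B := by positivity
        rw [hD]
        nlinarith [mul_nonneg h0 this.le]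
      have h3 : |V z * Lop 1 V z| ≤ D ^ 2 * Real.exp (-(Y / 2)) := by
        rw [abs_mul]
        calc |V z| * |Lop 1 V z| ≤ (D * Real.exp (-(z / 2))) * (D * Real.exp (-(z / 2))) := by gcongr
          _ = D ^ 2 * Real.exp (-z) := by
              rw [show -z = -(z / 2) + -(z / 2) by ring, Real.exp_add]; ring
          _ ≤ _ := by gcongr
      calc l * ξ (l * z) * (V z * Lop 1 V z) ≤ |l * ξ (l * z)| * |V z * Lop 1 V z| := by
            rw [← abs_mul]; exact le_abs_self _
        _ ≤ |l * ξ (l * z)| * (D ^ 2 * Real.exp (-(Y / 2))) := by gcongr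
        _ = _ := by ring
  have i1 : IntervalIntegrable (fun z => l * ξ (l * z)) volume 0 Y :=
    (hil.const_mul l).intervalIntegrable
  rw [intervalIntegral.integral_add (i1.mul_continuousOn cφ.continuousOn) (i1.abs.const_mul _),
    intervalIntegral.integral_const_mul] at hpt
  have habs : ∫ z in (0 : ℝ)..Y, |l * ξ (l * z)| ≤ ∫ z, |ξ z| := by
    rw [intervalIntegral.integral_of_le hY0.le]
    calc ∫ z in Set.Ioc 0 Y, |l * ξ (l * z)| ≤ ∫ z, |l * ξ (l * z)| :=
          setIntegral_le_integral (hil.const_mul l).abs (Filter.Eventually.of_forall fun _ => abs_nonneg _)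
      _ = ∫ z, |ξ z| := by
          simp only [abs_mul, abs_of_pos hl]
          rw [MeasureTheory.integral_const_mul, Measure.integral_comp_mul_left (fun z => |ξ z|)]
          simp only [abs_of_pos (inv_pos.2 hl), smul_eq_mul]
          field_simp
  have hφint : ∫ z in (0 : ℝ)..Y, l * ξ (l * z) * (w z * Lop 1 w z) =
      l * mollify (fun z => w z * Lop 1 w z) ξ l := by
    have j : ∀ a b, IntervalIntegrable (fun z => l * ξ (l * z) * (w z * Lop 1 w z)) volume a b :=
      fun a b => (hil.const_mul l).intervalIntegrable.mul_continuousOn cφ.continuousOn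
    rw [← intervalIntegral.integral_add_adjacent_intervals (j 0 (1 / 2)) (j (1 / 2) Y),
      ← intervalIntegral.integral_add_adjacent_intervals (j (1 / 2) 1) (j 1 Y)]
    have z1 : ∫ z in (0 : ℝ)..(1 / 2), l * ξ (l * z) * (w z * Lop 1 w z) = 0 := by
      rw [intervalIntegral.integral_congr (g := fun _ => 0)]
      · simp
      · intro t ht
        rw [Set.uIcc_of_le (by norm_num)] at ht
        simp [hLl t ht.2]
    have z2 : ∫ z in (1 : ℝ)..Y, l * ξ (l * z) * (w z * Lop 1 w z) = 0 := by
      rw [intervalIntegral.integral_congr (g := fun _ => 0)]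
      · simp
      · intro t ht
        rw [Set.uIcc_of_le (by linarith)] at ht
        simp [hLr t ht.1]
    rw [z1, z2, mollify, ← intervalIntegral.integral_const_mul, zero_add, add_zero]
    congr 1; funext z
    rw [mul_comm l z]; ring
  rw [hφint] at hpt
  have hYe : H / (2 * l) = Y / 2 := by rw [hY]; field_simp
  rw [hYe]
  have hl3 : 0 ≤ η * (l ^ 3)⁻¹ := by positivity
  have h1 : η * (l ^ 3)⁻¹ * energy Y 1 V ≤ η * (l ^ 3)⁻¹ * (2 * D ^ 2) := by gcongr
  have h2 : D ^ 2 * Real.exp (-(Y / 2)) * (∫ z in (0 : ℝ)..Y, |l * ξ (l * z)|) ≤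
      D ^ 2 * Real.exp (-(Y / 2)) * ∫ z, |ξ z| := by gcongr
  have h3 : 0 ≤ Real.exp (-(Y / 2)) * ∫ z, |ξ z| := by positivity
  have h4 : 0 ≤ D ^ 2 * (η * (l ^ 3)⁻¹) := by positivity
  nlinarith [mul_nonneg (sq_nonneg D) h3]

/-! ### Survival of the negative mass under averaging -/

theorem hasDerivAt_integral_comp_mul {ω a : ℝ → ℝ} (hω : Continuous ω) (ha : Continuous a)
    {c d : ℝ} {γ γ' : ℝ → ℝ} (hγ : ∀ x, HasDerivAt γ (γ' x) x) (hγ' : Continuous γ') (x : ℝ) :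
    HasDerivAt (fun x => ∫ l in c..d, ω l * γ (a l * x)) (∫ l in c..d, ω l * a l * γ' (a l * x)) x := by
  have cγ : Continuous γ := continuous_iff_continuousAt.2 fun x => (hγ x).continuousAt
  have hF' : Continuous fun p : ℝ × ℝ => ω p.1 * a p.1 * γ' (a p.1 * p.2) := by fun_prop
  obtain ⟨M, hM⟩ := ((isCompact_uIcc (a := c) (b := d)).prod
    (isCompact_closedBall x 1)).exists_bound_of_continuousOn hF'.continuousOn
  refine (intervalIntegral.hasDerivAt_integral_of_dominated_loc_of_deriv_le
    (F := fun x l => ω l * γ (a l * x)) (F' := fun x l => ω l * a l * γ' (a l * x)) (bound := fun _ => M)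
    (Metric.ball_mem_nhds x one_pos) ?_ ?_ ?_ ?_ ?_ ?_).2
  · exact Filter.Eventually.of_forall fun y =>
      (by fun_prop : Continuous fun l => ω l * γ (a l * y)).aestronglyMeasurable
  · exact (by fun_prop : Continuous fun l => ω l * γ (a l * x)).intervalIntegrable _ _
  · exact (by fun_prop : Continuous fun l => ω l * a l * γ' (a l * x)).aestronglyMeasurable
  · exact Filter.Eventually.of_forall fun l hl y hy =>
      hM (l, y) ⟨Set.uIoc_subset_uIcc hl, Metric.ball_subset_closedBall hy⟩
  · exact intervalIntegrable_const
  · refine Filter.Eventually.of_forall fun l _ y _ => ?_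
    have h1 : HasDerivAt (fun y => a l * y) (a l) y := by
      simpa using (hasDerivAt_id y).const_mul (a l)
    exact (((hγ (a l * y)).comp y h1).const_mul (ω l)).congr_deriv (by ring)

theorem contDiff_integral_comp_mul {c d : ℝ} {a : ℝ → ℝ} (ha : Continuous a) (n : ℕ) :
    ∀ {ω γ : ℝ → ℝ}, Continuous ω → ContDiff ℝ (⊤ : ℕ∞) γ →
      ContDiff ℝ n (fun x => ∫ l in c..d, ω l * γ (a l * x)) := by
  induction n with
  | zero =>
    intro ω γ hω hγ
    have hγ2 := contDiff_infty_iff_deriv.1 hγ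
    refine contDiff_zero.2 (continuous_iff_continuousAt.2 fun x => ?_)
    exact (hasDerivAt_integral_comp_mul hω ha (fun x => (hγ2.1 x).hasDerivAt)
      hγ2.2.continuous x).continuousAt
  | succ n ih =>
    intro ω γ hω hγ
    have hγ2 := contDiff_infty_iff_deriv.1 hγ
    have hd := fun x => hasDerivAt_integral_comp_mul (c := c) (d := d) hω ha
      (fun x => (hγ2.1 x).hasDerivAt) hγ2.2.continuous x
    have : ((n + 1 : ℕ) : WithTop ℕ∞) = (n : WithTop ℕ∞) + 1 := by norm_cast
    rw [this, contDiff_succ_iff_deriv]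
    refine ⟨fun x => (hd x).differentiableAt, by simp, ?_⟩
    rw [show deriv (fun x => ∫ l in c..d, ω l * γ (a l * x)) = _ from funext fun x => (hd x).deriv]
    exact ih (hω.mul ha) hγ2.2

/-- Equal to `x¹²` for `x ≤ 1/2` and to `1` for `x ≥ 1`. -/
def ramp (x : ℝ) : ℝ := x ^ 12 * cut x + (1 - cut x)

theorem ramp_contDiff : ContDiff ℝ (⊤ : ℕ∞) ramp :=
  ((contDiff_id.pow 12).mul cut_contDiff).add (contDiff_const.sub cut_contDiff)

theorem ramp_of_le {x : ℝ} (hx : x ≤ 1 / 2) : ramp x = x ^ 12 := by simp [ramp, cut_one hx]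

theorem ramp_of_ge {x : ℝ} (hx : 1 ≤ x) : ramp x = 1 := by simp [ramp, cut_zero hx]

theorem ramp_nonneg (x : ℝ) : 0 ≤ ramp x :=
  add_nonneg (mul_nonneg (by positivity) (cut_nonneg x)) (by linarith [cut_le_one x])

theorem ramp_pos {x : ℝ} (hx : 0 < x) : 0 < ramp x := by
  rcases le_or_gt x (1 / 2) with h | h
  · rw [ramp_of_le h]; positivity
  · have h1 : (1 / 2 : ℝ) ^ 12 ≤ x ^ 12 := by gcongr
    have h2 := cut_nonneg x
    have h3 := cut_le_one x
    have h4 : (1 / 2 : ℝ) ^ 12 * cut x ≤ x ^ 12 * cut x := by gcongr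
    have : 0 < (1 / 2 : ℝ) ^ 12 * cut x + (1 - cut x) := by norm_num; linarith
    unfold ramp; linarith

theorem ramp_le_one {x : ℝ} (hx : 0 ≤ x) : ramp x ≤ 1 := by
  rcases le_or_gt 1 x with h | h
  · rw [ramp_of_ge h]
  · have h1 : x ^ 12 ≤ 1 := pow_le_one₀ hx h.le
    have h2 := cut_nonneg x
    have : x ^ 12 * cut x ≤ 1 * cut x := by gcongr
    unfold ramp; linarith

/-- The inverse, made continuous away from `[1/2, 1]`. -/
def inv' (l : ℝ) : ℝ := (max l (1 / 2))⁻¹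

theorem inv'_continuous : Continuous inv' := by
  unfold inv'
  refine (continuous_id.max continuous_const).inv₀ fun x => ?_
  have : (1 / 2 : ℝ) ≤ max (id x) (1 / 2) := le_max_right _ _
  linarith

theorem inv'_eq {l : ℝ} (hl : 1 / 2 ≤ l) : inv' l = l⁻¹ := by simp only [inv', max_eq_left hl]

/-- The multiplicative average of `ramp`. -/
def avgRamp (φ : ℝ → ℝ) (x : ℝ) : ℝ := ∫ l in (1 / 2 : ℝ)..1, φ l * inv' l * ramp (inv' l * x)

/-- The normalisation constant of the mollifier. -/
def massOf (φ : ℝ → ℝ) : ℝ := ∫ l in (1 / 2 : ℝ)..1, φ l * inv' l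

section
variable {φ : ℝ → ℝ}

theorem avgRamp_contDiff (hφ : Continuous φ) : ContDiff ℝ 5 (avgRamp φ) :=
  contDiff_integral_comp_mul inv'_continuous 5 (hφ.mul inv'_continuous) ramp_contDiff

theorem avgRamp_of_le {x : ℝ} (hx : x ≤ 1 / 4) :
    avgRamp φ x = (∫ l in (1 / 2 : ℝ)..1, φ l * inv' l * inv' l ^ 12) * x ^ 12 := by
  rw [avgRamp, ← intervalIntegral.integral_mul_const]
  refine intervalIntegral.integral_congr fun l hl => ?_
  rw [Set.uIcc_of_le (by norm_num)] at hl
  have hl0 : 0 < l := by linarith [hl.1]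
  rw [ramp_of_le, mul_pow]
  · ring
  · rw [inv'_eq hl.1, inv_mul_le_iff₀ hl0]; linarith [hl.1]

theorem avgRamp_of_ge {x : ℝ} (hx : 1 ≤ x) : avgRamp φ x = massOf φ := by
  refine intervalIntegral.integral_congr fun l hl => ?_
  rw [Set.uIcc_of_le (by norm_num)] at hl
  have hl0 : 0 < l := by linarith [hl.1]
  rw [ramp_of_ge, mul_one]
  rw [inv'_eq hl.1, le_inv_mul_iff₀ hl0]; linarith [hl.2]

theorem avgRamp_pos (hφ : Continuous φ) (hpos : ∀ l, 1 / 2 < l → l < 1 → 0 < φ l) {x : ℝ}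
    (hx : 0 < x) : 0 < avgRamp φ x := by
  refine intervalIntegral.intervalIntegral_pos_of_pos_on
    (((hφ.mul inv'_continuous).mul (ramp_contDiff.continuous.comp
      (inv'_continuous.mul continuous_const))).intervalIntegrable _ _) (fun l hl => ?_) (by norm_num)
  have hl0 : 0 < l := by linarith [hl.1]
  have h1 := hpos l hl.1 hl.2
  rw [inv'_eq hl.1.le]
  have := ramp_pos (x := l⁻¹ * x) (by positivity)
  positivity

theorem avgRamp_nonneg (hpos : ∀ l, 1 / 2 < l → l < 1 → 0 < φ l) (x : ℝ) :
    0 ≤ avgRamp φ x := by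
  refine intervalIntegral.integral_nonneg_of_ae_restrict (by norm_num) ?_
  have h : ∀ᵐ l : ℝ, l ≠ 1 := by simp [ae_iff]
  filter_upwards [ae_restrict_mem measurableSet_Icc, ae_restrict_of_ae h,
    ae_restrict_of_ae (by simp [ae_iff] : ∀ᵐ l : ℝ, l ≠ 1 / 2)] with l hl h1 h2
  have hl1 : 1 / 2 < l := lt_of_le_of_ne hl.1 (Ne.symm h2)
  have := hpos l hl1 (lt_of_le_of_ne hl.2 h1)
  have h3 := ramp_nonneg (inv' l * x)
  have h4 : 0 ≤ inv' l := by rw [inv'_eq hl.1]; exact inv_nonneg.2 (by linarith)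
  simp only [Pi.zero_apply]
  positivity

/-- The twelfth power in `ramp` is made for this. For `x ≤ 1/4` the average is an exact multiple of
`x¹²`, so its root is a multiple of the smooth function `x⁶`, even across 0. For `x > 0` the average
is positive and the root is as smooth as the average. -/
theorem sqrt_avgRamp_contDiff (hφ : Continuous φ) (hpos : ∀ l, 1 / 2 < l → l < 1 → 0 < φ l) :
    ContDiff ℝ 5 (fun x => √(avgRamp φ x)) := by
  refine contDiff_iff_contDiffAt.2 fun x => ?_
  rcases le_or_gt x 0 with hx | hx
  · have h : (fun x => √(avgRamp φ x)) =ᶠ[nhds x]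
        fun x => √(∫ l in (1 / 2 : ℝ)..1, φ l * inv' l * inv' l ^ 12) * x ^ 6 := by
      filter_upwards [Iio_mem_nhds (show x < 1 / 4 by linarith)] with y hy
      rw [avgRamp_of_le (le_of_lt hy), Real.sqrt_mul' _ (by positivity)]
      congr 1
      rw [show y ^ 12 = (y ^ 6) ^ 2 by ring, Real.sqrt_sq (by positivity)]
    exact ContDiffAt.congr_of_eventuallyEq
      (contDiff_const.mul (contDiff_id.pow 6)).contDiffAt h
  · exact (avgRamp_contDiff hφ).contDiffAt.sqrt (avgRamp_pos hφ hpos hx).ne'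

/-- The symmetric cutoff between the lower and the upper half of the unit layer. -/
def halfCut (y : ℝ) : ℝ := Real.cos (Real.pi / 2 * Real.smoothTransition (2 * y - 1 / 2))

theorem halfCut_contDiff : ContDiff ℝ (⊤ : ℕ∞) halfCut :=
  Real.contDiff_cos.comp (contDiff_const.mul (Real.smoothTransition.contDiff.comp
    ((contDiff_const.mul contDiff_id).sub contDiff_const)))

theorem halfCut_one {y : ℝ} (hy : y ≤ 1 / 4) : halfCut y = 1 := by
  rw [halfCut, Real.smoothTransition.zero_of_nonpos (by linarith), mul_zero, Real.cos_zero]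

theorem halfCut_zero {y : ℝ} (hy : 3 / 4 ≤ y) : halfCut y = 0 := by
  rw [halfCut, Real.smoothTransition.one_of_one_le (by linarith), mul_one, Real.cos_pi_div_two]

/-- The symmetry `smoothTransition (1 - t) = 1 - smoothTransition t` turns the reflected cosine into
a sine. The identity splits the total mass `-1` between the two halves by weights that are squares,
as the high-wavenumber test requires. -/
theorem halfCut_sq_add (y : ℝ) : halfCut y ^ 2 + halfCut (1 - y) ^ 2 = 1 := by
  have h : ∀ t, Real.smoothTransition (1 - t) = 1 - Real.smoothTransition t := fun t => by
    have h1 := Real.smoothTransition.pos_denom t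
    have h2 := Real.smoothTransition.pos_denom (1 - t)
    rw [sub_sub_cancel] at h2
    unfold Real.smoothTransition
    rw [sub_sub_cancel, eq_sub_iff_add_eq, add_comm (expNegInvGlue (1 - t)), ← add_div,
      add_comm (expNegInvGlue (1 - t)), div_self h1.ne']
  unfold halfCut
  rw [show 2 * (1 - y) - 1 / 2 = 1 - (2 * y - 1 / 2) by ring, h, mul_sub, mul_one,
    Real.cos_pi_div_two_sub]
  exact Real.cos_sq_add_sin_sq _

/-- Lower bound for the slope tested with a square varying on the scale `Z`. -/
theorem integral_sq_lower_bound (hφ : Continuous φ) (hpos : ∀ l, 1 / 2 < l → l < 1 → 0 < φ l) :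
    ∃ C, 0 ≤ C ∧ ∀ (ξ : ℝ → ℝ) (H Z η K : ℝ), 0 ≤ η → 0 < Z → Z ≤ H → 1 ≤ K → Integrable ξ →
      Stab η H ξ → -(C * (η * K ^ 4 * (Z ^ 3)⁻¹ * (H / Z) + (K ^ 2)⁻¹ * ∫ z, |ξ z|)) ≤
        ∫ y in (0 : ℝ)..H, ξ y * (halfCut (y / H) * √(avgRamp φ (y / Z))) ^ 2 := by
  have cρ := sqrt_avgRamp_contDiff hφ hpos
  have cψ := contDiff_five halfCut_contDiff
  obtain ⟨P1, hP10, hP1⟩ := exists_iteratedDeriv_bound cρ 0 2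
  obtain ⟨B, hB0, hB⟩ := exists_iteratedDeriv_bound cψ 0 1
  set P := P1 + |√(massOf φ)| with hPdef
  have hP0 : 0 ≤ P := by positivity
  have hP : ∀ x, 0 ≤ x → ∀ i ≤ 5, |iteratedDeriv i (fun x => √(avgRamp φ x)) x| ≤ P := by
    intro x hx i hi
    rcases le_or_gt x 2 with h | h
    · exact (hP1 x ⟨hx, h⟩ i hi).trans (by simp [hPdef])
    · have he : (fun x => √(avgRamp φ x)) =ᶠ[nhds x] fun _ => √(massOf φ) := by
        filter_upwards [Ioi_mem_nhds (show 1 < x by linarith)] with y hy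
        rw [avgRamp_of_ge (le_of_lt hy)]
      rw [he.iteratedDeriv_eq, iteratedDeriv_const]
      split_ifs
      · simp [hPdef, hP10]
      · simpa using hP0
  set D := 32 * B * P with hD
  have hD0 : 0 ≤ D := by positivity
  refine ⟨32 * D ^ 2 + 3 * D ^ 2, by positivity, fun ξ H Z η K hη hZ hZH hK hi hS => ?_⟩
  have hH : 0 < H := hZ.trans_le hZH
  have hK0 : 0 < K := by linarith
  set h := H / Z with hh
  have hh0 : 0 < h := by positivity
  have cψ' : ContDiff ℝ 5 (fun x => halfCut (h⁻¹ * x)) := cψ.comp (contDiff_const.mul contDiff_id)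
  set Ψ : ℝ → ℝ := fun x => halfCut (h⁻¹ * x) * √(avgRamp φ x) with hΨ
  have cΨ : ContDiff ℝ 5 Ψ := cψ'.mul cρ
  have hb : ∀ x ∈ Set.Icc 0 h, ∀ i ≤ 5, |iteratedDeriv i Ψ x| ≤ D := fun x hx i hi => by
    refine iteratedDeriv_mul_bound cψ' cρ (fun i hi => ?_) (hP x hx.1) hi
    rw [iteratedDeriv_comp_mul_left cψ _ hi, abs_mul]
    have h1 : |h⁻¹ ^ i| ≤ 1 := by
      rw [abs_of_nonneg (by positivity)]
      exact pow_le_one₀ (by positivity) (inv_le_one_of_one_le₀ (by rw [hh, le_div_iff₀ hZ]; linarith))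
    have h2 := hB (h⁻¹ * x) ⟨by have := hx.1; positivity, by
      rw [inv_mul_le_iff₀ hh0]; linarith [hx.2]⟩ i hi
    calc _ ≤ 1 * B := by gcongr
      _ = B := one_mul B
  -- Near the wall `Ψ` is a multiple of `x⁶`, so its derivatives up to order five vanish at 0 and
  -- the boundary conditions hold for every wavenumber `K`.
  have hnear : Ψ =ᶠ[nhds 0]
      fun x => √(∫ l in (1 / 2 : ℝ)..1, φ l * inv' l * inv' l ^ 12) * x ^ 6 := by
    filter_upwards [Iio_mem_nhds (show (0 : ℝ) < min (1 / 4) (h / 4) by positivity)] with y hy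
    have hy1 : y < 1 / 4 := lt_of_lt_of_le hy (min_le_left _ _)
    have hy2 : y < h / 4 := lt_of_lt_of_le hy (min_le_right _ _)
    simp only [hΨ]
    rw [halfCut_one (by rw [inv_mul_le_iff₀ hh0]; linarith), one_mul, avgRamp_of_le hy1.le,
      Real.sqrt_mul' _ (by positivity), show y ^ 12 = (y ^ 6) ^ 2 by ring,
      Real.sqrt_sq (by positivity)]
  have hid : ∀ n < 6, iteratedDeriv n Ψ 0 = 0 := fun n hn => by
    rw [hnear.iteratedDeriv_eq, iteratedDeriv_const_mul_field, iteratedDeriv_fun_pow_zero,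
      if_neg (by omega), Nat.cast_zero, mul_zero]
  have h0 : Ψ 0 = 0 := by simpa using hid 0 (by norm_num)
  have hS' := hS.dilate hZ K hK0 Ψ cΨ h0 (by simpa using hid 1 (by norm_num))
    (by simp [Lop, hid, h0]) fun z hz => by
      simp only [hΨ]
      rw [halfCut_zero, zero_mul]
      rw [le_inv_mul_iff₀ hh0]; rw [← hh] at hz; linarith
  rw [← hh] at hS'
  have hK2 : 1 ≤ K ^ 2 := one_le_pow₀ hK
  have hK4 : 1 ≤ K ^ 4 := one_le_pow₀ hK
  have hK24 : K ^ 2 ≤ K ^ 4 := pow_le_pow_right₀ hK (by norm_num)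
  have gen : ∀ a b c : ℝ, |a| ≤ D → |b| ≤ D → |c| ≤ D →
      (a - 2 * K ^ 2 * b + K ^ 4 * c) ^ 2 ≤ 16 * K ^ 8 * D ^ 2 := fun a b c ha hb hc => by
    have h1 : |2 * K ^ 2 * b| ≤ 2 * K ^ 4 * D := by
      rw [abs_mul, abs_of_nonneg (by positivity : 0 ≤ 2 * K ^ 2)]; gcongr
    have h2 : |K ^ 4 * c| ≤ K ^ 4 * D := by
      rw [abs_mul, abs_of_nonneg (by positivity : 0 ≤ K ^ 4)]; gcongr
    have h3 : |a - 2 * K ^ 2 * b + K ^ 4 * c| ≤ 4 * K ^ 4 * D := by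
      calc |a - 2 * K ^ 2 * b + K ^ 4 * c| ≤ |a - 2 * K ^ 2 * b| + |K ^ 4 * c| := abs_add_le _ _
        _ ≤ |a| + |2 * K ^ 2 * b| + |K ^ 4 * c| := by gcongr; exact abs_sub _ _
        _ ≤ 4 * K ^ 4 * D := by nlinarith
    calc _ = |a - 2 * K ^ 2 * b + K ^ 4 * c| ^ 2 := (sq_abs _).symm
      _ ≤ (4 * K ^ 4 * D) ^ 2 := by gcongr
      _ = _ := by ring
  have hE : energy h K Ψ ≤ 32 * K ^ 8 * D ^ 2 * h := by
    have e : ∀ g : ℝ → ℝ, Continuous g → (∀ x ∈ Set.Icc 0 h, g x ^ 2 ≤ 16 * K ^ 8 * D ^ 2) →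
        ∫ z in (0 : ℝ)..h, g z ^ 2 ≤ 16 * K ^ 8 * D ^ 2 * h := fun g hg hb => by
      calc ∫ z in (0 : ℝ)..h, g z ^ 2 ≤ ∫ _ in (0 : ℝ)..h, 16 * K ^ 8 * D ^ 2 :=
            intervalIntegral.integral_mono_on hh0.le ((hg.pow 2).intervalIntegrable 0 h)
              intervalIntegrable_const hb
        _ = _ := by rw [intervalIntegral.integral_const, smul_eq_mul]; ring
    have e1 := e _ (dLop_continuous K cΨ) fun x hx =>
      gen _ _ _ (hb x hx 5 (by norm_num)) (hb x hx 3 (by norm_num)) (hb x hx 1 (by norm_num))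
    have e2 := e _ (Lop_continuous K cΨ) fun x hx =>
      gen _ _ _ (hb x hx 4 (by norm_num)) (hb x hx 2 (by norm_num))
        (by simpa using hb x hx 0 (by norm_num))
    have e3 : (K ^ 2)⁻¹ ≤ 1 := inv_le_one_of_one_le₀ hK2
    have e4 : 0 ≤ ∫ z in (0 : ℝ)..h, dLop K Ψ z ^ 2 :=
      intervalIntegral.integral_nonneg hh0.le fun _ _ => sq_nonneg _
    have e5 : (K ^ 2)⁻¹ * (∫ z in (0 : ℝ)..h, dLop K Ψ z ^ 2) ≤
        1 * ∫ z in (0 : ℝ)..h, dLop K Ψ z ^ 2 := by gcongr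
    unfold energy; linarith
  have hil : Integrable fun z => ξ (Z * z) := hi.comp_mul_left' hZ.ne'
  have i1 : IntervalIntegrable (fun z => Z * ξ (Z * z)) volume 0 h :=
    (hil.const_mul Z).intervalIntegrable
  have cg : Continuous fun z => Ψ z * Lop K Ψ z := cΨ.continuous.mul (Lop_continuous K cΨ)
  have csq : Continuous fun z => Ψ z ^ 2 := cΨ.continuous.pow 2
  -- For large `K` the kernel is `K⁴ Ψ²` up to `O(K²)`, and the energy is `O(K⁸ h)`. After division
  -- by `K⁴` the two errors are of order `K⁴` times the defect and `K⁻² ∫ |ξ|`.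
  have hpt : ∫ z in (0 : ℝ)..h, Z * ξ (Z * z) * (Ψ z * Lop K Ψ z) ≤
      ∫ z in (0 : ℝ)..h, (K ^ 4 * (Z * ξ (Z * z) * Ψ z ^ 2) +
        3 * K ^ 2 * D ^ 2 * |Z * ξ (Z * z)|) := by
    refine intervalIntegral.integral_mono_on hh0.le (i1.mul_continuousOn cg.continuousOn)
      (((i1.mul_continuousOn csq.continuousOn).const_mul _).add
        (i1.abs.const_mul _)) fun z hz => ?_
    have b4 := hb z hz 4 (by norm_num)
    have b2 := hb z hz 2 (by norm_num)
    have b0 := hb z hz 0 (by norm_num)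
    rw [iteratedDeriv_zero] at b0
    have h1 : |Ψ z * Lop K Ψ z - K ^ 4 * Ψ z ^ 2| ≤ 3 * K ^ 2 * D ^ 2 := by
      have e : Ψ z * Lop K Ψ z - K ^ 4 * Ψ z ^ 2 =
          Ψ z * (iteratedDeriv 4 Ψ z - 2 * K ^ 2 * iteratedDeriv 2 Ψ z) := by rw [Lop]; ring
      rw [e, abs_mul]
      have h2 : |iteratedDeriv 4 Ψ z - 2 * K ^ 2 * iteratedDeriv 2 Ψ z| ≤ 3 * K ^ 2 * D := by
        refine (abs_sub _ _).trans ?_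
        have : |2 * K ^ 2 * iteratedDeriv 2 Ψ z| ≤ 2 * K ^ 2 * D := by
          rw [abs_mul, abs_of_nonneg (by positivity : 0 ≤ 2 * K ^ 2)]; gcongr
        nlinarith
      calc _ ≤ D * (3 * K ^ 2 * D) := by gcongr
        _ = _ := by ring
    have h2 : Z * ξ (Z * z) * (Ψ z * Lop K Ψ z - K ^ 4 * Ψ z ^ 2) ≤
        3 * K ^ 2 * D ^ 2 * |Z * ξ (Z * z)| := by
      refine (le_abs_self _).trans ?_
      rw [abs_mul, mul_comm]
      gcongr
    linarith
  rw [intervalIntegral.integral_add ((i1.mul_continuousOn csq.continuousOn).const_mul _)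
    (i1.abs.const_mul _), intervalIntegral.integral_const_mul, intervalIntegral.integral_const_mul] at hpt
  have habs : ∫ z in (0 : ℝ)..h, |Z * ξ (Z * z)| ≤ ∫ z, |ξ z| := by
    rw [intervalIntegral.integral_of_le hh0.le]
    calc ∫ z in Set.Ioc 0 h, |Z * ξ (Z * z)| ≤ ∫ z, |Z * ξ (Z * z)| :=
          setIntegral_le_integral (hil.const_mul Z).abs (Filter.Eventually.of_forall fun _ => abs_nonneg _)
      _ = ∫ z, |ξ z| := by
          simp only [abs_mul, abs_of_pos hZ]
          rw [MeasureTheory.integral_const_mul, Measure.integral_comp_mul_left (fun z => |ξ z|)]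
          simp only [abs_of_pos (inv_pos.2 hZ), smul_eq_mul]
          field_simp
  have hch : ∫ z in (0 : ℝ)..h, Z * ξ (Z * z) * Ψ z ^ 2 =
      ∫ y in (0 : ℝ)..H, ξ y * (halfCut (y / H) * √(avgRamp φ (y / Z))) ^ 2 := by
    have := intervalIntegral.smul_integral_comp_mul_left (a := 0) (b := h)
      (fun y => ξ y * (halfCut (y / H) * √(avgRamp φ (y / Z))) ^ 2) Z
    rw [mul_zero, show Z * h = H by rw [hh]; field_simp] at this
    rw [← this, smul_eq_mul, ← intervalIntegral.integral_const_mul]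
    congr 1; funext z
    have e1 : Z * z / H = h⁻¹ * z := by rw [hh]; field_simp
    have e2 : Z * z / Z = z := by field_simp
    rw [e1, e2, hΨ]; ring
  rw [hch] at hpt
  set I := ∫ y in (0 : ℝ)..H, ξ y * (halfCut (y / H) * √(avgRamp φ (y / Z))) ^ 2
  have hJ0 : 0 ≤ ∫ z, |ξ z| := integral_nonneg fun _ => abs_nonneg _
  have hηZ : 0 ≤ η * (Z ^ 3)⁻¹ := by positivity
  have k1 : η * (Z ^ 3)⁻¹ * energy h K Ψ ≤ η * (Z ^ 3)⁻¹ * (32 * K ^ 8 * D ^ 2 * h) := by gcongr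
  have k2 : 3 * K ^ 2 * D ^ 2 * (∫ z in (0 : ℝ)..h, |Z * ξ (Z * z)|) ≤
      3 * K ^ 2 * D ^ 2 * ∫ z, |ξ z| := by gcongr
  have k3 : -(η * (Z ^ 3)⁻¹ * (32 * K ^ 8 * D ^ 2 * h)) - 3 * K ^ 2 * D ^ 2 * (∫ z, |ξ z|) ≤
      K ^ 4 * I := by linarith
  have k4 := mul_le_mul_of_nonneg_left k3 (inv_nonneg.2 (by positivity : 0 ≤ K ^ 4))
  rw [inv_mul_cancel_left₀ (by positivity)] at k4
  refine le_trans ?_ k4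
  have k5 : (K ^ 4)⁻¹ * (-(η * (Z ^ 3)⁻¹ * (32 * K ^ 8 * D ^ 2 * h)) - 3 * K ^ 2 * D ^ 2 * (∫ z, |ξ z|))
      = -(32 * D ^ 2 * (η * K ^ 4 * (Z ^ 3)⁻¹ * h)) - 3 * D ^ 2 * ((K ^ 2)⁻¹ * ∫ z, |ξ z|) := by
    field_simp
  rw [k5]
  have k6 : 0 ≤ D ^ 2 * (η * K ^ 4 * (Z ^ 3)⁻¹ * h) := by positivity
  have k7 : 0 ≤ D ^ 2 * ((K ^ 2)⁻¹ * ∫ z, |ξ z|) := by positivity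
  nlinarith

end

/-- Fubini and the substitution `y = l z` move the average from the slope onto the weight, turning
`1 - ramp` into `massOf φ - avgRamp φ (y / Z)`. Up to `H / 4` the factor `halfCut` is 1, and beyond
`H / 4 ≥ Z` the difference is zero. The factor `halfCut²` can therefore be inserted for free, and
both terms become squares or half-layer masses. -/
theorem integral_mollify_ramp {φ ξ : ℝ → ℝ} (hφ : Continuous φ)
    (hpos : ∀ l, 1 / 2 < l → l < 1 → 0 < φ l) (hm : Measurable ξ)
    (hi : Integrable ξ) {H Z : ℝ} (hs : ∀ z, z ∉ Set.Ioc 0 H → ξ z = 0) (hZ : 0 < Z)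
    (hZH : Z ≤ H / 4) :
    ∫ z in (0 : ℝ)..Z, mollify φ ξ z * (1 - ramp (z / Z)) =
      massOf φ * (∫ y in (0 : ℝ)..H, ξ y * halfCut (y / H) ^ 2) -
        ∫ y in (0 : ℝ)..H, ξ y * (halfCut (y / H) * √(avgRamp φ (y / Z))) ^ 2 := by
  have hH : 0 < H := by linarith
  set G : ℝ → ℝ := (Set.Ioi 0).indicator fun z => 1 - ramp (z / Z) with hG
  have cr : Continuous fun z => 1 - ramp (z / Z) :=
    continuous_const.sub (ramp_contDiff.continuous.comp (continuous_id.div_const Z))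
  have mG : Measurable G := cr.measurable.indicator measurableSet_Ioi
  have hGb : ∀ z, |G z| ≤ 1 := fun z => by
    by_cases hz : 0 < z
    · have h1 := ramp_nonneg (z / Z)
      have h2 := ramp_le_one (x := z / Z) (by positivity)
      rw [hG, Set.indicator_of_mem (by exact hz), abs_le]
      constructor <;> linarith
    · rw [hG, Set.indicator_of_notMem (by exact hz)]; simp
  have hGZ : ∀ z, Z ≤ z → G z = 0 := fun z hz => by
    rw [hG, Set.indicator_of_mem (by exact hZ.trans_le hz), ramp_of_ge, sub_self]
    rw [le_div_iff₀ hZ]; linarith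
  have e1 : ∫ z in (0 : ℝ)..Z, mollify φ ξ z * (1 - ramp (z / Z)) = ∫ z, mollify φ ξ z * G z := by
    rw [← integral_indicator_interval hZ.le]
    congr 1; funext z; congr 1
    by_cases hz : 0 < z
    · rw [hG, Set.indicator_of_mem (show z ∈ Set.Ioi 0 from hz)]
      by_cases hz2 : z ≤ Z
      · rw [Set.indicator_of_mem (show z ∈ Set.Ioc 0 Z from ⟨hz, hz2⟩)]
      · rw [Set.indicator_of_notMem fun h => hz2 h.2]
        have := hGZ z (le_of_lt (not_le.1 hz2))
        rw [hG, Set.indicator_of_mem (by exact hz)] at this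
        exact this.symm
    · rw [hG, Set.indicator_of_notMem fun h => hz h.1, Set.indicator_of_notMem (by exact hz)]
  rw [e1, integral_mollify_mul hφ hm hi mG hGb]
  have e2 : ∫ l in (1 / 2 : ℝ)..1, φ l * ∫ z, ξ (l * z) * G z =
      ∫ l in (1 / 2 : ℝ)..1, ∫ y, φ l * inv' l * (ξ y * G (inv' l * y)) := by
    refine intervalIntegral.integral_congr fun l hl => ?_
    rw [Set.uIcc_of_le (by norm_num)] at hl
    have hl0 : 0 < l := by linarith [hl.1]
    have h := Measure.integral_comp_mul_left (fun y => ξ y * G (l⁻¹ * y)) l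
    simp only [inv_mul_cancel_left₀ hl0.ne', abs_of_pos (inv_pos.2 hl0), smul_eq_mul] at h
    rw [h, MeasureTheory.integral_const_mul, inv'_eq hl.1]
    ring
  have hint : Integrable (fun p : ℝ × ℝ => φ p.1 * inv' p.1 * (ξ p.2 * G (inv' p.1 * p.2)))
      ((volume.restrict (Set.Ioc (1 / 2 : ℝ) 1)).prod volume) := by
    have hω : Integrable (fun l => φ l * inv' l) (volume.restrict (Set.Ioc (1 / 2 : ℝ) 1)) :=
      (hφ.mul inv'_continuous).integrableOn_Ioc
    have h1 := (hω.mul_prod hi).mul_bdd (c := 1)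
      (g := fun p : ℝ × ℝ => G (inv' p.1 * p.2))
      (mG.comp ((inv'_continuous.measurable.comp measurable_fst).mul measurable_snd)).aestronglyMeasurable
      (Filter.Eventually.of_forall fun p => by simpa using hGb _)
    refine h1.congr (Filter.Eventually.of_forall fun p => ?_)
    simp only; ring
  have e3 : ∫ l in (1 / 2 : ℝ)..1, ∫ y, φ l * inv' l * (ξ y * G (inv' l * y)) =
      ∫ y, ∫ l in (1 / 2 : ℝ)..1, φ l * inv' l * (ξ y * G (inv' l * y)) := by
    simp only [intervalIntegral.integral_of_le (by norm_num : (1 / 2 : ℝ) ≤ 1)]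
    exact integral_integral_swap (f := fun l y => φ l * inv' l * (ξ y * G (inv' l * y))) hint
  have e4 : ∀ y, ∫ l in (1 / 2 : ℝ)..1, φ l * inv' l * (ξ y * G (inv' l * y)) =
      ξ y * (Set.Ioc 0 H).indicator (fun y => massOf φ * halfCut (y / H) ^ 2 -
        (halfCut (y / H) * √(avgRamp φ (y / Z))) ^ 2) y := by
    intro y
    by_cases hy : y ∈ Set.Ioc 0 H
    swap
    · simp [hs y hy]
    have hy0 : 0 < y := hy.1
    rw [Set.indicator_of_mem hy]
    have h1 : ∫ l in (1 / 2 : ℝ)..1, φ l * inv' l * (ξ y * G (inv' l * y)) =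
        ξ y * (massOf φ - avgRamp φ (y / Z)) := by
      have j1 : IntervalIntegrable (fun l => φ l * inv' l) volume (1 / 2 : ℝ) 1 :=
        (hφ.mul inv'_continuous).intervalIntegrable _ _
      have j2 : IntervalIntegrable (fun l => φ l * inv' l * ramp (inv' l * (y / Z))) volume
          (1 / 2 : ℝ) 1 := ((hφ.mul inv'_continuous).mul (ramp_contDiff.continuous.comp
            (inv'_continuous.mul continuous_const))).intervalIntegrable _ _
      rw [massOf, avgRamp, ← intervalIntegral.integral_sub j1 j2, ← intervalIntegral.integral_const_mul]
      refine intervalIntegral.integral_congr fun l hl => ?_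
      rw [Set.uIcc_of_le (by norm_num)] at hl
      have hl0 : 0 < l := by linarith [hl.1]
      have : 0 < inv' l * y := by rw [inv'_eq hl.1]; positivity
      rw [hG, Set.indicator_of_mem (by exact this), mul_div_assoc]
      ring
    rw [h1]
    congr 1
    rw [mul_pow, Real.sq_sqrt (avgRamp_nonneg hpos _)]
    rcases le_or_gt y (H / 4) with h | h
    · rw [halfCut_one (by rw [div_le_iff₀ hH]; linarith)]; ring
    · rw [avgRamp_of_ge (by rw [le_div_iff₀ hZ]; linarith)]; ring
  rw [e2, e3]
  simp only [e4]
  have cS : Continuous fun y => √(avgRamp φ (y / Z)) :=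
    (sqrt_avgRamp_contDiff hφ hpos).continuous.comp (continuous_id.div_const Z)
  have cH : Continuous fun y => halfCut (y / H) :=
    halfCut_contDiff.continuous.comp (continuous_id.div_const H)
  have i0 : IntervalIntegrable ξ volume 0 H := hi.intervalIntegrable
  have i1 : IntervalIntegrable (fun y => ξ y * (massOf φ * halfCut (y / H) ^ 2)) volume 0 H :=
    i0.mul_continuousOn (by fun_prop : Continuous fun y => massOf φ * halfCut (y / H) ^ 2).continuousOn
  have i2 : IntervalIntegrable (fun y => ξ y * (halfCut (y / H) * √(avgRamp φ (y / Z))) ^ 2)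
      volume 0 H := i0.mul_continuousOn
    (by fun_prop : Continuous fun y => (halfCut (y / H) * √(avgRamp φ (y / Z))) ^ 2).continuousOn
  rw [integral_indicator_interval hH.le, ← intervalIntegral.integral_const_mul]
  simp only [mul_sub]
  rw [intervalIntegral.integral_sub i1 i2]
  congr 1
  congr 1; funext y; ring

theorem integral_abs_le_sqrt {ξ : ℝ → ℝ} (hm : Measurable ξ) (hi2 : Integrable fun z => ξ z ^ 2)
    {N H : ℝ} (hN : ∫ z, ξ z ^ 2 ≤ N) (hH : 0 ≤ H) (hs : ∀ z, z ∉ Set.Ioc 0 H → ξ z = 0) :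
    ∫ z, |ξ z| ≤ √(N * H) := by
  have h0 : ∫ z, |ξ z| = ∫ z in Set.Ioc 0 H, |ξ z| * 1 := by
    rw [← MeasureTheory.integral_indicator measurableSet_Ioc]
    congr 1; funext z
    by_cases hz : z ∈ Set.Ioc 0 H
    · simp [hz]
    · simp [hz, hs z hz]
  have hf : MemLp (fun z => |ξ z|) 2 (volume.restrict (Set.Ioc 0 H)) := by
    refine (memLp_two_iff_integrable_sq hm.abs.aestronglyMeasurable).2 ?_
    simp only [sq_abs]; exact hi2.integrableOn
  have hg : MemLp (fun _ : ℝ => (1 : ℝ)) 2 (volume.restrict (Set.Ioc 0 H)) := memLp_const 1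
  have h := abs_integral_mul_le_sqrt hf hg
  rw [h0]
  refine (le_abs_self _).trans (h.trans ?_)
  have hN0 : 0 ≤ N := (integral_nonneg fun _ => sq_nonneg _).trans hN
  rw [Real.sqrt_mul hN0]
  gcongr
  · simp only [sq_abs]
    exact (setIntegral_le_integral hi2 (Filter.Eventually.of_forall fun _ => sq_nonneg _)).trans hN
  · simp [hH]

/-- The properties of a mollified slope `X` on `[0, Z]`: approximate stability, an almost pointwise
positivity, a definite negative mass near the boundary, and a Cauchy-Schwarz bound. -/
structure Mollified (A m₀ N Z : ℝ) (X : ℝ → ℝ) : Prop where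
  integrable : Integrable X
  stab : Stab A Z X
  lower : ∀ z, 0 < z → z ≤ Z → -(A * (z ^ 4)⁻¹) ≤ X z
  mass : ∫ z in (0 : ℝ)..Z, X z * (1 - ramp (z / Z)) ≤ -m₀
  cauchy : ∀ a b : ℝ, a ≤ b → ∀ g : ℝ → ℝ, Continuous g →
    |∫ z in a..b, X z * g z| ≤ A * √N * √(∫ z in a..b, g z ^ 2)

/-- The scales are height `H = u⁵`, averaging scale `Z = u⁴` and wavenumber `K = u²`. Then `∫ |ξ| ≤
√(N u⁵) ≤ u³`, and the two errors in the mass are of order `K⁴ Z⁻³ (H / Z) = u⁻³` and `K⁻² u³ =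
u⁻¹`. In the pointwise bound at `l ≤ u⁴` the exponential error is at most `e^{-u/2} u³ ≤ u⁻¹² ≤
l⁻³`. -/
theorem exists_mollified : ∃ A m₀ U : ℝ, 0 < A ∧ 0 < m₀ ∧ 4 ≤ U ∧
    ∀ (u N : ℝ) (ξ : ℝ → ℝ), U ≤ u → N ≤ u → Measurable ξ → Integrable ξ →
      Integrable (fun z => ξ z ^ 2) → (∫ z, ξ z ^ 2) ≤ N → (∀ z, z ∉ Set.Ioc 0 (u ^ 5) → ξ z = 0) →
      Stab (1 / 2) (u ^ 5) ξ → (∫ y in (0 : ℝ)..(u ^ 5), ξ y * halfCut (y / u ^ 5) ^ 2) ≤ -(1 / 2) →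
      ∃ X, Mollified A m₀ N (u ^ 4) X := by
  obtain ⟨w, cw, w0, w0', hL0, hnn, hLl, hLr, hpos, C, hC0, hC⟩ := exists_positive_test
  set φ : ℝ → ℝ := fun z => w z * Lop 1 w z with hφdef
  have cφ : Continuous φ := cw.continuous.mul (Lop_continuous 1 cw)
  obtain ⟨C1, hC10, hC1⟩ := mollify_lower_bound cw w0 w0' hLl hLr hC0 hC
  obtain ⟨C2, hC20, hC2⟩ := integral_sq_lower_bound cφ hpos
  have hM : 0 < massOf φ :=
    intervalIntegral.intervalIntegral_pos_of_pos_on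
      ((cφ.mul inv'_continuous).intervalIntegrable _ _) (fun l hl => by
        have hl0 : 0 < l := by linarith [hl.1]
        rw [inv'_eq hl.1.le]
        exact mul_pos (hpos l hl.1 hl.2) (inv_pos.2 hl0)) (by norm_num)
  have hP : 0 ≤ ∫ l in (1 / 2 : ℝ)..1, φ l :=
    intervalIntegral.integral_nonneg (by norm_num) fun l _ => hnn l
  set P := ∫ l in (1 / 2 : ℝ)..1, φ l
  have hexp : ∀ᶠ u : ℝ in Filter.atTop, u ^ 15 * Real.exp (-u / 2) ≤ 1 := by
    have h := (Real.tendsto_pow_mul_exp_neg_atTop_nhds_zero 15).comp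
      (Filter.tendsto_id.atTop_div_const (by norm_num : (0 : ℝ) < 2))
    have h2 := h.eventually (gt_mem_nhds (show (0 : ℝ) < (1 / 2) ^ 15 by positivity))
    filter_upwards [h2] with u hu
    simp only [Function.comp, id, div_pow] at hu
    rw [show -(u / 2) = -u / 2 by ring] at hu
    have h3 : u ^ 15 * Real.exp (-u / 2) = 2 ^ 15 * (u ^ 15 / 2 ^ 15 * Real.exp (-u / 2)) := by ring
    rw [h3]
    have : (2 : ℝ) ^ 15 * (1 / 2) ^ 15 = 1 := by norm_num
    linarith [mul_lt_mul_of_pos_left hu (by norm_num : (0 : ℝ) < 2 ^ 15)]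
  obtain ⟨U0, hU0⟩ := Filter.eventually_atTop.1 hexp
  -- The summand `8 P = 16 · (1/2) · P` is the defect, `2 C1` serves the pointwise bound, and `2 P`
  -- serves the Cauchy-Schwarz bound. Half of `massOf φ` is available from the hypothesis on `ξ`,
  -- and a quarter is given up to the high-wavenumber error, which fixes the last threshold for `u`.
  refine ⟨8 * P + 2 * C1 + 2 * P + 1, massOf φ / 4, max (max U0 4) (8 * C2 / massOf φ), by positivity,
    by positivity, (le_max_right _ _).trans (le_max_left _ _), ?_⟩
  intro u N ξ hu hNu hm hi hi2 hN hs hS hmass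
  have hu4 : 4 ≤ u := ((le_max_right _ _).trans (le_max_left _ _)).trans hu
  have huU : U0 ≤ u := ((le_max_left _ _).trans (le_max_left _ _)).trans hu
  have huC : 8 * C2 / massOf φ ≤ u := (le_max_right _ _).trans hu
  have hu0 : 0 < u := by linarith
  have hN0 : 0 ≤ N := (integral_nonneg fun _ => sq_nonneg _).trans hN
  have habs : ∫ z, |ξ z| ≤ u ^ 3 := by
    refine (integral_abs_le_sqrt hm hi2 hN (by positivity) hs).trans ?_
    rw [show u ^ 3 = √((u ^ 3) ^ 2) by rw [Real.sqrt_sq (by positivity)]]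
    apply Real.sqrt_le_sqrt
    calc N * u ^ 5 ≤ u * u ^ 5 := by gcongr
      _ = _ := by ring
  have hZH : u ^ 4 ≤ u ^ 5 / 4 := by
    rw [le_div_iff₀ (by norm_num)]
    calc u ^ 4 * 4 ≤ u ^ 4 * u := by gcongr
      _ = u ^ 5 := by ring
  refine ⟨mollify φ ξ, integrable_mollify cφ hm hi, ?_, ?_, ?_, ?_⟩
  · refine ((hS.mollify cφ hnn hm hi (by norm_num) (by positivity)).mono_height (h' := u ^ 4)
      (by linarith [pow_pos hu0 5]) (by positivity)).mono_defect ?_ (by positivity)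
    linarith
  · intro l hl hlZ
    have h := hC1 ξ (u ^ 5) (1 / 2) l (by norm_num) hi hS hl (by linarith)
    have h1 : Real.exp (-(u ^ 5 / (2 * l))) ≤ Real.exp (-u / 2) := by
      apply Real.exp_le_exp.2
      rw [neg_div, neg_le_neg_iff, div_le_div_iff₀ (by norm_num) (by positivity)]
      calc u * (2 * l) ≤ u * (2 * u ^ 4) := by gcongr
        _ = u ^ 5 * 2 := by ring
    have h2 : Real.exp (-(u ^ 5 / (2 * l))) * (∫ z, |ξ z|) ≤ (l ^ 3)⁻¹ := by
      calc _ ≤ Real.exp (-u / 2) * u ^ 3 := by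
            have : 0 ≤ ∫ z, |ξ z| := integral_nonneg fun _ => abs_nonneg _
            gcongr
        _ ≤ (u ^ 12)⁻¹ := by
            rw [le_inv_comm₀ (by positivity) (by positivity), le_inv_comm₀ (by positivity) (by positivity)]
            rw [← one_div, le_div_iff₀ (by positivity)]
            calc Real.exp (-u / 2) * u ^ 3 * u ^ 12 = u ^ 15 * Real.exp (-u / 2) := by ring
              _ ≤ 1 := hU0 u huU
        _ ≤ (l ^ 3)⁻¹ := by
            gcongr
            calc l ^ 3 ≤ (u ^ 4) ^ 3 := by gcongr
              _ = u ^ 12 := by ring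
    have h3 : -(2 * C1 * (l ^ 3)⁻¹) ≤ l * mollify φ ξ l := by
      refine le_trans ?_ h
      have h4 : 1 / 2 * (l ^ 3)⁻¹ + Real.exp (-(u ^ 5 / (2 * l))) * (∫ z, |ξ z|) ≤ 2 * (l ^ 3)⁻¹ := by
        have : 0 < (l ^ 3)⁻¹ := by positivity
        linarith
      have := mul_le_mul_of_nonneg_left h4 hC10
      linarith
    have h4 : -(2 * C1 * (l ^ 4)⁻¹) ≤ mollify φ ξ l := by
      have := mul_le_mul_of_nonneg_left h3 (inv_nonneg.2 hl.le)
      rw [inv_mul_cancel_left₀ hl.ne'] at this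
      refine le_trans (le_of_eq ?_) this
      field_simp
    refine le_trans ?_ h4
    have : 0 ≤ (l ^ 4)⁻¹ := by positivity
    nlinarith
  · rw [integral_mollify_ramp cφ hpos hm hi hs (by positivity) hZH]
    have h := hC2 ξ (u ^ 5) (u ^ 4) (1 / 2) (u ^ 2) (by norm_num) (by positivity)
      (by linarith [pow_pos hu0 5]) (one_le_pow₀ (by linarith)) hi hS
    have h1 : 1 / 2 * (u ^ 2) ^ 4 * ((u ^ 4) ^ 3)⁻¹ * (u ^ 5 / u ^ 4) + ((u ^ 2) ^ 2)⁻¹ * (∫ z, |ξ z|) ≤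
        2 * u⁻¹ := by
      have e1 : 1 / 2 * (u ^ 2) ^ 4 * ((u ^ 4) ^ 3)⁻¹ * (u ^ 5 / u ^ 4) = 1 / 2 * (u ^ 3)⁻¹ := by
        field_simp
      have e2 : ((u ^ 2) ^ 2)⁻¹ * (∫ z, |ξ z|) ≤ u⁻¹ := by
        calc ((u ^ 2) ^ 2)⁻¹ * (∫ z, |ξ z|) ≤ ((u ^ 2) ^ 2)⁻¹ * u ^ 3 := by gcongr
          _ = u⁻¹ := by field_simp
      have e3 : (u ^ 3)⁻¹ ≤ u⁻¹ := by
        gcongr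
        exact le_self_pow₀ (by linarith) (by norm_num)
      have : 0 < u⁻¹ := by positivity
      rw [e1]; linarith
    have h2 : C2 * (2 * u⁻¹) ≤ massOf φ / 4 := by
      rw [div_le_iff₀ hM] at huC
      have : C2 * (2 * u⁻¹) = (8 * C2) / (4 * u) := by field_simp; ring
      rw [this, div_le_div_iff₀ (by positivity) (by norm_num)]
      linarith
    have h3 := mul_le_mul_of_nonneg_left h1 hC20
    have h4 := mul_le_mul_of_nonneg_left hmass hM.le
    linarith
  · intro a b hab g hg
    refine (abs_integral_mollify_mul_le cφ hnn hm hi hi2 hN hab hg).trans ?_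
    have hs2 : √(2 * N) ≤ 2 * √N := by
      rw [show (2 : ℝ) * √N = √(4 * N) by rw [Real.sqrt_mul (by norm_num), show (4 : ℝ) = 2 ^ 2 by norm_num, Real.sqrt_sq (by norm_num)]]
      exact Real.sqrt_le_sqrt (by linarith)
    calc P * (√(2 * N) * √(∫ z in a..b, g z ^ 2)) ≤ P * (2 * √N * √(∫ z in a..b, g z ^ 2)) := by
          gcongr
      _ = 2 * P * (√N * √(∫ z in a..b, g z ^ 2)) := by ring
      _ ≤ (8 * P + 2 * C1 + 2 * P + 1) * (√N * √(∫ z in a..b, g z ^ 2)) := by gcongr; linarith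
      _ = _ := by ring

/-! ### Test functions in logarithmic variables -/

theorem hasDerivAt_iteratedDeriv_smooth {f : ℝ → ℝ} (hf : ContDiff ℝ (⊤ : ℕ∞) f) (n : ℕ) (x : ℝ) :
    HasDerivAt (iteratedDeriv n f) (iteratedDeriv (n + 1) f x) x := by
  rw [iteratedDeriv_succ]
  exact ((hf.differentiable_iteratedDeriv n (by exact_mod_cast WithTop.coe_lt_top n)) x).hasDerivAt

section log
variable {w f : ℝ → ℝ}

/-- Derivatives of `z² f(log z)`. -/
theorem iteratedDeriv_log (hf : ContDiff ℝ (⊤ : ℕ∞) f)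
    (hw : ∀ z, 0 < z → w z = z ^ 2 * f (Real.log z)) {z : ℝ} (hz : 0 < z) :
    iteratedDeriv 1 w z = z * (iteratedDeriv 1 f (Real.log z) + 2 * f (Real.log z)) ∧
    iteratedDeriv 2 w z = iteratedDeriv 2 f (Real.log z) + 3 * iteratedDeriv 1 f (Real.log z)
      + 2 * f (Real.log z) ∧
    iteratedDeriv 3 w z = z⁻¹ * (iteratedDeriv 3 f (Real.log z) + 3 * iteratedDeriv 2 f (Real.log z)
      + 2 * iteratedDeriv 1 f (Real.log z)) ∧
    iteratedDeriv 4 w z = (z ^ 2)⁻¹ * (iteratedDeriv 4 f (Real.log z)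
      + 2 * iteratedDeriv 3 f (Real.log z) - iteratedDeriv 2 f (Real.log z)
      - 2 * iteratedDeriv 1 f (Real.log z)) ∧
    iteratedDeriv 5 w z = (z ^ 3)⁻¹ * (iteratedDeriv 5 f (Real.log z)
      - 5 * iteratedDeriv 3 f (Real.log z) + 4 * iteratedDeriv 1 f (Real.log z)) := by
  have hd : ∀ (n : ℕ) (z : ℝ), 0 < z → HasDerivAt (fun z => iteratedDeriv n f (Real.log z))
      (iteratedDeriv (n + 1) f (Real.log z) * z⁻¹) z := fun n z hz =>
    (hasDerivAt_iteratedDeriv_smooth hf n _).comp z (Real.hasDerivAt_log hz.ne')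
  have hinv : ∀ (n : ℕ) (z : ℝ), 0 < z →
      HasDerivAt (fun z : ℝ => (z ^ n)⁻¹) (-(n * z ^ (n - 1)) / (z ^ n) ^ 2) z := fun n z hz =>
    (hasDerivAt_pow n z).inv (pow_ne_zero _ hz.ne')
  have w1 : ∀ z ∈ Set.Ioi (0 : ℝ), iteratedDeriv 1 w z =
      z * (iteratedDeriv 1 f (Real.log z) + 2 * iteratedDeriv 0 f (Real.log z)) :=
    iteratedDeriv_step isOpen_Ioi (n := 0) (g := fun z => z ^ 2 * iteratedDeriv 0 f (Real.log z))
      (fun z hz => by simpa using hw z hz) fun z hz => by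
        have hz : 0 < z := hz
        refine ((hasDerivAt_pow 2 z).mul (hd 0 z hz)).congr_deriv ?_
        field_simp; ring
  have w2 : ∀ z ∈ Set.Ioi (0 : ℝ), iteratedDeriv 2 w z = iteratedDeriv 2 f (Real.log z)
      + 3 * iteratedDeriv 1 f (Real.log z) + 2 * iteratedDeriv 0 f (Real.log z) :=
    iteratedDeriv_step isOpen_Ioi w1 fun z hz => by
        have hz : 0 < z := hz
        refine ((hasDerivAt_id z).mul ((hd 1 z hz).add ((hd 0 z hz).const_mul 2))).congr_deriv ?_
        simp only [id, Pi.add_apply]; field_simp; ring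
  have w3 : ∀ z ∈ Set.Ioi (0 : ℝ), iteratedDeriv 3 w z = z⁻¹ * (iteratedDeriv 3 f (Real.log z)
      + 3 * iteratedDeriv 2 f (Real.log z) + 2 * iteratedDeriv 1 f (Real.log z)) :=
    iteratedDeriv_step isOpen_Ioi w2 fun z hz => by
        have hz : 0 < z := hz
        refine (((hd 2 z hz).add ((hd 1 z hz).const_mul 3)).add
          ((hd 0 z hz).const_mul 2)).congr_deriv ?_
        ring
  have w4 : ∀ z ∈ Set.Ioi (0 : ℝ), iteratedDeriv 4 w z = (z ^ 2)⁻¹ * (iteratedDeriv 4 f (Real.log z)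
      + 2 * iteratedDeriv 3 f (Real.log z) - iteratedDeriv 2 f (Real.log z)
      - 2 * iteratedDeriv 1 f (Real.log z)) :=
    iteratedDeriv_step isOpen_Ioi w3 fun z hz => by
        have hz : 0 < z := hz
        refine ((hasDerivAt_inv hz.ne').mul (((hd 3 z hz).add ((hd 2 z hz).const_mul 3)).add
          ((hd 1 z hz).const_mul 2))).congr_deriv ?_
        simp only [Pi.add_apply]; field_simp; ring
  have w5 : ∀ z ∈ Set.Ioi (0 : ℝ), iteratedDeriv 5 w z = (z ^ 3)⁻¹ * (iteratedDeriv 5 f (Real.log z)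
      - 5 * iteratedDeriv 3 f (Real.log z) + 4 * iteratedDeriv 1 f (Real.log z)) :=
    iteratedDeriv_step isOpen_Ioi w4 fun z hz => by
        have hz : 0 < z := hz
        refine ((hinv 2 z hz).mul ((((hd 4 z hz).add ((hd 3 z hz).const_mul 2)).sub
          (hd 2 z hz)).sub ((hd 1 z hz).const_mul 2))).congr_deriv ?_
        simp only [Pi.add_apply, Pi.sub_apply]; field_simp; ring
  simp only [iteratedDeriv_zero] at w1 w2
  exact ⟨w1 z hz, w2 z hz, w3 z hz, w4 z hz, w5 z hz⟩

/-- The leading operator acting on `f` when `w = z² f(log z)`. -/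
def logP (f : ℝ → ℝ) (σ : ℝ) : ℝ :=
  iteratedDeriv 4 f σ + 2 * iteratedDeriv 3 f σ - iteratedDeriv 2 f σ - 2 * iteratedDeriv 1 f σ

/-- The second derivative of `z² f(log z)` in logarithmic variables. -/
def logQ (f : ℝ → ℝ) (σ : ℝ) : ℝ :=
  iteratedDeriv 2 f σ + 3 * iteratedDeriv 1 f σ + 2 * f σ

theorem Lop_log (hf : ContDiff ℝ (⊤ : ℕ∞) f) (hw : ∀ z, 0 < z → w z = z ^ 2 * f (Real.log z))
    (k : ℝ) {z : ℝ} (hz : 0 < z) : Lop k w z = (z ^ 2)⁻¹ * (logP f (Real.log z)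
      - 2 * (k * z) ^ 2 * logQ f (Real.log z) + (k * z) ^ 4 * f (Real.log z)) := by
  obtain ⟨-, h2, -, h4, -⟩ := iteratedDeriv_log hf hw hz
  rw [Lop, h2, h4, hw z hz, logP, logQ]
  field_simp

/-- On `z² f(log z)` the fourth derivative acts as `z⁻² (D + 2)(D + 1) D (D - 1) f`, so the powers
of `z` cancel in the kernel. The symbol has a simple zero at `D = 0` with derivative `-2`, hence for
slowly varying `f` and small `k z` the kernel is approximately `-2 f f' = -(f²)'`. -/
theorem kernel_log (hf : ContDiff ℝ (⊤ : ℕ∞) f) (hw : ∀ z, 0 < z → w z = z ^ 2 * f (Real.log z))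
    (k : ℝ) {z : ℝ} (hz : 0 < z) : w z * Lop k w z = f (Real.log z) * (logP f (Real.log z)
      - 2 * (k * z) ^ 2 * logQ f (Real.log z) + (k * z) ^ 4 * f (Real.log z)) := by
  rw [Lop_log hf hw k hz, hw z hz]
  field_simp

theorem abs_Lop_log_le (hf : ContDiff ℝ (⊤ : ℕ∞) f)
    (hw : ∀ z, 0 < z → w z = z ^ 2 * f (Real.log z)) {k z A : ℝ} (hz : 0 < z) (hk : 0 ≤ k)
    (hkz : k * z ≤ 1) (hA : ∀ i ≤ 5, |iteratedDeriv i f (Real.log z)| ≤ A) :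
    |Lop k w z| ≤ 25 * A * (z ^ 2)⁻¹ ∧ |dLop k w z| ≤ 25 * A * (z ^ 3)⁻¹ := by
  obtain ⟨h1, -, h3, -, h5⟩ := iteratedDeriv_log hf hw hz
  have hkz0 : 0 ≤ k * z := by positivity
  have k2 : (k * z) ^ 2 ≤ 1 := pow_le_one₀ hkz0 hkz
  have k4 : (k * z) ^ 4 ≤ 1 := pow_le_one₀ hkz0 hkz
  have j2 : 0 ≤ (k * z) ^ 2 := by positivity
  have j4 : 0 ≤ (k * z) ^ 4 := by positivity
  have a0 := hA 0 (by norm_num)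
  have a1 := hA 1 (by norm_num)
  have a2 := hA 2 (by norm_num)
  have a3 := hA 3 (by norm_num)
  have a4 := hA 4 (by norm_num)
  have a5 := hA 5 (by norm_num)
  rw [iteratedDeriv_zero] at a0
  have comb : ∀ a b c : ℝ, |a| ≤ 10 * A → |b| ≤ 6 * A → |c| ≤ 3 * A →
      |a - 2 * (k * z) ^ 2 * b + (k * z) ^ 4 * c| ≤ 25 * A := fun a b c ha hb hc => by
    have e1 : |2 * (k * z) ^ 2 * b| ≤ 2 * 1 * (6 * A) := by
      rw [abs_mul, abs_of_nonneg (by positivity : 0 ≤ 2 * (k * z) ^ 2)]; gcongr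
    have e2 : |(k * z) ^ 4 * c| ≤ 1 * (3 * A) := by
      rw [abs_mul, abs_of_nonneg j4]; gcongr
    rw [abs_le] at *
    constructor <;> linarith
  rw [abs_le] at a0 a1 a2 a3 a4 a5
  constructor
  · rw [Lop_log hf hw k hz, abs_mul, abs_of_pos (by positivity), mul_comm]
    gcongr
    apply comb
    · rw [logP, abs_le]; constructor <;> linarith
    · rw [logQ, abs_le]; constructor <;> linarith
    · rw [abs_le]; constructor <;> linarith
  · have e : dLop k w z = (z ^ 3)⁻¹ * ((iteratedDeriv 5 f (Real.log z)
      - 5 * iteratedDeriv 3 f (Real.log z) + 4 * iteratedDeriv 1 f (Real.log z)) -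
      2 * (k * z) ^ 2 * (iteratedDeriv 3 f (Real.log z)
      + 3 * iteratedDeriv 2 f (Real.log z) + 2 * iteratedDeriv 1 f (Real.log z)) + (k * z) ^ 4 *
      (iteratedDeriv 1 f (Real.log z) + 2 * f (Real.log z))) := by
      rw [dLop, h1, h3, h5]; field_simp
    rw [e, abs_mul, abs_of_pos (by positivity), mul_comm]
    gcongr
    apply comb <;> rw [abs_le] <;> constructor <;> linarith

theorem integral_inv_pow_le {a b : ℝ} (ha : 0 < a) (hab : a ≤ b) {n : ℕ} (hn : 1 ≤ n) :
    ∫ z in a..b, (z ^ (n + 1))⁻¹ ≤ (a ^ n)⁻¹ := by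
  have h0 : (0 : ℝ) ∉ Set.uIcc a b := by rw [Set.uIcc_of_le hab]; intro h; linarith [h.1]
  have h := integral_zpow (a := a) (b := b) (n := -((n : ℤ) + 1)) (Or.inr ⟨by omega, h0⟩)
  have e : ∀ z : ℝ, z ^ (-((n : ℤ) + 1)) = (z ^ (n + 1))⁻¹ := fun z => by
    rw [zpow_neg]; norm_cast
  simp only [e] at h
  rw [h]
  have e2 : ∀ z : ℝ, z ^ (-((n : ℤ) + 1) + 1) = (z ^ n)⁻¹ := fun z => by
    rw [show -((n : ℤ) + 1) + 1 = -(n : ℤ) by ring, zpow_neg]; norm_cast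
  rw [e2, e2]
  have e3 : ((-((n : ℤ) + 1) : ℤ) : ℝ) + 1 = -n := by push_cast; ring
  rw [e3]
  have hn' : (1 : ℝ) ≤ n := by exact_mod_cast hn
  have hb : 0 ≤ (b ^ n)⁻¹ := by have := ha.trans_le hab; positivity
  have ha' : 0 ≤ (a ^ n)⁻¹ := by positivity
  rw [div_neg, ← neg_div, div_le_iff₀ (by positivity)]
  nlinarith

/-- Energy of a test function `z² f(log z)` vanishing below `a`. -/
theorem energy_log_le (hf : ContDiff ℝ (⊤ : ℕ∞) f) (cw : ContDiff ℝ 5 w)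
    (hw : ∀ z, 0 < z → w z = z ^ 2 * f (Real.log z)) {k a h A : ℝ} (ha : 0 < a) (hah : a ≤ h)
    (hk : 0 < k) (hka : k * a ≤ 1) (h0 : ∀ z, 0 < z → z ≤ a → w z = 0)
    (hA : ∀ z, a ≤ z → z ≤ h → (k * z ≤ 1 ∧ ∀ i ≤ 5, |iteratedDeriv i f (Real.log z)| ≤ A) ∨
      (Lop k w z = 0 ∧ dLop k w z = 0)) :
    energy h k w ≤ 1250 * A ^ 2 * (k ^ 2 * a ^ 5)⁻¹ := by
  have hz0 : ∀ n ≤ 5, ∀ z, 0 < z → z < a → iteratedDeriv n w z = 0 := fun n hn z hz1 hz => by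
    have : w =ᶠ[nhds z] fun _ => 0 := by
      filter_upwards [Ioo_mem_nhds hz1 hz] with y hy using h0 y hy.1 (le_of_lt hy.2)
    rw [this.iteratedDeriv_eq]; simp
  have key : ∀ (g : ℝ → ℝ) (n : ℕ), 1 ≤ n → Continuous g → (∀ z, 0 < z → z < a → g z = 0) →
      (∀ z, a ≤ z → z ≤ h → g z ^ 2 ≤ (25 * A) ^ 2 * (z ^ (n + 1))⁻¹) →
      ∫ z in (0 : ℝ)..h, g z ^ 2 ≤ (25 * A) ^ 2 * (a ^ n)⁻¹ := by
    intro g n hn hg hg0 hb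
    have ii : ∀ x y, IntervalIntegrable (fun z => g z ^ 2) volume x y := fun x y =>
      (hg.pow 2).intervalIntegrable _ _
    rw [← intervalIntegral.integral_add_adjacent_intervals (ii 0 a) (ii a h)]
    have z1 : ∫ z in (0 : ℝ)..a, g z ^ 2 = 0 := by
      rw [intervalIntegral.integral_congr_Ioo_of_le (g := fun _ => 0) ha.le]
      · simp
      · intro z hz; simp [hg0 z hz.1 hz.2]
    rw [z1, zero_add]
    have i2 : IntervalIntegrable (fun z : ℝ => (z ^ (n + 1))⁻¹) volume a h := by
      refine ContinuousOn.intervalIntegrable ?_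
      rw [Set.uIcc_of_le hah]
      refine ContinuousOn.inv₀ (by fun_prop) fun z hz => ?_
      have : 0 < z := ha.trans_le hz.1
      positivity
    calc ∫ z in a..h, g z ^ 2 ≤ ∫ z in a..h, (25 * A) ^ 2 * (z ^ (n + 1))⁻¹ :=
          intervalIntegral.integral_mono_on hah (ii a h) (i2.const_mul _) fun z hz => hb z hz.1 hz.2
      _ = (25 * A) ^ 2 * ∫ z in a..h, (z ^ (n + 1))⁻¹ := intervalIntegral.integral_const_mul _ _
      _ ≤ _ := by gcongr; exact integral_inv_pow_le ha hah hn
  have e1 := key (dLop k w) 5 (by norm_num) (dLop_continuous k cw)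
    (fun z hz1 hz => by
      simp only [dLop, hz0 5 (by norm_num) z hz1 hz, hz0 3 (by norm_num) z hz1 hz,
        hz0 1 (by norm_num) z hz1 hz]
      ring)
    (fun z h1 h2 => by
      have hz : 0 < z := ha.trans_le h1
      rcases hA z h1 h2 with ⟨h3, h4⟩ | h3
      · have := (abs_Lop_log_le hf hw hz hk.le h3 h4).2
        calc dLop k w z ^ 2 = |dLop k w z| ^ 2 := (sq_abs _).symm
          _ ≤ (25 * A * (z ^ 3)⁻¹) ^ 2 := by gcongr
          _ = _ := by rw [mul_pow (25 * A), ← inv_pow, ← inv_pow]; ring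
      · rw [h3.2, zero_pow two_ne_zero]; positivity)
  have e2 := key (Lop k w) 3 (by norm_num) (Lop_continuous k cw)
    (fun z hz1 hz => by
      simp [Lop, hz0 4 (by norm_num) z hz1 hz, hz0 2 (by norm_num) z hz1 hz, h0 z hz1 hz.le])
    (fun z h1 h2 => by
      have hz : 0 < z := ha.trans_le h1
      rcases hA z h1 h2 with ⟨h3, h4⟩ | h3
      · have := (abs_Lop_log_le hf hw hz hk.le h3 h4).1
        calc Lop k w z ^ 2 = |Lop k w z| ^ 2 := (sq_abs _).symm
          _ ≤ (25 * A * (z ^ 2)⁻¹) ^ 2 := by gcongr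
          _ = _ := by rw [mul_pow (25 * A), ← inv_pow, ← inv_pow]; ring
      · rw [h3.1, zero_pow two_ne_zero]; positivity)
  -- The condition `k a ≤ 1` makes the derivative term `k⁻² a⁻⁵` dominate the term `a⁻³`.
  have e3 : (a ^ 3)⁻¹ ≤ (k ^ 2 * a ^ 5)⁻¹ := by
    gcongr
    have : (k * a) ^ 2 ≤ 1 := pow_le_one₀ (by positivity) hka
    calc k ^ 2 * a ^ 5 = (k * a) ^ 2 * a ^ 3 := by ring
      _ ≤ 1 * a ^ 3 := by gcongr
      _ = a ^ 3 := one_mul _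
  have e4 := mul_le_mul_of_nonneg_left e1 (by positivity : 0 ≤ (k ^ 2)⁻¹)
  have e5 : (k ^ 2)⁻¹ * ((25 * A) ^ 2 * (a ^ 5)⁻¹) = (25 * A) ^ 2 * (k ^ 2 * a ^ 5)⁻¹ := by
    rw [mul_inv]; ring
  have e6 : (25 * A) ^ 2 * (a ^ 3)⁻¹ ≤ (25 * A) ^ 2 * (k ^ 2 * a ^ 5)⁻¹ := by gcongr
  unfold energy
  linarith

end log

theorem iteratedDeriv_eq_zero_of_Iio {w : ℝ → ℝ} {a : ℝ} (h : ∀ z, z < a → w z = 0) (n : ℕ) {z : ℝ}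
    (hz : z < a) : iteratedDeriv n w z = 0 := by
  have : w =ᶠ[nhds z] fun _ => 0 := by
    filter_upwards [Iio_mem_nhds hz] with y hy using h y hy
  rw [this.iteratedDeriv_eq]; simp

theorem iteratedDeriv_eq_zero_of_Ioi {w : ℝ → ℝ} {a : ℝ} (h : ∀ z, a < z → w z = 0) (n : ℕ) {z : ℝ}
    (hz : a < z) : iteratedDeriv n w z = 0 := by
  have : w =ᶠ[nhds z] fun _ => 0 := by
    filter_upwards [Ioi_mem_nhds hz] with y hy using h y hy
  rw [this.iteratedDeriv_eq]; simp

theorem exists_iteratedDeriv_bound_of_support {w : ℝ → ℝ} (hw : ContDiff ℝ 5 w) {a b : ℝ}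
    (ha : ∀ z, z < a → w z = 0) (hb : ∀ z, b < z → w z = 0) :
    ∃ A, 0 ≤ A ∧ ∀ z, ∀ i ≤ 5, |iteratedDeriv i w z| ≤ A := by
  obtain ⟨A, hA0, hA⟩ := exists_iteratedDeriv_bound hw a b
  refine ⟨A, hA0, fun z i hi => ?_⟩
  rcases lt_or_ge z a with h | h
  · rw [iteratedDeriv_eq_zero_of_Iio ha i h]; simpa
  rcases lt_or_ge b z with h' | h'
  · rw [iteratedDeriv_eq_zero_of_Ioi hb i h']; simpa
  exact hA z ⟨h, h'⟩ i hi

/-- `Real.log` is even, so the composition vanishes on both sides of 0. At 0 itself the value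
`Real.log 0 = 0` is a mere default, and the factor `z²` does the work. -/
theorem log_eventuallyEq_zero {f : ℝ → ℝ} {s : ℝ} (hs : ∀ σ, σ < s → f σ = 0) :
    (fun z => z ^ 2 * f (Real.log z)) =ᶠ[nhds 0] fun _ => 0 := by
  filter_upwards [Metric.ball_mem_nhds (0 : ℝ) (Real.exp_pos s)] with z hz
  by_cases h0 : z = 0
  · simp [h0]
  rw [hs, mul_zero]
  rw [← Real.log_abs, Real.log_lt_iff_lt_exp (abs_pos.2 h0)]
  simpa using hz

theorem contDiff_log {f : ℝ → ℝ} (hf : ContDiff ℝ (⊤ : ℕ∞) f) {s : ℝ} (hs : ∀ σ, σ < s → f σ = 0) :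
    ContDiff ℝ 5 (fun z => z ^ 2 * f (Real.log z)) := by
  refine contDiff_iff_contDiffAt.2 fun z => ?_
  by_cases hz : z = 0
  · subst hz
    exact contDiffAt_const.congr_of_eventuallyEq (log_eventuallyEq_zero hs)
  · have h1 : ContDiffAt ℝ 5 Real.log z := Real.contDiffAt_log.2 hz
    exact (contDiffAt_id.pow 2).mul ((contDiff_five hf).contDiffAt.comp z h1)

/-! ### Logarithmic windows and their almost monotonicity -/

/-- A smooth increasing angle: `0` for `x ≤ 1`, `π/2` for `x ≥ 36/25`. -/
def angle (x : ℝ) : ℝ :=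
  Real.pi / 2 * ((∫ t in (1 : ℝ)..x, bump 1 (36 / 25) t) / ∫ t in (1 : ℝ)..(36 / 25), bump 1 (36 / 25) t)

/-- The derivative of `angle`. -/
def angleDeriv (x : ℝ) : ℝ :=
  Real.pi / 2 * (bump 1 (36 / 25) x / ∫ t in (1 : ℝ)..(36 / 25), bump 1 (36 / 25) t)

/-- The derivative of `sin² ∘ angle`, a bump positive on `(1, 36/25)`. -/
def weight (x : ℝ) : ℝ := 2 * Real.sin (angle x) * (Real.cos (angle x) * angleDeriv x)

/-- The profile whose square is `sin² (angle x) - sin² (angle (25 x / 36))`. -/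
def profile (x : ℝ) : ℝ := Real.sin (angle x) * Real.cos (angle (25 / 36 * x))

theorem integral_bump_pos : 0 < ∫ t in (1 : ℝ)..(36 / 25), bump 1 (36 / 25) t :=
  intervalIntegral.intervalIntegral_pos_of_pos_on
    ((bump_contDiff _ _).continuous.intervalIntegrable _ _) (fun _ ht => bump_pos ht.1 ht.2)
    (by norm_num)

theorem angle_hasDerivAt (x : ℝ) : HasDerivAt angle (angleDeriv x) x :=
  ((integral_right_hasDerivAt (bump_contDiff _ _).continuous 1 x).div_const _).const_mul _

theorem angle_contDiff : ContDiff ℝ (⊤ : ℕ∞) angle :=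
  contDiff_const.mul ((contDiff_integral_right (bump_contDiff _ _) 1).div_const _)

theorem angleDeriv_continuous : Continuous angleDeriv :=
  continuous_const.mul ((bump_contDiff _ _).continuous.div_const _)

theorem angleDeriv_nonneg (x : ℝ) : 0 ≤ angleDeriv x :=
  mul_nonneg (by positivity) (div_nonneg (bump_nonneg _ _ _) integral_bump_pos.le)

theorem angle_monotone : Monotone angle :=
  monotone_of_deriv_nonneg (fun x => (angle_hasDerivAt x).differentiableAt)
    fun x => by rw [(angle_hasDerivAt x).deriv]; exact angleDeriv_nonneg x

theorem angle_of_le {x : ℝ} (hx : x ≤ 1) : angle x = 0 := by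
  have : ∫ t in (1 : ℝ)..x, bump 1 (36 / 25) t = 0 := by
    rw [intervalIntegral.integral_congr (g := fun _ => 0)]
    · simp
    · intro t ht; rw [Set.uIcc_of_ge hx] at ht; exact bump_zero_left ht.2
  simp [angle, this]

theorem angle_of_ge {x : ℝ} (hx : 36 / 25 ≤ x) : angle x = Real.pi / 2 := by
  have hi : ∀ a b : ℝ, IntervalIntegrable (bump 1 (36 / 25)) volume a b := fun a b =>
    (bump_contDiff _ _).continuous.intervalIntegrable _ _
  have : ∫ t in (36 / 25 : ℝ)..x, bump 1 (36 / 25) t = 0 := by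
    rw [intervalIntegral.integral_congr (g := fun _ => 0)]
    · simp
    · intro t ht; rw [Set.uIcc_of_le hx] at ht; exact bump_zero_right ht.1
  rw [angle, ← intervalIntegral.integral_add_adjacent_intervals (hi 1 (36 / 25)) (hi (36 / 25) x), this,
    add_zero, div_self integral_bump_pos.ne', mul_one]

theorem angle_nonneg (x : ℝ) : 0 ≤ angle x := by
  rcases le_total x 1 with h | h
  · rw [angle_of_le h]
  · rw [← angle_of_le le_rfl]; exact angle_monotone h

theorem angle_le (x : ℝ) : angle x ≤ Real.pi / 2 := by
  rcases le_total (36 / 25) x with h | h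
  · rw [angle_of_ge h]
  · rw [← angle_of_ge le_rfl]; exact angle_monotone h

theorem weight_continuous : Continuous weight := by
  have h1 := angle_contDiff.continuous
  have h2 := angleDeriv_continuous
  unfold weight; fun_prop

theorem weight_nonneg (x : ℝ) : 0 ≤ weight x := by
  have h1 := Real.sin_nonneg_of_nonneg_of_le_pi (angle_nonneg x) (by linarith [angle_le x, Real.pi_pos])
  have h2 := Real.cos_nonneg_of_neg_pi_div_two_le_of_le
    (by linarith [angle_nonneg x, Real.pi_pos]) (angle_le x)
  have h3 := angleDeriv_nonneg x
  unfold weight; positivity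

theorem weight_of_le {x : ℝ} (hx : x ≤ 1) : weight x = 0 := by simp [weight, angle_of_le hx]

theorem weight_of_ge {x : ℝ} (hx : 36 / 25 ≤ x) : weight x = 0 := by simp [weight, angle_of_ge hx]

theorem weight_pos {x : ℝ} (h1 : 1 < x) (h2 : x < 36 / 25) : 0 < weight x := by
  have hb : ∀ t, 1 < t → t < 36 / 25 → 0 < angleDeriv t := fun t ht1 ht2 =>
    mul_pos (by positivity) (div_pos (bump_pos ht1 ht2) integral_bump_pos)
  have hi : ∀ a b, IntervalIntegrable angleDeriv volume a b := fun a b =>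
    angleDeriv_continuous.intervalIntegrable _ _
  have a1 : 0 < angle x := by
    have e := intervalIntegral.integral_eq_sub_of_hasDerivAt
      (fun t _ => angle_hasDerivAt t) (hi 1 x)
    rw [angle_of_le (le_refl 1), sub_zero] at e
    rw [← e]
    exact intervalIntegral.intervalIntegral_pos_of_pos_on (hi _ _)
      (fun t ht => hb t ht.1 (ht.2.trans h2)) h1
  have a2 : angle x < Real.pi / 2 := by
    have e := intervalIntegral.integral_eq_sub_of_hasDerivAt
      (fun t _ => angle_hasDerivAt t) (hi x (36 / 25))
    rw [angle_of_ge (le_refl (36 / 25))] at e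
    have := intervalIntegral.intervalIntegral_pos_of_pos_on (hi x (36 / 25))
      (fun t ht => hb t (h1.trans ht.1) ht.2) h2
    linarith
  have h3 := Real.sin_pos_of_pos_of_lt_pi a1 (by linarith [Real.pi_pos])
  have h4 := Real.cos_pos_of_mem_Ioo (x := angle x) ⟨by linarith [Real.pi_pos], a2⟩
  have h5 := hb x h1 h2
  unfold weight; positivity

theorem profile_contDiff : ContDiff ℝ (⊤ : ℕ∞) profile :=
  (Real.contDiff_sin.comp angle_contDiff).mul
    (Real.contDiff_cos.comp (angle_contDiff.comp (contDiff_const.mul contDiff_id)))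

theorem profile_of_le {x : ℝ} (hx : x ≤ 1) : profile x = 0 := by simp [profile, angle_of_le hx]

theorem profile_of_ge {x : ℝ} (hx : (36 / 25) ^ 2 ≤ x) : profile x = 0 := by
  rw [profile, angle_of_ge (x := 25 / 36 * x) (by linarith), Real.cos_pi_div_two, mul_zero]

/-- The two angles never move at the same time. Up to `36/25` the slower one is still 0, and from
there on the faster one is already `π/2`, so the product of sine and cosine squares to a difference.
-/
theorem profile_sq (x : ℝ) :
    profile x ^ 2 = Real.sin (angle x) ^ 2 - Real.sin (angle (25 / 36 * x)) ^ 2 := by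
  rcases le_total x (36 / 25) with h | h
  · rw [profile, angle_of_le (x := 25 / 36 * x) (by linarith)]; simp
  · rw [profile, angle_of_ge h, Real.sin_pi_div_two, one_mul, Real.cos_sq']; ring

/-- The drift `2 f f'` of the profile is exactly one window minus its dilate by `36/25`. The smooth
square root `profile` of the difference exists because of `profile_sq`, and this is why the cutoffs
are written with sine and cosine. -/
theorem two_mul_profile_mul_deriv (x : ℝ) :
    2 * (profile x * iteratedDeriv 1 profile x) = weight x - 25 / 36 * weight (25 / 36 * x) := by
  have hs : ∀ x, HasDerivAt (fun x => Real.sin (angle x) ^ 2) (weight x) x := fun x => by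
    refine ((angle_hasDerivAt x).sin.pow 2).congr_deriv ?_
    simp [weight]
  have hl : HasDerivAt (fun x : ℝ => 25 / 36 * x) (25 / 36) x := by
    simpa using (hasDerivAt_id x).const_mul (25 / 36 : ℝ)
  have h1 : HasDerivAt (fun x => profile x ^ 2) (weight x - weight (25 / 36 * x) * (25 / 36)) x := by
    simp only [profile_sq]
    exact (hs x).sub ((hs (25 / 36 * x)).comp x hl)
  have h2 := (hasDerivAt_iteratedDeriv_smooth profile_contDiff 0 x)
  rw [iteratedDeriv_zero] at h2
  have h3 := (h2.pow 2).unique h1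
  simp only [Nat.cast_ofNat, Nat.add_one_sub_one, pow_one] at h3
  linarith

/-- The dilated windows cover an interval. -/
theorem exists_cover : ∃ c, 0 < c ∧ ∀ x : ℝ, 6 / 5 ≤ x → x ≤ (6 / 5) ^ 5 →
    c ≤ ∑ i ∈ Finset.range 5, weight (x / (6 / 5) ^ i) := by
  have hc : Continuous fun x : ℝ => ∑ i ∈ Finset.range 5, weight (x / (6 / 5) ^ i) :=
    continuous_finsetSum _ fun i _ => weight_continuous.comp (continuous_id.div_const _)
  obtain ⟨x, hx, hm⟩ := (isCompact_Icc (a := (6 / 5 : ℝ)) (b := (6 / 5) ^ 5)).exists_isMinOn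
    ⟨6 / 5, by norm_num⟩ hc.continuousOn
  refine ⟨_, ?_, fun y h1 h2 => hm ⟨h1, h2⟩⟩
  simp only
  -- With `q = 6/5` the open windows `(qⁱ, qⁱ⁺²)` overlap, and those with `0 ≤ i ≤ 4` cover the
  -- closed interval `[q, q⁵]` including both endpoints.
  have key : ∃ i ∈ Finset.range 5, 0 < weight (x / (6 / 5) ^ i) := by
    obtain ⟨h1, h2⟩ := hx
    by_cases c1 : x < (6 / 5) ^ 2
    · exact ⟨0, by simp, weight_pos (by norm_num; linarith) (by norm_num at *; linarith)⟩
    by_cases c2 : x < (6 / 5) ^ 3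
    · exact ⟨1, by simp, weight_pos (by norm_num at *; linarith) (by norm_num at *; linarith)⟩
    by_cases c3 : x < (6 / 5) ^ 4
    · exact ⟨2, by simp, weight_pos (by norm_num at *; linarith) (by norm_num at *; linarith)⟩
    by_cases c4 : x < (6 / 5) ^ 5
    · exact ⟨3, by simp, weight_pos (by norm_num at *; linarith) (by norm_num at *; linarith)⟩
    · exact ⟨4, by simp, weight_pos (by norm_num at *; linarith) (by norm_num at *; linarith)⟩
  exact Finset.sum_pos' (fun i _ => weight_nonneg _) key

/-- The average of `Y` over the logarithmic window of scale `s`. -/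
def win (Y : ℝ → ℝ) (h s : ℝ) : ℝ := s⁻¹ * ∫ z in (1 : ℝ)..h, Y z * weight (Real.log z / s)

theorem intervalIntegrable_mul_log {Y g : ℝ → ℝ} {a h : ℝ} (ha : 0 < a) (hah : a ≤ h)
    (hY : IntervalIntegrable Y volume a h) (hg : Continuous g) :
    IntervalIntegrable (fun z => Y z * g (Real.log z)) volume a h := by
  refine hY.mul_continuousOn ?_
  rw [Set.uIcc_of_le hah]
  exact hg.comp_continuousOn (Real.continuousOn_log.mono fun z hz => by
    have := ha.trans_le hz.1; exact this.ne')

theorem win_nonneg {Y : ℝ → ℝ} {h s : ℝ} (hh : 1 ≤ h) (hs : 0 ≤ s) (hY : ∀ z ∈ Set.Icc 1 h, 0 ≤ Y z) :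
    0 ≤ win Y h s :=
  mul_nonneg (inv_nonneg.2 hs) (intervalIntegral.integral_nonneg hh fun z hz =>
    mul_nonneg (hY z hz) (weight_nonneg _))

/-- The slope, shifted by a multiple of `z⁻⁴` so as to be non-negative. -/
def shift (η : ℝ) (X : ℝ → ℝ) (z : ℝ) : ℝ := X z + 2 * η * (z ^ 4)⁻¹

/-- One multiple of `η z⁻⁴` would make the slope non-negative. The second multiple makes the shifted
slope dominate the absolute value, so that kernel errors of either sign can be charged to it. -/
theorem abs_le_shift {η z : ℝ} {X : ℝ → ℝ} (hη : 0 ≤ η) (h : -(η * (z ^ 4)⁻¹) ≤ X z) :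
    |X z| ≤ shift η X z := by
  have : 0 ≤ η * (z ^ 4)⁻¹ := by positivity
  unfold shift
  rw [abs_le]; constructor <;> linarith

theorem intervalIntegrable_inv_pow {a b : ℝ} (ha : 0 < a) (hab : a ≤ b) (n : ℕ) :
    IntervalIntegrable (fun z : ℝ => (z ^ n)⁻¹) volume a b := by
  refine ContinuousOn.intervalIntegrable ?_
  rw [Set.uIcc_of_le hab]
  refine ContinuousOn.inv₀ (by fun_prop) fun z hz => ?_
  have : 0 < z := ha.trans_le hz.1
  positivity

theorem intervalIntegrable_shift {η a b : ℝ} {X : ℝ → ℝ} (hX : Integrable X) (ha : 0 < a)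
    (hab : a ≤ b) : IntervalIntegrable (shift η X) volume a b :=
  hX.intervalIntegrable.add ((intervalIntegrable_inv_pow ha hab 4).const_mul _)

theorem integral_le_combination {a b p q t : ℝ} {g f₁ f₂ f₃ : ℝ → ℝ} (hab : a ≤ b)
    (hg : IntervalIntegrable g volume a b) (h₁ : IntervalIntegrable f₁ volume a b)
    (h₂ : IntervalIntegrable f₂ volume a b) (h₃ : IntervalIntegrable f₃ volume a b)
    (h : ∀ z ∈ Set.Icc a b, g z ≤ p * f₁ z + q * f₂ z + t * f₃ z) :
    ∫ z in a..b, g z ≤ p * (∫ z in a..b, f₁ z) + q * (∫ z in a..b, f₂ z) +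
      t * ∫ z in a..b, f₃ z := by
  have i₁ := h₁.const_mul p
  have i₂ := h₂.const_mul q
  have i₃ := h₃.const_mul t
  rw [← intervalIntegral.integral_const_mul, ← intervalIntegral.integral_const_mul,
    ← intervalIntegral.integral_const_mul, ← intervalIntegral.integral_add i₁ i₂,
    ← intervalIntegral.integral_add (i₁.add i₂) i₃]
  exact intervalIntegral.integral_mono_on hab hg ((i₁.add i₂).add i₃) h

theorem integral_cover_le {Y : ℝ → ℝ} {h s : ℝ} (hh : 1 ≤ h) (hs : 0 < s)
    (hYi : IntervalIntegrable Y volume 1 h) (hY : ∀ z ∈ Set.Icc 1 h, 0 ≤ Y z) :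
    ∫ z in (1 : ℝ)..h, Y z * ∑ i ∈ Finset.range 5, weight (Real.log z / s / (6 / 5) ^ i) ≤
      3 * s * ∑ i ∈ Finset.range 5, win Y h ((6 / 5) ^ i * s) := by
  have e : ∀ z, Y z * ∑ i ∈ Finset.range 5, weight (Real.log z / s / (6 / 5) ^ i) =
      ∑ i ∈ Finset.range 5, Y z * weight (Real.log z / ((6 / 5) ^ i * s)) := fun z => by
    rw [Finset.mul_sum]
    refine Finset.sum_congr rfl fun i _ => ?_
    rw [div_div, mul_comm s]
  simp only [e]
  rw [intervalIntegral.integral_finsetSum fun i _ =>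
    intervalIntegrable_mul_log (g := fun σ => weight (σ / ((6 / 5) ^ i * s))) one_pos hh hYi
      (weight_continuous.comp (continuous_id.div_const _)), Finset.mul_sum]
  refine Finset.sum_le_sum fun i hi => ?_
  have hw0 : 0 ≤ win Y h ((6 / 5) ^ i * s) := win_nonneg hh (by positivity) hY
  have hp : 0 < (6 / 5) ^ i * s := by positivity
  have e2 : ∫ z in (1 : ℝ)..h, Y z * weight (Real.log z / ((6 / 5) ^ i * s)) =
      ((6 / 5) ^ i * s) * win Y h ((6 / 5) ^ i * s) := by
    rw [win, mul_inv_cancel_left₀ hp.ne']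
  rw [e2]
  gcongr
  have : i ≤ 4 := by simp at hi; omega
  calc (6 / 5 : ℝ) ^ i ≤ (6 / 5) ^ 4 := by gcongr; norm_num
    _ ≤ 3 := by norm_num

set_option maxHeartbeats 1000000 in
/-- The windowed averages are almost increasing. -/
theorem win_step : ∃ C, 0 ≤ C ∧ ∀ (η h s : ℝ) (X : ℝ → ℝ), 0 ≤ η → 1 ≤ s →
    Real.exp ((6 / 5) ^ 5 * s) ≤ h → Integrable X → Stab η h X →
    (∀ z, 0 < z → z ≤ h → -(η * (z ^ 4)⁻¹) ≤ X z) →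
    win (shift η X) h ((6 / 5) * s) ≤ win (shift η X) h ((6 / 5) ^ 3 * s) +
      C / s * (∑ i ∈ Finset.range 5, win (shift η X) h ((6 / 5) ^ i * s)) + C * η / s := by
  obtain ⟨A, hA0, hA⟩ := exists_iteratedDeriv_bound_of_support (contDiff_five profile_contDiff)
    (a := 1) (b := (36 / 25) ^ 2) (fun z hz => profile_of_le hz.le) (fun z hz => profile_of_ge hz.le)
  obtain ⟨c, hc0, hc⟩ := exists_cover
  refine ⟨420 * A ^ 2 * c⁻¹ * 3 + 2504 * A ^ 2, by positivity, ?_⟩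
  intro η h s X hη hs hh hXi hS hlow
  -- The test lives on `r ≤ log z ≤ (36/25)² r`, that is between `(6/5) s` and `(6/5)⁵ s`, which is
  -- the interval covered by the five windows of scales `s` to `(6/5)⁴ s`.
  set r := 6 / 5 * s with hr
  have hr1 : 1 ≤ r := by rw [hr]; linarith
  have hr0 : 0 < r := by linarith
  have hri : r⁻¹ ≤ 1 := inv_le_one_of_one_le₀ hr1
  have hri0 : 0 < r⁻¹ := inv_pos.2 hr0
  set f : ℝ → ℝ := fun σ => profile (r⁻¹ * σ) with hf
  have cf : ContDiff ℝ (⊤ : ℕ∞) f := profile_contDiff.comp (contDiff_const.mul contDiff_id)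
  have hfi : ∀ i ≤ 5, ∀ σ, iteratedDeriv i f σ = r⁻¹ ^ i * iteratedDeriv i profile (r⁻¹ * σ) :=
    fun i hi σ => iteratedDeriv_comp_mul_left (contDiff_five profile_contDiff) _ hi σ
  have hfA : ∀ i ≤ 5, ∀ σ, |iteratedDeriv i f σ| ≤ A := fun i hi σ => by
    rw [hfi i hi, abs_mul, abs_of_nonneg (by positivity)]
    calc _ ≤ 1 * A := by
          gcongr
          · exact pow_le_one₀ hri0.le hri
          · exact hA _ i hi
      _ = A := one_mul A
  have hfA2 : ∀ i ≤ 5, 2 ≤ i → ∀ σ, |iteratedDeriv i f σ| ≤ A * r⁻¹ ^ 2 := fun i hi h2 σ => by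
    rw [hfi i hi, abs_mul, abs_of_nonneg (by positivity), mul_comm]
    exact mul_le_mul (hA _ i hi) (pow_le_pow_of_le_one hri0.le hri h2) (by positivity) hA0
  have hf0 : ∀ σ, σ ≤ r → f σ = 0 := fun σ hσ => profile_of_le (by
    rw [inv_mul_le_iff₀ hr0]; linarith)
  have hf1 : ∀ σ, (36 / 25) ^ 2 * r ≤ σ → f σ = 0 := fun σ hσ => profile_of_ge (by
    rw [le_inv_mul_iff₀ hr0]; linarith)
  set w : ℝ → ℝ := fun z => z ^ 2 * f (Real.log z) with hw
  have cw : ContDiff ℝ 5 w := contDiff_log cf (s := r) fun σ hσ => hf0 σ hσ.le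
  have hwe : w =ᶠ[nhds 0] fun _ => 0 := log_eventuallyEq_zero (s := r) fun σ hσ => hf0 σ hσ.le
  have hwz : ∀ z, 0 < z → w z = z ^ 2 * f (Real.log z) := fun z _ => rfl
  have hexp1 : (1 : ℝ) ≤ Real.exp r := Real.one_le_exp hr0.le
  have hexph : Real.exp ((36 / 25) ^ 2 * r) ≤ h := by
    refine le_trans (Real.exp_le_exp.2 (le_of_eq ?_)) hh
    rw [hr]; ring
  have heh : Real.exp r ≤ h := le_trans (Real.exp_le_exp.2 (by linarith)) hexph
  have hh1 : 1 ≤ h := hexp1.trans heh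
  -- The exponent `9/4` lies strictly between `(36/25)² = 2.0736` and `5/2`. The first inequality
  -- makes `k z` exponentially small on the support, and the second makes the energy `k⁻² e^{-5r} =
  -- e^{-r/2}` small. Such a choice exists because the ratio `(6/5)⁴` of the ends of the support is
  -- below `5/2`.
  set k := Real.exp (-(9 / 4 * r)) with hk
  have hk0 : 0 < k := Real.exp_pos _
  have hlogle : ∀ z, 0 < z → z ≤ Real.exp r → Real.log z ≤ r := fun z hz h =>
    (Real.log_le_iff_le_exp hz).2 h
  have hkz : ∀ z, 0 < z → Real.log z ≤ (36 / 25) ^ 2 * r → (k * z) ^ 2 ≤ 32 * r⁻¹ ^ 2 ∧ k * z ≤ 1 := by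
    intro z hz hlz
    have e1 : k * z ≤ Real.exp (-(r / 8)) := by
      calc k * z ≤ Real.exp (-(9 / 4 * r)) * Real.exp ((36 / 25) ^ 2 * r) := by
            gcongr
            rw [← Real.log_le_iff_le_exp hz]; exact hlz
        _ ≤ _ := by
            rw [← Real.exp_add]; apply Real.exp_le_exp.2; linarith
    have e2 : (r / 4) ^ 2 / 2 ≤ Real.exp (r / 4) := by
      have := Real.quadratic_le_exp_of_nonneg (x := r / 4) (by positivity)
      linarith
    constructor
    · calc (k * z) ^ 2 ≤ Real.exp (-(r / 8)) ^ 2 := by gcongr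
        _ = (Real.exp (r / 4))⁻¹ := by
            rw [← Real.exp_nat_mul, ← Real.exp_neg]; congr 1; push_cast; ring
        _ ≤ ((r / 4) ^ 2 / 2)⁻¹ := by gcongr
        _ = _ := by field_simp; norm_num
    · exact e1.trans (Real.exp_le_one_iff.2 (by linarith))
  have hE : energy h k w ≤ 2500 * A ^ 2 * r⁻¹ := by
    have := energy_log_le cf cw hwz (k := k) (a := Real.exp r) (h := h) (A := A) (Real.exp_pos r) heh hk0
      (hkz _ (Real.exp_pos r) (by rw [Real.log_exp]; linarith)).2
      (fun z hz0 hz => by simp only [hw]; rw [hf0 _ (hlogle z hz0 hz), mul_zero]) (fun z h1 h2 => by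
        have hz : 0 < z := (Real.exp_pos r).trans_le h1
        rcases le_or_gt (Real.log z) ((36 / 25) ^ 2 * r) with h3 | h3
        · exact Or.inl ⟨(hkz z hz h3).2, fun i hi => hfA i hi _⟩
        · right
          have hev : w =ᶠ[nhds z] fun _ => 0 := by
            filter_upwards [Ioi_mem_nhds ((Real.lt_log_iff_exp_lt hz).1 h3)] with y hy
            have hy0 : 0 < y := (Real.exp_pos _).trans hy
            simp only [hw]
            rw [hf1 _ ((Real.lt_log_iff_exp_lt hy0).2 hy).le, mul_zero]
          rw [Lop_congr hev, dLop_congr hev]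
          simp [Lop, dLop])
    refine this.trans ?_
    have e : (k ^ 2 * Real.exp r ^ 5)⁻¹ = (Real.exp (r / 2))⁻¹ := by
      rw [hk, ← Real.exp_nat_mul, ← Real.exp_nat_mul, ← Real.exp_add]
      congr 2; push_cast; ring
    have e2 : (Real.exp (r / 2))⁻¹ ≤ 2 * r⁻¹ := by
      rw [show 2 * r⁻¹ = (r / 2)⁻¹ by field_simp]
      gcongr
      linarith [Real.add_one_le_exp (r / 2)]
    rw [e]
    calc _ ≤ 1250 * A ^ 2 * (2 * r⁻¹) := by gcongr
      _ = _ := by ring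
  have hst := hS k hk0 w cw (by simp [hw]) (by rw [hwe.deriv_eq]; simp)
    (by rw [Lop_congr hwe]; simp [Lop]) (fun z hz => by
      simp only [hw]
      rw [hf1, mul_zero]
      rw [Real.le_log_iff_exp_le (by linarith)]
      exact hexph.trans hz)
  set Y := shift η X with hY
  set D : ℝ → ℝ := fun σ => r⁻¹ * (weight (r⁻¹ * σ) - 25 / 36 * weight (25 / 36 * (r⁻¹ * σ))) with hD
  have hDf : ∀ σ, D σ = 2 * (f σ * iteratedDeriv 1 f σ) := fun σ => by
    rw [hfi 1 (by norm_num), hD]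
    simp only [← two_mul_profile_mul_deriv, hf]
    ring
  set S : ℝ → ℝ := fun σ => ∑ i ∈ Finset.range 5, weight (σ / s / (6 / 5) ^ i) with hSdef
  have hS0 : ∀ σ, 0 ≤ S σ := fun σ => Finset.sum_nonneg fun i _ => weight_nonneg _
  have hYX : ∀ z ∈ Set.Icc 1 h, |X z| ≤ Y z := fun z hz =>
    abs_le_shift hη (hlow z (by linarith [hz.1]) hz.2)
  have hpt : ∀ z ∈ Set.Icc 1 h, X z * (w z * Lop k w z) ≤
      -(Y z * D (Real.log z)) + 420 * A ^ 2 * r⁻¹ ^ 2 * c⁻¹ * (Y z * S (Real.log z)) +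
        4 * η * A ^ 2 * r⁻¹ * (z ^ 2)⁻¹ := by
    intro z hz
    have hz0 : 0 < z := by linarith [hz.1]
    have hY0 : 0 ≤ Y z := (abs_nonneg _).trans (hYX z hz)
    have hS0' := hS0 (Real.log z)
    by_cases hin : r ≤ Real.log z ∧ Real.log z ≤ (36 / 25) ^ 2 * r
    · obtain ⟨h1, h2⟩ := hin
      obtain ⟨hk2, hk1⟩ := hkz z hz0 h2
      set σ := Real.log z with hσ
      have a0 := hfA 0 (by norm_num) σ
      rw [iteratedDeriv_zero] at a0
      have a1 := hfA 1 (by norm_num) σ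
      have a2 := hfA 2 (by norm_num) σ
      have b2 := hfA2 2 (by norm_num) (by norm_num) σ
      have b3 := hfA2 3 (by norm_num) (by norm_num) σ
      have b4 := hfA2 4 (by norm_num) (by norm_num) σ
      have hker := kernel_log cf hwz k hz0
      rw [← hσ] at hker
      -- Since `f` varies on the scale `r`, its derivatives of order at least two are `O(r⁻²)`, and
      -- so is `(k z)²`. The only term of order `r⁻¹` is the drift `-2 f f' = -D`.
      set err := f σ * ((iteratedDeriv 4 f σ + 2 * iteratedDeriv 3 f σ - iteratedDeriv 2 f σ)
        - 2 * (k * z) ^ 2 * logQ f σ + (k * z) ^ 4 * f σ) with herr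
      have hKe : w z * Lop k w z = -D σ + err := by
        rw [hker, hDf, herr, logP]; ring
      have hE1 : |err| ≤ 420 * A ^ 2 * r⁻¹ ^ 2 := by
        have p1 : |iteratedDeriv 4 f σ + 2 * iteratedDeriv 3 f σ - iteratedDeriv 2 f σ| ≤
            4 * (A * r⁻¹ ^ 2) := by
          rw [abs_le] at *; constructor <;> linarith
        have p2 : |logQ f σ| ≤ 6 * A := by
          rw [logQ]; rw [abs_le] at *; constructor <;> linarith
        have p3 : |2 * (k * z) ^ 2 * logQ f σ| ≤ 2 * (32 * r⁻¹ ^ 2) * (6 * A) := by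
          rw [abs_mul, abs_of_nonneg (by positivity)]; gcongr
        have p4 : |(k * z) ^ 4 * f σ| ≤ 32 * r⁻¹ ^ 2 * A := by
          rw [abs_mul, abs_of_nonneg (by positivity)]
          gcongr
          calc (k * z) ^ 4 ≤ (k * z) ^ 2 :=
                pow_le_pow_of_le_one (by positivity) hk1 (by norm_num)
            _ ≤ _ := hk2
        rw [herr, abs_mul]
        calc _ ≤ A * (4 * (A * r⁻¹ ^ 2) + 2 * (32 * r⁻¹ ^ 2) * (6 * A) + 32 * r⁻¹ ^ 2 * A) := by
              gcongr
              refine (abs_add_le _ _).trans ?_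
              gcongr
              refine (abs_sub _ _).trans ?_
              gcongr
          _ = _ := by ring
      have hD1 : D σ ≤ 2 * A ^ 2 := by
        rw [hDf]
        have : f σ * iteratedDeriv 1 f σ ≤ A * A := (le_abs_self _).trans (by rw [abs_mul]; gcongr)
        linarith
      -- The `O(r⁻²)` error is charged to the sum of windows, which is bounded below on the support
      -- of `f`.
      have hcov : c ≤ S σ := by
        apply hc
        · rw [le_div_iff₀ (by linarith)]; exact h1
        · rw [div_le_iff₀ (by linarith)]; refine h2.trans (le_of_eq ?_); rw [hr]; ring
      have hcov' : 1 ≤ c⁻¹ * S σ := by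
        rw [← inv_mul_cancel₀ hc0.ne']; gcongr
      -- On the support `r ≤ log z ≤ z²`. Giving up two powers of `z` yields the factor `r⁻¹`, and
      -- `z⁻²` remains integrable.
      have hz4 : (z ^ 4)⁻¹ ≤ r⁻¹ * (z ^ 2)⁻¹ := by
        rw [← mul_inv]
        gcongr
        have : r ≤ z ^ 2 := by
          have h3 : r ≤ z := by
            have := Real.add_one_le_exp (Real.log z)
            rw [Real.exp_log hz0] at this
            linarith
          exact h3.trans (le_self_pow₀ hz.1 two_ne_zero)
        calc r * z ^ 2 ≤ z ^ 2 * z ^ 2 := by gcongr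
          _ = z ^ 4 := by ring
      have t1 : X z * err ≤ 420 * A ^ 2 * r⁻¹ ^ 2 * c⁻¹ * (Y z * S σ) := by
        calc X z * err ≤ |X z| * |err| := by rw [← abs_mul]; exact le_abs_self _
          _ ≤ Y z * (420 * A ^ 2 * r⁻¹ ^ 2) := by gcongr; exact hYX z hz
          _ ≤ Y z * (420 * A ^ 2 * r⁻¹ ^ 2) * (c⁻¹ * S σ) := by
              apply le_mul_of_one_le_right (by positivity) hcov'
          _ = _ := by ring
      have t2 : 2 * η * (z ^ 4)⁻¹ * D σ ≤ 4 * η * A ^ 2 * r⁻¹ * (z ^ 2)⁻¹ := by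
        calc 2 * η * (z ^ 4)⁻¹ * D σ ≤ 2 * η * (z ^ 4)⁻¹ * (2 * A ^ 2) := by gcongr
          _ ≤ 2 * η * (r⁻¹ * (z ^ 2)⁻¹) * (2 * A ^ 2) := by gcongr
          _ = _ := by ring
      have hXY : X z = Y z - 2 * η * (z ^ 4)⁻¹ := by rw [hY, shift]; ring
      have : X z * (w z * Lop k w z) = -(Y z * D σ) + 2 * η * (z ^ 4)⁻¹ * D σ + X z * err := by
        rw [hKe, mul_add, mul_neg]
        nth_rewrite 1 [hXY]
        ring
      rw [this]; linarith
    · have hf00 : f (Real.log z) = 0 := by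
        by_cases h1 : r ≤ Real.log z
        · exact hf1 _ (le_of_lt (not_le.1 fun h2 => hin ⟨h1, h2⟩))
        · exact hf0 _ (le_of_lt (not_le.1 h1))
      have hwz0 : w z = 0 := by simp only [hw, hf00, mul_zero]
      rw [hDf, hf00, hwz0]
      have : 0 ≤ 420 * A ^ 2 * r⁻¹ ^ 2 * c⁻¹ * (Y z * S (Real.log z)) := by positivity
      have : 0 ≤ 4 * η * A ^ 2 * r⁻¹ * (z ^ 2)⁻¹ := by positivity
      linarith
  have hXii : ∀ a b, IntervalIntegrable X volume a b := fun a b => hXi.intervalIntegrable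
  have cK : Continuous fun z => w z * Lop k w z := cw.continuous.mul (Lop_continuous k cw)
  have iK : ∀ a b, IntervalIntegrable (fun z => X z * (w z * Lop k w z)) volume a b := fun a b =>
    (hXii a b).mul_continuousOn cK.continuousOn
  have hYi : IntervalIntegrable Y volume 1 h := intervalIntegrable_shift hXi one_pos hh1
  have iw : ∀ t : ℝ, IntervalIntegrable (fun z => Y z * weight (Real.log z / t)) volume 1 h := fun t =>
    intervalIntegrable_mul_log (g := fun σ => weight (σ / t)) one_pos hh1 hYi
      (weight_continuous.comp (continuous_id.div_const t))
  have hs0 : 0 < s := by linarith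
  have hDI : ∫ z in (1 : ℝ)..h, Y z * D (Real.log z) = win Y h r - win Y h ((6 / 5) ^ 3 * s) := by
    have e : ∀ z, Y z * D (Real.log z) = r⁻¹ * (Y z * weight (Real.log z / r)) -
        ((6 / 5) ^ 3 * s)⁻¹ * (Y z * weight (Real.log z / ((6 / 5) ^ 3 * s))) := fun z => by
      have e1 : 25 / 36 * (r⁻¹ * Real.log z) = Real.log z / ((6 / 5) ^ 3 * s) := by
        rw [hr]; field_simp; norm_num
      have e2 : ((6 / 5) ^ 3 * s)⁻¹ = 25 / 36 * r⁻¹ := by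
        rw [hr]; field_simp; norm_num
      simp only [hD]
      rw [e1, e2, div_eq_inv_mul (Real.log z) r]; ring
    simp only [e]
    rw [intervalIntegral.integral_sub ((iw _).const_mul _) ((iw _).const_mul _),
      intervalIntegral.integral_const_mul, intervalIntegral.integral_const_mul, win, win]
  have hSI : ∫ z in (1 : ℝ)..h, Y z * S (Real.log z) ≤
      3 * s * ∑ i ∈ Finset.range 5, win Y h ((6 / 5) ^ i * s) :=
    integral_cover_le hh1 hs0 hYi fun z hz => (abs_nonneg _).trans (hYX z hz)
  have iS : IntervalIntegrable (fun z => Y z * S (Real.log z)) volume 1 h :=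
    intervalIntegrable_mul_log one_pos hh1 hYi
      (continuous_finsetSum _ fun i _ => weight_continuous.comp
        ((continuous_id.div_const s).div_const _))
  have iD : IntervalIntegrable (fun z => Y z * D (Real.log z)) volume 1 h :=
    intervalIntegrable_mul_log one_pos hh1 hYi (by
      have := weight_continuous
      simp only [hD]; fun_prop)
  have hle : ∫ z in (1 : ℝ)..h, X z * (w z * Lop k w z) ≤
      -(∫ z in (1 : ℝ)..h, Y z * D (Real.log z)) + 420 * A ^ 2 * r⁻¹ ^ 2 * c⁻¹ *
        (∫ z in (1 : ℝ)..h, Y z * S (Real.log z)) + 4 * η * A ^ 2 * r⁻¹ *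
          ∫ z in (1 : ℝ)..h, (z ^ 2)⁻¹ := by
    have := integral_le_combination hh1 (iK 1 h) iD iS (intervalIntegrable_inv_pow one_pos hh1 2)
      (p := -1) (q := 420 * A ^ 2 * r⁻¹ ^ 2 * c⁻¹) (t := 4 * η * A ^ 2 * r⁻¹)
      fun z hz => by have := hpt z hz; linarith
    linarith
  have hz1 : ∫ z in (0 : ℝ)..1, X z * (w z * Lop k w z) = 0 := by
    rw [intervalIntegral.integral_congr_Ioo_of_le (g := fun _ => 0) zero_le_one]
    · simp
    · intro z hz
      have : w z = 0 := by
        simp only [hw]; rw [hf0 _ (hlogle z hz.1 (hz.2.le.trans hexp1)), mul_zero]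
      simp [this]
  rw [← intervalIntegral.integral_add_adjacent_intervals (iK 0 1) (iK 1 h), hz1, zero_add] at hst
  have h2 : ∫ z in (1 : ℝ)..h, (z ^ 2)⁻¹ ≤ 1 := by
    simpa using integral_inv_pow_le one_pos hh1 (n := 1) le_rfl
  have hrs : r⁻¹ ≤ s⁻¹ := by gcongr; rw [hr]; linarith
  set T := ∑ i ∈ Finset.range 5, win Y h ((6 / 5) ^ i * s) with hT
  have hT0 : 0 ≤ T := Finset.sum_nonneg fun i _ =>
    win_nonneg hh1 (by positivity) fun z hz => (abs_nonneg _).trans (hYX z hz)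
  have hYS0 : 0 ≤ ∫ z in (1 : ℝ)..h, Y z * S (Real.log z) :=
    intervalIntegral.integral_nonneg hh1 fun z hz =>
      mul_nonneg ((abs_nonneg _).trans (hYX z hz)) (hS0 _)
  have h20 : 0 ≤ ∫ z in (1 : ℝ)..h, (z ^ 2)⁻¹ :=
    intervalIntegral.integral_nonneg hh1 fun z _ => by positivity
  -- The windows are normalised by their scale, so the cover costs one factor `s`. It cancels one of
  -- the two factors `r⁻¹`.
  have q1 : 420 * A ^ 2 * r⁻¹ ^ 2 * c⁻¹ * (∫ z in (1 : ℝ)..h, Y z * S (Real.log z)) ≤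
      420 * A ^ 2 * c⁻¹ * 3 / s * T := by
    calc _ ≤ 420 * A ^ 2 * s⁻¹ ^ 2 * c⁻¹ * (3 * s * T) := by gcongr
      _ = _ := by field_simp
  have q2 : 4 * η * A ^ 2 * r⁻¹ * (∫ z in (1 : ℝ)..h, (z ^ 2)⁻¹) ≤ 4 * A ^ 2 * η / s := by
    calc _ ≤ 4 * η * A ^ 2 * s⁻¹ * 1 := by gcongr
      _ = _ := by field_simp
  have q3 : η * energy h k w ≤ 2500 * A ^ 2 * η / s := by
    calc _ ≤ η * (2500 * A ^ 2 * s⁻¹) := by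
          gcongr; exact hE.trans (by gcongr)
      _ = _ := by field_simp
  rw [hDI] at hle
  have q4 : 0 ≤ 2504 * A ^ 2 / s * T := by positivity
  have q5 : 0 ≤ 420 * A ^ 2 * c⁻¹ * 3 * η / s := by positivity
  have q6 : (420 * A ^ 2 * c⁻¹ * 3 + 2504 * A ^ 2) / s * T =
      420 * A ^ 2 * c⁻¹ * 3 / s * T + 2504 * A ^ 2 / s * T := by ring
  have q7 : (420 * A ^ 2 * c⁻¹ * 3 + 2504 * A ^ 2) * η / s = 420 * A ^ 2 * c⁻¹ * 3 * η / s +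
      4 * A ^ 2 * η / s + 2500 * A ^ 2 * η / s := by ring
  rw [q6, q7]
  linarith

/-! ### The growing test function near the wall -/

/-- The inverse hyperbolic sine in logarithmic variables. -/
def logsinh (σ : ℝ) : ℝ := Real.arsinh (Real.exp σ)

/-- The derivative of `logsinh`. -/
def slope (σ : ℝ) : ℝ := Real.exp σ / √(1 + Real.exp σ ^ 2)

theorem logsinh_contDiff : ContDiff ℝ (⊤ : ℕ∞) logsinh := Real.contDiff_exp.arsinh

theorem logsinh_hasDerivAt (σ : ℝ) : HasDerivAt logsinh (slope σ) σ := by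
  refine ((Real.hasDerivAt_arsinh (Real.exp σ)).comp σ (Real.hasDerivAt_exp σ)).congr_deriv ?_
  rw [slope, div_eq_inv_mul]

theorem slope_sq (σ : ℝ) : slope σ ^ 2 = 1 - (1 + Real.exp σ ^ 2)⁻¹ := by
  have : 0 < 1 + Real.exp σ ^ 2 := by positivity
  rw [slope, div_pow, Real.sq_sqrt this.le]
  field_simp; ring

theorem slope_pos (σ : ℝ) : 0 < slope σ := by
  have := Real.exp_pos σ
  unfold slope; positivity

theorem slope_le_one (σ : ℝ) : slope σ ≤ 1 := by
  have h := slope_sq σ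
  have : 0 < (1 + Real.exp σ ^ 2)⁻¹ := by positivity
  nlinarith [slope_pos σ]

theorem slope_hasDerivAt (σ : ℝ) : HasDerivAt slope (slope σ - slope σ ^ 3) σ := by
  have he := Real.hasDerivAt_exp σ
  have hp : 0 < 1 + Real.exp σ ^ 2 := by positivity
  have h1 : HasDerivAt (fun σ => 1 + Real.exp σ ^ 2) (2 * Real.exp σ * Real.exp σ) σ := by
    refine ((he.pow 2).const_add 1).congr_deriv ?_
    simp
  have h2 := he.div (h1.sqrt hp.ne') (Real.sqrt_pos.2 hp).ne'
  refine h2.congr_deriv ?_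
  have hs : √(1 + Real.exp σ ^ 2) ^ 2 = 1 + Real.exp σ ^ 2 := Real.sq_sqrt hp.le
  have hs0 : 0 < √(1 + Real.exp σ ^ 2) := Real.sqrt_pos.2 hp
  unfold slope
  generalize √(1 + Real.exp σ ^ 2) = q at hs hs0
  field_simp

/-- The relation `slope' = slope - slope³` makes every derivative a polynomial in `slope`, which
takes values in `(0, 1)`. All later estimates are polynomial inequalities on that interval. -/
theorem logsinh_iteratedDeriv (σ : ℝ) :
    iteratedDeriv 1 logsinh σ = slope σ ∧
    iteratedDeriv 2 logsinh σ = slope σ - slope σ ^ 3 ∧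
    iteratedDeriv 3 logsinh σ = slope σ - 4 * slope σ ^ 3 + 3 * slope σ ^ 5 ∧
    iteratedDeriv 4 logsinh σ = slope σ - 13 * slope σ ^ 3 + 27 * slope σ ^ 5 - 15 * slope σ ^ 7 ∧
    iteratedDeriv 5 logsinh σ = slope σ - 40 * slope σ ^ 3 + 174 * slope σ ^ 5 - 240 * slope σ ^ 7
      + 105 * slope σ ^ 9 := by
  have hp : ∀ (n : ℕ) σ, HasDerivAt (fun σ => slope σ ^ n)
      (n * slope σ ^ (n - 1) * (slope σ - slope σ ^ 3)) σ := fun n σ => (slope_hasDerivAt σ).pow n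
  have w1 : ∀ z ∈ Set.univ, iteratedDeriv 1 logsinh z = slope z :=
    iteratedDeriv_step isOpen_univ (n := 0) (g := logsinh) (fun z _ => by simp)
      fun z _ => logsinh_hasDerivAt z
  have w2 : ∀ z ∈ Set.univ, iteratedDeriv 2 logsinh z = slope z - slope z ^ 3 :=
    iteratedDeriv_step isOpen_univ w1 fun z _ => slope_hasDerivAt z
  have w3 : ∀ z ∈ Set.univ, iteratedDeriv 3 logsinh z = slope z - 4 * slope z ^ 3 + 3 * slope z ^ 5 :=
    iteratedDeriv_step isOpen_univ w2 fun z _ =>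
      ((slope_hasDerivAt z).sub (hp 3 z)).congr_deriv (by push_cast; ring)
  have w4 : ∀ z ∈ Set.univ, iteratedDeriv 4 logsinh z = slope z - 13 * slope z ^ 3 + 27 * slope z ^ 5
      - 15 * slope z ^ 7 :=
    iteratedDeriv_step isOpen_univ w3 fun z _ =>
      (((slope_hasDerivAt z).sub ((hp 3 z).const_mul 4)).add ((hp 5 z).const_mul 3)).congr_deriv
        (by push_cast; ring)
  have w5 : ∀ z ∈ Set.univ, iteratedDeriv 5 logsinh z = slope z - 40 * slope z ^ 3
      + 174 * slope z ^ 5 - 240 * slope z ^ 7 + 105 * slope z ^ 9 :=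
    iteratedDeriv_step isOpen_univ w4 fun z _ =>
      ((((slope_hasDerivAt z).sub ((hp 3 z).const_mul 13)).add ((hp 5 z).const_mul 27)).sub
        ((hp 7 z).const_mul 15)).congr_deriv (by push_cast; ring)
  exact ⟨w1 σ trivial, w2 σ trivial, w3 σ trivial, w4 σ trivial, w5 σ trivial⟩

theorem abs_iteratedDeriv_logsinh_le {i : ℕ} (h1 : 1 ≤ i) (hi : i ≤ 5) (σ : ℝ) :
    |iteratedDeriv i logsinh σ| ≤ 280 * slope σ := by
  obtain ⟨e1, e2, e3, e4, e5⟩ := logsinh_iteratedDeriv σ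
  have t0 := slope_pos σ
  have t1 := slope_le_one σ
  have hp : ∀ n : ℕ, 1 ≤ n → slope σ ^ n ≤ slope σ := fun n hn =>
    pow_le_of_le_one t0.le t1 (by omega)
  have h3 := hp 3 (by norm_num)
  have h5 := hp 5 (by norm_num)
  have h7 := hp 7 (by norm_num)
  have h9 := hp 9 (by norm_num)
  have p3 := pow_pos t0 3
  have p5 := pow_pos t0 5
  have p7 := pow_pos t0 7
  have p9 := pow_pos t0 9
  interval_cases i
  · rw [e1, abs_le]; constructor <;> linarith
  · rw [e2, abs_le]; constructor <;> linarith
  · rw [e3, abs_le]; constructor <;> linarith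
  · rw [e4, abs_le]; constructor <;> linarith
  · rw [e5, abs_le]; constructor <;> linarith

theorem logP_logsinh (σ : ℝ) :
    logP logsinh σ = -(slope σ ^ 3 * (20 - 33 * slope σ ^ 2 + 15 * slope σ ^ 4)) := by
  obtain ⟨e1, e2, e3, e4, -⟩ := logsinh_iteratedDeriv σ
  rw [logP, e1, e2, e3, e4]; ring

/-- With `t = slope σ` the gap is `t³ (18 - 33 t² + 15 t⁴) = 3 t³ (1 - t²)(6 - 5 t²) ≥ 0`. -/
theorem logP_logsinh_le (σ : ℝ) : logP logsinh σ ≤ -(2 * slope σ ^ 3) := by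
  rw [logP_logsinh]
  have t0 := slope_pos σ
  have t1 := slope_le_one σ
  have h1 : 0 ≤ 1 - slope σ ^ 2 := by nlinarith
  have h2 : 0 ≤ 6 - 5 * slope σ ^ 2 := by nlinarith
  have h3 := mul_nonneg (pow_pos t0 3).le (mul_nonneg h1 h2)
  nlinarith

theorem logsinh_pos (σ : ℝ) : 0 < logsinh σ := Real.arsinh_pos_iff.2 (Real.exp_pos σ)

theorem half_add_le_logsinh (σ : ℝ) : 1 / 2 + σ ≤ logsinh σ := by
  have h : 2 * Real.exp σ ≤ Real.exp (logsinh σ) := by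
    rw [logsinh, Real.exp_arsinh]
    have : Real.exp σ ≤ √(1 + Real.exp σ ^ 2) := Real.le_sqrt_of_sq_le (by linarith)
    linarith
  have h2 : Real.exp (1 / 2 + σ) ≤ 2 * Real.exp σ := by
    rw [Real.exp_add]
    gcongr
    have := Real.exp_one_lt_d9
    have h3 : Real.exp (1 / 2) ^ 2 = Real.exp 1 := by
      rw [← Real.exp_nat_mul]; norm_num
    nlinarith [Real.exp_pos (1 / 2)]
  exact Real.exp_le_exp.1 (h2.trans h)

theorem logsinh_le {σ : ℝ} (hσ : 0 ≤ σ) : logsinh σ ≤ 2 + σ := by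
  have h : Real.exp (logsinh σ) ≤ 3 * Real.exp σ := by
    rw [logsinh, Real.exp_arsinh]
    have h1 : 1 ≤ Real.exp σ := Real.one_le_exp hσ
    have : √(1 + Real.exp σ ^ 2) ≤ 2 * Real.exp σ := by
      rw [Real.sqrt_le_left (by positivity)]; nlinarith
    linarith
  have h2 : 3 * Real.exp σ ≤ Real.exp (2 + σ) := by
    rw [Real.exp_add]
    gcongr
    linarith [Real.add_one_le_exp 2]
  exact Real.exp_le_exp.1 (h.trans h2)

theorem half_le_slope {σ : ℝ} (hσ : 0 ≤ σ) : 1 / 2 ≤ slope σ := by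
  have h := slope_sq σ
  have h1 : 1 ≤ Real.exp σ := Real.one_le_exp hσ
  have h2 : (1 + Real.exp σ ^ 2)⁻¹ ≤ 2⁻¹ := by
    gcongr; nlinarith
  have h0 := slope_pos σ
  norm_num at h2
  nlinarith

theorem arsinh_le_self {x : ℝ} (hx : 0 ≤ x) : Real.arsinh x ≤ x := by
  have := Real.self_le_sinh_iff.2 (Real.arsinh_nonneg_iff.2 hx)
  rwa [Real.sinh_arsinh] at this

theorem iteratedDeriv_even_of_odd {u : ℝ → ℝ} (hu : ∀ x, u (-x) = -u x) {n : ℕ} (hn : Even n) :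
    iteratedDeriv n u 0 = 0 := by
  have h := iteratedDeriv_comp_neg n u 0
  rw [show (fun x => u (-x)) = fun x => -u x from funext hu, iteratedDeriv_fun_neg, hn.neg_one_pow,
    neg_zero, one_smul] at h
  linarith

/-- Leibniz bound for a product of slowly varying functions. -/
theorem iteratedDeriv_mul_bound_slow {u v : ℝ → ℝ} {z A ε : ℝ} (hu : ContDiff ℝ 5 u)
    (hv : ContDiff ℝ 5 v) (hε : 0 ≤ ε) (hε1 : ε ≤ 1) (hu0 : |u z| ≤ A) (hv0 : |v z| ≤ A)
    (hui : ∀ i, 1 ≤ i → i ≤ 5 → |iteratedDeriv i u z| ≤ A * ε)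
    (hvi : ∀ i, 1 ≤ i → i ≤ 5 → |iteratedDeriv i v z| ≤ A * ε) {n : ℕ} (hn1 : 1 ≤ n) (hn : n ≤ 5) :
    |iteratedDeriv n (fun x => u x * v x) z| ≤ 32 * A ^ 2 * ε := by
  have hn' : (n : WithTop ℕ∞) ≤ 5 := by exact_mod_cast hn
  have hA0 : 0 ≤ A := (abs_nonneg _).trans hu0
  have hAε : A * ε ≤ A := mul_le_of_le_one_right hA0 hε1
  have hu' : ∀ i ≤ 5, |iteratedDeriv i u z| ≤ A := fun i hi => by
    rcases Nat.eq_zero_or_pos i with h | h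
    · subst h; simpa using hu0
    · exact (hui i h hi).trans hAε
  have hv' : ∀ i ≤ 5, |iteratedDeriv i v z| ≤ A := fun i hi => by
    rcases Nat.eq_zero_or_pos i with h | h
    · subst h; simpa using hv0
    · exact (hvi i h hi).trans hAε
  have := iteratedDeriv_mul (n := n) (hu.contDiffAt.of_le hn') (hv.contDiffAt.of_le hn') (x := z)
  change |iteratedDeriv n (u * v) z| ≤ _
  rw [this]
  refine (Finset.abs_sum_le_sum_abs _ _).trans ?_
  calc ∑ i ∈ Finset.range (n + 1), |(n.choose i : ℝ) * iteratedDeriv i u z * iteratedDeriv (n - i) v z|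
      ≤ ∑ i ∈ Finset.range (n + 1), (n.choose i : ℝ) * (A ^ 2 * ε) := by
        refine Finset.sum_le_sum fun i hi => ?_
        have hi5 : i ≤ n := by simp at hi; omega
        rw [abs_mul, abs_mul, Nat.abs_cast, mul_assoc]
        refine mul_le_mul_of_nonneg_left ?_ (Nat.cast_nonneg _)
        rcases Nat.eq_zero_or_pos i with h | h
        · calc _ ≤ A * (A * ε) := mul_le_mul (hu' i (by omega)) (hvi (n - i) (by omega) (by omega))
                (abs_nonneg _) hA0
            _ = _ := by ring
        · calc _ ≤ (A * ε) * A := mul_le_mul (hui i h (by omega)) (hv' (n - i) (by omega))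
                (abs_nonneg _) (by positivity)
            _ = _ := by ring
    _ = 2 ^ n * (A ^ 2 * ε) := by
        rw [← Finset.sum_mul]
        congr 1
        exact_mod_cast Nat.sum_range_choose n
    _ ≤ 2 ^ 5 * (A ^ 2 * ε) := by gcongr; norm_num
    _ = _ := by ring

/-- The energy does not see the region where the test function vanishes. -/
theorem energy_eq_of_vanish {w : ℝ → ℝ} (hw : ContDiff ℝ 5 w) {b h k : ℝ} (hb : 0 ≤ b) (hbh : b ≤ h)
    (hv : ∀ z, b ≤ z → w z = 0) : energy h k w = energy b k w := by
  have key : ∀ f : ℝ → ℝ, (∀ z, b ≤ z → f z = 0) →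
      ∫ z in (0 : ℝ)..h, f z = ∫ z in (0 : ℝ)..b, f z := fun f hf => by
    rw [intervalIntegral.integral_of_le (hb.trans hbh), intervalIntegral.integral_of_le hb]
    apply setIntegral_eq_of_subset_of_forall_sdiff_eq_zero measurableSet_Ioc
      (Set.Ioc_subset_Ioc_right hbh)
    intro x hx
    apply hf
    by_contra hlt
    exact hx.2 ⟨hx.1.1, le_of_lt (not_le.1 hlt)⟩
  unfold energy
  rw [key, key]
  · intro z hz; simp [Lop_eq_zero_of_vanish hw k hv hz]
  · intro z hz; simp [dLop_eq_zero_of_vanish hw k hv hz]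

/-- The boundary condition on `Lop k w` provides a factor `z`. Together with `w = O(z³)` the kernel
is `O(z⁴)` at the wall, exactly enough to compensate the lower bound `-η z⁻⁴` on the slope. -/
theorem abs_Lop_le_of_zero {w : ℝ → ℝ} (cw : ContDiff ℝ 5 w) (k : ℝ) (h0 : Lop k w 0 = 0) (b : ℝ) :
    ∃ M, 0 ≤ M ∧ ∀ z ∈ Set.Icc 0 b, |Lop k w z| ≤ M * z := by
  obtain ⟨M, hM0, hM⟩ := exists_bound_Ioc (dLop_continuous k cw) 0 b
  refine ⟨M, hM0, fun z hz => ?_⟩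
  have := (convex_Icc (0 : ℝ) b).norm_image_sub_le_of_norm_hasDerivWithin_le
    (fun x _ => (Lop_hasDerivAt k cw x).hasDerivWithinAt) (fun x hx => hM x hx)
    (Set.left_mem_Icc.2 (hz.1.trans hz.2)) hz
  rw [h0, sub_zero, sub_zero, Real.norm_eq_abs, Real.norm_eq_abs, abs_of_nonneg hz.1] at this
  exact this

/-- The test function `z² arsinh z`, cut off at the logarithmic scale `r`. -/
theorem exists_growing_test : ∃ C₁, 0 ≤ C₁ ∧ ∀ r : ℝ, 1 ≤ r → ∃ (w : ℝ → ℝ) (k M : ℝ), 0 < k ∧ 0 ≤ M ∧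
    ContDiff ℝ 5 w ∧ w 0 = 0 ∧ deriv w 0 = 0 ∧ Lop k w 0 = 0 ∧
    (∀ z, Real.exp ((6 / 5) ^ 3 * r) ≤ z → w z = 0) ∧
    (∀ z, 0 < z → Real.log z < (6 / 5) ^ 2 * r → w z * Lop k w z ≤ 0) ∧
    (∀ z, 1 ≤ z → Real.log z < (6 / 5) ^ 2 * r →
      w z * Lop k w z ≤ -(1 / 2 * (1 / 2 + Real.log z))) ∧
    (∀ z, 0 < z → (6 / 5) ^ 2 * r ≤ Real.log z → Real.log z ≤ (6 / 5) ^ 3 * r →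
      w z * Lop k w z ≤ C₁ * r) ∧
    (∀ z, 1 ≤ z → |w z * Lop k w z| ≤ M) ∧
    (∀ z, 0 ≤ z → z ≤ 1 → |w z * Lop k w z| ≤ M * z ^ 4) := by
  -- The affine map sends `(6/5)²` to `1/2` and `(6/5)³` to `1`, the ends of the transition of
  -- `cut`.
  set χ : ℝ → ℝ := fun x => cut (125 / 72 * x - 2) with hχ
  have cχ : ContDiff ℝ (⊤ : ℕ∞) χ :=
    cut_contDiff.comp ((contDiff_const.mul contDiff_id).sub contDiff_const)
  obtain ⟨B, hB0, hB⟩ := exists_iteratedDeriv_bound (contDiff_five cχ) 0 2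
  set A := 284 + B with hA
  have hA0 : 0 ≤ A := by positivity
  refine ⟨1792 * A ^ 2, by positivity, fun r hr => ?_⟩
  have hr0 : 0 < r := by linarith
  have hri0 : 0 < r⁻¹ := inv_pos.2 hr0
  have hri1 : r⁻¹ ≤ 1 := inv_le_one_of_one_le₀ hr
  set v : ℝ → ℝ := fun σ => χ (r⁻¹ * σ) with hv
  have cv : ContDiff ℝ (⊤ : ℕ∞) v := cχ.comp (contDiff_const.mul contDiff_id)
  have hv1 : ∀ σ, σ ≤ (6 / 5) ^ 2 * r → v σ = 1 := fun σ hσ => by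
    have : r⁻¹ * σ ≤ (6 / 5) ^ 2 := by rw [inv_mul_le_iff₀ hr0]; linarith
    exact cut_one (by linarith)
  have hv0 : ∀ σ, (6 / 5) ^ 3 * r ≤ σ → v σ = 0 := fun σ hσ => by
    have : (6 / 5) ^ 3 ≤ r⁻¹ * σ := by rw [le_inv_mul_iff₀ hr0]; linarith
    exact cut_zero (by linarith)
  have hvn : ∀ σ, 0 ≤ v σ := fun σ => cut_nonneg _
  have hvl : ∀ σ, v σ ≤ 1 := fun σ => cut_le_one _
  set f : ℝ → ℝ := fun σ => logsinh σ * v σ with hf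
  have cf : ContDiff ℝ (⊤ : ℕ∞) f := logsinh_contDiff.mul cv
  set w : ℝ → ℝ := fun z => z ^ 2 * (Real.arsinh z * v (Real.log z)) with hw
  have hwz : ∀ z, 0 < z → w z = z ^ 2 * f (Real.log z) := fun z hz => by
    simp only [hw, hf, logsinh, Real.exp_log hz]
  have hnear : w =ᶠ[nhds 0] fun z => z ^ 2 * Real.arsinh z := by
    filter_upwards [Metric.ball_mem_nhds (0 : ℝ) one_pos] with z hz
    have h1 : Real.log z ≤ 0 := by
      rw [← Real.log_abs]
      exact Real.log_nonpos (abs_nonneg _) (by simpa using (le_of_lt (show dist z 0 < 1 from hz)))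
    simp only [hw]
    rw [hv1 _ (h1.trans (by positivity)), mul_one]
  have cu : ContDiff ℝ 5 fun z : ℝ => z ^ 2 * Real.arsinh z :=
    (contDiff_id.pow 2).mul Real.contDiff_arsinh
  have cw : ContDiff ℝ 5 w := by
    refine contDiff_iff_contDiffAt.2 fun z => ?_
    by_cases hz : z = 0
    · subst hz
      exact cu.contDiffAt.congr_of_eventuallyEq hnear
    · have h1 : ContDiffAt ℝ 5 Real.log z := Real.contDiffAt_log.2 hz
      exact (contDiffAt_id.pow 2).mul (Real.contDiff_arsinh.contDiffAt.mul
        ((contDiff_five cv).contDiffAt.comp z h1))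
  have hodd : ∀ x : ℝ, (-x) ^ 2 * Real.arsinh (-x) = -(x ^ 2 * Real.arsinh x) := fun x => by
    rw [Real.arsinh_neg]; ring
  -- The wavenumber is the inverse of the upper end of the support, so `k z ≤ 1` there. Smallness of
  -- `k z` is not needed, because the terms in `k` without derivatives of `f` have the favourable
  -- sign.
  set k := Real.exp (-((6 / 5) ^ 3 * r)) with hk
  have hk0 : 0 < k := Real.exp_pos _
  have hw0 : w 0 = 0 := by simp [hw]
  have hL0 : Lop k w 0 = 0 := by
    rw [Lop_congr hnear, Lop, iteratedDeriv_even_of_odd hodd (by decide),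
      iteratedDeriv_even_of_odd hodd (by decide)]
    simp
  have hd0 : deriv w 0 = 0 := by
    rw [hnear.deriv_eq]
    have := (hasDerivAt_pow 2 (0 : ℝ)).mul (Real.hasDerivAt_arsinh 0)
    have h2 : HasDerivAt (fun z : ℝ => z ^ 2 * Real.arsinh z) 0 0 :=
      this.congr_deriv (by simp)
    exact h2.deriv
  have hkz : ∀ z, 0 < z → Real.log z ≤ (6 / 5) ^ 3 * r → k * z ≤ 1 := fun z hz hl => by
    rw [Real.log_le_iff_le_exp hz] at hl
    calc k * z ≤ k * Real.exp ((6 / 5) ^ 3 * r) := by gcongr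
      _ = 1 := by rw [hk, ← Real.exp_add]; simp
  have hvan : ∀ z, Real.exp ((6 / 5) ^ 3 * r) ≤ z → w z = 0 := fun z hz => by
    have hz0 : 0 < z := (Real.exp_pos _).trans_le hz
    simp only [hw]
    rw [hv0 _ ((Real.le_log_iff_exp_le hz0).2 hz)]; simp
  obtain ⟨M₁, hM₁0, hM₁⟩ := exists_bound_Ioc (cw.continuous.mul (Lop_continuous k cw)) 0
    (Real.exp ((6 / 5) ^ 3 * r))
  obtain ⟨M₂, hM₂0, hM₂⟩ := abs_Lop_le_of_zero cw k hL0 1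
  -- the kernel where the cutoff is inactive
  have hkern : ∀ z, 0 < z → Real.log z < (6 / 5) ^ 2 * r →
      w z * Lop k w z ≤ -(2 * logsinh (Real.log z) * slope (Real.log z) ^ 3) := by
    intro z hz hl
    set σ := Real.log z with hσ
    have hev : f =ᶠ[nhds σ] logsinh := by
      filter_upwards [Iio_mem_nhds hl] with y hy
      simp only [hf]; rw [hv1 y (le_of_lt hy), mul_one]
    have hkz1 := hkz z hz (hl.le.trans (by gcongr <;> norm_num))
    have hkz0 : 0 ≤ k * z := by positivity
    -- This makes `-2 (k z)² logQ` at most `-4 (k z)² logsinh`, which outweighs the positive term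
    -- `(k z)⁴ logsinh`.
    have hQ : 2 * logsinh σ ≤ logQ logsinh σ := by
      obtain ⟨e1, e2, -⟩ := logsinh_iteratedDeriv σ
      rw [logQ, e1, e2]
      have t0 := slope_pos σ
      have t3 : slope σ ^ 3 ≤ slope σ := pow_le_of_le_one t0.le (slope_le_one σ) (by norm_num)
      linarith
    have hy := logsinh_pos σ
    have hP := logP_logsinh_le σ
    rw [kernel_log cf hwz k hz, ← hσ]
    have eP : logP f σ = logP logsinh σ := by simp only [logP, hev.iteratedDeriv_eq]
    have eQ : logQ f σ = logQ logsinh σ := by simp only [logQ, hev.iteratedDeriv_eq, hev.eq_of_nhds]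
    rw [eP, eQ, hev.eq_of_nhds]
    have k2 : (k * z) ^ 2 ≤ 1 := pow_le_one₀ hkz0 hkz1
    have j2 : 0 ≤ (k * z) ^ 2 := by positivity
    have p1 : (k * z) ^ 2 * (2 * logsinh σ) ≤ (k * z) ^ 2 * logQ logsinh σ := by gcongr
    have p2 : (k * z) ^ 4 * logsinh σ ≤ (k * z) ^ 2 * logsinh σ :=
      mul_le_mul_of_nonneg_right (pow_le_pow_of_le_one hkz0 hkz1 (by norm_num)) hy.le
    have p3 : 0 ≤ (k * z) ^ 2 * logsinh σ := by positivity
    calc logsinh σ * _ ≤ logsinh σ * (-(2 * slope σ ^ 3)) := by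
          gcongr; linarith
      _ = _ := by ring
  refine ⟨w, k, max M₁ M₂, hk0, le_max_of_le_left hM₁0, cw, hw0, hd0, hL0, hvan, ?_, ?_, ?_, ?_, ?_⟩
  · intro z hz hl
    refine (hkern z hz hl).trans ?_
    have := logsinh_pos (Real.log z)
    have := slope_pos (Real.log z)
    have : 0 ≤ 2 * logsinh (Real.log z) * slope (Real.log z) ^ 3 := by positivity
    linarith
  · intro z hz hl
    refine (hkern z (by linarith) hl).trans ?_
    have h1 := half_add_le_logsinh (Real.log z)
    have hl0 := Real.log_nonneg hz
    have h2 := half_le_slope hl0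
    have h3 : (1 / 2 : ℝ) ^ 2 * (1 / 2) ≤ slope (Real.log z) ^ 3 := by
      calc (1 / 2 : ℝ) ^ 2 * (1 / 2) = (1 / 2) ^ 3 := by norm_num
        _ ≤ _ := by gcongr
    have h4 : slope (Real.log z) ^ 2 ≥ 1 / 2 := by
      rw [slope_sq]
      have h1 : 1 ≤ Real.exp (Real.log z) := Real.one_le_exp hl0
      have h2 : (1 + Real.exp (Real.log z) ^ 2)⁻¹ ≤ 2⁻¹ := by
        gcongr; nlinarith
      norm_num at h2 ⊢
      linarith
    have h5 : 1 / 4 ≤ slope (Real.log z) ^ 3 := by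
      rw [pow_succ]; nlinarith
    have h6 : (1 / 2 + Real.log z) * (1 / 4) ≤ logsinh (Real.log z) * slope (Real.log z) ^ 3 := by
      have := (logsinh_pos (Real.log z)).le
      gcongr
    linarith
  · intro z hz h1 h2
    set σ := Real.log z with hσ
    have hσ0 : 0 ≤ σ := le_trans (by positivity) h1
    -- Writing `f = r u v` with bounded factors whose derivatives are `O(r⁻¹)` shows that `f` is
    -- `O(r)` and its derivatives are `O(1)`. The kernel is then only `O(r)`, not `O(r²)`.
    set u : ℝ → ℝ := fun σ => r⁻¹ * logsinh σ with hu
    have cu' : ContDiff ℝ 5 u := contDiff_five (contDiff_const.mul logsinh_contDiff)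
    have hfu : f = fun σ => r * (u σ * v σ) := by
      funext σ; simp only [hf, hu]; field_simp
    have hyle : logsinh σ ≤ 4 * r := (logsinh_le hσ0).trans (by nlinarith)
    have hxr : r⁻¹ * σ ∈ Set.Icc (0 : ℝ) 2 :=
      ⟨by positivity, by rw [inv_mul_le_iff₀ hr0]; nlinarith⟩
    have hfi : ∀ i, 1 ≤ i → i ≤ 5 → |iteratedDeriv i f σ| ≤ 32 * A ^ 2 := by
      intro i hi1 hi
      rw [hfu, iteratedDeriv_const_mul_field, abs_mul, abs_of_pos hr0]
      have := iteratedDeriv_mul_bound_slow (z := σ) (A := A) (ε := r⁻¹) cu' (contDiff_five cv) hri0.le hri1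
        (by
          simp only [hu]
          rw [abs_of_nonneg (mul_nonneg hri0.le (logsinh_pos σ).le), inv_mul_le_iff₀ hr0]
          have : 4 * r ≤ A * r := by gcongr; linarith
          linarith)
        (by rw [abs_of_nonneg (hvn σ)]; exact (hvl σ).trans (by linarith))
        (fun j hj1 hj => by
          simp only [hu]
          rw [iteratedDeriv_const_mul_field, abs_mul, abs_of_pos hri0, mul_comm]
          gcongr
          refine (abs_iteratedDeriv_logsinh_le hj1 hj σ).trans ?_
          have := slope_le_one σ
          linarith)
        (fun j hj1 hj => by
          simp only [hv]
          rw [iteratedDeriv_comp_mul_left (contDiff_five cχ) _ hj, abs_mul, abs_of_pos (by positivity),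
            mul_comm]
          exact mul_le_mul ((hB _ hxr j hj).trans (by linarith))
            (pow_le_of_le_one hri0.le hri1 (by omega)) (by positivity) hA0) hi1 hi
      calc _ ≤ r * (32 * A ^ 2 * r⁻¹) := by gcongr
        _ = _ := by field_simp
    have hf0 : |f σ| ≤ 4 * r := by
      simp only [hf]
      rw [abs_mul, abs_of_pos (logsinh_pos σ), abs_of_nonneg (hvn σ)]
      exact (mul_le_mul hyle (hvl σ) (hvn σ) (by positivity)).trans (mul_one _).le
    have b1 := hfi 1 (by norm_num) (by norm_num)
    have b2 := hfi 2 (by norm_num) (by norm_num)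
    have b3 := hfi 3 (by norm_num) (by norm_num)
    have b4 := hfi 4 (by norm_num) (by norm_num)
    have hkz1 := hkz z hz h2
    have hkz0 : 0 ≤ k * z := by positivity
    have k2 : (k * z) ^ 2 ≤ 1 := pow_le_one₀ hkz0 hkz1
    rw [kernel_log cf hwz k hz, ← hσ]
    -- The only terms quadratic in the large quantity `f` combine to `-(k z)² (4 - (k z)²) f²`,
    -- which is non-positive and can be dropped.
    have e : f σ * (logP f σ - 2 * (k * z) ^ 2 * logQ f σ + (k * z) ^ 4 * f σ) =
        f σ * (logP f σ - 2 * (k * z) ^ 2 * (iteratedDeriv 2 f σ + 3 * iteratedDeriv 1 f σ)) -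
          (k * z) ^ 2 * (4 - (k * z) ^ 2) * f σ ^ 2 := by
      rw [logQ]; ring
    rw [e]
    have h3 : 0 ≤ (k * z) ^ 2 * (4 - (k * z) ^ 2) * f σ ^ 2 :=
      mul_nonneg (mul_nonneg (by positivity) (by linarith)) (by positivity)
    have h4 : f σ * (logP f σ - 2 * (k * z) ^ 2 * (iteratedDeriv 2 f σ + 3 * iteratedDeriv 1 f σ)) ≤
        4 * r * (6 * (32 * A ^ 2) + 2 * 1 * (4 * (32 * A ^ 2))) := by
      refine (le_abs_self _).trans ?_
      rw [abs_mul]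
      gcongr
      refine (abs_sub _ _).trans ?_
      gcongr
      · rw [logP]; rw [abs_le] at *; constructor <;> linarith
      · rw [abs_mul, abs_of_nonneg (by positivity : 0 ≤ 2 * (k * z) ^ 2)]
        gcongr
        rw [abs_le] at *; constructor <;> linarith
    linarith
  · intro z hz
    rcases le_or_gt z (Real.exp ((6 / 5) ^ 3 * r)) with h | h
    · exact (hM₁ z ⟨by linarith, h⟩).trans (le_max_left _ _)
    · rw [hvan z h.le]; simp [hM₁0]
  · intro z hz hz1
    have h1 : |w z| ≤ z ^ 3 := by
      have ha := Real.arsinh_nonneg_iff.2 hz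
      simp only [hw]
      rw [abs_of_nonneg (mul_nonneg (by positivity) (mul_nonneg ha (hvn _)))]
      calc z ^ 2 * (Real.arsinh z * v (Real.log z)) ≤ z ^ 2 * (z * 1) := by
            gcongr
            · exact hvn _
            · exact arsinh_le_self hz
            · exact hvl _
        _ = z ^ 3 := by ring
    rw [abs_mul]
    calc |w z| * |Lop k w z| ≤ z ^ 3 * (M₂ * z) := by gcongr; exact hM₂ z ⟨hz, hz1⟩
      _ = M₂ * z ^ 4 := by ring
      _ ≤ max M₁ M₂ * z ^ 4 := by gcongr; exact le_max_right _ _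

theorem exists_weight_bound : ∃ B, 0 < B ∧ ∀ x, weight x ≤ B := by
  obtain ⟨B, hB0, hB⟩ := exists_bound_Ioc weight_continuous 1 (36 / 25)
  refine ⟨B + 1, by linarith, fun x => ?_⟩
  rcases le_or_gt x 1 with h | h
  · rw [weight_of_le h]; linarith
  rcases le_or_gt (36 / 25) x with h' | h'
  · rw [weight_of_ge h']; linarith
  · have := (le_abs_self _).trans (hB x ⟨h.le, h'.le⟩); linarith

set_option maxHeartbeats 1000000 in
/-- The mass near the boundary and the first windowed average are controlled by the later ones. -/
theorem win_base : ∃ C₀, 0 ≤ C₀ ∧ ∀ s : ℝ, 2 ≤ s → ∃ C, 0 ≤ C ∧ ∀ (η h : ℝ) (X : ℝ → ℝ), 0 ≤ η →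
    Real.exp ((6 / 5) ^ 4 * s) ≤ h → Integrable X → Stab η h X →
    (∀ z, 0 < z → z ≤ h → -(η * (z ^ 4)⁻¹) ≤ X z) →
    win (shift η X) h s ≤
      C₀ * (∑ i ∈ Finset.range 5, win (shift η X) h ((6 / 5) ^ i * (6 / 5 * s))) + C * η ∧
    ∫ z in (1 : ℝ)..4, shift η X z ≤
      C * ((∑ i ∈ Finset.range 5, win (shift η X) h ((6 / 5) ^ i * (6 / 5 * s))) + η) := by
  obtain ⟨C₁, hC₁0, htest⟩ := exists_growing_test
  obtain ⟨B, hB0, hB⟩ := exists_weight_bound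
  obtain ⟨c, hc0, hc⟩ := exists_cover
  -- This constant must be independent of `s`, which is later chosen large in terms of it. The
  -- kernel gains `s` from its logarithmic growth and the window another `s`, against `r²` on the
  -- cutoff region, and `r² / s² = 36/25`.
  refine ⟨2 * B * (3 * C₁ * c⁻¹ * (36 / 25)), by positivity, fun s hs => ?_⟩
  obtain ⟨w, k, M, hk0, hM0, cw, hw0, hd0, hL0, hvan, hneg, hgrow, hfall, hMb, hM4⟩ :=
    htest (6 / 5 * s) (by linarith)
  set r := 6 / 5 * s with hr
  have hs0 : 0 < s := by linarith
  have hr0 : 0 < r := by positivity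
  set b := Real.exp ((6 / 5) ^ 3 * r) with hb
  set E := energy b k w with hE
  have hE0 : 0 ≤ E := by
    rw [hE, energy]
    have h1 : 0 ≤ ∫ z in (0 : ℝ)..b, dLop k w z ^ 2 :=
      intervalIntegral.integral_nonneg (Real.exp_pos _).le fun _ _ => sq_nonneg _
    have h2 : 0 ≤ ∫ z in (0 : ℝ)..b, Lop k w z ^ 2 :=
      intervalIntegral.integral_nonneg (Real.exp_pos _).le fun _ _ => sq_nonneg _
    positivity
  refine ⟨4 * (3 * C₁ * c⁻¹ * r ^ 2) + (4 + 2 * B) * (E + 3 * M), by positivity, ?_⟩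
  intro η h X hη hbh' hXi hS hlow
  have hbh : b ≤ h := by
    refine le_trans (Real.exp_le_exp.2 (le_of_eq ?_)) hbh'
    rw [hr]; ring
  have hb4 : 4 ≤ b := by
    have := Real.add_one_le_exp ((6 / 5) ^ 3 * r)
    rw [← hb] at this
    nlinarith
  have h4 : 4 ≤ h := hb4.trans hbh
  have hst := hS k hk0 w cw hw0 hd0 hL0 fun z hz => hvan z (hbh.trans hz)
  rw [energy_eq_of_vanish cw (by linarith) hbh hvan, ← hE] at hst
  set Y := shift η X with hY
  set S : ℝ → ℝ := fun σ => ∑ i ∈ Finset.range 5, weight (σ / r / (6 / 5) ^ i) with hSdef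
  have hSn : ∀ σ, 0 ≤ S σ := fun σ => Finset.sum_nonneg fun i _ => weight_nonneg _
  have hYX : ∀ z ∈ Set.Icc 1 h, |X z| ≤ Y z := fun z hz =>
    abs_le_shift hη (hlow z (by linarith [hz.1]) hz.2)
  have hYn : ∀ z ∈ Set.Icc 1 h, 0 ≤ Y z := fun z hz => (abs_nonneg _).trans (hYX z hz)
  -- The parameter `e` is `1/4` on `1 ≤ z ≤ 4`, where the constant part `1/4` of the negative kernel
  -- pays for the mass near the wall, and 0 above. The logarithmic part pays for the first window.
  have hpt : ∀ e, 0 ≤ e → e ≤ 1 / 4 → ∀ z ∈ Set.Icc 1 h, (e = 0 ∨ z ≤ 4) →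
      X z * (w z * Lop k w z) + e * Y z ≤ -(s / (2 * B)) * (Y z * weight (Real.log z / s)) +
        C₁ * r * c⁻¹ * (Y z * S (Real.log z)) + 2 * η * M * (z ^ 2)⁻¹ := by
    intro e he0 he1 z hz hez
    have hz0 : 0 < z := by linarith [hz.1]
    have hYz := hYn z hz
    have hlz : 0 ≤ Real.log z := Real.log_nonneg hz.1
    have hXY : X z = Y z - 2 * η * (z ^ 4)⁻¹ := by rw [hY, shift]; ring
    have hSz := hSn (Real.log z)
    have h7 : 0 ≤ C₁ * r * c⁻¹ * (Y z * S (Real.log z)) :=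
      mul_nonneg (by positivity) (mul_nonneg hYz hSz)
    have hq0 : 0 ≤ Y z * (C₁ * r) := mul_nonneg hYz (by positivity)
    have hη7 : 0 ≤ 2 * η * M * (z ^ 2)⁻¹ := by positivity
    have t1 : -(2 * η * (z ^ 4)⁻¹ * (w z * Lop k w z)) ≤ 2 * η * M * (z ^ 2)⁻¹ := by
      have h1 : (z ^ 4)⁻¹ ≤ (z ^ 2)⁻¹ := by
        gcongr
        · exact hz.1
        · norm_num
      have h2 := neg_le_of_abs_le (hMb z hz.1)
      calc -(2 * η * (z ^ 4)⁻¹ * (w z * Lop k w z)) = 2 * η * (z ^ 4)⁻¹ * -(w z * Lop k w z) := by ring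
        _ ≤ 2 * η * (z ^ 4)⁻¹ * M := by gcongr; linarith
        _ ≤ 2 * η * (z ^ 2)⁻¹ * M := by gcongr
        _ = _ := by ring
    have e1 : X z * (w z * Lop k w z) =
        Y z * (w z * Lop k w z) + -(2 * η * (z ^ 4)⁻¹ * (w z * Lop k w z)) := by
      rw [hXY]; ring
    rcases lt_or_ge (Real.log z) ((6 / 5) ^ 2 * r) with h1 | h1
    · have h2 := hgrow z hz.1 h1
      -- The window of scale `s` vanishes for `log z ≤ s`, so a multiple of it is dominated by the
      -- growing kernel.
      have h3 : s / B * weight (Real.log z / s) ≤ Real.log z := by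
        rcases le_or_gt (Real.log z) s with h4 | h4
        · rw [weight_of_le (by rw [div_le_iff₀ hs0]; linarith)]; simpa
        · calc s / B * weight (Real.log z / s) ≤ s / B * B := by gcongr; exact hB _
            _ = s := by field_simp
            _ ≤ _ := h4.le
      have h5 : w z * Lop k w z + e ≤ -(s / (2 * B) * weight (Real.log z / s)) := by
        have : s / (2 * B) * weight (Real.log z / s) = 1 / 2 * (s / B * weight (Real.log z / s)) := by
          field_simp
        rw [this]; linarith
      have h6 := mul_le_mul_of_nonneg_left h5 hYz
      rw [e1]; linarith
    · have hw1 : weight (Real.log z / s) = 0 := weight_of_ge (by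
        rw [le_div_iff₀ hs0]; refine le_trans ?_ h1; rw [hr]; linarith)
      have hz4 : 4 < z := by
        have := Real.add_one_le_exp (Real.log z)
        rw [Real.exp_log hz0] at this
        have : 4 < (6 / 5) ^ 2 * r + 1 := by rw [hr]; linarith
        linarith
      have he : e = 0 := hez.resolve_right (by linarith)
      rw [hw1, he]
      rcases le_or_gt (Real.log z) ((6 / 5) ^ 3 * r) with h2 | h2
      · have h3 := hfall z hz0 h1 h2
        have hcov : c ≤ S (Real.log z) := by
          apply hc
          · rw [le_div_iff₀ hr0]; exact le_trans (by linarith) h1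
          · rw [div_le_iff₀ hr0]; exact h2.trans (by linarith)
        have hcov' : 1 ≤ c⁻¹ * S (Real.log z) := by
          rw [← inv_mul_cancel₀ hc0.ne']
          exact mul_le_mul_of_nonneg_left hcov (inv_pos.2 hc0).le
        have h4 : Y z * (w z * Lop k w z) ≤ C₁ * r * c⁻¹ * (Y z * S (Real.log z)) := by
          calc Y z * (w z * Lop k w z) ≤ Y z * (C₁ * r) := mul_le_mul_of_nonneg_left h3 hYz
            _ ≤ Y z * (C₁ * r) * (c⁻¹ * S (Real.log z)) := le_mul_of_one_le_right hq0 hcov'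
            _ = _ := by ring
        rw [e1]; linarith
      · rw [hvan z ((Real.lt_log_iff_exp_lt hz0).1 h2).le]
        linarith
  have hXii : ∀ a b, IntervalIntegrable X volume a b := fun a b => hXi.intervalIntegrable
  have cK : Continuous fun z => w z * Lop k w z := cw.continuous.mul (Lop_continuous k cw)
  have iK : ∀ a b, IntervalIntegrable (fun z => X z * (w z * Lop k w z)) volume a b := fun a b =>
    (hXii a b).mul_continuousOn cK.continuousOn
  have iY : ∀ a b : ℝ, 1 ≤ a → a ≤ b → IntervalIntegrable Y volume a b := fun a b ha hab =>
    intervalIntegrable_shift hXi (by linarith) hab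
  have cS : Continuous S := continuous_finsetSum _ fun i _ => weight_continuous.comp
        ((continuous_id.div_const _).div_const _)
  have iW : ∀ a b : ℝ, 1 ≤ a → a ≤ b →
      IntervalIntegrable (fun z => Y z * weight (Real.log z / s)) volume a b := fun a b ha hab =>
    intervalIntegrable_mul_log (g := fun σ => weight (σ / s)) (by linarith) hab (iY a b ha hab)
      (weight_continuous.comp (continuous_id.div_const s))
  have iS : ∀ a b : ℝ, 1 ≤ a → a ≤ b →
      IntervalIntegrable (fun z => Y z * S (Real.log z)) volume a b := fun a b ha hab =>
    intervalIntegrable_mul_log (by linarith) hab (iY a b ha hab) cS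
  have iP : ∀ a b : ℝ, 1 ≤ a → a ≤ b → IntervalIntegrable (fun z : ℝ => (z ^ 2)⁻¹) volume a b :=
    fun a b ha hab => intervalIntegrable_inv_pow (by linarith) hab 2
  have j1 := integral_le_combination (g := fun z => X z * (w z * Lop k w z) + 1 / 4 * Y z)
    (by norm_num : (1 : ℝ) ≤ 4) ((iK 1 4).add ((iY 1 4 le_rfl (by norm_num)).const_mul _))
    (iW 1 4 le_rfl (by norm_num)) (iS 1 4 le_rfl (by norm_num)) (iP 1 4 le_rfl (by norm_num))
    fun z hz => hpt (1 / 4) (by norm_num) le_rfl z ⟨hz.1, hz.2.trans h4⟩ (Or.inr hz.2)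
  have j2 := integral_le_combination (g := fun z => X z * (w z * Lop k w z))
    h4 (iK 4 h) (iW 4 h (by norm_num) h4) (iS 4 h (by norm_num) h4) (iP 4 h (by norm_num) h4)
    fun z hz => by
      have := hpt 0 le_rfl (by norm_num) z ⟨by linarith [hz.1], hz.2⟩ (Or.inl rfl)
      rw [zero_mul, add_zero] at this
      exact this
  rw [intervalIntegral.integral_add (iK 1 4) ((iY 1 4 le_rfl (by norm_num)).const_mul _),
    intervalIntegral.integral_const_mul] at j1
  -- Below 1 the kernel is non-positive and `O(z⁴)`, so only the lower bound on `X` enters and its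
  -- singularity `z⁻⁴` cancels.
  have j0 : ∫ z in (0 : ℝ)..1, X z * (w z * Lop k w z) ≤ η * M := by
    calc ∫ z in (0 : ℝ)..1, X z * (w z * Lop k w z) ≤ ∫ _ in (0 : ℝ)..1, η * M := by
          refine intervalIntegral.integral_mono_on zero_le_one (iK 0 1) intervalIntegrable_const
            fun z hz => ?_
          rcases hz.1.eq_or_lt with h0 | h0
          · rw [← h0, hw0]; simp; positivity
          · have hn := hneg z h0 (lt_of_le_of_lt (Real.log_nonpos hz.1 hz.2) (by positivity))
            have hl := hlow z h0 (hz.2.trans (by linarith))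
            have hm := hM4 z hz.1 hz.2
            rw [abs_of_nonpos hn] at hm
            calc X z * (w z * Lop k w z) = (-X z) * -(w z * Lop k w z) := by ring
              _ ≤ (η * (z ^ 4)⁻¹) * -(w z * Lop k w z) :=
                  mul_le_mul_of_nonneg_right (by linarith) (by linarith)
              _ ≤ (η * (z ^ 4)⁻¹) * (M * z ^ 4) := by gcongr
              _ = η * M := by field_simp
      _ = η * M := by simp
  have spl : ∀ g : ℝ → ℝ, (∀ a b : ℝ, 1 ≤ a → a ≤ b → IntervalIntegrable g volume a b) →
      (∫ z in (1 : ℝ)..4, g z) + (∫ z in (4 : ℝ)..h, g z) = ∫ z in (1 : ℝ)..h, g z := fun g hg =>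
    intervalIntegral.integral_add_adjacent_intervals (hg 1 4 le_rfl (by norm_num))
      (hg 4 h (by norm_num) h4)
  have sW := spl _ iW
  have sS := spl _ iS
  have sP := spl _ iP
  rw [← intervalIntegral.integral_add_adjacent_intervals (iK 0 1) (iK 1 h),
    ← intervalIntegral.integral_add_adjacent_intervals (iK 1 4) (iK 4 h)] at hst
  have hh1 : 1 ≤ h := by linarith
  have k1 : ∫ z in (1 : ℝ)..h, Y z * weight (Real.log z / s) = s * win Y h s := by
    rw [win, mul_inv_cancel_left₀ hs0.ne']
  have k2 : ∫ z in (1 : ℝ)..h, Y z * S (Real.log z) ≤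
      3 * r * ∑ i ∈ Finset.range 5, win Y h ((6 / 5) ^ i * r) :=
    integral_cover_le hh1 hr0 (iY 1 h le_rfl hh1) hYn
  have k3 : ∫ z in (1 : ℝ)..h, (z ^ 2)⁻¹ ≤ 1 := by
    simpa using integral_inv_pow_le one_pos hh1 (n := 1) le_rfl
  set T := ∑ i ∈ Finset.range 5, win Y h ((6 / 5) ^ i * r) with hT
  have hT0 : 0 ≤ T := Finset.sum_nonneg fun i _ => win_nonneg hh1 (by positivity) hYn
  set I := ∫ z in (1 : ℝ)..4, Y z with hI
  have hI0 : 0 ≤ I := intervalIntegral.integral_nonneg (by norm_num) fun z hz =>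
    hYn z ⟨hz.1, hz.2.trans h4⟩
  have hW0 : 0 ≤ win Y h s := win_nonneg hh1 hs0.le hYn
  have main : 1 / 4 * I + s / (2 * B) * (s * win Y h s) ≤
      C₁ * r * c⁻¹ * (3 * r * T) + 2 * η * M * 1 + η * M + η * E := by
    have m1 : C₁ * r * c⁻¹ * (∫ z in (1 : ℝ)..h, Y z * S (Real.log z)) ≤
        C₁ * r * c⁻¹ * (3 * r * T) := by gcongr
    have m2 : 2 * η * M * (∫ z in (1 : ℝ)..h, (z ^ 2)⁻¹) ≤ 2 * η * M * 1 := by gcongr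
    rw [← k1]
    rw [← sW]
    rw [← sS] at m1
    rw [← sP] at m2
    linarith
  have hs1 : 1 ≤ s ^ 2 := one_le_pow₀ (by linarith)
  constructor
  · have m3 : s / (2 * B) * (s * win Y h s) ≤ C₁ * r * c⁻¹ * (3 * r * T) + η * (E + 3 * M) := by
      linarith
    have m4 := mul_le_mul_of_nonneg_left m3 (by positivity : 0 ≤ 2 * B * (s ^ 2)⁻¹)
    have e1 : 2 * B * (s ^ 2)⁻¹ * (s / (2 * B) * (s * win Y h s)) = win Y h s := by field_simp
    have e2 : 2 * B * (s ^ 2)⁻¹ * (C₁ * r * c⁻¹ * (3 * r * T) + η * (E + 3 * M)) =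
        2 * B * (3 * C₁ * c⁻¹ * (36 / 25)) * T + 2 * B * (s ^ 2)⁻¹ * (E + 3 * M) * η := by
      rw [hr]; field_simp; ring
    rw [e1, e2] at m4
    refine m4.trans ?_
    have m5 : (s ^ 2)⁻¹ ≤ 1 := inv_le_one_of_one_le₀ hs1
    have m6 : 2 * B * (s ^ 2)⁻¹ * (E + 3 * M) * η ≤ 2 * B * 1 * (E + 3 * M) * η := by gcongr
    have m7 : 0 ≤ 4 * (3 * C₁ * c⁻¹ * r ^ 2) * η := by positivity
    have m8 : 0 ≤ 4 * (E + 3 * M) * η := by positivity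
    linarith
  · have m3 : 0 ≤ s / (2 * B) * (s * win Y h s) := by positivity
    have m4 : 0 ≤ (4 + 2 * B) * (E + 3 * M) * T := by positivity
    have m5 : 0 ≤ 4 * (3 * C₁ * c⁻¹ * r ^ 2) * η := by positivity
    have m6 : 0 ≤ 2 * B * (E + 3 * M) * η := by positivity
    linarith

/-! ### Logarithmic smallness of the mass near the wall -/

/-- Downward induction in steps of two, from a top block of four indices where `Q ≤ T` is known. The
geometric errors sum up, and the factor 5 closes the induction since `5 (q - q³) ≥ 1` for `q = 5/6`.
-/
theorem le_of_descending_chain {Q : ℕ → ℝ} {m : ℕ} {T D : ℝ} (hD : 0 ≤ D)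
    (htop : ∀ j, j ≤ m → m ≤ j + 3 → Q j ≤ T)
    (hstep : ∀ n, n + 5 ≤ m → Q (n + 1) ≤ Q (n + 3) + D * (5 / 6) ^ n) (d : ℕ) :
    ∀ j, 1 ≤ j → j ≤ m → m - j = d → Q j ≤ T + 5 * D * (5 / 6) ^ j := by
  induction d using Nat.strong_induction_on with
  | _ d ih =>
    intro j hj hjm hd
    rcases Nat.lt_or_ge (j + 3) m with h | h
    · obtain ⟨n, rfl⟩ : ∃ n, j = n + 1 := ⟨j - 1, by omega⟩
      have h1 := hstep n (by omega)
      have h2 := ih (m - (n + 3)) (by omega) (n + 3) (by omega) (by omega) rfl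
      have h3 : 0 ≤ D * (5 / 6) ^ n := by positivity
      have e1 : 5 * D * (5 / 6 : ℝ) ^ (n + 3) = 5 * (5 / 6) ^ 3 * (D * (5 / 6) ^ n) := by ring
      have e2 : 5 * D * (5 / 6 : ℝ) ^ (n + 1) = 5 * (5 / 6) * (D * (5 / 6) ^ n) := by ring
      rw [e1] at h2
      rw [e2]
      linarith
    · have := htop j hjm h
      have : 0 ≤ 5 * D * (5 / 6 : ℝ) ^ j := by positivity
      linarith

/-- The boundary mass of the shifted slope is logarithmically small compared to the total mass. -/
theorem boundary_mass_le : ∃ C h₀, 0 ≤ C ∧ 4 ≤ h₀ ∧ ∀ (η h : ℝ) (X : ℝ → ℝ), 0 ≤ η → h₀ ≤ h →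
    Integrable X → Stab η h X → (∀ z, 0 < z → z ≤ h → -(η * (z ^ 4)⁻¹) ≤ X z) →
    ∫ z in (1 : ℝ)..4, shift η X z ≤
      C * (η + (Real.log h)⁻¹ * ∫ z in (1 : ℝ)..h, shift η X z) := by
  obtain ⟨C, hC0, hC⟩ := win_step
  obtain ⟨C₀, hC₀0, hC₀⟩ := win_base
  obtain ⟨B, hB0, hB⟩ := exists_weight_bound
  -- The first scale is so large that the errors of all steps together amount to at most half of the
  -- maximal window average, and can be absorbed.
  set s := max 2 (50 * C * (1 + 5 * C₀)) with hs
  have hs2 : 2 ≤ s := le_max_left _ _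
  have hsC : 50 * C * (1 + 5 * C₀) ≤ s := le_max_right _ _
  have hs0 : 0 < s := by linarith
  obtain ⟨C', hC'0, hC'⟩ := hC₀ s hs2
  refine ⟨C' * (5 * (2 * (B * (6 / 5) ^ 4) + 10 * C / s * (5 * C' + 1)) + 1), Real.exp ((6 / 5) ^ 5 * s),
    by positivity, ?_, ?_⟩
  · have := Real.add_one_le_exp ((6 / 5) ^ 5 * s)
    linarith
  intro η h X hη hh hXi hS hlow
  have hh0 : 0 < h := (Real.exp_pos _).trans_le hh
  have hlog : (6 / 5) ^ 5 * s ≤ Real.log h := (Real.le_log_iff_exp_le hh0).2 hh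
  have hlog0 : 0 < Real.log h := lt_of_lt_of_le (by positivity) hlog
  have hh1 : 1 ≤ h := (Real.one_le_exp (by positivity)).trans hh
  set Y := shift η X with hY
  have hYn : ∀ z ∈ Set.Icc 1 h, 0 ≤ Y z := fun z hz =>
    (abs_nonneg _).trans (abs_le_shift hη (hlow z (by linarith [hz.1]) hz.2))
  have iY : IntervalIntegrable Y volume 1 h := intervalIntegrable_shift hXi one_pos hh1
  set J := ∫ z in (1 : ℝ)..h, Y z with hJ
  have hJ0 : 0 ≤ J := intervalIntegral.integral_nonneg hh1 hYn
  set Q : ℕ → ℝ := fun n => win Y h ((6 / 5) ^ n * s) with hQ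
  have hQn : ∀ n, 0 ≤ Q n := fun n => win_nonneg hh1 (by positivity) hYn
  -- `m` is the last index whose scale `(6/5)^m s` is at most `log h`.
  obtain ⟨m, hm1, hm2⟩ := exists_nat_pow_near (x := Real.log h / s) (y := (6 / 5 : ℝ))
    (by rw [le_div_iff₀ hs0]; linarith) (by norm_num)
  rw [le_div_iff₀ hs0] at hm1
  rw [div_lt_iff₀ hs0] at hm2
  have hm5 : 5 ≤ m := by
    by_contra hlt
    have : (6 / 5 : ℝ) ^ (m + 1) ≤ (6 / 5) ^ 5 := pow_le_pow_right₀ (by norm_num) (by omega)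
    have : (6 / 5 : ℝ) ^ (m + 1) * s ≤ (6 / 5) ^ 5 * s := by gcongr
    linarith
  set T := B * (6 / 5) ^ 4 * ((Real.log h)⁻¹ * J) with hT
  have hT0 : 0 ≤ T := by positivity
  -- At the top the scale is comparable to `log h`, and the normalisation of the window alone gives
  -- the factor `1 / log h`.
  have htop : ∀ j, j ≤ m → m ≤ j + 3 → Q j ≤ T := by
    intro j _ hj
    have h1 : ((6 / 5) ^ j * s)⁻¹ ≤ (6 / 5) ^ 4 * (Real.log h)⁻¹ := by
      have e : (6 / 5 : ℝ) ^ 4 * (Real.log h)⁻¹ = (Real.log h / (6 / 5) ^ 4)⁻¹ := by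
        rw [inv_div]; exact (div_eq_mul_inv _ _).symm
      rw [e]
      apply inv_anti₀ (by positivity)
      rw [div_le_iff₀ (by positivity)]
      have : (6 / 5 : ℝ) ^ (m + 1) ≤ (6 / 5) ^ (j + 4) := pow_le_pow_right₀ (by norm_num) (by omega)
      calc Real.log h ≤ (6 / 5) ^ (m + 1) * s := hm2.le
        _ ≤ (6 / 5) ^ (j + 4) * s := by gcongr
        _ = _ := by ring
    have h2 : ∫ z in (1 : ℝ)..h, Y z * weight (Real.log z / ((6 / 5) ^ j * s)) ≤ B * J := by
      rw [hJ, ← intervalIntegral.integral_const_mul]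
      refine intervalIntegral.integral_mono_on hh1
        (intervalIntegrable_mul_log (g := fun σ => weight (σ / ((6 / 5) ^ j * s))) one_pos hh1 iY
          (weight_continuous.comp (continuous_id.div_const _))) (iY.const_mul _) fun z hz => ?_
      rw [mul_comm]
      exact mul_le_mul_of_nonneg_right (hB _) (hYn z hz)
    simp only [hQ, win]
    calc _ ≤ ((6 / 5) ^ j * s)⁻¹ * (B * J) := mul_le_mul_of_nonneg_left h2 (by positivity)
      _ ≤ ((6 / 5) ^ 4 * (Real.log h)⁻¹) * (B * J) := mul_le_mul_of_nonneg_right h1 (by positivity)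
      _ = T := by rw [hT]; ring
  have hstepQ : ∀ n, n + 5 ≤ m → Q (n + 1) ≤ Q (n + 3) +
      C / ((6 / 5) ^ n * s) * (∑ i ∈ Finset.range 5, Q (n + i)) + C * η / ((6 / 5) ^ n * s) := by
    intro n hn
    have hp : (1 : ℝ) ≤ (6 / 5) ^ n := one_le_pow₀ (by norm_num)
    have := hC η h ((6 / 5) ^ n * s) X hη (by nlinarith) (by
      rw [← Real.le_log_iff_exp_le hh0]
      refine le_trans ?_ hm1
      have : (6 / 5 : ℝ) ^ (n + 5) ≤ (6 / 5) ^ m := pow_le_pow_right₀ (by norm_num) hn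
      calc (6 / 5) ^ 5 * ((6 / 5) ^ n * s) = (6 / 5) ^ (n + 5) * s := by ring
        _ ≤ _ := by gcongr) hXi hS hlow
    have e : ∀ i : ℕ, (6 / 5 : ℝ) ^ i * ((6 / 5) ^ n * s) = (6 / 5) ^ (n + i) * s := fun i => by ring
    have e1 : 6 / 5 * ((6 / 5) ^ n * s) = (6 / 5) ^ (n + 1) * s := by ring
    simp only [e, e1] at this
    exact this
  obtain ⟨hb1, hb2⟩ := hC' η h X hη (by
    refine le_trans (Real.exp_le_exp.2 ?_) hh
    gcongr
    · norm_num
    · norm_num) hXi hS hlow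
  have e : ∀ i : ℕ, (6 / 5 : ℝ) ^ i * (6 / 5 * s) = (6 / 5) ^ (i + 1) * s := fun i => by ring
  simp only [e] at hb1 hb2
  change win Y h s ≤ C₀ * (∑ i ∈ Finset.range 5, Q (i + 1)) + C' * η at hb1
  change ∫ z in (1 : ℝ)..4, Y z ≤ C' * ((∑ i ∈ Finset.range 5, Q (i + 1)) + η) at hb2
  have hQ0 : win Y h s = Q 0 := by simp [hQ]
  rw [hQ0] at hb1
  -- The step errors contain the averages themselves, so their maximum over indices at least 1 is
  -- bounded in terms of itself. No step bounds `Q 0`, and `win_base` supplies that estimate.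
  obtain ⟨j₀, hj₀, hmax⟩ := Finset.exists_max_image (Finset.Icc 1 m) Q ⟨1, by simp; omega⟩
  set U := Q j₀ with hU
  have hU0 : 0 ≤ U := hQn _
  have hUle : ∀ j, 1 ≤ j → j ≤ m → Q j ≤ U := fun j h1 h2 => hmax j (by simp [h1, h2])
  have hsum : ∑ i ∈ Finset.range 5, Q (i + 1) ≤ 5 * U := by
    calc _ ≤ ∑ _i ∈ Finset.range 5, U :=
          Finset.sum_le_sum fun i hi => hUle _ (by omega) (by simp at hi; omega)
      _ = _ := by simp
  set D := C / s * (5 * (U + Q 0) + η) with hD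
  have hD0 : 0 ≤ D := by have := hQn 0; positivity
  have hstep : ∀ n, n + 5 ≤ m → Q (n + 1) ≤ Q (n + 3) + D * (5 / 6) ^ n := by
    intro n hn
    have h1 := hstepQ n hn
    have h2 : ∑ i ∈ Finset.range 5, Q (n + i) ≤ 5 * (U + Q 0) := by
      calc _ ≤ ∑ _i ∈ Finset.range 5, (U + Q 0) := by
            refine Finset.sum_le_sum fun i hi => ?_
            rcases Nat.eq_zero_or_pos (n + i) with h | h
            · rw [h]; linarith
            · have := hUle (n + i) h (by simp at hi; omega)
              have := hQn 0
              linarith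
        _ = _ := by simp; ring
    have e1 : C / ((6 / 5) ^ n * s) = C / s * (5 / 6) ^ n := by
      rw [show (5 / 6 : ℝ) ^ n = ((6 / 5) ^ n)⁻¹ by rw [← inv_pow]; norm_num]
      field_simp
    have e2 : C * η / ((6 / 5) ^ n * s) = C / s * (5 / 6) ^ n * η := by
      rw [← e1]; ring
    rw [e2, e1] at h1
    have h3 : C / s * (5 / 6) ^ n * (∑ i ∈ Finset.range 5, Q (n + i)) ≤
        C / s * (5 / 6) ^ n * (5 * (U + Q 0)) := by gcongr
    have e3 : D * (5 / 6) ^ n = C / s * (5 / 6) ^ n * (5 * (U + Q 0)) + C / s * (5 / 6) ^ n * η := by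
      rw [hD]; ring
    rw [e3]; linarith
  have hj₀' := Finset.mem_Icc.1 hj₀
  have hUD := le_of_descending_chain hD0 htop hstep (m - j₀) j₀ hj₀'.1 hj₀'.2 rfl
  have hUD2 : U ≤ T + 5 * D := by
    refine hUD.trans ?_
    have : (5 / 6 : ℝ) ^ j₀ ≤ 1 := pow_le_one₀ (by norm_num) (by norm_num)
    have := mul_le_mul_of_nonneg_left this (by positivity : 0 ≤ 5 * D)
    linarith
  have hQ0le : Q 0 ≤ 5 * C₀ * U + C' * η := by
    have := mul_le_mul_of_nonneg_left hsum hC₀0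
    linarith
  have hDle : 5 * D ≤ U / 2 + 5 * C / s * (5 * C' + 1) * η := by
    have h1 : 25 * C / s * (1 + 5 * C₀) ≤ 1 / 2 := by
      rw [div_mul_eq_mul_div, div_le_iff₀ hs0]; linarith
    have h2 : 5 * D ≤ 5 * (C / s * (5 * (U + (5 * C₀ * U + C' * η)) + η)) := by
      rw [hD]; gcongr
    have h3 : 5 * (C / s * (5 * (U + (5 * C₀ * U + C' * η)) + η)) =
        25 * C / s * (1 + 5 * C₀) * U + 5 * C / s * (5 * C' + 1) * η := by ring
    have h4 := mul_le_mul_of_nonneg_right h1 hU0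
    linarith
  have hUfin : U ≤ 2 * T + 10 * C / s * (5 * C' + 1) * η := by
    have : 10 * C / s * (5 * C' + 1) * η = 2 * (5 * C / s * (5 * C' + 1) * η) := by ring
    linarith
  calc ∫ z in (1 : ℝ)..4, Y z ≤ C' * ((∑ i ∈ Finset.range 5, Q (i + 1)) + η) := hb2
    _ ≤ C' * (5 * (2 * T + 10 * C / s * (5 * C' + 1) * η) + η) := by gcongr; linarith
    _ ≤ C' * (5 * (2 * (B * (6 / 5) ^ 4) + 10 * C / s * (5 * C' + 1)) + 1) *
          (η + (Real.log h)⁻¹ * J) := by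
        have p1 : 0 ≤ (Real.log h)⁻¹ * J := by positivity
        set G := (Real.log h)⁻¹ * J
        have p2 : 0 ≤ 10 * C / s * (5 * C' + 1) := by positivity
        set F := 10 * C / s * (5 * C' + 1)
        have p3 : 0 ≤ B * (6 / 5) ^ 4 := by positivity
        set B' := B * (6 / 5) ^ 4
        rw [hT, mul_assoc C']
        gcongr
        nlinarith [mul_nonneg p2 p1, mul_nonneg p3 hη]

/-! ### The inner test function -/

theorem iteratedDeriv_add_mul {w v : ℝ → ℝ} (hw : ContDiff ℝ 5 w) (hv : ContDiff ℝ 5 v) (ε : ℝ) {n : ℕ}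
    (hn : n ≤ 5) (z : ℝ) : iteratedDeriv n (fun z => w z + ε * v z) z =
      iteratedDeriv n w z + ε * iteratedDeriv n v z := by
  have hn' : (n : WithTop ℕ∞) ≤ 5 := by exact_mod_cast hn
  rw [iteratedDeriv_fun_add (hw.of_le hn').contDiffAt
    ((contDiff_const.mul hv).of_le hn').contDiffAt, iteratedDeriv_const_mul_field]

theorem Lop_add_mul {w v : ℝ → ℝ} (hw : ContDiff ℝ 5 w) (hv : ContDiff ℝ 5 v) (k ε z : ℝ) :
    Lop k (fun z => w z + ε * v z) z = Lop k w z + ε * Lop k v z := by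
  simp only [Lop, iteratedDeriv_add_mul hw hv ε (n := 4) (by norm_num),
    iteratedDeriv_add_mul hw hv ε (n := 2) (by norm_num)]
  ring

theorem dLop_add_mul {w v : ℝ → ℝ} (hw : ContDiff ℝ 5 w) (hv : ContDiff ℝ 5 v) (k ε z : ℝ) :
    dLop k (fun z => w z + ε * v z) z = dLop k w z + ε * dLop k v z := by
  simp only [dLop, iteratedDeriv_add_mul hw hv ε (n := 5) (by norm_num),
    iteratedDeriv_add_mul hw hv ε (n := 3) (by norm_num),
    iteratedDeriv_add_mul hw hv ε (n := 1) (by norm_num)]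
  ring

theorem slope_le_exp (σ : ℝ) : slope σ ≤ Real.exp σ := by
  have h1 : 1 ≤ √(1 + Real.exp σ ^ 2) := Real.one_le_sqrt.2 (by nlinarith [Real.exp_pos σ])
  rw [slope]
  exact div_le_self (Real.exp_pos σ).le h1

theorem exp_log_sub {z δ : ℝ} (hz : 0 < z) (hδ : 0 < δ) :
    Real.exp (Real.log z - Real.log δ) = δ⁻¹ * z := by
  rw [Real.exp_sub, Real.exp_log hz, Real.exp_log hδ, div_eq_inv_mul]

/-- The logarithmic profile of `core`, without the cutoff. -/
def coreProfile (δ σ : ℝ) : ℝ := 1 / 2 * (Real.arsinh δ⁻¹ - logsinh (σ - Real.log δ))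

theorem coreProfile_contDiff (δ : ℝ) : ContDiff ℝ (⊤ : ℕ∞) (coreProfile δ) :=
  contDiff_const.mul (contDiff_const.sub (logsinh_contDiff.comp (contDiff_id.sub contDiff_const)))

theorem coreProfile_iteratedDeriv (δ σ : ℝ) {i : ℕ} (hi : 1 ≤ i) :
    iteratedDeriv i (coreProfile δ) σ = -(1 / 2) * iteratedDeriv i logsinh (σ - Real.log δ) := by
  unfold coreProfile
  rw [iteratedDeriv_const_mul_field, iteratedDeriv_const_sub (by omega),
    show (-fun z => logsinh (z - Real.log δ)) = fun z => -logsinh (z - Real.log δ) from rfl,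
    iteratedDeriv_fun_neg, iteratedDeriv_comp_sub_const]
  ring

/-- The test function `z² (arsinh (1/δ) - arsinh (z/δ)) / 2`, cut off above `z = 1`. -/
def core (δ z : ℝ) : ℝ := z ^ 2 * (1 / 2 * (Real.arsinh δ⁻¹ - Real.arsinh (δ⁻¹ * z)) * cut (z / 2))

theorem core_contDiff (δ : ℝ) : ContDiff ℝ (⊤ : ℕ∞) (core δ) :=
  (contDiff_id.pow 2).mul ((contDiff_const.mul (contDiff_const.sub
    (contDiff_const.mul contDiff_id).arsinh)).mul (cut_contDiff.comp (contDiff_id.div_const 2)))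

theorem core_eq_log {δ z : ℝ} (hδ : 0 < δ) (hz : 0 < z) :
    core δ z = z ^ 2 * (coreProfile δ (Real.log z) * cut (Real.exp (Real.log z) / 2)) := by
  rw [core, coreProfile, logsinh, exp_log_sub hz hδ, Real.exp_log hz]

section inner
variable {δ z : ℝ}

/-- The cut-off logarithmic profile of `core`. -/
def cutProfile (δ σ : ℝ) : ℝ := coreProfile δ σ * cut (Real.exp σ / 2)

theorem cutProfile_contDiff (δ : ℝ) : ContDiff ℝ (⊤ : ℕ∞) (cutProfile δ) :=
  (coreProfile_contDiff δ).mul (cut_contDiff.comp (Real.contDiff_exp.div_const 2))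

theorem cutProfile_eventuallyEq (hz : 0 < z) (hz1 : z < 1) :
    cutProfile δ =ᶠ[nhds (Real.log z)] coreProfile δ := by
  filter_upwards [Iio_mem_nhds (Real.log_neg hz hz1)] with y hy
  have : Real.exp y ≤ 1 := Real.exp_le_one_iff.2 (le_of_lt hy)
  rw [cutProfile, cut_one (by linarith), mul_one]

/-- For `z` much larger than `δ` the profile is a constant minus `(1/2) log z`, and `logP` maps
`-σ/2` to 1. Exactly, the deviation is a polynomial in `t = slope` with a factor `1 - t`, and `1 - t
≤ 1 - t² = (1 + (z/δ)²)⁻¹`. -/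
theorem abs_logP_coreProfile_sub_one_le (hδ : 0 < δ) (hz : 0 < z) :
    |logP (coreProfile δ) (Real.log z) - 1| ≤ 36 * (1 + (δ⁻¹ * z) ^ 2)⁻¹ := by
  set σ := Real.log z - Real.log δ with hσ
  have hP : logP (coreProfile δ) (Real.log z) = -(1 / 2) * logP logsinh σ := by
    simp only [logP, coreProfile_iteratedDeriv δ _ (i := 4) (by norm_num),
      coreProfile_iteratedDeriv δ _ (i := 3) (by norm_num),
      coreProfile_iteratedDeriv δ _ (i := 2) (by norm_num),
      coreProfile_iteratedDeriv δ _ (i := 1) (by norm_num)]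
    ring
  rw [hP, logP_logsinh]
  have hs := slope_sq σ
  rw [hσ, exp_log_sub hz hδ, ← hσ] at hs
  set t := slope σ with ht
  have t0 : 0 ≤ t := (slope_pos σ).le
  have t1 : t ≤ 1 := slope_le_one σ
  have hp : ∀ n : ℕ, 0 ≤ t ^ n ∧ t ^ n ≤ 1 := fun n => ⟨by positivity, pow_le_one₀ t0 t1⟩
  have e : -(1 / 2) * -(t ^ 3 * (20 - 33 * t ^ 2 + 15 * t ^ 4)) - 1 =
      -((1 - t) * (1 + t + t ^ 2 - 9 * t ^ 3 - 9 * t ^ 4 + 15 / 2 * t ^ 5 + 15 / 2 * t ^ 6)) := by ring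
  have e2 : (1 + (δ⁻¹ * z) ^ 2)⁻¹ = 1 - t ^ 2 := by linarith
  rw [e, e2, abs_neg, abs_mul, abs_of_nonneg (by linarith : 0 ≤ 1 - t)]
  have h1 : |1 + t + t ^ 2 - 9 * t ^ 3 - 9 * t ^ 4 + 15 / 2 * t ^ 5 + 15 / 2 * t ^ 6| ≤ 36 := by
    obtain ⟨a2, b2⟩ := hp 2
    obtain ⟨a3, b3⟩ := hp 3
    obtain ⟨a4, b4⟩ := hp 4
    obtain ⟨a5, b5⟩ := hp 5
    obtain ⟨a6, b6⟩ := hp 6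
    rw [abs_le]; constructor <;> linarith
  calc _ ≤ (1 - t) * 36 := mul_le_mul_of_nonneg_left h1 (by linarith)
    _ ≤ 36 * (1 - t ^ 2) := by nlinarith

theorem arsinh_nonneg' {x : ℝ} (hx : 0 ≤ x) : 0 ≤ Real.arsinh x := Real.arsinh_nonneg_iff.2 hx

theorem coreProfile_bounds (hδ : 0 < δ) (hz : 0 < z) (hz1 : z ≤ 1) :
    0 ≤ coreProfile δ (Real.log z) ∧ coreProfile δ (Real.log z) ≤ Real.arsinh δ⁻¹ := by
  rw [coreProfile, logsinh, exp_log_sub hz hδ]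
  have h1 : Real.arsinh (δ⁻¹ * z) ≤ Real.arsinh δ⁻¹ :=
    Real.arsinh_le_arsinh.2 (mul_le_of_le_one_right (by positivity) hz1)
  have h2 : 0 ≤ Real.arsinh (δ⁻¹ * z) := arsinh_nonneg' (by positivity)
  constructor <;> linarith

/-- Pointwise bounds on `core` in the region where the cutoff is inactive. -/
theorem core_inner_bounds (hδ : 0 < δ) (hδ1 : δ ≤ 1) (hz : 0 < z) (hz1 : z < 1) {k : ℝ} (hk : 0 < k)
    (hk1 : k ≤ 1) :
    |core δ z| ≤ Real.arsinh δ⁻¹ ∧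
    |z ^ 2 * Lop k (core δ) z - 1| ≤
      36 * (1 + (δ⁻¹ * z) ^ 2)⁻¹ + k ^ 2 * (4 + 5 * Real.arsinh δ⁻¹) ∧
    |Lop k (core δ) z| ≤ 50 * (δ ^ 2)⁻¹ ∧
    |dLop k (core δ) z| ≤ 2000 * (δ ^ 3)⁻¹ ∧
    |dLop k (core δ) z| ≤ 2000 * ((z ^ 3)⁻¹ + δ⁻¹) := by
  have cf := cutProfile_contDiff δ
  have hw : ∀ z, 0 < z → core δ z = z ^ 2 * cutProfile δ (Real.log z) := fun z hz => core_eq_log hδ hz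
  have hev := cutProfile_eventuallyEq (δ := δ) hz hz1
  obtain ⟨h1, h2, h3, h4, h5⟩ := iteratedDeriv_log cf hw hz
  simp only [hev.iteratedDeriv_eq, hev.eq_of_nhds] at h1 h2 h3 h4 h5
  have hz2 : z ^ 2 ≤ 1 := pow_le_one₀ hz.le hz1.le
  have hcore := hw z hz
  rw [hev.eq_of_nhds] at hcore
  have hP1 := abs_logP_coreProfile_sub_one_le hδ hz
  obtain ⟨g0, g1⟩ := coreProfile_bounds hδ hz hz1.le
  set a := Real.arsinh δ⁻¹ with ha
  have ha0 : 0 ≤ a := arsinh_nonneg' (by positivity)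
  have haδ : a ≤ δ⁻¹ := arsinh_le_self (by positivity)
  set g := coreProfile δ (Real.log z) with hg
  set σ := Real.log z - Real.log δ with hσ
  obtain ⟨e1, e2, e3, e4, e5⟩ := logsinh_iteratedDeriv σ
  have d1 := coreProfile_iteratedDeriv δ (Real.log z) (i := 1) (by norm_num)
  have d2 := coreProfile_iteratedDeriv δ (Real.log z) (i := 2) (by norm_num)
  have d3 := coreProfile_iteratedDeriv δ (Real.log z) (i := 3) (by norm_num)
  have d4 := coreProfile_iteratedDeriv δ (Real.log z) (i := 4) (by norm_num)
  have d5 := coreProfile_iteratedDeriv δ (Real.log z) (i := 5) (by norm_num)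
  rw [← hσ, e1] at d1
  rw [← hσ, e2] at d2
  rw [← hσ, e3] at d3
  rw [← hσ, e4] at d4
  rw [← hσ, e5] at d5
  have htz : slope σ ≤ δ⁻¹ * z := by
    have := slope_le_exp σ
    rwa [hσ, exp_log_sub hz hδ, ← hσ] at this
  set t := slope σ with ht
  have t0 : 0 ≤ t := (slope_pos σ).le
  have t1 : t ≤ 1 := slope_le_one σ
  have hp : ∀ n : ℕ, 0 ≤ t ^ n ∧ t ^ n ≤ 1 := fun n => ⟨by positivity, pow_le_one₀ t0 t1⟩
  obtain ⟨p2, q2⟩ := hp 2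
  obtain ⟨p3, q3⟩ := hp 3
  obtain ⟨p4, q4⟩ := hp 4
  obtain ⟨p6, q6⟩ := hp 6
  have t3t : t ^ 3 ≤ t := pow_le_of_le_one t0 t1 (by norm_num)
  have t5t : t ^ 5 ≤ t := pow_le_of_le_one t0 t1 (by norm_num)
  have p5 : 0 ≤ t ^ 5 := by positivity
  have k2 : k ^ 2 ≤ 1 := pow_le_one₀ hk.le hk1
  have k4 : k ^ 4 ≤ k ^ 2 := pow_le_pow_of_le_one hk.le hk1 (by norm_num)
  have hD1 : 1 ≤ δ⁻¹ := (one_le_inv₀ hδ).2 hδ1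
  have hD2 : δ⁻¹ ≤ (δ ^ 2)⁻¹ := by rw [← inv_pow]; exact le_self_pow₀ hD1 (by norm_num)
  have hD3 : (δ ^ 2)⁻¹ ≤ (δ ^ 3)⁻¹ := by
    rw [← inv_pow, ← inv_pow]; exact pow_le_pow_right₀ hD1 (by norm_num)
  -- second derivative
  have w2 : |iteratedDeriv 2 (core δ) z| ≤ 2 + 2 * a := by
    rw [h2, d1, d2, abs_le]
    constructor <;> linarith
  have w0 : |core δ z| ≤ a := by
    rw [hcore, abs_of_nonneg (by positivity)]
    calc z ^ 2 * g ≤ 1 * a := by gcongr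
      _ = a := one_mul a
  have w1 : |iteratedDeriv 1 (core δ) z| ≤ 1 + 2 * a := by
    rw [h1, d1, abs_mul, abs_of_pos hz]
    calc _ ≤ 1 * (1 + 2 * a) := by
          gcongr
          rw [abs_le]; constructor <;> linarith
      _ = _ := one_mul _
  -- Near the wall `slope` is at most `z / δ`. Each singular factor `z⁻¹` is paired with one factor
  -- `t`, which replaces the singularity by powers of `δ⁻¹`.
  have hzt : z⁻¹ * t ≤ δ⁻¹ := by rw [inv_mul_le_iff₀ hz, mul_comm]; exact htz
  have hzt0 : 0 ≤ z⁻¹ * t := by positivity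
  have w3 : |iteratedDeriv 3 (core δ) z| ≤ 8 * δ⁻¹ := by
    have : |iteratedDeriv 3 (coreProfile δ) (Real.log z) + 3 * iteratedDeriv 2 (coreProfile δ) (Real.log z)
        + 2 * iteratedDeriv 1 (coreProfile δ) (Real.log z)| ≤ 8 * t := by
      rw [d1, d2, d3, abs_le]; constructor <;> linarith
    rw [h3, abs_mul, abs_of_pos (inv_pos.2 hz)]
    calc _ ≤ z⁻¹ * (8 * t) := by gcongr
      _ = 8 * (z⁻¹ * t) := by ring
      _ ≤ _ := by gcongr
  have w4 : z ^ 2 * iteratedDeriv 4 (core δ) z = logP (coreProfile δ) (Real.log z) := by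
    rw [h4, logP]; field_simp
  have w4' : |iteratedDeriv 4 (core δ) z| ≤ 34 * (δ ^ 2)⁻¹ := by
    have : iteratedDeriv 4 (core δ) z = (z⁻¹ * t) ^ 2 * (1 / 2 * (t * (20 - 33 * t ^ 2 + 15 * t ^ 4))) := by
      rw [h4, d1, d2, d3, d4]; field_simp; ring
    rw [this, abs_mul, abs_of_nonneg (by positivity), ← inv_pow, mul_comm]
    have h6 : |1 / 2 * (t * (20 - 33 * t ^ 2 + 15 * t ^ 4))| ≤ 34 := by
      rw [abs_mul, abs_mul, abs_of_nonneg t0]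
      have : |20 - 33 * t ^ 2 + 15 * t ^ 4| ≤ 68 := by rw [abs_le]; constructor <;> linarith
      calc _ ≤ |(1 : ℝ) / 2| * (1 * 68) := by gcongr
        _ = 34 := by norm_num
    gcongr
  have w5 : |iteratedDeriv 5 (core δ) z| ≤ 280 * (z⁻¹ * t) ^ 3 := by
    have : iteratedDeriv 5 (core δ) z =
        (z⁻¹ * t) ^ 3 * (10 - 159 / 2 * t ^ 2 + 120 * t ^ 4 - 105 / 2 * t ^ 6) := by
      rw [h5, d1, d3, d5]; field_simp; ring
    rw [this, abs_mul, abs_of_nonneg (by positivity), mul_comm]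
    gcongr
    rw [abs_le]; constructor <;> linarith
  refine ⟨w0, ?_, ?_, ?_⟩
  · have e : z ^ 2 * Lop k (core δ) z - 1 = (logP (coreProfile δ) (Real.log z) - 1) -
        2 * k ^ 2 * (z ^ 2 * iteratedDeriv 2 (core δ) z) + k ^ 4 * (z ^ 2 * core δ z) := by
      rw [← w4, Lop]; ring
    have b1 : |2 * k ^ 2 * (z ^ 2 * iteratedDeriv 2 (core δ) z)| ≤ 2 * k ^ 2 * (1 * (2 + 2 * a)) := by
      rw [abs_mul, abs_of_nonneg (by positivity : 0 ≤ 2 * k ^ 2), abs_mul, abs_of_nonneg (sq_nonneg z)]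
      gcongr
    have b2 : |k ^ 4 * (z ^ 2 * core δ z)| ≤ k ^ 2 * (1 * a) := by
      rw [abs_mul, abs_of_nonneg (by positivity : 0 ≤ k ^ 4), abs_mul, abs_of_nonneg (sq_nonneg z)]
      gcongr
    rw [e]
    rw [abs_le] at hP1 b1 b2 ⊢
    constructor <;> linarith
  · have b1 : |2 * k ^ 2 * iteratedDeriv 2 (core δ) z| ≤ 2 * 1 * (2 + 2 * a) := by
      rw [abs_mul, abs_of_nonneg (by positivity : 0 ≤ 2 * k ^ 2)]; gcongr
    have b2 : |k ^ 4 * core δ z| ≤ 1 * a := by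
      rw [abs_mul, abs_of_nonneg (by positivity : 0 ≤ k ^ 4)]
      gcongr
      exact k4.trans k2
    rw [Lop]
    rw [abs_le] at w4' b1 b2 ⊢
    constructor <;> linarith
  · have b1 : |2 * k ^ 2 * iteratedDeriv 3 (core δ) z| ≤ 2 * 1 * (8 * δ⁻¹) := by
      rw [abs_mul, abs_of_nonneg (by positivity : 0 ≤ 2 * k ^ 2)]; gcongr
    have b2 : |k ^ 4 * iteratedDeriv 1 (core δ) z| ≤ 1 * (1 + 2 * a) := by
      rw [abs_mul, abs_of_nonneg (by positivity : 0 ≤ k ^ 4)]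
      gcongr
      exact k4.trans k2
    have b3 : |dLop k (core δ) z| ≤ 280 * (z⁻¹ * t) ^ 3 + 19 * δ⁻¹ := by
      rw [dLop]
      rw [abs_le] at w5 b1 b2 ⊢
      constructor <;> linarith
    have c1 : (z⁻¹ * t) ^ 3 ≤ (δ ^ 3)⁻¹ := by rw [← inv_pow]; gcongr
    have c2 : (z⁻¹ * t) ^ 3 ≤ (z ^ 3)⁻¹ := by
      rw [← inv_pow]
      gcongr
      exact mul_le_of_le_one_right (by positivity) t1
    have c3 : 0 ≤ (z ^ 3)⁻¹ := by positivity
    constructor <;> linarith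

/-- Pointwise bounds on `core` in the region of the cutoff. -/
theorem core_outer_bounds : ∃ C, 0 ≤ C ∧ ∀ δ z k : ℝ, 0 < δ → 1 ≤ z → z ≤ 2 → 0 < k → k ≤ 1 / 2 →
    |core δ z| ≤ C ∧ |Lop k (core δ) z| ≤ C ∧ |dLop k (core δ) z| ≤ C := by
  have cv : ContDiff ℝ (⊤ : ℕ∞) fun σ : ℝ => cut (Real.exp σ / 2) :=
    cut_contDiff.comp (Real.contDiff_exp.div_const 2)
  obtain ⟨B, hB0, hB⟩ := exists_iteratedDeriv_bound (contDiff_five cv) 0 1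
  refine ⟨25 * (32 * 140 * B), by positivity, fun δ z k hδ hz hz2 hk hk1 => ?_⟩
  have hz0 : 0 < z := by linarith
  have cf := cutProfile_contDiff δ
  have hw : ∀ z, 0 < z → core δ z = z ^ 2 * cutProfile δ (Real.log z) := fun z hz => core_eq_log hδ hz
  have hl0 : 0 ≤ Real.log z := Real.log_nonneg hz
  have hl1 : Real.log z ≤ 1 := by
    have := Real.log_le_sub_one_of_pos hz0; linarith
  have hA : ∀ i ≤ 5, |iteratedDeriv i (cutProfile δ) (Real.log z)| ≤ 32 * 140 * B := fun i hi => by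
    refine iteratedDeriv_mul_bound (contDiff_five (coreProfile_contDiff δ)) (contDiff_five cv)
      (fun j hj => ?_) (hB _ ⟨hl0, hl1⟩) hi
    rcases Nat.eq_zero_or_pos j with h | h
    · subst h
      rw [iteratedDeriv_zero, coreProfile]
      -- The subtracted constant is the value of `logsinh` at `z = 1`. Since `slope ≤ 1`, the mean
      -- value theorem bounds the difference by `log z`, uniformly in `δ`.
      have e : Real.arsinh δ⁻¹ = logsinh (0 - Real.log δ) := by
        rw [logsinh, zero_sub, Real.exp_neg, Real.exp_log hδ]
      have hmv := (convex_univ (𝕜 := ℝ) (E := ℝ)).norm_image_sub_le_of_norm_hasDerivWithin_le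
        (f := logsinh) (f' := slope) (C := 1) (fun x _ => (logsinh_hasDerivAt x).hasDerivWithinAt)
        (fun x _ => by rw [Real.norm_of_nonneg (slope_pos x).le]; exact slope_le_one x)
        (Set.mem_univ (Real.log z - Real.log δ)) (Set.mem_univ (0 - Real.log δ))
      rw [e, abs_mul]
      rw [Real.norm_eq_abs, Real.norm_eq_abs] at hmv
      have e2 : |0 - Real.log δ - (Real.log z - Real.log δ)| = Real.log z := by
        rw [show 0 - Real.log δ - (Real.log z - Real.log δ) = -Real.log z by ring, abs_neg,
          abs_of_nonneg hl0]
      rw [e2] at hmv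
      have : |(1 : ℝ) / 2| = 1 / 2 := by norm_num
      rw [this]; linarith
    · rw [coreProfile_iteratedDeriv δ _ h, abs_mul]
      have h1 := abs_iteratedDeriv_logsinh_le h hj (Real.log z - Real.log δ)
      have h2 := slope_le_one (Real.log z - Real.log δ)
      have : |-(1 / 2 : ℝ)| = 1 / 2 := by norm_num
      rw [this]; linarith
  obtain ⟨b1, b2⟩ := abs_Lop_log_le cf hw hz0 hk.le (by nlinarith : k * z ≤ 1) hA
  have h2 : (z ^ 2)⁻¹ ≤ 1 := inv_le_one_of_one_le₀ (one_le_pow₀ hz)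
  have h3 : (z ^ 3)⁻¹ ≤ 1 := inv_le_one_of_one_le₀ (one_le_pow₀ hz)
  refine ⟨?_, b1.trans (mul_le_of_le_one_right (by positivity) h2),
    b2.trans (mul_le_of_le_one_right (by positivity) h3)⟩
  have h4 := hA 0 (by norm_num)
  rw [iteratedDeriv_zero] at h4
  rw [hw z hz0, abs_mul, abs_of_nonneg (sq_nonneg z)]
  calc z ^ 2 * |cutProfile δ (Real.log z)| ≤ 2 ^ 2 * (32 * 140 * B) := by gcongr
    _ ≤ 25 * (32 * 140 * B) := by gcongr; norm_num

end inner

theorem Lop_pow_two (k z : ℝ) : Lop k (fun z => z ^ 2) z = -(4 * k ^ 2) + k ^ 4 * z ^ 2 := by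
  have h4 : iteratedDeriv 4 (fun z : ℝ => z ^ 2) z = 0 := by
    rw [iteratedDeriv_eq_iterate, iter_deriv_pow]; norm_num [Nat.descFactorial, Finset.prod_range_succ]
  have h2 : iteratedDeriv 2 (fun z : ℝ => z ^ 2) z = 2 := by
    rw [iteratedDeriv_eq_iterate, iter_deriv_pow]; norm_num [Nat.descFactorial, Finset.prod_range_succ]
  rw [Lop, h4, h2]; ring

theorem Lop_pow_four (k z : ℝ) :
    Lop k (fun z => z ^ 4) z = 24 - 24 * k ^ 2 * z ^ 2 + k ^ 4 * z ^ 4 := by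
  have h4 : iteratedDeriv 4 (fun z : ℝ => z ^ 4) z = 24 := by
    rw [iteratedDeriv_eq_iterate, iter_deriv_pow]; norm_num [Nat.descFactorial, Finset.prod_range_succ]
  have h2 : iteratedDeriv 2 (fun z : ℝ => z ^ 4) z = 12 * z ^ 2 := by
    rw [iteratedDeriv_eq_iterate, iter_deriv_pow]; norm_num [Nat.descFactorial, Finset.prod_range_succ]
  rw [Lop, h4, h2]; ring

/-- The monomial `z⁴`, cut off above `z = 1`. -/
def quartic (z : ℝ) : ℝ := z ^ 4 * cut (z / 2)

theorem quartic_contDiff : ContDiff ℝ (⊤ : ℕ∞) quartic :=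
  (contDiff_id.pow 4).mul (cut_contDiff.comp (contDiff_id.div_const 2))

theorem cut_half_eventuallyEq_one {z : ℝ} (hz : z < 1) : (fun z => cut (z / 2)) =ᶠ[nhds z] fun _ => 1 := by
  filter_upwards [Iio_mem_nhds hz] with y hy
  exact cut_one (by have := (show y < 1 from hy); linarith)

/-- The combination of `core` and `quartic` satisfying the boundary condition at `z = 0`. -/
def inner (k δ z : ℝ) : ℝ := core δ z + k ^ 2 * Real.arsinh δ⁻¹ / 12 * quartic z

theorem inner_contDiff (k δ : ℝ) : ContDiff ℝ 5 (inner k δ) :=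
  (contDiff_five (core_contDiff δ)).add (contDiff_const.mul (contDiff_five quartic_contDiff))

theorem inner_eventuallyEq (k δ : ℝ) : inner k δ =ᶠ[nhds 0] fun z =>
    (k ^ 2 * Real.arsinh δ⁻¹ / 12 * z ^ 4 + 1 / 2 * Real.arsinh δ⁻¹ * z ^ 2) +
      -(1 / 2) * (z ^ 2 * Real.arsinh (δ⁻¹ * z)) := by
  filter_upwards [cut_half_eventuallyEq_one (z := 0) one_pos] with y hy
  rw [inner, core, quartic, hy]; ring

theorem inner_zero (k δ : ℝ) : inner k δ 0 = 0 := by simp [inner, core, quartic]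

theorem deriv_inner_zero (k δ : ℝ) : deriv (inner k δ) 0 = 0 := by
  have h : HasDerivAt (core δ) 0 0 := by
    have c : DifferentiableAt ℝ (fun z : ℝ => 1 / 2 * (Real.arsinh δ⁻¹ - Real.arsinh (δ⁻¹ * z)) * cut (z / 2)) 0 :=
      (((contDiff_const.mul (contDiff_const.sub
        (contDiff_const.mul contDiff_id).arsinh)).mul (cut_contDiff.comp (contDiff_id.div_const 2)) :
        ContDiff ℝ (⊤ : ℕ∞) _).differentiable (by simp)).differentiableAt
    exact ((hasDerivAt_pow 2 (0 : ℝ)).mul c.hasDerivAt).congr_deriv (by simp)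
  have h2 : HasDerivAt quartic 0 0 := by
    have c : DifferentiableAt ℝ (fun z : ℝ => cut (z / 2)) 0 :=
      ((cut_contDiff.comp (contDiff_id.div_const 2) :
        ContDiff ℝ (⊤ : ℕ∞) _).differentiable (by simp)).differentiableAt
    exact ((hasDerivAt_pow 4 (0 : ℝ)).mul c.hasDerivAt).congr_deriv (by simp)
  have := h.add (h2.const_mul (k ^ 2 * Real.arsinh δ⁻¹ / 12))
  rw [mul_zero, add_zero] at this
  exact this.deriv

/-- The part with `arsinh (z/δ)` is odd, so its even derivatives vanish at 0. With `a = arsinh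
(1/δ)`, the remaining `(a/2) z²` contributes `-2 k² a`, and the coefficient `k² a / 12` of `z⁴`
contributes `24 k² a / 12`, which cancels it. -/
theorem Lop_inner_zero (k δ : ℝ) : Lop k (inner k δ) 0 = 0 := by
  have c4 : ContDiff ℝ 5 fun z : ℝ => z ^ 4 := contDiff_id.pow 4
  have c2 : ContDiff ℝ 5 fun z : ℝ => z ^ 2 := contDiff_id.pow 2
  have ca : ContDiff ℝ 5 fun z : ℝ => z ^ 2 * Real.arsinh (δ⁻¹ * z) :=
    c2.mul (contDiff_const.mul contDiff_id).arsinh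
  have hodd : ∀ x : ℝ, (-x) ^ 2 * Real.arsinh (δ⁻¹ * -x) = -(x ^ 2 * Real.arsinh (δ⁻¹ * x)) := fun x => by
    rw [mul_neg, Real.arsinh_neg]; ring
  have e0 : Lop k (fun z : ℝ => z ^ 2 * Real.arsinh (δ⁻¹ * z)) 0 = 0 := by
    rw [Lop, iteratedDeriv_even_of_odd hodd (by decide), iteratedDeriv_even_of_odd hodd (by decide)]
    simp
  have ck : ContDiff ℝ 5 fun z : ℝ => k ^ 2 * Real.arsinh δ⁻¹ / 12 * z ^ 4 := contDiff_const.mul c4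
  have ek : Lop k (fun z : ℝ => k ^ 2 * Real.arsinh δ⁻¹ / 12 * z ^ 4) 0 = 2 * k ^ 2 * Real.arsinh δ⁻¹ := by
    have h := Lop_add_mul (w := fun _ => 0) contDiff_const c4 k (k ^ 2 * Real.arsinh δ⁻¹ / 12) 0
    simp only [zero_add] at h
    rw [h, Lop_pow_four]
    simp [Lop]; ring
  rw [Lop_congr (inner_eventuallyEq k δ),
    Lop_add_mul (w := fun z => k ^ 2 * Real.arsinh δ⁻¹ / 12 * z ^ 4 + 1 / 2 * Real.arsinh δ⁻¹ * z ^ 2)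
      (ck.add (contDiff_const.mul c2)) ca, e0, Lop_add_mul ck c2, ek, Lop_pow_two]
  ring

theorem inner_vanish (k δ : ℝ) {z : ℝ} (hz : 2 ≤ z) : inner k δ z = 0 := by
  rw [inner, core, quartic, cut_zero (by linarith)]; simp

theorem quartic_bounds : ∃ C, 0 ≤ C ∧ ∀ k z : ℝ, 0 ≤ k → k ≤ 1 → 0 ≤ z → z ≤ 2 →
    |quartic z| ≤ C ∧ |Lop k quartic z| ≤ C ∧ |dLop k quartic z| ≤ C := by
  obtain ⟨A, hA0, hA⟩ := exists_iteratedDeriv_bound (contDiff_five quartic_contDiff) 0 2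
  refine ⟨4 * A, by positivity, fun k z hk hk1 hz hz2 => ⟨?_, Lop_bound hk hk1 (hA z ⟨hz, hz2⟩)⟩⟩
  have := hA z ⟨hz, hz2⟩ 0 (by norm_num)
  rw [iteratedDeriv_zero] at this
  linarith

/-- Pointwise bounds on `inner`. -/
theorem inner_bounds : ∃ C, 1 ≤ C ∧ ∀ δ k : ℝ, 0 < δ → δ ≤ 1 → 0 < k → k ≤ 1 / 2 → k ^ 2 * δ⁻¹ ≤ 1 →
    (∀ z, 0 < z → z < 1 → |inner k δ z| ≤ C * δ⁻¹ ∧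
      |z ^ 2 * Lop k (inner k δ) z - 1| ≤ C * ((1 + (δ⁻¹ * z) ^ 2)⁻¹ + k ^ 2 * δ⁻¹)) ∧
    (∀ z, 1 ≤ z → z ≤ 2 → |inner k δ z| ≤ C ∧ |Lop k (inner k δ) z| ≤ C) ∧
    (∀ z, 0 < z → z ≤ 2 → |Lop k (inner k δ) z| ≤ C * (δ ^ 2)⁻¹ ∧
      |dLop k (inner k δ) z| ≤ C * (δ ^ 3)⁻¹ ∧
      |dLop k (inner k δ) z| ≤ C * ((z ^ 3)⁻¹ + δ⁻¹)) := by
  obtain ⟨C₁, hC₁, h₁⟩ := core_outer_bounds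
  obtain ⟨C₂, hC₂, h₂⟩ := quartic_bounds
  refine ⟨2000 + C₁ + C₂, by linarith, fun δ k hδ hδ1 hk hk1 hkδ => ?_⟩
  have hD1 : 1 ≤ δ⁻¹ := (one_le_inv₀ hδ).2 hδ1
  have hD2 : δ⁻¹ ≤ (δ ^ 2)⁻¹ := by rw [← inv_pow]; exact le_self_pow₀ hD1 (by norm_num)
  have hD3 : (δ ^ 2)⁻¹ ≤ (δ ^ 3)⁻¹ := by
    rw [← inv_pow, ← inv_pow]; exact pow_le_pow_right₀ hD1 (by norm_num)
  have ha : Real.arsinh δ⁻¹ ≤ δ⁻¹ := arsinh_le_self (by linarith)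
  have ha0 : 0 ≤ Real.arsinh δ⁻¹ := arsinh_nonneg' (by linarith)
  have cc := contDiff_five (core_contDiff δ)
  have cq := contDiff_five quartic_contDiff
  have eL : ∀ z, Lop k (inner k δ) z = Lop k (core δ) z + k ^ 2 * Real.arsinh δ⁻¹ / 12 * Lop k quartic z :=
    fun z => Lop_add_mul cc cq k _ z
  have eD : ∀ z, dLop k (inner k δ) z = dLop k (core δ) z + k ^ 2 * Real.arsinh δ⁻¹ / 12 * dLop k quartic z :=
    fun z => dLop_add_mul cc cq k _ z
  have k2 : 0 ≤ k ^ 2 := sq_nonneg k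
  have ka : k ^ 2 * Real.arsinh δ⁻¹ ≤ k ^ 2 * δ⁻¹ := mul_le_mul_of_nonneg_left ha k2
  have ka0 : 0 ≤ k ^ 2 * Real.arsinh δ⁻¹ := mul_nonneg k2 ha0
  have kd : k ^ 2 ≤ k ^ 2 * δ⁻¹ := le_mul_of_one_le_right k2 hD1
  have hκ : ∀ x, |x| ≤ C₂ → |k ^ 2 * Real.arsinh δ⁻¹ / 12 * x| ≤ k ^ 2 * δ⁻¹ * C₂ := fun x hx => by
    rw [abs_mul, abs_of_nonneg (by linarith)]
    exact mul_le_mul (by linarith) hx (abs_nonneg _) (by linarith)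
  have hκ1 : ∀ x, |x| ≤ C₂ → |k ^ 2 * Real.arsinh δ⁻¹ / 12 * x| ≤ C₂ := fun x hx =>
    (hκ x hx).trans (mul_le_of_le_one_left hC₂ hkδ)
  refine ⟨fun z hz hz1 => ?_, fun z hz hz2 => ?_, fun z hz hz2 => ?_⟩
  · obtain ⟨q0, q1, -⟩ := h₂ k z hk.le (by linarith) hz.le (by linarith)
    obtain ⟨c0, c1, -⟩ := core_inner_bounds hδ hδ1 hz hz1 hk (by linarith)
    have z2 : z ^ 2 ≤ 1 := pow_le_one₀ hz.le hz1.le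
    constructor
    · calc |inner k δ z| ≤ |core δ z| + |k ^ 2 * Real.arsinh δ⁻¹ / 12 * quartic z| := abs_add_le _ _
        _ ≤ 1 * δ⁻¹ + C₂ * 1 := by have := hκ1 _ q0; linarith
        _ ≤ 1 * δ⁻¹ + C₂ * δ⁻¹ := by gcongr
        _ ≤ (2000 + C₁ + C₂) * δ⁻¹ := by rw [← add_mul]; gcongr; linarith
    · rw [eL]
      have b1 : |z ^ 2 * (k ^ 2 * Real.arsinh δ⁻¹ / 12 * Lop k quartic z)| ≤ 1 * (k ^ 2 * δ⁻¹ * C₂) := by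
        rw [abs_mul, abs_of_nonneg (sq_nonneg z)]
        exact mul_le_mul z2 (hκ _ q1) (abs_nonneg _) zero_le_one
      have p : 0 ≤ (1 + (δ⁻¹ * z) ^ 2)⁻¹ := by positivity
      have p' : 0 ≤ (C₁ + C₂) * (1 + (δ⁻¹ * z) ^ 2)⁻¹ := by positivity
      have p2 : 0 ≤ C₁ * (k ^ 2 * δ⁻¹) := by positivity
      calc |z ^ 2 * (Lop k (core δ) z + k ^ 2 * Real.arsinh δ⁻¹ / 12 * Lop k quartic z) - 1|
          = |(z ^ 2 * Lop k (core δ) z - 1) + z ^ 2 * (k ^ 2 * Real.arsinh δ⁻¹ / 12 * Lop k quartic z)| := by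
            congr 1; ring
        _ ≤ _ := abs_add_le _ _
        _ ≤ 36 * (1 + (δ⁻¹ * z) ^ 2)⁻¹ + (4 * k ^ 2 + 5 * (k ^ 2 * Real.arsinh δ⁻¹))
            + 1 * (k ^ 2 * δ⁻¹ * C₂) := by linarith
        _ ≤ _ := by linarith
  · obtain ⟨q0, q1, -⟩ := h₂ k z hk.le (by linarith) (by linarith) hz2
    obtain ⟨c0, c1, -⟩ := h₁ δ z k hδ hz hz2 hk hk1
    constructor
    · refine (abs_add_le _ _).trans ?_
      have := hκ1 _ q0; linarith
    · rw [eL]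
      refine (abs_add_le _ _).trans ?_
      have := hκ1 _ q1; linarith
  · obtain ⟨-, q1, q2⟩ := h₂ k z hk.le (by linarith) hz.le hz2
    have j1 := hκ1 _ q1
    have j2 := hκ1 _ q2
    have z3 : 0 ≤ (z ^ 3)⁻¹ := by positivity
    have core_b : |Lop k (core δ) z| ≤ (50 + C₁) * (δ ^ 2)⁻¹ ∧ |dLop k (core δ) z| ≤ (2000 + C₁) * (δ ^ 3)⁻¹ ∧
        |dLop k (core δ) z| ≤ (2000 + C₁) * ((z ^ 3)⁻¹ + δ⁻¹) := by
      rcases lt_or_ge z 1 with h | h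
      · obtain ⟨-, -, c1, c2, c3⟩ := core_inner_bounds hδ hδ1 hz h hk (by linarith)
        refine ⟨c1.trans ?_, c2.trans ?_, c3.trans ?_⟩ <;>
          exact mul_le_mul_of_nonneg_right (by linarith) (by linarith)
      · obtain ⟨-, c1, c2⟩ := h₁ δ z k hδ h hz2 hk hk1
        refine ⟨c1.trans ?_, c2.trans ?_, c2.trans ?_⟩
        · nlinarith
        · nlinarith
        · nlinarith
    obtain ⟨c1, c2, c3⟩ := core_b
    rw [eL, eD]
    refine ⟨(abs_add_le _ _).trans ?_, (abs_add_le _ _).trans ?_, (abs_add_le _ _).trans ?_⟩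
    · nlinarith
    · nlinarith
    · nlinarith

/-- The energy of `inner`. -/
theorem energy_inner_le : ∃ C, 0 ≤ C ∧ ∀ δ k h : ℝ, 0 < δ → δ ≤ 1 → 0 < k → k ≤ 1 / 2 → k ^ 2 * δ⁻¹ ≤ 1 →
    2 ≤ h → energy h k (inner k δ) ≤ C * ((k ^ 2)⁻¹ * (δ ^ 5)⁻¹) := by
  obtain ⟨C, hC, hb⟩ := inner_bounds
  refine ⟨9 * C ^ 2, by positivity, fun δ k h hδ hδ1 hk hk1 hkδ hh => ?_⟩
  obtain ⟨-, -, h3⟩ := hb δ k hδ hδ1 hk hk1 hkδ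
  have hD1 : 1 ≤ δ⁻¹ := (one_le_inv₀ hδ).2 hδ1
  have hp : ∀ n ≤ 5, δ⁻¹ ^ n ≤ (δ ^ 5)⁻¹ := fun n hn => by
    rw [← inv_pow]; exact pow_le_pow_right₀ hD1 hn
  have cw := inner_contDiff k δ
  rw [energy_eq_of_vanish cw zero_le_two hh fun z hz => inner_vanish k δ hz, energy]
  have ci : ∀ a b, IntervalIntegrable (fun z => dLop k (inner k δ) z ^ 2) volume a b := fun a b =>
    ((dLop_continuous k cw).pow 2).intervalIntegrable a b
  -- Below `δ` the square is of size `δ⁻⁶` on an interval of length `δ`. Above `δ` the integral of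
  -- `z⁻⁶` is of the same order `δ⁻⁵`.
  have i1 : ∫ z in (0 : ℝ)..δ, dLop k (inner k δ) z ^ 2 ≤ C ^ 2 * (δ ^ 5)⁻¹ := by
    have := intervalIntegral.norm_integral_le_of_norm_le_const (a := 0) (b := δ)
      (f := fun z => dLop k (inner k δ) z ^ 2) (C := (C * (δ ^ 3)⁻¹) ^ 2) fun z hz => by
        rw [Set.uIoc_of_le hδ.le] at hz
        rw [Real.norm_eq_abs, abs_pow]
        exact pow_le_pow_left₀ (abs_nonneg _) (h3 z hz.1 (by linarith [hz.2])).2.1 2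
    rw [sub_zero, abs_of_pos hδ] at this
    refine (Real.le_norm_self _).trans (this.trans (le_of_eq ?_))
    field_simp
  have i2 : ∫ z in δ..2, dLop k (inner k δ) z ^ 2 ≤ 6 * C ^ 2 * (δ ^ 5)⁻¹ := by
    have hδ2 : δ ≤ 2 := by linarith
    have ii := intervalIntegrable_inv_pow hδ hδ2 6
    calc ∫ z in δ..2, dLop k (inner k δ) z ^ 2
        ≤ ∫ z in δ..2, (2 * C ^ 2 * (z ^ 6)⁻¹ + 2 * C ^ 2 * δ⁻¹ ^ 2) := by
          refine intervalIntegral.integral_mono_on hδ2 (ci _ _)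
            ((ii.const_mul _).add intervalIntegrable_const) fun z hz => ?_
          have hz0 : 0 < z := hδ.trans_le hz.1
          rw [← sq_abs]
          have e : (z ^ 6)⁻¹ = (z ^ 3)⁻¹ ^ 2 := by rw [← inv_pow, ← inv_pow]; ring
          calc |dLop k (inner k δ) z| ^ 2 ≤ (C * ((z ^ 3)⁻¹ + δ⁻¹)) ^ 2 :=
                pow_le_pow_left₀ (abs_nonneg _) (h3 z hz0 hz.2).2.2 2
            _ ≤ _ := by
              rw [e]
              nlinarith [mul_nonneg (sq_nonneg C) (sq_nonneg ((z ^ 3)⁻¹ - δ⁻¹))]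
      _ = 2 * C ^ 2 * (∫ z in δ..2, (z ^ 6)⁻¹) + (2 - δ) * (2 * C ^ 2 * δ⁻¹ ^ 2) := by
          rw [intervalIntegral.integral_add (ii.const_mul _) intervalIntegrable_const,
            intervalIntegral.integral_const_mul, intervalIntegral.integral_const, smul_eq_mul]
      _ ≤ 2 * C ^ 2 * (δ ^ 5)⁻¹ + 2 * (2 * C ^ 2 * (δ ^ 5)⁻¹) := by
          have j := integral_inv_pow_le hδ hδ2 (n := 5) (by norm_num)
          have j2 := hp 2 (by norm_num)
          gcongr
          linarith
      _ = _ := by ring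
  have i3 : ∫ z in (0 : ℝ)..2, Lop k (inner k δ) z ^ 2 ≤ 2 * C ^ 2 * (δ ^ 5)⁻¹ := by
    have := intervalIntegral.norm_integral_le_of_norm_le_const (a := 0) (b := 2)
      (f := fun z => Lop k (inner k δ) z ^ 2) (C := (C * (δ ^ 2)⁻¹) ^ 2) fun z hz => by
        rw [Set.uIoc_of_le zero_le_two] at hz
        rw [Real.norm_eq_abs, abs_pow]
        exact pow_le_pow_left₀ (abs_nonneg _) (h3 z hz.1 hz.2).1 2
    rw [sub_zero, abs_two] at this
    refine (Real.le_norm_self _).trans (this.trans ?_)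
    have j := hp 4 (by norm_num)
    have e : (C * (δ ^ 2)⁻¹) ^ 2 = C ^ 2 * δ⁻¹ ^ 4 := by rw [mul_pow, ← inv_pow]; ring
    rw [e]
    have := mul_le_mul_of_nonneg_left j (sq_nonneg C)
    linarith
  rw [← intervalIntegral.integral_add_adjacent_intervals (ci 0 δ) (ci δ 2)]
  have hk2 : 1 ≤ (k ^ 2)⁻¹ := (one_le_inv₀ (by positivity)).2 (pow_le_one₀ hk.le (by linarith))
  have hk0 : 0 ≤ (k ^ 2)⁻¹ := by linarith
  have hpos : 0 ≤ C ^ 2 * (δ ^ 5)⁻¹ := by positivity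
  calc _ ≤ (k ^ 2)⁻¹ * (7 * (C ^ 2 * (δ ^ 5)⁻¹)) + 2 * (C ^ 2 * (δ ^ 5)⁻¹) := by
        refine add_le_add (mul_le_mul_of_nonneg_left ?_ hk0) ?_ <;> linarith
    _ ≤ _ := by nlinarith

/-! ### The outer test function -/

/-- The outer test function at unit wavenumber. -/
def outerOne (x : ℝ) : ℝ := (1 / 6 * x ^ 4 + 1 * x ^ 2) * cut (x / 2)

theorem outerOne_contDiff : ContDiff ℝ (⊤ : ℕ∞) outerOne :=
  ((contDiff_const.mul (contDiff_id.pow 4)).add (contDiff_const.mul (contDiff_id.pow 2))).mul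
    (cut_contDiff.comp (contDiff_id.div_const 2))

theorem outerOne_eventuallyEq {z : ℝ} (hz : z < 1) :
    outerOne =ᶠ[nhds z] fun x => 1 / 6 * x ^ 4 + 1 * x ^ 2 := by
  filter_upwards [cut_half_eventuallyEq_one hz] with y hy
  rw [outerOne, hy, mul_one]

/-- The coefficient `1/6` cancels the constant term, since `24/6 - 4 = 0`, which is the boundary
condition at 0. What remains is negative to leading order, so the kernel of the outer function by
itself has the sign opposite to that of the function and vanishes like the fourth power. -/
theorem Lop_outerOne {z : ℝ} (hz : z < 1) : Lop 1 outerOne z = z ^ 4 / 6 - 3 * z ^ 2 := by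
  have c4 : ContDiff ℝ 5 fun z : ℝ => z ^ 4 := contDiff_id.pow 4
  have c2 : ContDiff ℝ 5 fun z : ℝ => z ^ 2 := contDiff_id.pow 2
  have ck : ContDiff ℝ 5 fun z : ℝ => 1 / 6 * z ^ 4 := contDiff_const.mul c4
  have ek : Lop 1 (fun z : ℝ => 1 / 6 * z ^ 4) z = 1 / 6 * Lop 1 (fun z => z ^ 4) z := by
    simp only [Lop, iteratedDeriv_const_mul_field]; ring
  rw [Lop_congr (outerOne_eventuallyEq hz), Lop_add_mul ck c2, ek, Lop_pow_four, Lop_pow_two]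
  ring

/-- The outer test function at wavenumber `k`. -/
def outer (k z : ℝ) : ℝ := (k ^ 2)⁻¹ * outerOne (k * z)

theorem outer_contDiff (k : ℝ) : ContDiff ℝ 5 (outer k) :=
  contDiff_const.mul ((contDiff_five outerOne_contDiff).comp (contDiff_const.mul contDiff_id))

section outer
variable {k z : ℝ}

theorem Lop_outer (hk : 0 < k) (z : ℝ) : Lop k (outer k) z = k ^ 2 * Lop 1 outerOne (k * z) := by
  have h := Lop_comp_mul_left (contDiff_five outerOne_contDiff) k 1 z
  rw [mul_one] at h
  have : Lop k (outer k) z = (k ^ 2)⁻¹ * Lop k (fun z => outerOne (k * z)) z := by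
    unfold outer
    simp only [Lop, iteratedDeriv_const_mul_field]; ring
  rw [this, h]; field_simp

theorem dLop_outer (hk : 0 < k) (z : ℝ) : dLop k (outer k) z = k ^ 3 * dLop 1 outerOne (k * z) := by
  have h := dLop_comp_mul_left (contDiff_five outerOne_contDiff) k 1 z
  rw [mul_one] at h
  have : dLop k (outer k) z = (k ^ 2)⁻¹ * dLop k (fun z => outerOne (k * z)) z := by
    unfold outer
    simp only [dLop, iteratedDeriv_const_mul_field]; ring
  rw [this, h]; field_simp

theorem outer_vanish (hk : 0 < k) (hz : 2 * k⁻¹ ≤ z) : outer k z = 0 := by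
  have : 2 ≤ k * z := by
    rw [← div_eq_mul_inv, div_le_iff₀ hk] at hz; linarith
  rw [outer, outerOne, cut_zero (by linarith)]; simp

theorem outer_eq (hk : 0 < k) (hz : k * z < 1) : outer k z = z ^ 2 * (1 + (k * z) ^ 2 / 6) := by
  rw [outer, (outerOne_eventuallyEq hz).eq_of_nhds]; field_simp; ring

theorem Lop_outer_eq (hk : 0 < k) (hz : k * z < 1) :
    Lop k (outer k) z = -(k ^ 4 * z ^ 2 * (3 - (k * z) ^ 2 / 6)) := by
  rw [Lop_outer hk, Lop_outerOne hz]; ring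

theorem outer_zero (k : ℝ) : outer k 0 = 0 := by simp [outer, outerOne]

theorem deriv_outer_zero (hk : 0 < k) : deriv (outer k) 0 = 0 := by
  have hev : outer k =ᶠ[nhds 0] fun z => z ^ 2 * (1 + (k * z) ^ 2 / 6) := by
    have : ∀ᶠ z in nhds (0 : ℝ), k * z < 1 :=
      (continuous_const.mul continuous_id).tendsto' 0 0 (by simp) |>.eventually (Iio_mem_nhds one_pos)
    filter_upwards [this] with z hz using outer_eq hk hz
  rw [hev.deriv_eq]
  have c : DifferentiableAt ℝ (fun z : ℝ => 1 + (k * z) ^ 2 / 6) 0 := by fun_prop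
  exact (((hasDerivAt_pow 2 (0 : ℝ)).mul c.hasDerivAt).congr_deriv (by simp)).deriv

theorem Lop_outer_zero (hk : 0 < k) : Lop k (outer k) 0 = 0 := by
  rw [Lop_outer_eq hk (by simp)]; simp

end outer

/-- Bounds on the outer test function in the region of the cutoff, and its energy. -/
theorem outer_bounds : ∃ C, 0 ≤ C ∧ ∀ k : ℝ, 0 < k → k ≤ 1 →
    (∀ z, 0 ≤ z → z ≤ 2 * k⁻¹ → |outer k z * Lop k (outer k) z| ≤ C) ∧
    (∀ h, 2 * k⁻¹ ≤ h → energy h k (outer k) ≤ C * k ^ 3) := by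
  obtain ⟨A, hA0, hA⟩ := exists_iteratedDeriv_bound (contDiff_five outerOne_contDiff) 0 2
  refine ⟨64 * A ^ 2, by positivity, fun k hk hk1 => ?_⟩
  have hmem : ∀ z, 0 ≤ z → z ≤ 2 * k⁻¹ → k * z ∈ Set.Icc (0 : ℝ) 2 := fun z hz hz2 =>
    ⟨by positivity, by rw [← div_eq_mul_inv, le_div_iff₀ hk] at hz2; linarith⟩
  have hb := fun z hz hz2 => Lop_bound zero_le_one le_rfl (hA (k * z) (hmem z hz hz2))
  have A2 : 0 ≤ A ^ 2 := sq_nonneg A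
  constructor
  · intro z hz hz2
    have h0 := hA _ (hmem z hz hz2) 0 (by norm_num)
    rw [iteratedDeriv_zero] at h0
    have e : outer k z * Lop k (outer k) z = outerOne (k * z) * Lop 1 outerOne (k * z) := by
      rw [Lop_outer hk, outer]; field_simp
    rw [e, abs_mul]
    calc _ ≤ A * (4 * A) := mul_le_mul h0 (hb z hz hz2).1 (abs_nonneg _) hA0
      _ ≤ 64 * A ^ 2 := by linarith
  · intro h hh
    have hk2 : 0 ≤ 2 * k⁻¹ := by positivity
    rw [energy_eq_of_vanish (outer_contDiff k) hk2 hh fun z hz => outer_vanish hk hz, energy]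
    have i1 : ∫ z in (0 : ℝ)..2 * k⁻¹, dLop k (outer k) z ^ 2 ≤ 32 * A ^ 2 * k ^ 5 := by
      have := intervalIntegral.norm_integral_le_of_norm_le_const (a := 0) (b := 2 * k⁻¹)
        (f := fun z => dLop k (outer k) z ^ 2) (C := (k ^ 3 * (4 * A)) ^ 2) fun z hz => by
          rw [Set.uIoc_of_le hk2] at hz
          rw [Real.norm_eq_abs, abs_pow, dLop_outer hk, abs_mul, abs_of_pos (pow_pos hk 3)]
          exact pow_le_pow_left₀ (by positivity)
            (mul_le_mul_of_nonneg_left (hb z hz.1.le hz.2).2 (by positivity)) 2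
      rw [sub_zero, abs_of_nonneg hk2] at this
      refine (Real.le_norm_self _).trans (this.trans (le_of_eq ?_))
      field_simp; ring
    have i2 : ∫ z in (0 : ℝ)..2 * k⁻¹, Lop k (outer k) z ^ 2 ≤ 32 * A ^ 2 * k ^ 3 := by
      have := intervalIntegral.norm_integral_le_of_norm_le_const (a := 0) (b := 2 * k⁻¹)
        (f := fun z => Lop k (outer k) z ^ 2) (C := (k ^ 2 * (4 * A)) ^ 2) fun z hz => by
          rw [Set.uIoc_of_le hk2] at hz
          rw [Real.norm_eq_abs, abs_pow, Lop_outer hk, abs_mul, abs_of_pos (pow_pos hk 2)]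
          exact pow_le_pow_left₀ (by positivity)
            (mul_le_mul_of_nonneg_left (hb z hz.1.le hz.2).1 (by positivity)) 2
      rw [sub_zero, abs_of_nonneg hk2] at this
      refine (Real.le_norm_self _).trans (this.trans (le_of_eq ?_))
      field_simp; ring
    have e : (k ^ 2)⁻¹ * (32 * A ^ 2 * k ^ 5) = 32 * A ^ 2 * k ^ 3 := by field_simp
    have := mul_le_mul_of_nonneg_left i1 (by positivity : 0 ≤ (k ^ 2)⁻¹)
    linarith

/-! ### Interaction of the inner and outer test functions -/

/-- Consequences of stability for a multiplicatively averaged slope: stability with defect `η`, a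
pointwise lower bound, negative mass, and an energy bound `B² N` in Cauchy-Schwarz form. -/
structure ReducedSlope (η B m₀ N h : ℝ) (X : ℝ → ℝ) : Prop where
  integrable : Integrable X
  stab : Stab η h X
  lower : ∀ z, 0 < z → z ≤ h → -(η * (z ^ 4)⁻¹) ≤ X z
  mass : ∫ z in (0 : ℝ)..h, X z * (1 - ramp (z / h)) ≤ -m₀
  cauchy : ∀ a b : ℝ, a ≤ b → ∀ g : ℝ → ℝ, Continuous g →
    |∫ z in a..b, X z * g z| ≤ B * √N * √(∫ z in a..b, g z ^ 2)

/-- Dilation leaves the mass unchanged, multiplies the defect and the pointwise constant by `l⁻³`,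
and multiplies the `L²` bound by `√l`. A fixed large `l` thus makes `η` as small as desired at the
expense of `B`. -/
theorem Mollified.dilate {A m₀ N Z : ℝ} {X : ℝ → ℝ} (hX : Mollified A m₀ N Z X) {l : ℝ} (hl : 0 < l)
    (hZ : 0 < Z) :
    ReducedSlope (A * (l ^ 3)⁻¹) (A * √l) m₀ N (Z / l) fun z => l * X (l * z) where
  integrable := (hX.integrable.comp_mul_left' hl.ne').const_mul l
  stab := hX.stab.dilate hl
  lower z hz hz2 := by
    rw [le_div_iff₀ hl] at hz2
    have := mul_le_mul_of_nonneg_left (hX.lower (l * z) (by positivity) (by linarith)) hl.le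
    refine le_of_eq_of_le ?_ this
    field_simp
  mass := by
    have := intervalIntegral.integral_comp_mul_left (a := 0) (b := Z / l)
      (fun z => X z * (1 - ramp (z / Z))) hl.ne'
    rw [mul_zero, mul_div_cancel₀ _ hl.ne', smul_eq_mul] at this
    have e : ∫ z in (0 : ℝ)..Z / l, l * X (l * z) * (1 - ramp (z / (Z / l))) =
        l * ∫ z in (0 : ℝ)..Z / l, X (l * z) * (1 - ramp (l * z / Z)) := by
      rw [← intervalIntegral.integral_const_mul]
      refine intervalIntegral.integral_congr fun z _ => ?_
      rw [show z / (Z / l) = l * z / Z by field_simp]; ring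
    rw [e, this, mul_inv_cancel_left₀ hl.ne']
    exact hX.mass
  cauchy a b hab g hg := by
    have h1 := hX.cauchy (l * a) (l * b) (by gcongr) (fun z => g (l⁻¹ * z))
      (hg.comp (continuous_const.mul continuous_id))
    have e1 := intervalIntegral.integral_comp_mul_left (a := a) (b := b)
      (fun z => X z * g (l⁻¹ * z)) hl.ne'
    have e2 := intervalIntegral.integral_comp_mul_left (a := a) (b := b)
      (fun z => g (l⁻¹ * z) ^ 2) hl.ne'
    simp only [inv_mul_cancel_left₀ hl.ne', smul_eq_mul] at e1 e2
    have e : ∫ z in a..b, l * X (l * z) * g z = l * ∫ z in a..b, X (l * z) * g z := by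
      rw [← intervalIntegral.integral_const_mul]
      refine intervalIntegral.integral_congr fun z _ => ?_
      ring
    rw [e, e1, mul_inv_cancel_left₀ hl.ne', e2]
    refine h1.trans (le_of_eq ?_)
    have hI : ∫ z in l * a..l * b, g (l⁻¹ * z) ^ 2 = l * (l⁻¹ * ∫ z in l * a..l * b, g (l⁻¹ * z) ^ 2) :=
      (mul_inv_cancel_left₀ hl.ne' _).symm
    rw [hI, inv_mul_cancel_left₀ hl.ne', Real.sqrt_mul hl.le]
    ring

/-- The boundary layer estimate at scale `l`. -/
theorem band_mass_le : ∃ C h₀, 0 ≤ C ∧ 4 ≤ h₀ ∧ ∀ (η h l : ℝ) (X : ℝ → ℝ), 0 ≤ η → 1 ≤ l → h₀ ≤ h / l →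
    Integrable X → Stab η h X → (∀ z, 0 < z → z ≤ h → -(η * (z ^ 4)⁻¹) ≤ X z) →
    ∫ z in l..4 * l, shift η X z ≤
      C * (η * (l ^ 3)⁻¹ + (Real.log (h / l))⁻¹ * ∫ z in (1 : ℝ)..h, shift η X z) := by
  obtain ⟨C, h₀, hC, hh₀, key⟩ := boundary_mass_le
  refine ⟨C, h₀, hC, hh₀, fun η h l X hη hl hh hX hs hlow => ?_⟩
  have hl0 : 0 < l := by linarith
  have hY : ∀ z, 0 < z → z ≤ h → 0 ≤ shift η X z := fun z h1 h2 =>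
    (abs_nonneg _).trans (abs_le_shift hη (hlow z h1 h2))
  have hlh : l ≤ h := by
    have : 1 ≤ h / l := by linarith
    rwa [le_div_iff₀ hl0, one_mul] at this
  -- The shift commutes with dilation because `z⁻⁴` has the matching homogeneity. At `z = 0` both
  -- sides rely on the convention `0⁻¹ = 0`.
  have e : ∀ z, shift (η * (l ^ 3)⁻¹) (fun z => l * X (l * z)) z = l * shift η X (l * z) := fun z => by
    unfold shift
    rcases eq_or_ne z 0 with h | h
    · subst h; simp
    · field_simp
  have ei : ∀ a b : ℝ, ∫ z in a..b, shift (η * (l ^ 3)⁻¹) (fun z => l * X (l * z)) z =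
      ∫ z in l * a..l * b, shift η X z := fun a b => by
    simp only [e]
    rw [intervalIntegral.integral_const_mul, intervalIntegral.integral_comp_mul_left _ hl0.ne',
      smul_eq_mul, mul_inv_cancel_left₀ hl0.ne']
  have k := key (η * (l ^ 3)⁻¹) (h / l) (fun z => l * X (l * z)) (by positivity) hh
    ((hX.comp_mul_left' hl0.ne').const_mul l) (hs.dilate hl0) (fun z hz hz2 => by
      rw [le_div_iff₀ hl0] at hz2
      have := mul_le_mul_of_nonneg_left (hlow (l * z) (by positivity) (by linarith)) hl0.le
      refine le_of_eq_of_le ?_ this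
      field_simp)
  rw [ei, ei, mul_one, mul_div_cancel₀ _ hl0.ne', mul_comm l 4] at k
  refine k.trans (mul_le_mul_of_nonneg_left ?_ hC)
  have hlog : 0 ≤ (Real.log (h / l))⁻¹ := inv_nonneg.2 (Real.log_nonneg (by linarith))
  gcongr
  refine intervalIntegral.integral_mono_interval hl hlh le_rfl ?_
    (intervalIntegrable_shift hX one_pos (hl.trans hlh))
  filter_upwards [ae_restrict_mem measurableSet_Ioc] with z hz
  exact hY z (by linarith [hz.1]) hz.2

/-- The negative mass concentrates near the boundary and controls the rest. -/
theorem ReducedSlope.core_mass {η B m₀ N h : ℝ} {X : ℝ → ℝ} (hX : ReducedSlope η B m₀ N h X)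
    (hη : 0 ≤ η) (hh : 2 ≤ h) :
    m₀ - 2 * η + 1 / 2 * ∫ z in (1 : ℝ)..h / 2, shift η X z ≤
      -∫ z in (0 : ℝ)..1, X z * (1 - ramp (z / h)) := by
  have cr : Continuous fun z => 1 - ramp (z / h) :=
    continuous_const.sub (ramp_contDiff.continuous.comp (continuous_id.div_const h))
  have hh0 : 0 < h := by linarith
  have ii : ∀ a b, IntervalIntegrable (fun z => X z * (1 - ramp (z / h))) volume a b := fun a b =>
    hX.integrable.intervalIntegrable.mul_continuousOn cr.continuousOn
  have hm := hX.mass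
  rw [← intervalIntegral.integral_add_adjacent_intervals (ii 0 1) (ii 1 h)] at hm
  have hY : ∀ z, 0 < z → z ≤ h → 0 ≤ shift η X z := fun z h1 h2 =>
    (abs_nonneg _).trans (abs_le_shift hη (hX.lower z h1 h2))
  have iY : ∀ b, 1 ≤ b → IntervalIntegrable (shift η X) volume 1 b := fun b hb =>
    intervalIntegrable_shift hX.integrable one_pos hb
  have iY' : ∀ b, 1 ≤ b → IntervalIntegrable (fun z => shift η X z * (1 - ramp (z / h))) volume 1 b :=
    fun b hb => (iY b hb).mul_continuousOn cr.continuousOn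
  have i4 := intervalIntegrable_inv_pow one_pos (by linarith : 1 ≤ h) 4
  -- Away from the wall, replacing `X` by its shift costs at most `2 η ∫ z⁻⁴`, so the total mass
  -- there is non-negative up to `2 η`.
  have e : ∫ z in (1 : ℝ)..h, shift η X z * (1 - ramp (z / h)) ≤
      (∫ z in (1 : ℝ)..h, X z * (1 - ramp (z / h))) + 2 * η := by
    have h1 : ∫ z in (1 : ℝ)..h, shift η X z * (1 - ramp (z / h)) ≤
        ∫ z in (1 : ℝ)..h, (X z * (1 - ramp (z / h)) + 2 * η * (z ^ 4)⁻¹) := by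
      refine intervalIntegral.integral_mono_on (by linarith) (iY' h (by linarith))
        ((ii _ _).add (i4.const_mul _)) fun z hz => ?_
      have hz0 : 0 < z := by linarith [hz.1]
      have r0 := ramp_nonneg (z / h)
      have : 0 ≤ 2 * η * (z ^ 4)⁻¹ * ramp (z / h) := by positivity
      unfold shift; linarith
    rw [intervalIntegral.integral_add (ii _ _) (i4.const_mul _), intervalIntegral.integral_const_mul] at h1
    have := integral_inv_pow_le one_pos (by linarith : 1 ≤ h) (n := 3) (by norm_num)
    rw [one_pow, inv_one] at this
    have := mul_le_mul_of_nonneg_left this (by linarith : 0 ≤ 2 * η)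
    linarith
  have f : 1 / 2 * ∫ z in (1 : ℝ)..h / 2, shift η X z ≤
      ∫ z in (1 : ℝ)..h, shift η X z * (1 - ramp (z / h)) := by
    have h1 : 1 / 2 * ∫ z in (1 : ℝ)..h / 2, shift η X z ≤
        ∫ z in (1 : ℝ)..h / 2, shift η X z * (1 - ramp (z / h)) := by
      rw [← intervalIntegral.integral_const_mul]
      refine intervalIntegral.integral_mono_on (by linarith) ((iY _ (by linarith)).const_mul _)
        (iY' _ (by linarith)) fun z hz => ?_
      have hz0 : 0 < z := by linarith [hz.1]
      have hz2 : z / h ≤ 1 / 2 := by rw [div_le_iff₀ hh0]; linarith [hz.2]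
      have : ramp (z / h) ≤ 1 / 2 := by
        rw [ramp_of_le hz2]
        calc (z / h) ^ 12 ≤ (1 / 2) ^ 12 := by gcongr
          _ ≤ 1 / 2 := by norm_num
      have := mul_le_mul_of_nonneg_left this (hY z hz0 (by linarith [hz.2]))
      linarith
    refine h1.trans ?_
    refine intervalIntegral.integral_mono_interval le_rfl (by linarith) (by linarith) ?_
      (iY' h (by linarith))
    filter_upwards [ae_restrict_mem measurableSet_Ioc] with z hz
    have hz0 : 0 < z := by linarith [hz.1]
    have := ramp_le_one (x := z / h) (by positivity)
    exact mul_nonneg (hY z hz0 hz.2) (by linarith)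
  linarith

theorem energy_add_mul_le {w v : ℝ → ℝ} (hw : ContDiff ℝ 5 w) (hv : ContDiff ℝ 5 v) (k ε : ℝ) {h : ℝ}
    (hh : 0 ≤ h) :
    energy h k (fun z => w z + ε * v z) ≤ 2 * energy h k w + 2 * ε ^ 2 * energy h k v := by
  have key : ∀ f g : ℝ → ℝ, Continuous f → Continuous g →
      ∫ z in (0 : ℝ)..h, (f z + ε * g z) ^ 2 ≤
        2 * (∫ z in (0 : ℝ)..h, f z ^ 2) + 2 * ε ^ 2 * ∫ z in (0 : ℝ)..h, g z ^ 2 := fun f g hf hg => by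
    have i1 : IntervalIntegrable (fun z => f z ^ 2) volume 0 h := (hf.pow 2).intervalIntegrable _ _
    have i2 : IntervalIntegrable (fun z => g z ^ 2) volume 0 h := (hg.pow 2).intervalIntegrable _ _
    have i3 : IntervalIntegrable (fun z => (f z + ε * g z) ^ 2) volume 0 h :=
      ((hf.add (continuous_const.mul hg)).pow 2).intervalIntegrable _ _
    rw [← intervalIntegral.integral_const_mul, ← intervalIntegral.integral_const_mul,
      ← intervalIntegral.integral_add (i1.const_mul _) (i2.const_mul _)]
    refine intervalIntegral.integral_mono_on hh i3 ((i1.const_mul _).add (i2.const_mul _)) fun z _ => ?_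
    nlinarith [sq_nonneg (f z - ε * g z)]
  have h1 := key _ _ (dLop_continuous k hw) (dLop_continuous k hv)
  have h2 := key _ _ (Lop_continuous k hw) (Lop_continuous k hv)
  have hk : 0 ≤ (k ^ 2)⁻¹ := by positivity
  have h3 := mul_le_mul_of_nonneg_left h1 hk
  unfold energy
  simp only [Lop_add_mul hw hv, dLop_add_mul hw hv]
  linarith

/-- The mixed kernel of the two test functions. -/
def cross (k δ z : ℝ) : ℝ := outer k z * Lop k (inner k δ) z + inner k δ z * Lop k (outer k) z

theorem cross_continuous (k δ : ℝ) : Continuous (cross k δ) :=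
  ((outer_contDiff k).continuous.mul (Lop_continuous k (inner_contDiff k δ))).add
    ((inner_contDiff k δ).continuous.mul (Lop_continuous k (outer_contDiff k)))

theorem cross_vanish (k δ : ℝ) {z : ℝ} (hz : 2 ≤ z) : cross k δ z = 0 := by
  rw [cross, inner_vanish k δ hz,
    Lop_eq_zero_of_vanish (inner_contDiff k δ) k (fun z hz => inner_vanish k δ hz) hz]
  simp

/-- For `δ ≪ z < 1` the product `outer · L inner` is approximately `z² · z⁻² = 1`. In `inner · L
outer` the operator gains `k⁴`, so this product is at most of order `k² δ⁻¹`. -/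
theorem cross_bounds : ∃ C, 1 ≤ C ∧ ∀ δ k : ℝ, 0 < δ → δ ≤ 1 → 0 < k → k ≤ 1 / 4 → k ^ 2 * δ⁻¹ ≤ 1 →
    (∀ z, 0 < z → z < 1 → |cross k δ z - 1| ≤ C * ((1 + (δ⁻¹ * z) ^ 2)⁻¹ + k ^ 2 * δ⁻¹)) ∧
    (∀ z, 1 ≤ z → z ≤ 2 → |cross k δ z| ≤ C) := by
  obtain ⟨C, hC, hb⟩ := inner_bounds
  refine ⟨20 * C, by linarith, fun δ k hδ hδ1 hk hk1 hkδ => ?_⟩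
  obtain ⟨h1, h2, -⟩ := hb δ k hδ hδ1 hk (by linarith) hkδ
  have k2 : k ^ 2 ≤ 1 := pow_le_one₀ hk.le (by linarith)
  have k4 : k ^ 4 ≤ k ^ 2 := pow_le_pow_of_le_one hk.le (by linarith) (by norm_num)
  have hD1 : 1 ≤ δ⁻¹ := (one_le_inv₀ hδ).2 hδ1
  have kd : k ^ 2 ≤ k ^ 2 * δ⁻¹ := le_mul_of_one_le_right (sq_nonneg k) hD1
  have hkz : ∀ z, 0 < z → z ≤ 2 → k * z < 1 ∧ 0 ≤ (k * z) ^ 2 ∧ (k * z) ^ 2 ≤ 1 := fun z hz hz2 => by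
    have : k * z ≤ 1 / 4 * 2 := mul_le_mul hk1 hz2 hz.le (by norm_num)
    exact ⟨by linarith, by positivity, pow_le_one₀ (by positivity) (by linarith)⟩
  constructor
  · intro z hz hz1
    obtain ⟨a1, a2, a3⟩ := hkz z hz (by linarith)
    obtain ⟨b1, b2⟩ := h1 z hz hz1
    have z2 : z ^ 2 ≤ 1 := pow_le_one₀ hz.le hz1.le
    have z0 : 0 ≤ z ^ 2 := sq_nonneg z
    set P := (1 + (δ⁻¹ * z) ^ 2)⁻¹ with hP
    have P0 : 0 ≤ P := by positivity
    set r := z ^ 2 * Lop k (inner k δ) z - 1 with hr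
    set s := (k * z) ^ 2 / 6 with hs
    have s1 : s ≤ k ^ 2 := by
      have : k ^ 2 * z ^ 2 ≤ k ^ 2 * 1 := mul_le_mul_of_nonneg_left z2 (sq_nonneg k)
      rw [hs, mul_pow]; nlinarith
    have s0 : 0 ≤ s := by positivity
    have e : cross k δ z - 1 = r + s * r + s - inner k δ z * (k ^ 4 * z ^ 2 * (3 - s)) := by
      rw [cross, outer_eq hk a1, Lop_outer_eq hk a1, hr]; ring
    have c1 : |s * r| ≤ |r| := by
      rw [abs_mul, abs_of_nonneg s0]
      exact mul_le_of_le_one_left (abs_nonneg _) (s1.trans k2)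
    have c2 : |inner k δ z * (k ^ 4 * z ^ 2 * (3 - s))| ≤ C * δ⁻¹ * (k ^ 2 * 1 * 3) := by
      rw [abs_mul]
      refine mul_le_mul b1 ?_ (abs_nonneg _) (by positivity)
      have h3 : 0 ≤ 3 - s := by linarith
      rw [abs_of_nonneg (mul_nonneg (by positivity) h3)]
      exact mul_le_mul (mul_le_mul k4 z2 z0 (sq_nonneg k)) (by linarith) h3 (by positivity)
    rw [e]
    have t1 : |r + s * r + s - inner k δ z * (k ^ 4 * z ^ 2 * (3 - s))| ≤
        |r| + |s * r| + |s| + |inner k δ z * (k ^ 4 * z ^ 2 * (3 - s))| := by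
      refine (abs_sub _ _).trans ?_
      gcongr
      exact (abs_add_le _ _).trans (by gcongr; exact abs_add_le _ _)
    rw [abs_of_nonneg s0] at t1
    have t2 : k ^ 2 * δ⁻¹ ≤ C * (k ^ 2 * δ⁻¹) := le_mul_of_one_le_left (by positivity) hC
    have t3 : 0 ≤ C * P := by positivity
    linarith
  · intro z hz hz2
    have hz0 : 0 < z := by linarith
    obtain ⟨a1, a2, a3⟩ := hkz z hz0 hz2
    obtain ⟨b1, b2⟩ := h2 z hz hz2
    have z2 : z ^ 2 ≤ 4 := by nlinarith
    have o1 : |outer k z| ≤ 4 * 2 := by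
      rw [outer_eq hk a1, abs_of_nonneg (by positivity)]
      exact mul_le_mul z2 (by linarith) (by positivity) (by norm_num)
    have o2 : |Lop k (outer k) z| ≤ 1 * 4 * 3 := by
      have h3 : 0 ≤ 3 - (k * z) ^ 2 / 6 := by linarith
      rw [Lop_outer_eq hk a1, abs_neg, abs_of_nonneg (mul_nonneg (by positivity) h3)]
      exact mul_le_mul (mul_le_mul (k4.trans k2) z2 (by positivity) zero_le_one) (by linarith) h3
        (by norm_num)
    refine (abs_add_le _ _).trans ?_
    rw [abs_mul, abs_mul]
    have p1 := mul_le_mul o1 b2 (abs_nonneg _) (by norm_num)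
    have p2 := mul_le_mul b1 o2 (abs_nonneg _) (by linarith)
    linarith

theorem integral_inv_one_add_sq_le {δ : ℝ} (hδ : 0 < δ) :
    ∫ z in (0 : ℝ)..1, (1 + (δ⁻¹ * z) ^ 2)⁻¹ ≤ 2 * δ := by
  have := intervalIntegral.integral_comp_mul_left (a := 0) (b := 1) (fun z : ℝ => (1 + z ^ 2)⁻¹)
    (inv_pos.2 hδ).ne'
  rw [this, integral_inv_one_add_sq, smul_eq_mul, inv_inv, mul_zero, Real.arctan_zero, sub_zero, mul_comm]
  have h1 := Real.arctan_lt_pi_div_two (δ⁻¹ * 1)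
  have h2 := Real.pi_le_four
  exact mul_le_mul_of_nonneg_right (by linarith) hδ.le

/-- The mixed kernel approximates `1 - ramp` in `L²(0, 1)`. -/
theorem integral_cross_sub_sq_le : ∃ C, 0 ≤ C ∧ ∀ δ k h : ℝ, 0 < δ → δ ≤ 1 → 0 < k → k ≤ 1 / 4 →
    k ^ 2 * δ⁻¹ ≤ 1 → 2 ≤ h → h⁻¹ ≤ k ^ 2 →
    ∫ z in (0 : ℝ)..1, (cross k δ z - (1 - ramp (z / h))) ^ 2 ≤ C * (δ + (k ^ 2 * δ⁻¹) ^ 2) := by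
  obtain ⟨C, hC, hb⟩ := cross_bounds
  refine ⟨4 * (C + 1) ^ 2, by positivity, fun δ k h hδ hδ1 hk hk1 hkδ hh hhk => ?_⟩
  obtain ⟨h1, -⟩ := hb δ k hδ hδ1 hk hk1 hkδ
  have hh0 : 0 < h := by linarith
  have hD1 : 1 ≤ δ⁻¹ := (one_le_inv₀ hδ).2 hδ1
  have kd : k ^ 2 ≤ k ^ 2 * δ⁻¹ := le_mul_of_one_le_right (sq_nonneg k) hD1
  have cr : Continuous fun z => cross k δ z - (1 - ramp (z / h)) :=
    (cross_continuous k δ).sub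
      (continuous_const.sub (ramp_contDiff.continuous.comp (continuous_id.div_const h)))
  have cP : Continuous fun z : ℝ => (1 + (δ⁻¹ * z) ^ 2)⁻¹ :=
    Continuous.inv₀ (by fun_prop) fun z => by positivity
  have iP : IntervalIntegrable (fun z : ℝ => (1 + (δ⁻¹ * z) ^ 2)⁻¹) volume 0 1 := cP.intervalIntegrable _ _
  set D := 2 * (C + 1) ^ 2 with hD
  have D0 : 0 ≤ D := by positivity
  set q := k ^ 2 * δ⁻¹ with hq
  have q0 : 0 ≤ q := by positivity
  calc ∫ z in (0 : ℝ)..1, (cross k δ z - (1 - ramp (z / h))) ^ 2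
      ≤ ∫ z in (0 : ℝ)..1, (D * (1 + (δ⁻¹ * z) ^ 2)⁻¹ + D * q ^ 2) := by
        refine intervalIntegral.integral_mono_on_of_le_Ioo zero_le_one ((cr.pow 2).intervalIntegrable _ _)
          ((iP.const_mul _).add intervalIntegrable_const) fun z hz => ?_
        have hz0 : 0 < z := hz.1
        have b := h1 z hz.1 hz.2
        have hzh : z / h ≤ k ^ 2 := by
          refine le_trans ?_ hhk
          rw [div_eq_mul_inv]
          exact mul_le_of_le_one_left (by positivity) hz.2.le
        have hzh0 : 0 ≤ z / h := by positivity
        have k2 : k ^ 2 ≤ 1 / 4 * (1 / 4) := by rw [sq]; exact mul_le_mul hk1 hk1 hk.le (by norm_num)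
        have hr : ramp (z / h) ≤ q := by
          rw [ramp_of_le (by linarith)]
          exact (pow_le_of_le_one hzh0 (by linarith) (by norm_num)).trans (hzh.trans kd)
        have hr0 := ramp_nonneg (z / h)
        have hz4 : (1 + (δ⁻¹ * z) ^ 2)⁻¹ ≤ 1 := inv_le_one_of_one_le₀ (by nlinarith [sq_nonneg (δ⁻¹ * z)])
        set P := (1 + (δ⁻¹ * z) ^ 2)⁻¹ with hP
        have P0 : 0 ≤ P := by positivity
        have b2 : |cross k δ z - (1 - ramp (z / h))| ≤ (C + 1) * (P + q) := by
          have : cross k δ z - (1 - ramp (z / h)) = (cross k δ z - 1) + ramp (z / h) := by ring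
          rw [this]
          refine (abs_add_le _ _).trans ?_
          rw [abs_of_nonneg hr0]
          linarith
        rw [← sq_abs]
        calc _ ≤ ((C + 1) * (P + q)) ^ 2 := pow_le_pow_left₀ (abs_nonneg _) b2 2
          _ ≤ D * P + D * q ^ 2 := by
            -- Because `P ≤ 1`, its square is traded for `P` itself, whose integral is `O(δ)`.
            have : (P + q) ^ 2 ≤ 2 * P + 2 * q ^ 2 := by nlinarith [sq_nonneg (P - q)]
            rw [mul_pow, hD]
            nlinarith [sq_nonneg (C + 1)]
    _ = D * (∫ z in (0 : ℝ)..1, (1 + (δ⁻¹ * z) ^ 2)⁻¹) + D * q ^ 2 := by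
        rw [intervalIntegral.integral_add (iP.const_mul _) intervalIntegrable_const,
          intervalIntegral.integral_const_mul]
        simp
    _ ≤ D * (2 * δ) + D * q ^ 2 := by
        have := mul_le_mul_of_nonneg_left (integral_inv_one_add_sq_le hδ) D0
        linarith
    _ ≤ 4 * (C + 1) ^ 2 * (δ + q ^ 2) := by
        rw [hD]
        have : 0 ≤ (C + 1) ^ 2 * q ^ 2 := by positivity
        linarith

/-- The quadratic self-interaction of the inner test function. -/
theorem integral_inner_sq_le : ∃ C, 0 ≤ C ∧ ∀ δ k : ℝ, 0 < δ → δ ≤ 1 → 0 < k → k ≤ 1 / 2 →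
    k ^ 2 * δ⁻¹ ≤ 1 →
    √(∫ z in (0 : ℝ)..2, (inner k δ z * Lop k (inner k δ) z) ^ 2) ≤ C * (δ ^ 3)⁻¹ := by
  obtain ⟨C, hC, hb⟩ := inner_bounds
  refine ⟨2 * C ^ 2, by positivity, fun δ k hδ hδ1 hk hk1 hkδ => ?_⟩
  obtain ⟨h1, h2, h3⟩ := hb δ k hδ hδ1 hk hk1 hkδ
  have hD1 : 1 ≤ δ⁻¹ := (one_le_inv₀ hδ).2 hδ1
  have h0 : ∀ z, 0 < z → z ≤ 2 → |inner k δ z| ≤ C * δ⁻¹ := fun z hz hz2 => by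
    rcases lt_or_ge z 1 with h | h
    · exact (h1 z hz h).1
    · exact (h2 z h hz2).1.trans (le_mul_of_one_le_right (by linarith) hD1)
  have hb : ∀ z, 0 < z → z ≤ 2 → |inner k δ z * Lop k (inner k δ) z| ≤ C ^ 2 * (δ ^ 3)⁻¹ := fun z hz hz2 => by
    rw [abs_mul]
    calc _ ≤ (C * δ⁻¹) * (C * (δ ^ 2)⁻¹) :=
          mul_le_mul (h0 z hz hz2) (h3 z hz hz2).1 (abs_nonneg _) (by positivity)
      _ = _ := by rw [← inv_pow, ← inv_pow]; ring
  have := intervalIntegral.norm_integral_le_of_norm_le_const (a := 0) (b := 2)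
    (f := fun z => (inner k δ z * Lop k (inner k δ) z) ^ 2) (C := (C ^ 2 * (δ ^ 3)⁻¹) ^ 2) fun z hz => by
      rw [Set.uIoc_of_le zero_le_two] at hz
      rw [Real.norm_eq_abs, abs_pow]
      exact pow_le_pow_left₀ (abs_nonneg _) (hb z hz.1 hz.2) 2
  rw [sub_zero, abs_two] at this
  refine Real.sqrt_le_iff.2 ⟨by positivity, (Real.le_norm_self _).trans (this.trans ?_)⟩
  nlinarith [sq_nonneg (C ^ 2 * (δ ^ 3)⁻¹)]

/-- The quadratic self-interaction of the outer test function. -/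
theorem integral_outer_le : ∃ C, 0 ≤ C ∧ ∀ (η h k : ℝ) (X : ℝ → ℝ), 0 ≤ η → 0 < k → k ≤ 1 →
    2 * k⁻¹ ≤ h → Integrable X → (∀ z, 0 < z → z ≤ h → -(η * (z ^ 4)⁻¹) ≤ X z) →
    ∫ z in (0 : ℝ)..h, X z * (outer k z * Lop k (outer k) z) ≤
      4 * η * k ^ 3 + C * ∫ z in k⁻¹..2 * k⁻¹, shift η X z := by
  obtain ⟨C, hC, hb⟩ := outer_bounds
  refine ⟨C, hC, fun η h k X hη hk hk1 hh hX hlow => ?_⟩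
  obtain ⟨hb, -⟩ := hb k hk hk1
  have hl : 0 < k⁻¹ := inv_pos.2 hk
  have cg : Continuous fun z => outer k z * Lop k (outer k) z :=
    (outer_contDiff k).continuous.mul (Lop_continuous k (outer_contDiff k))
  have ii : ∀ a b, IntervalIntegrable (fun z => X z * (outer k z * Lop k (outer k) z)) volume a b :=
    fun a b => hX.intervalIntegrable.mul_continuousOn cg.continuousOn
  -- Below `k⁻¹` the kernel is `-k⁴ z⁴ q` with `0 ≤ q ≤ 4`, so only the pointwise lower bound on `X`
  -- matters and the powers of `z` cancel.
  have e1 : ∫ z in (0 : ℝ)..k⁻¹, X z * (outer k z * Lop k (outer k) z) ≤ 4 * η * k ^ 3 := by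
    calc _ ≤ ∫ _ in (0 : ℝ)..k⁻¹, 4 * η * k ^ 4 := by
          refine intervalIntegral.integral_mono_on_of_le_Ioo hl.le (ii _ _) intervalIntegrable_const
            fun z hz => ?_
          have hz0 : 0 < z := hz.1
          have hkz : k * z < 1 := by
            have := mul_lt_mul_of_pos_left hz.2 hk
            rwa [mul_inv_cancel₀ hk.ne'] at this
          have hkz2 : (k * z) ^ 2 ≤ 1 := pow_le_one₀ (by positivity) hkz.le
          have hkz0 : 0 ≤ (k * z) ^ 2 := sq_nonneg _
          have hx := hlow z hz0 (by linarith [hz.2])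
          rw [outer_eq hk hkz, Lop_outer_eq hk hkz]
          set q := (1 + (k * z) ^ 2 / 6) * (3 - (k * z) ^ 2 / 6) with hq
          have q0 : 0 ≤ q := mul_nonneg (by linarith) (by linarith)
          have q4 : q ≤ 4 := by
            have : q ≤ (1 + 1 / 6) * 3 := mul_le_mul (by linarith) (by linarith) (by linarith) (by norm_num)
            linarith
          have hz4 : 0 ≤ k ^ 4 * z ^ 4 * q := by positivity
          have := mul_le_mul_of_nonneg_right hx hz4
          have e : η * (z ^ 4)⁻¹ * (k ^ 4 * z ^ 4 * q) = η * k ^ 4 * q := by field_simp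
          have e2 : X z * (z ^ 2 * (1 + (k * z) ^ 2 / 6) * -(k ^ 4 * z ^ 2 * (3 - (k * z) ^ 2 / 6))) =
              -(X z * (k ^ 4 * z ^ 4 * q)) := by rw [hq]; ring
          have := mul_le_mul_of_nonneg_left q4 (by positivity : 0 ≤ η * k ^ 4)
          rw [e2]; linarith
      _ = 4 * η * k ^ 3 := by
          rw [intervalIntegral.integral_const, sub_zero, smul_eq_mul]; field_simp
  have e2 : ∫ z in k⁻¹..2 * k⁻¹, X z * (outer k z * Lop k (outer k) z) ≤
      C * ∫ z in k⁻¹..2 * k⁻¹, shift η X z := by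
    rw [← intervalIntegral.integral_const_mul]
    refine intervalIntegral.integral_mono_on (by linarith) (ii _ _)
      ((intervalIntegrable_shift hX hl (by linarith)).const_mul _) fun z hz => ?_
    have hz0 : 0 < z := hl.trans_le hz.1
    calc _ ≤ |X z * (outer k z * Lop k (outer k) z)| := le_abs_self _
      _ = |X z| * |outer k z * Lop k (outer k) z| := abs_mul _ _
      _ ≤ shift η X z * C := by
          have := abs_le_shift hη (hlow z hz0 (by linarith [hz.2]))
          exact mul_le_mul this (hb z hz0.le hz.2) (abs_nonneg _) ((abs_nonneg _).trans this)
      _ = _ := mul_comm _ _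
  have e3 : ∫ z in 2 * k⁻¹..h, X z * (outer k z * Lop k (outer k) z) = 0 := by
    rw [intervalIntegral.integral_congr (g := fun _ => 0) fun z hz => ?_]
    · simp
    · rw [Set.uIcc_of_le hh] at hz
      simp only [outer_vanish hk hz.1, zero_mul, mul_zero]
  rw [← intervalIntegral.integral_add_adjacent_intervals (ii 0 k⁻¹) (ii _ h),
    ← intervalIntegral.integral_add_adjacent_intervals (ii k⁻¹ (2 * k⁻¹)) (ii _ h), e3]
  linarith

/-- Stability tested with `outer + ε inner`. -/
theorem ReducedSlope.test_le {η B m₀ N h : ℝ} {X : ℝ → ℝ} (hX : ReducedSlope η B m₀ N h X) (hη : 0 ≤ η)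
    {k : ℝ} (hk : 0 < k) (hk1 : k ≤ 1) (hh : 2 * k⁻¹ ≤ h) (δ ε : ℝ) :
    -(η * (2 * energy h k (outer k) + 2 * ε ^ 2 * energy h k (inner k δ))) ≤
      (∫ z in (0 : ℝ)..h, X z * (outer k z * Lop k (outer k) z)) +
      ε * ((∫ z in (0 : ℝ)..1, X z * cross k δ z) + ∫ z in (1 : ℝ)..2, X z * cross k δ z) +
      ε ^ 2 * ∫ z in (0 : ℝ)..2, X z * (inner k δ z * Lop k (inner k δ) z) := by
  have co := outer_contDiff k
  have ci := inner_contDiff k δ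
  have hk' : 1 ≤ k⁻¹ := (one_le_inv₀ hk).2 hk1
  have h2 : 2 ≤ h := by linarith
  have cw : ContDiff ℝ 5 fun z => outer k z + ε * inner k δ z := co.add (contDiff_const.mul ci)
  have hs := hX.stab k hk _ cw (by rw [outer_zero, inner_zero]; simp)
    (by
      have d1 : DifferentiableAt ℝ (outer k) 0 := (co.differentiable (by norm_num)).differentiableAt
      have d2 : DifferentiableAt ℝ (inner k δ) 0 := (ci.differentiable (by norm_num)).differentiableAt
      have h1 := d1.hasDerivAt.add (d2.hasDerivAt.const_mul ε)
      rw [deriv_outer_zero hk, deriv_inner_zero, mul_zero, add_zero] at h1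
      exact h1.deriv)
    (by rw [Lop_add_mul co ci, Lop_outer_zero hk, Lop_inner_zero]; simp)
    (fun z hz => by rw [outer_vanish hk (hh.trans hz), inner_vanish k δ (h2.trans hz)]; simp)
  have he := mul_le_mul_of_nonneg_left (energy_add_mul_le co ci k ε (by linarith : 0 ≤ h)) hη
  refine le_trans (by linarith) (hs.trans (le_of_eq ?_))
  have iX : ∀ g : ℝ → ℝ, Continuous g → ∀ a b, IntervalIntegrable (fun z => X z * g z) volume a b :=
    fun g hg a b => hX.integrable.intervalIntegrable.mul_continuousOn hg.continuousOn
  have c11 : Continuous fun z => outer k z * Lop k (outer k) z := co.continuous.mul (Lop_continuous k co)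
  have c22 : Continuous fun z => inner k δ z * Lop k (inner k δ) z := ci.continuous.mul (Lop_continuous k ci)
  have c12 := cross_continuous k δ
  have e : ∀ z, X z * ((outer k z + ε * inner k δ z) * Lop k (fun z => outer k z + ε * inner k δ z) z) =
      X z * (outer k z * Lop k (outer k) z) + ε * (X z * cross k δ z) +
        ε ^ 2 * (X z * (inner k δ z * Lop k (inner k δ) z)) := fun z => by
    rw [Lop_add_mul co ci, cross]; ring
  have hv : ∀ g : ℝ → ℝ, Continuous g → (∀ z, 2 ≤ z → g z = 0) →
      ∫ z in (0 : ℝ)..h, X z * g z = ∫ z in (0 : ℝ)..2, X z * g z := fun g hg hg0 => by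
    rw [← intervalIntegral.integral_add_adjacent_intervals (iX g hg 0 2) (iX g hg 2 h),
      intervalIntegral.integral_congr (a := 2) (b := h) (g := fun _ => 0) fun z hz => ?_]
    · simp
    · rw [Set.uIcc_of_le h2] at hz
      simp only [hg0 z hz.1, mul_zero]
  simp only [e]
  rw [intervalIntegral.integral_add ((iX _ c11 _ _).add ((iX _ c12 _ _).const_mul _))
      ((iX _ c22 _ _).const_mul _), intervalIntegral.integral_add (iX _ c11 _ _) ((iX _ c12 _ _).const_mul _),
    intervalIntegral.integral_const_mul, intervalIntegral.integral_const_mul,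
    hv _ c12 fun z hz => cross_vanish k δ hz,
    hv _ c22 fun z hz => by rw [inner_vanish k δ hz, zero_mul],
    intervalIntegral.integral_add_adjacent_intervals (iX _ c12 0 1) (iX _ c12 1 2)]

/-- The mass near the boundary, and how little of the slope there is away from it. -/
theorem ReducedSlope.band_bounds : ∃ C l₀, 0 ≤ C ∧ 4 ≤ l₀ ∧ ∀ (η B m₀ N h l : ℝ) (X : ℝ → ℝ),
    ReducedSlope η B m₀ N h X → 0 ≤ η → η ≤ m₀ / 4 → l₀ ≤ l → 2 * l * Real.exp (l ^ 3) ≤ h →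
    m₀ / 2 ≤ (-∫ z in (0 : ℝ)..1, X z * (1 - ramp (z / h))) ∧
    ∫ z in (1 : ℝ)..4, shift η X z ≤
      C * (η + 2 * (-∫ z in (0 : ℝ)..1, X z * (1 - ramp (z / h))) * l⁻¹) ∧
    ∫ z in l..4 * l, shift η X z ≤
      3 * C * (-∫ z in (0 : ℝ)..1, X z * (1 - ramp (z / h))) * (l ^ 3)⁻¹ := by
  obtain ⟨C, h₀, hC, hh₀, key⟩ := band_mass_le
  refine ⟨C, h₀, hC, hh₀, fun η B m₀ N h l X hX hη hηm hl hh => ?_⟩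
  have hl4 : 4 ≤ l := hh₀.trans hl
  have hl0 : 0 < l := by linarith
  have hexp : l ^ 3 + 1 ≤ Real.exp (l ^ 3) := Real.add_one_le_exp _
  have hl3 : l ≤ l ^ 3 := le_self_pow₀ (by linarith) (by norm_num)
  have hexp0 : 0 < Real.exp (l ^ 3) := Real.exp_pos _
  have hle : Real.exp (l ^ 3) ≤ h / 2 / l := by
    rw [le_div_iff₀ hl0]; linarith
  have hle1 : h / 2 / l ≤ h / 2 := div_le_self (by nlinarith) (by linarith)
  have hh2 : 2 ≤ h / 2 := by linarith
  have hm := hX.core_mass hη (by linarith : 2 ≤ h)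
  set m := -∫ z in (0 : ℝ)..1, X z * (1 - ramp (z / h)) with hmdef
  have hY : ∀ z, 0 < z → z ≤ h → 0 ≤ shift η X z := fun z h1 h2 =>
    (abs_nonneg _).trans (abs_le_shift hη (hX.lower z h1 h2))
  have hJ0 : 0 ≤ ∫ z in (1 : ℝ)..h / 2, shift η X z :=
    intervalIntegral.integral_nonneg (by linarith) fun z hz => hY z (by linarith [hz.1]) (by linarith [hz.2])
  set J := ∫ z in (1 : ℝ)..h / 2, shift η X z with hJ
  have hstab : Stab η (h / 2) X := hX.stab.mono_height (by linarith) (by linarith)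
  have hlow : ∀ z, 0 < z → z ≤ h / 2 → -(η * (z ^ 4)⁻¹) ≤ X z := fun z h1 h2 =>
    hX.lower z h1 (by linarith)
  -- The exponential height gives a gain of `l⁻³` at the scale `l`. For the mass near 1 a gain of
  -- `l⁻¹` suffices.
  have hlog : l ^ 3 ≤ Real.log (h / 2 / l) := by
    rwa [Real.le_log_iff_exp_le (hexp0.trans_le hle)]
  have hlog1 : l ^ 3 ≤ Real.log (h / 2 / 1) := by
    rw [div_one, Real.le_log_iff_exp_le (by linarith)]; exact hle.trans hle1
  have k1 := key η (h / 2) 1 X hη le_rfl (by rw [div_one]; linarith) hX.integrable hstab hlow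
  have k2 := key η (h / 2) l X hη (by linarith) (by linarith) hX.integrable hstab hlow
  rw [← hJ, one_pow, inv_one, mul_one, mul_one] at k1
  rw [← hJ] at k2
  have hJm : J ≤ 2 * m := by linarith
  have hm0 : m₀ / 2 ≤ m := by linarith
  have hl3p : 0 < l ^ 3 := by positivity
  have i1 : (Real.log (h / 2 / 1))⁻¹ ≤ l⁻¹ := inv_anti₀ hl0 (hl3.trans hlog1)
  have i2 : (Real.log (h / 2 / l))⁻¹ ≤ (l ^ 3)⁻¹ := inv_anti₀ hl3p hlog
  have li : 0 ≤ l⁻¹ := by positivity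
  have li3 : 0 ≤ (l ^ 3)⁻¹ := by positivity
  refine ⟨hm0, k1.trans ?_, k2.trans ?_⟩
  · refine mul_le_mul_of_nonneg_left ?_ hC
    have := mul_le_mul i1 hJm hJ0 li
    linarith
  · have := mul_le_mul i2 hJm hJ0 li3
    have h3 : η * (l ^ 3)⁻¹ ≤ m * (l ^ 3)⁻¹ := mul_le_mul_of_nonneg_right (by linarith) li3
    calc _ ≤ C * (m * (l ^ 3)⁻¹ + (l ^ 3)⁻¹ * (2 * m)) := mul_le_mul_of_nonneg_left (by linarith) hC
      _ = _ := by ring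

/-- The mixed term is negative. -/
theorem ReducedSlope.cross_le : ∃ C₁ C₂, 1 ≤ C₁ ∧ 0 ≤ C₂ ∧ ∀ (η B m₀ N h δ k : ℝ) (X : ℝ → ℝ),
    ReducedSlope η B m₀ N h X → 0 ≤ η → 0 ≤ B → 0 < δ → δ ≤ 1 → 0 < k → k ≤ 1 / 4 → k ^ 2 * δ⁻¹ ≤ 1 →
    4 ≤ h → h⁻¹ ≤ k ^ 2 →
    (∫ z in (0 : ℝ)..1, X z * cross k δ z) + ∫ z in (1 : ℝ)..2, X z * cross k δ z ≤
      (∫ z in (0 : ℝ)..1, X z * (1 - ramp (z / h))) +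
        B * √N * √(C₂ * (δ + (k ^ 2 * δ⁻¹) ^ 2)) + C₁ * ∫ z in (1 : ℝ)..4, shift η X z := by
  obtain ⟨C₁, hC₁, h₁⟩ := cross_bounds
  obtain ⟨C₂, hC₂, h₂⟩ := integral_cross_sub_sq_le
  refine ⟨C₁, C₂, hC₁, hC₂, fun η B m₀ N h δ k X hX hη hB hδ hδ1 hk hk1 hkδ hh hhk => ?_⟩
  obtain ⟨-, hb⟩ := h₁ δ k hδ hδ1 hk hk1 hkδ
  have hsq := h₂ δ k h hδ hδ1 hk hk1 hkδ (by linarith) hhk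
  have iX : ∀ g : ℝ → ℝ, Continuous g → ∀ a b, IntervalIntegrable (fun z => X z * g z) volume a b :=
    fun g hg a b => hX.integrable.intervalIntegrable.mul_continuousOn hg.continuousOn
  have c12 := cross_continuous k δ
  have cr : Continuous fun z => 1 - ramp (z / h) :=
    continuous_const.sub (ramp_contDiff.continuous.comp (continuous_id.div_const h))
  have e1 : ∫ z in (0 : ℝ)..1, X z * cross k δ z ≤
      (∫ z in (0 : ℝ)..1, X z * (1 - ramp (z / h))) + B * √N * √(C₂ * (δ + (k ^ 2 * δ⁻¹) ^ 2)) := by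
    have h3 := hX.cauchy 0 1 zero_le_one (fun z => cross k δ z - (1 - ramp (z / h))) (c12.sub cr)
    have h4 : ∫ z in (0 : ℝ)..1, X z * (cross k δ z - (1 - ramp (z / h))) =
        (∫ z in (0 : ℝ)..1, X z * cross k δ z) - ∫ z in (0 : ℝ)..1, X z * (1 - ramp (z / h)) := by
      rw [← intervalIntegral.integral_sub (iX _ c12 _ _) (iX _ cr _ _)]
      simp only [mul_sub]
    rw [h4] at h3
    have h5 := (le_abs_self _).trans (h3.trans (mul_le_mul_of_nonneg_left (Real.sqrt_le_sqrt hsq)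
      (mul_nonneg hB (Real.sqrt_nonneg N))))
    linarith
  have hY : ∀ z, 0 < z → z ≤ h → 0 ≤ shift η X z := fun z h1 h2 =>
    (abs_nonneg _).trans (abs_le_shift hη (hX.lower z h1 h2))
  have iY := intervalIntegrable_shift (η := η) hX.integrable one_pos (by norm_num : (1 : ℝ) ≤ 4)
  have iY2 := intervalIntegrable_shift (η := η) hX.integrable one_pos (by norm_num : (1 : ℝ) ≤ 2)
  have e2 : ∫ z in (1 : ℝ)..2, X z * cross k δ z ≤ C₁ * ∫ z in (1 : ℝ)..4, shift η X z := by
    have h3 : ∫ z in (1 : ℝ)..2, X z * cross k δ z ≤ ∫ z in (1 : ℝ)..2, C₁ * shift η X z := by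
      refine intervalIntegral.integral_mono_on (by norm_num) (iX _ c12 _ _) (iY2.const_mul _) fun z hz => ?_
      have hz0 : 0 < z := by linarith [hz.1]
      calc _ ≤ |X z * cross k δ z| := le_abs_self _
        _ = |cross k δ z| * |X z| := by rw [abs_mul, mul_comm]
        _ ≤ _ := mul_le_mul (hb z hz.1 hz.2) (abs_le_shift hη (hX.lower z hz0 (by linarith [hz.2])))
          (abs_nonneg _) (by linarith)
    rw [intervalIntegral.integral_const_mul] at h3
    refine h3.trans (mul_le_mul_of_nonneg_left ?_ (by linarith))
    refine intervalIntegral.integral_mono_interval le_rfl (by norm_num) (by norm_num) ?_ iY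
    filter_upwards [ae_restrict_mem measurableSet_Ioc] with z hz
    exact hY z (by linarith [hz.1]) (by linarith [hz.2])
  linarith

/-- If a quadratic polynomial with small constant term is non-negative for all positive arguments then
its linear coefficient is not very negative. -/
theorem le_of_quadratic_nonneg {m a b : ℝ} (hm : 0 < m) (hb : 0 < b)
    (h : ∀ ε, 0 < ε → 0 ≤ a * m - ε * (m / 2) + ε ^ 2 * b) : m ≤ 16 * a * b := by
  -- This `ε` minimises the quadratic polynomial.
  have := h (m / (4 * b)) (by positivity)
  have e : a * m - m / (4 * b) * (m / 2) + (m / (4 * b)) ^ 2 * b = m / (16 * b) * (16 * a * b - m) := by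
    field_simp; ring
  rw [e] at this
  have := nonneg_of_mul_nonneg_right this (by positivity)
  linarith

theorem sqrt_small {B C N δ q M : ℝ} (hB : 0 ≤ B) (hM : 0 ≤ M) (hN : 0 ≤ N)
    (h1 : B ^ 2 * C * (N * δ) ≤ M ^ 2 / 2) (h2 : B ^ 2 * C * (N * q ^ 2) ≤ M ^ 2 / 2) :
    B * √N * √(C * (δ + q ^ 2)) ≤ M := by
  rw [mul_assoc, ← Real.sqrt_mul hN]
  calc B * √(N * (C * (δ + q ^ 2))) = √(B ^ 2 * (N * (C * (δ + q ^ 2)))) := by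
        rw [Real.sqrt_mul (sq_nonneg B), Real.sqrt_sq hB]
    _ ≤ M := Real.sqrt_le_iff.2 ⟨hM, by linarith⟩

set_option maxHeartbeats 1000000 in
/-- The length scale `l` below the logarithmic scale of the layer is bounded by a power of the energy:
the core of the argument, with the interaction of `inner` and `outer`. -/
theorem ReducedSlope.scale_le {m₀ : ℝ} (hm₀ : 0 < m₀) : ∃ η₀, 0 < η₀ ∧ ∀ B, 0 ≤ B → ∃ K l₀, 1 ≤ K ∧ 4 ≤ l₀ ∧
    ∀ (η N h l : ℝ) (X : ℝ → ℝ), ReducedSlope η B m₀ N h X → 0 ≤ η → η ≤ η₀ → 1 ≤ N → N ≤ l → l₀ ≤ l →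
      2 * l * Real.exp (l ^ 3) ≤ h → l ≤ K * N ^ 5 := by
  obtain ⟨Cb, h₀, hCb, hh₀, hband⟩ := ReducedSlope.band_bounds
  obtain ⟨C₁, C₂, hC₁, hC₂, hcross⟩ := ReducedSlope.cross_le
  obtain ⟨Cs, hCs, hself⟩ := integral_inner_sq_le
  obtain ⟨Co, hCo, houter⟩ := integral_outer_le
  obtain ⟨Ce, hCe, heo⟩ := outer_bounds
  obtain ⟨Cn, hCn, hen⟩ := energy_inner_le
  set D := C₁ * Cb with hD
  have hD0 : 0 ≤ D := mul_nonneg (by linarith) hCb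
  -- The threshold for `η` is fixed before `B`. It will be reached by a dilation, and the dilation
  -- factor enters `B`.
  refine ⟨min (min 1 (m₀ / 4)) (m₀ / (32 * (D + 1))), by positivity, fun B hB => ?_⟩
  set M := m₀ / 16 with hM
  have hM0 : 0 < M := by positivity
  set F := B ^ 2 * C₂ with hF
  have hF0 : 0 ≤ F := by positivity
  -- With `δ = c / N` the Cauchy-Schwarz error of the mixed term is of order `√(N δ) = √c`. The
  -- constant `c` is chosen so that the error is at most `M = m₀ / 16`.
  set c := min 1 (M ^ 2 / (2 * (F + 1))) with hc
  have hc0 : 0 < c := by positivity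
  have hc1 : c ≤ 1 := min_le_left _ _
  have hcF : F * c ≤ M ^ 2 / 2 := by
    have : c ≤ M ^ 2 / (2 * (F + 1)) := min_le_right _ _
    rw [le_div_iff₀ (by positivity)] at this
    linarith
  set C₃ := 2 + Ce + 3 * Co * Cb with hC₃
  set C₄ := 2 * Cn * (c ^ 5)⁻¹ + B * Cs * (c ^ 3)⁻¹ + 1 with hC₄
  have hC₃0 : 0 ≤ C₃ := by positivity
  have hC₄0 : 0 < C₄ := by positivity
  refine ⟨1 + 32 * C₃ * C₄ / m₀, max h₀ (max (32 * D) (max c⁻¹ (2 * F / (c ^ 2 * M ^ 2)))),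
    le_add_of_nonneg_right (by positivity), le_max_of_le_left hh₀,
    fun η N h l X hX hη hηη hN hNl hl hh => ?_⟩
  have hη1 : η ≤ 1 := hηη.trans ((min_le_left _ _).trans (min_le_left _ _))
  have hηm : η ≤ m₀ / 4 := hηη.trans ((min_le_left _ _).trans (min_le_right _ _))
  have hηD : D * η ≤ m₀ / 32 := by
    have : η ≤ m₀ / (32 * (D + 1)) := hηη.trans (min_le_right _ _)
    rw [le_div_iff₀ (by positivity)] at this
    linarith
  have hl1 : h₀ ≤ l := (le_max_left _ _).trans hl
  have hl2 : 32 * D ≤ l := (le_max_left _ _).trans ((le_max_right _ _).trans hl)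
  have hl3 : c⁻¹ ≤ l :=
    (le_max_left _ _).trans ((le_max_right _ _).trans ((le_max_right _ _).trans hl))
  have hl4 : 2 * F / (c ^ 2 * M ^ 2) ≤ l :=
    (le_max_right _ _).trans ((le_max_right _ _).trans ((le_max_right _ _).trans hl))
  clear hl
  have hl4' : 4 ≤ l := hh₀.trans hl1
  have hl0 : 0 < l := by linarith
  have hN0 : 0 < N := by linarith
  -- The wavelength is `l`, so the cutoff of the outer function falls into the band where the slope
  -- has mass `O(m l⁻³)`.
  set k := l⁻¹ with hk
  have hk0 : 0 < k := inv_pos.2 hl0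
  have hkl : k⁻¹ = l := inv_inv l
  have hlk : l * k = 1 := mul_inv_cancel₀ hl0.ne'
  have hk4 : k ≤ 1 / 4 := by
    rw [hk, inv_le_comm₀ hl0 (by norm_num)]; linarith
  have hNk : N * k ≤ 1 := by
    calc N * k ≤ l * k := mul_le_mul_of_nonneg_right hNl hk0.le
      _ = 1 := hlk
  have hl3e : l ^ 3 + 1 ≤ Real.exp (l ^ 3) := Real.add_one_le_exp _
  have hlle : l ^ 2 ≤ l ^ 3 := pow_le_pow_right₀ (by linarith) (by norm_num)
  have hll : l ≤ l ^ 2 := le_self_pow₀ (by linarith) (by norm_num)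
  have hhl : 2 * l * l ^ 2 ≤ h := le_trans (mul_le_mul_of_nonneg_left (by linarith) (by linarith)) hh
  have hhl2 : l ^ 2 ≤ h := (le_mul_of_one_le_left (sq_nonneg l) (by linarith)).trans hhl
  have hh2l : 2 * l ≤ h :=
    (le_mul_of_one_le_right (by linarith) (one_le_pow₀ (by linarith))).trans hhl
  have hh0 : 0 < h := by linarith
  have hhk : h⁻¹ ≤ k ^ 2 := by
    rw [hk, inv_pow]; exact inv_anti₀ (by positivity) hhl2
  -- the inner scale
  set δ := c * N⁻¹ with hδ
  have hN1 : N⁻¹ ≤ 1 := inv_le_one_of_one_le₀ hN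
  have hδ0 : 0 < δ := by positivity
  have hδ1 : δ ≤ 1 := mul_le_one₀ hc1 (by positivity) hN1
  have hδi : δ⁻¹ = c⁻¹ * N := by rw [hδ, mul_inv, inv_inv]
  have hq : k ^ 2 * δ⁻¹ ≤ c⁻¹ * k := by
    rw [hδi]
    calc k ^ 2 * (c⁻¹ * N) = c⁻¹ * k * (N * k) := by ring
      _ ≤ c⁻¹ * k := mul_le_of_le_one_right (by positivity) hNk
  have hck : c⁻¹ * k ≤ 1 := by
    calc c⁻¹ * k ≤ l * k := mul_le_mul_of_nonneg_right hl3 hk0.le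
      _ = 1 := hlk
  have hkδ : k ^ 2 * δ⁻¹ ≤ 1 := hq.trans hck
  obtain ⟨hm, hY1, hYl⟩ := hband η B m₀ N h l X hX hη hηm hl1 hh
  have hcr := hcross η B m₀ N h δ k X hX hη hB hδ0 hδ1 hk0 hk4 hkδ (by linarith) hhk
  set m := -∫ z in (0 : ℝ)..1, X z * (1 - ramp (z / h)) with hmdef
  have hm0 : 0 < m := by linarith
  clear_value D M F c C₃ C₄ k δ m
  have hsm : B * √N * √(C₂ * (δ + (k ^ 2 * δ⁻¹) ^ 2)) ≤ M := by
    refine sqrt_small hB hM0.le hN0.le ?_ ?_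
    · have : N * δ = c := by rw [hδ]; field_simp
      rw [this, ← hF]; exact hcF
    · have h1 : N * (k ^ 2 * δ⁻¹) ^ 2 ≤ (c⁻¹) ^ 2 * k := by
        calc N * (k ^ 2 * δ⁻¹) ^ 2 ≤ N * (c⁻¹ * k) ^ 2 :=
              mul_le_mul_of_nonneg_left (pow_le_pow_left₀ (by positivity) hq 2) hN0.le
          _ = c⁻¹ ^ 2 * k * (N * k) := by ring
          _ ≤ _ := mul_le_of_le_one_right (by positivity) hNk
      rw [div_le_iff₀ (by positivity)] at hl4
      have h2 := mul_le_mul_of_nonneg_left hl4 hk0.le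
      have h3 : F * (c⁻¹ ^ 2 * k) ≤ M ^ 2 / 2 := by
        have e1 : k * (l * (c ^ 2 * M ^ 2)) = c ^ 2 * M ^ 2 := by
          rw [← mul_assoc, mul_comm k, hlk, one_mul]
        rw [e1] at h2
        have e2 : F * (c⁻¹ ^ 2 * k) = k * (2 * F) / (2 * c ^ 2) := by field_simp
        rw [e2, div_le_iff₀ (by positivity)]
        linarith
      rw [← hF]
      exact (mul_le_mul_of_nonneg_left h1 hF0).trans h3
  have hY1' : C₁ * ∫ z in (1 : ℝ)..4, shift η X z ≤ m / 8 := by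
    have h1 := mul_le_mul_of_nonneg_left hY1 (by linarith : 0 ≤ C₁)
    have h2 : D * k ≤ 1 / 32 := by
      have := mul_le_mul_of_nonneg_right hl2 hk0.le
      rw [hlk] at this; linarith
    have h3 := mul_le_mul_of_nonneg_right h2 hm0.le
    have e : C₁ * (Cb * (η + 2 * m * k)) = D * η + 2 * (D * k * m) := by rw [hD]; ring
    rw [← hk, e] at h1
    linarith
  -- The three contributions are `-m`, at most `m₀/16 ≤ m/8` from Cauchy-Schwarz, and at most `m/8`
  -- from the mass between 1 and 4.
  have hcr' : (∫ z in (0 : ℝ)..1, X z * cross k δ z) + ∫ z in (1 : ℝ)..2, X z * cross k δ z ≤ -(m / 2) := by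
    linarith
  -- The self-interaction is only `O(N⁴)`. It is weakened to `l² N⁵`, the size of the energy of the
  -- inner function.
  have hE22 : ∫ z in (0 : ℝ)..2, X z * (inner k δ z * Lop k (inner k δ) z) ≤
      B * Cs * (c ^ 3)⁻¹ * (l ^ 2 * N ^ 5) := by
    have h1 := hX.cauchy 0 2 zero_le_two (fun z => inner k δ z * Lop k (inner k δ) z)
      ((inner_contDiff k δ).continuous.mul (Lop_continuous k (inner_contDiff k δ)))
    have h2 := hself δ k hδ0 hδ1 hk0 (by linarith) hkδ
    have h3 : √N ≤ N := by
      rw [Real.sqrt_le_left hN0.le]; exact le_self_pow₀ hN (by norm_num)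
    have e : (δ ^ 3)⁻¹ = (c ^ 3)⁻¹ * N ^ 3 := by rw [← inv_pow, hδi, mul_pow, inv_pow]
    calc _ ≤ _ := (le_abs_self _).trans h1
      _ ≤ (B * N) * (Cs * (δ ^ 3)⁻¹) :=
        mul_le_mul (mul_le_mul_of_nonneg_left h3 hB) h2 (Real.sqrt_nonneg _) (by positivity)
      _ = B * Cs * (c ^ 3)⁻¹ * (1 * N ^ 4) := by rw [e]; ring
      _ ≤ _ := by
        refine mul_le_mul_of_nonneg_left (mul_le_mul (one_le_pow₀ (by linarith))
          (pow_le_pow_right₀ hN (by norm_num)) (by positivity) (by positivity)) (by positivity)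
  have hE11 : ∫ z in (0 : ℝ)..h, X z * (outer k z * Lop k (outer k) z) ≤
      4 * η * k ^ 3 + Co * (3 * Cb * m * k ^ 3) := by
    refine (houter η h k X hη hk0 (by linarith) (by rw [hkl]; exact hh2l) hX.integrable hX.lower).trans ?_
    have h1 : ∫ z in l..2 * l, shift η X z ≤ ∫ z in l..4 * l, shift η X z := by
      refine intervalIntegral.integral_mono_interval le_rfl (by linarith) (by linarith) ?_
        (intervalIntegrable_shift hX.integrable hl0 (by linarith))
      filter_upwards [ae_restrict_mem measurableSet_Ioc] with z hz
      have hz0 : 0 < z := hl0.trans hz.1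
      have : 4 * l ≤ h := by
        have := mul_le_mul_of_nonneg_left (by linarith : 2 ≤ l ^ 2) (by linarith : 0 ≤ 2 * l)
        linarith
      exact (abs_nonneg _).trans (abs_le_shift hη (hX.lower z hz0 (hz.2.trans this)))
    have e : k ^ 3 = (l ^ 3)⁻¹ := by rw [hk, inv_pow]
    rw [hkl]
    have h2 := mul_le_mul_of_nonneg_left (h1.trans hYl) hCo
    rw [← e] at h2
    linarith
  have heo' : energy h k (outer k) ≤ Ce * k ^ 3 := by
    obtain ⟨-, h1⟩ := heo k hk0 (by linarith)
    exact h1 h (by rw [hkl]; exact hh2l)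
  have hen' : energy h k (inner k δ) ≤ Cn * (c ^ 5)⁻¹ * (l ^ 2 * N ^ 5) := by
    have h1 := hen δ k h hδ0 hδ1 hk0 (by linarith) hkδ (by linarith)
    have e : (δ ^ 5)⁻¹ = (c ^ 5)⁻¹ * N ^ 5 := by rw [← inv_pow, hδi, mul_pow, inv_pow]
    have e2 : (k ^ 2)⁻¹ = l ^ 2 := by rw [← inv_pow, hkl]
    rw [e, e2] at h1
    linarith
  have hk3 : 0 ≤ k ^ 3 := by positivity
  have hquad : ∀ ε, 0 < ε → 0 ≤ C₃ * k ^ 3 * m - ε * (m / 2) + ε ^ 2 * (C₄ * (l ^ 2 * N ^ 5)) := by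
    intro ε hε
    have ht := hX.test_le hη hk0 (by linarith) (by rw [hkl]; exact hh2l) δ ε
    have a1 := mul_le_mul_of_nonneg_left hcr' hε.le
    have a2 := mul_le_mul_of_nonneg_left hE22 (sq_nonneg ε)
    have a3 : η * (2 * energy h k (outer k)) ≤ m * (Ce * k ^ 3) := by
      have : η * energy h k (outer k) ≤ m / 2 * (Ce * k ^ 3) :=
        (mul_le_mul_of_nonneg_left heo' hη).trans
          (mul_le_mul_of_nonneg_right (by linarith) (by positivity))
      linarith
    have a4 : η * (2 * ε ^ 2 * energy h k (inner k δ)) ≤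
        2 * ε ^ 2 * (Cn * (c ^ 5)⁻¹ * (l ^ 2 * N ^ 5)) := by
      have h1 : η * energy h k (inner k δ) ≤ 1 * (Cn * (c ^ 5)⁻¹ * (l ^ 2 * N ^ 5)) :=
        (mul_le_mul_of_nonneg_left hen' hη).trans
          (mul_le_mul_of_nonneg_right hη1 (by positivity))
      have := mul_le_mul_of_nonneg_left h1 (by positivity : 0 ≤ 2 * ε ^ 2)
      linarith
    have a5 : 4 * η * k ^ 3 ≤ 2 * m * k ^ 3 := mul_le_mul_of_nonneg_right (by linarith) hk3
    have a6 : 0 ≤ ε ^ 2 * (l ^ 2 * N ^ 5) := by positivity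
    rw [hC₃, hC₄]
    linarith
  have hfin := le_of_quadratic_nonneg hm0 (by positivity) hquad
  -- The gain `k³` from the band beats the loss `l²` from the energy by exactly one power of `l`.
  have e : 16 * (C₃ * k ^ 3) * (C₄ * (l ^ 2 * N ^ 5)) = k * (16 * C₃ * C₄ * N ^ 5) := by
    have : k ^ 3 * l ^ 2 = k := by
      calc k ^ 3 * l ^ 2 = k * (l * k) ^ 2 := by ring
        _ = k := by rw [hlk]; ring
    calc _ = (k ^ 3 * l ^ 2) * (16 * C₃ * C₄ * N ^ 5) := by ring
      _ = _ := by rw [this]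
  rw [e] at hfin
  have h1 : l * (m₀ / 2) ≤ 16 * C₃ * C₄ * N ^ 5 := by
    have := mul_le_mul_of_nonneg_left (hm.trans hfin) hl0.le
    rwa [← mul_assoc l k, hlk, one_mul] at this
  have h2 : l ≤ 32 * C₃ * C₄ / m₀ * N ^ 5 := by
    rw [div_mul_eq_mul_div, le_div_iff₀ hm₀]; linarith
  have h3 : 0 ≤ N ^ 5 := by positivity
  linarith

/-! ### From the length scale to the Nusselt number -/

/-- The logarithm of the height is bounded by a power of the energy of a stable slope carrying a definite
negative mass in its lower half. -/
theorem exists_log_le : ∃ c U : ℝ, 0 < c ∧ 1 ≤ U ∧ ∀ (u N : ℝ) (ξ : ℝ → ℝ), U ≤ u → 1 ≤ N → N ≤ u →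
    Measurable ξ → Integrable ξ → Integrable (fun z => ξ z ^ 2) → (∫ z, ξ z ^ 2) ≤ N →
    (∀ z, z ∉ Set.Ioc 0 (u ^ 5) → ξ z = 0) → Stab (1 / 2) (u ^ 5) ξ →
    (∫ y in (0 : ℝ)..(u ^ 5), ξ y * halfCut (y / u ^ 5) ^ 2) ≤ -(1 / 2) →
    c * Real.log u ≤ N ^ 15 := by
  obtain ⟨A, m₀, U, hA, hm₀, hU, hmol⟩ := exists_mollified
  obtain ⟨η₀, hη₀, hsc⟩ := ReducedSlope.scale_le hm₀
  -- A fixed dilation by `l` brings the defect `A l⁻³` below `η₀`.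
  set l := max 1 (A / η₀) with hl
  have hl1 : 1 ≤ l := le_max_left _ _
  have hl0 : 0 < l := by linarith
  have hlη : A * (l ^ 3)⁻¹ ≤ η₀ := by
    have h1 : A / η₀ ≤ l := le_max_right _ _
    have h2 : l ≤ l ^ 3 := le_self_pow₀ hl1 (by norm_num)
    rw [div_le_iff₀ hη₀] at h1
    rw [← div_eq_mul_inv, div_le_iff₀ (by positivity)]
    have := mul_le_mul_of_nonneg_right h2 hη₀.le
    linarith
  obtain ⟨K, l₀, hK, hl₀, hsc⟩ := hsc (A * √l) (by positivity)
  refine ⟨(K ^ 3)⁻¹, max U (max (2 * l) (Real.exp (l₀ ^ 3))), by positivity,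
    le_max_of_le_left (by linarith), fun u N ξ hu hN hNu hm hi hi2 hN2 hs hst hhalf => ?_⟩
  have hu1 : U ≤ u := (le_max_left _ _).trans hu
  have hu2 : 2 * l ≤ u := (le_max_left _ _).trans ((le_max_right _ _).trans hu)
  have hu3 : Real.exp (l₀ ^ 3) ≤ u := (le_max_right _ _).trans ((le_max_right _ _).trans hu)
  have hu0 : 0 < u := by linarith
  have hlog : l₀ ^ 3 ≤ Real.log u := by rwa [Real.le_log_iff_exp_le hu0]
  have hlog0 : 0 ≤ Real.log u := le_trans (by positivity) hlog
  obtain ⟨X, hX⟩ := hmol u N ξ hu1 hNu hm hi hi2 hN2 hs hst hhalf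
  -- With `r³ = log u` the requirement on the height reads `2 r u ≤ u⁴ / l`, which holds for large
  -- `u`.
  set r := Real.log u ^ (1 / 3 : ℝ) with hr
  have hr0 : 0 ≤ r := Real.rpow_nonneg hlog0 _
  have hr3 : r ^ 3 = Real.log u := by
    rw [hr, ← Real.rpow_natCast, ← Real.rpow_mul hlog0]; norm_num
  have hlr : l₀ ≤ r := by
    refine le_of_pow_le_pow_left₀ (n := 3) (by norm_num) hr0 ?_
    rw [hr3]; exact hlog
  have hru : r ≤ u := by
    have h1 : r ≤ r ^ 3 := le_self_pow₀ (by linarith) (by norm_num)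
    have h2 := Real.log_le_self hu0.le
    linarith
  have hKi : (K ^ 3)⁻¹ ≤ 1 := inv_le_one_of_one_le₀ (one_le_pow₀ hK)
  rw [← hr3]
  -- The scale estimate needs `N ≤ r`. In the opposite case `log u = r³ ≤ N³`, which is stronger
  -- than required.
  rcases le_total N r with h | h
  · have key := hsc (A * (l ^ 3)⁻¹) N (u ^ 4 / l) r _ (hX.dilate hl0 (by positivity)) (by positivity) hlη hN h hlr
      (by
        rw [hr3, Real.exp_log hu0, le_div_iff₀ hl0]
        calc 2 * r * u * l = (2 * l) * (r * u) := by ring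
          _ ≤ u * (u * u) := mul_le_mul hu2 (mul_le_mul_of_nonneg_right hru hu0.le) (by positivity) hu0.le
          _ = u ^ 3 := by ring
          _ ≤ u ^ 4 := pow_le_pow_right₀ (by linarith) (by norm_num))
    rw [inv_mul_le_iff₀ (by positivity)]
    calc r ^ 3 ≤ (K * N ^ 5) ^ 3 := pow_le_pow_left₀ hr0 key 3
      _ = _ := by ring
  · calc (K ^ 3)⁻¹ * r ^ 3 ≤ 1 * N ^ 3 :=
        mul_le_mul hKi (pow_le_pow_left₀ hr0 h 3) (by positivity) zero_le_one
      _ ≤ N ^ 15 := by rw [one_mul]; exact pow_le_pow_right₀ hN (by norm_num)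

/-- Test functions vanish at `h`, and the integral ignores 0. The slope may thus be altered outside
the open layer, where the derivative of the profile is not controlled. -/
theorem Stab.congr_Ioo {η h : ℝ} {X X' : ℝ → ℝ} (hX : Stab η h X) (h0 : 0 ≤ h)
    (he : ∀ z ∈ Set.Ioo 0 h, X z = X' z) : Stab η h X' := by
  intro k hk w hw w0 w0' hL0 hv
  refine (hX k hk w hw w0 w0' hL0 hv).trans (le_of_eq ?_)
  apply intervalIntegral.integral_congr_ae
  refine Filter.Eventually.of_forall fun z hz => ?_
  rw [Set.uIoc_of_le h0] at hz
  rcases hz.2.lt_or_eq with h | h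
  · rw [he z ⟨hz.1, h⟩]
  · simp [hv z h.ge]

/-- The energy bound for slopes of mean `-1` that are stable in both orientations. -/
theorem exists_slope_energy_bound : ∃ c U : ℝ, 0 < c ∧ 1 ≤ U ∧ ∀ (H : ℝ) (ξ : ℝ → ℝ), U ≤ H →
    Measurable ξ → Integrable ξ → Integrable (fun z => ξ z ^ 2) → (∀ z, z ∉ Set.Ioo 0 H → ξ z = 0) →
    Stab (1 / 2) H ξ → Stab (1 / 2) H (fun z => ξ (H - z)) → ∫ z in (0 : ℝ)..H, ξ z = -1 →
    c * Real.log H ^ (1 / 15 : ℝ) ≤ ∫ z, ξ z ^ 2 := by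
  obtain ⟨c₀, U, hc₀, hU, key⟩ := exists_log_le
  -- With `log H = 5 log u` the choice gives `c¹⁵ log H ≤ (c₀ / 2) log u`, which contradicts `c₀ log
  -- u ≤ N¹⁵`.
  set c := min 1 c₀ / 10 with hc
  have hc0 : 0 < c := by positivity
  have hc1 : c ≤ 1 / 10 := by have := min_le_left 1 c₀; rw [hc]; linarith
  have hcc : c ≤ c₀ / 10 := by have := min_le_right 1 c₀; rw [hc]; linarith
  have hc15 : c ^ 15 ≤ c := pow_le_of_le_one hc0.le (by linarith) (by norm_num)
  refine ⟨c, max (U ^ 5) (Real.exp ((c ^ 15)⁻¹)), hc0, le_max_of_le_left (one_le_pow₀ hU),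
    fun H ξ hH hm hi hi2 hs hst hst' hint => ?_⟩
  have hH1 : U ^ 5 ≤ H := (le_max_left _ _).trans hH
  have hH2 : Real.exp ((c ^ 15)⁻¹) ≤ H := (le_max_right _ _).trans hH
  have hH0 : 0 < H := (Real.exp_pos _).trans_le hH2
  have hlogH : (c ^ 15)⁻¹ ≤ Real.log H := by rwa [Real.le_log_iff_exp_le hH0]
  have hlog0 : 0 ≤ Real.log H := le_trans (by positivity) hlogH
  by_contra! hlt
  -- The claimed lower bound serves, by contradiction, as an upper bound for the energy. The lower
  -- threshold for `H` makes it at least 1.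
  set N := c * Real.log H ^ (1 / 15 : ℝ) with hN
  have hN0 : 0 ≤ N := by positivity
  have hN15 : N ^ 15 = c ^ 15 * Real.log H := by
    rw [hN, mul_pow, ← Real.rpow_natCast (Real.log H ^ (1 / 15 : ℝ)), ← Real.rpow_mul hlog0]; norm_num
  have hN1 : 1 ≤ N := by
    refine le_of_pow_le_pow_left₀ (n := 15) (by norm_num) hN0 ?_
    rw [hN15, one_pow]
    rwa [inv_le_iff_one_le_mul₀' (by positivity)] at hlogH
  set u := H ^ (1 / 5 : ℝ) with hu
  have hu0 : 0 ≤ u := by positivity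
  have hu5 : u ^ 5 = H := by rw [hu, ← Real.rpow_natCast, ← Real.rpow_mul hH0.le]; norm_num
  have hUu : U ≤ u := le_of_pow_le_pow_left₀ (n := 5) (by norm_num) hu0 (by rwa [hu5])
  have hu1 : 1 ≤ u := hU.trans hUu
  have hlog : Real.log H = 5 * Real.log u := by rw [← hu5, Real.log_pow]; norm_num
  have hlu0 : 0 < Real.log u := by
    have : 0 < (c ^ 15)⁻¹ := by positivity
    linarith
  have hNu : N ≤ u := by
    refine le_of_pow_le_pow_left₀ (n := 15) (by norm_num) hu0 ?_
    rw [hN15, hlog]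
    have h1 : c ^ 15 * (5 * Real.log u) ≤ 1 / 10 * (5 * Real.log u) :=
      mul_le_mul_of_nonneg_right (by linarith) (by linarith)
    have h2 := Real.log_le_self hu0
    have h3 : u ≤ u ^ 15 := le_self_pow₀ hu1 (by norm_num)
    linarith
  -- Below the energy bound the lower half carries mass strictly above `-1/2`. Applied to the slope
  -- and to its reflection, this contradicts the total mass `-1`.
  have hcon : ∀ ξ : ℝ → ℝ, Measurable ξ → Integrable ξ → Integrable (fun z => ξ z ^ 2) →
      ∫ z, ξ z ^ 2 < N → (∀ z, z ∉ Set.Ioo 0 H → ξ z = 0) → Stab (1 / 2) H ξ →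
      -(1 / 2) < ∫ y in (0 : ℝ)..H, ξ y * halfCut (y / H) ^ 2 := by
    intro ξ hm hi hi2 hlt hs hst
    by_contra! hle
    have := key u N ξ hUu hN1 hNu hm hi hi2 hlt.le
      (fun z hz => hs z fun h => hz (by rw [hu5]; exact ⟨h.1, h.2.le⟩)) (by rwa [hu5]) (by rwa [hu5])
    rw [hN15, hlog] at this
    have h1 : c ^ 15 * (5 * Real.log u) ≤ c₀ / 10 * (5 * Real.log u) :=
      mul_le_mul_of_nonneg_right (by linarith) (by linarith)
    nlinarith
  have k1 := hcon ξ hm hi hi2 hlt hs hst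
  have e2 : ∫ z, ξ (H - z) ^ 2 = ∫ z, ξ z ^ 2 := integral_sub_left_eq_self (fun z => ξ z ^ 2) volume H
  have k2 := hcon (fun z => ξ (H - z)) (hm.comp (measurable_const.sub measurable_id)) (hi.comp_sub_left H)
    (hi2.comp_sub_left H) (by rw [e2]; exact hlt)
    (fun z hz => hs _ fun h => hz ⟨by linarith [h.2], by linarith [h.1]⟩) hst'
  have e3 : ∫ y in (0 : ℝ)..H, ξ (H - y) * halfCut (y / H) ^ 2 =
      ∫ y in (0 : ℝ)..H, ξ y * halfCut (1 - y / H) ^ 2 := by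
    have := intervalIntegral.integral_comp_sub_left (a := 0) (b := H)
      (fun y => ξ y * halfCut (1 - y / H) ^ 2) H
    rw [sub_self, sub_zero] at this
    rw [← this]
    refine intervalIntegral.integral_congr fun y _ => ?_
    congr 3
    field_simp
    ring
  rw [e3] at k2
  have c1 : Continuous fun y : ℝ => halfCut (y / H) ^ 2 :=
    (halfCut_contDiff.continuous.comp (continuous_id.div_const H)).pow 2
  have c2 : Continuous fun y : ℝ => halfCut (1 - y / H) ^ 2 :=
    (halfCut_contDiff.continuous.comp (continuous_const.sub (continuous_id.div_const H))).pow 2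
  have i1 : IntervalIntegrable (fun y => ξ y * halfCut (y / H) ^ 2) volume 0 H :=
    hi.intervalIntegrable.mul_continuousOn c1.continuousOn
  have i2 : IntervalIntegrable (fun y => ξ y * halfCut (1 - y / H) ^ 2) volume 0 H :=
    hi.intervalIntegrable.mul_continuousOn c2.continuousOn
  have e4 := intervalIntegral.integral_add i1 i2
  simp only [← mul_add, halfCut_sq_add, mul_one] at e4
  rw [hint] at e4
  linarith

/-- The energy bound for stable profiles with buoyancy coefficient `s³` in a layer of height `h`. -/
theorem exists_profile_energy_bound : ∃ c U : ℝ, 0 < c ∧ 1 ≤ U ∧ ∀ (s h : ℝ) (τ : ℝ → ℝ), 0 < s → 0 < h →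
    U ≤ s * h → IsStableProfile (s ^ 3) h τ →
    ENNReal.ofReal (s * (c * Real.log (s * h) ^ (1 / 15 : ℝ))) ≤ dirichletEnergy h τ := by
  obtain ⟨c, U, hc, hU, key⟩ := exists_slope_energy_bound
  refine ⟨c, U, hc, hU, fun s h τ hs hh hUs hτ => ?_⟩
  -- Infinite energy is trivial. Finite energy supplies the square integrability of the slope.
  by_cases htop : dirichletEnergy h τ = ⊤
  · rw [htop]; exact le_top
  have hI := hτ.absolutelyContinuous.intervalIntegrable_deriv
  have hint := hτ.absolutelyContinuous.integral_deriv_eq_sub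
  rw [hτ.value_zero, hτ.value_top] at hint
  set ξ : ℝ → ℝ := (Set.Ioo 0 h).indicator (deriv τ) with hξ
  have hm : Measurable ξ := (measurable_deriv τ).indicator measurableSet_Ioo
  have hi : Integrable ξ := by
    rw [hξ, integrable_indicator_iff measurableSet_Ioo]
    exact ((intervalIntegrable_iff_integrableOn_Ioc_of_le hh.le).1 hI).mono_set Set.Ioo_subset_Ioc_self
  have e2 : (fun z => ξ z ^ 2) = (Set.Ioo 0 h).indicator fun z => deriv τ z ^ 2 := by
    funext z
    by_cases hz : z ∈ Set.Ioo 0 h <;> simp [hξ, hz]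
  have hi2' : IntegrableOn (fun z => deriv τ z ^ 2) (Set.Ioo 0 h) := by
    refine ⟨((measurable_deriv τ).pow_const 2).aestronglyMeasurable, ?_⟩
    rw [hasFiniteIntegral_iff_ofReal (Filter.Eventually.of_forall fun z => sq_nonneg _)]
    exact lt_of_le_of_ne le_top htop
  have hi2 : Integrable fun z => ξ z ^ 2 := by
    rw [e2, integrable_indicator_iff measurableSet_Ioo]; exact hi2'
  have henergy : ENNReal.ofReal (∫ z, ξ z ^ 2) = dirichletEnergy h τ := by
    rw [e2, MeasureTheory.integral_indicator measurableSet_Ioo, dirichletEnergy]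
    exact ofReal_integral_eq_lintegral_ofReal hi2' (Filter.Eventually.of_forall fun z => sq_nonneg _)
  have hξd : ∀ z ∈ Set.Ioo 0 h, deriv τ z = ξ z := fun z hz => by rw [hξ, Set.indicator_of_mem hz]
  have hint' : ∫ z in (0 : ℝ)..h, ξ z = -1 := by
    rw [intervalIntegral.integral_of_le hh.le, integral_Ioc_eq_integral_Ioo] at hint ⊢
    rw [← setIntegral_congr_fun measurableSet_Ioo hξd, hint]
    norm_num
  have hsi : 0 < s⁻¹ := inv_pos.2 hs
  -- Stretching the layer by `s = R^{1/3}` normalises the defect to `1/2`, turns the height into `s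
  -- h`, and divides the energy by `s`.
  have hsc : (s ^ 3)⁻¹ / 2 * (s⁻¹ ^ 3)⁻¹ = 1 / 2 := by field_simp
  have hsh : h / s⁻¹ = s * h := by field_simp
  have st1 := (hτ.stable.stab.congr_Ioo hh.le hξd).dilate hsi
  have st2 := (hτ.stable.stab_reflect.congr_Ioo hh.le (X' := fun z => ξ (h - z)) fun z hz =>
    hξd _ ⟨by linarith [hz.2], by linarith [hz.1]⟩).dilate hsi
  rw [hsc, hsh] at st1 st2
  have hb := key (s * h) (fun z => s⁻¹ * ξ (s⁻¹ * z)) hUs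
    ((hm.comp (measurable_const.mul measurable_id)).const_mul _) ((hi.comp_mul_left' hsi.ne').const_mul _)
    (by
      simp only [mul_pow]
      exact (hi2.comp_mul_left' hsi.ne').const_mul _)
    (fun z hz => by
      rw [hξ, Set.indicator_of_notMem, mul_zero]
      rintro ⟨h1, h2⟩
      refine hz ⟨pos_of_mul_pos_right h1 hsi.le, ?_⟩
      rwa [inv_mul_lt_iff₀ hs] at h2)
    st1 (by
      convert st2 using 4
      field_simp)
    (by
      rw [intervalIntegral.integral_const_mul, intervalIntegral.integral_comp_mul_left _ hsi.ne', mul_zero,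
        inv_mul_cancel_left₀ hs.ne', hint', smul_eq_mul]
      field_simp)
  have e3 : ∫ z, (s⁻¹ * ξ (s⁻¹ * z)) ^ 2 = s⁻¹ * ∫ z, ξ z ^ 2 := by
    simp only [mul_pow]
    rw [MeasureTheory.integral_const_mul, Measure.integral_comp_mul_left (fun z => ξ z ^ 2), inv_inv,
      abs_of_pos hs, smul_eq_mul]
    field_simp
  rw [e3, le_inv_mul_iff₀ hs] at hb
  rw [← henergy]
  exact ENNReal.ofReal_le_ofReal hb

end BackgroundField

end

theorem theorem1 :
    ∃ c : ℝ, 0 < c ∧ ∃ C : ℝ,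
      (∀ H : ℝ, C ≤ H → ∀ τ : ℝ → ℝ, BackgroundField.IsStableProfile 1 H τ →
        ENNReal.ofReal (c * Real.log H ^ (1 / 15 : ℝ)) ≤
          BackgroundField.dirichletEnergy H τ) ∧
      (∀ H : ℝ, C ≤ H →
        ENNReal.ofReal (c * Real.log H ^ (1 / 15 : ℝ)) ≤ BackgroundField.nusseltBF 1 H) ∧
      (∀ Ra : ℝ, C ≤ Ra →
        ENNReal.ofReal (c * (Ra ^ (1 / 3 : ℝ) * Real.log Ra ^ (1 / 15 : ℝ))) ≤
          BackgroundField.nusseltBF Ra 1) := by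
  obtain ⟨c, U, hc, hU, key⟩ := BackgroundField.exists_profile_energy_bound
  -- The common threshold is `U³`, because the rescaled height in the unit container is the cube
  -- root of the Rayleigh number.
  have hU3 : U ≤ U ^ 3 := le_self_pow₀ hU (by norm_num)
  have part1 : ∀ H : ℝ, U ^ 3 ≤ H → ∀ τ : ℝ → ℝ, BackgroundField.IsStableProfile 1 H τ →
      ENNReal.ofReal (c / 3 * Real.log H ^ (1 / 15 : ℝ)) ≤ BackgroundField.dirichletEnergy H τ := by
    intro H hH τ hτ
    have h0 : 0 ≤ Real.log H ^ (1 / 15 : ℝ) := Real.rpow_nonneg (Real.log_nonneg (by linarith)) _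
    have := key 1 H τ one_pos (by linarith) (by linarith) (by rwa [one_pow])
    rw [one_mul, one_mul] at this
    refine le_trans (ENNReal.ofReal_le_ofReal ?_) this
    exact mul_le_mul_of_nonneg_right (by linarith) h0
  refine ⟨c / 3, by positivity, U ^ 3, part1, fun H hH => le_iInf₂ fun τ hτ => part1 H hH τ hτ,
    fun Ra hRa => le_iInf₂ fun τ hτ => ?_⟩
  have hRa0 : 0 < Ra := by linarith
  set s := Ra ^ (1 / 3 : ℝ) with hs
  have hs0 : 0 < s := Real.rpow_pos_of_pos hRa0 _
  have hs3 : s ^ 3 = Ra := by rw [hs, ← Real.rpow_natCast, ← Real.rpow_mul hRa0.le]; norm_num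
  have hUs : U ≤ s := le_of_pow_le_pow_left₀ (n := 3) (by norm_num) hs0.le (by rwa [hs3])
  have hk := key s 1 τ hs0 one_pos (by rwa [mul_one]) (by rwa [hs3])
  rw [mul_one] at hk
  refine le_trans (ENNReal.ofReal_le_ofReal ?_) hk
  have hlog : Real.log s = 1 / 3 * Real.log Ra := Real.log_rpow hRa0 _
  have hlog0 : 0 ≤ Real.log Ra := Real.log_nonneg (by linarith)
  -- The factor `1/3` in `log s = (1/3) log Ra` is pulled out of the power at the cost of the
  -- constant `c / 3`.
  have h13 : (1 / 3 : ℝ) ≤ (1 / 3 : ℝ) ^ (1 / 15 : ℝ) := by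
    have := Real.rpow_le_rpow_of_exponent_ge (x := 1 / 3) (by norm_num) (by norm_num)
      (by norm_num : (1 / 15 : ℝ) ≤ 1)
    rwa [Real.rpow_one] at this
  rw [hlog, Real.mul_rpow (by norm_num) hlog0]
  have hL0 : 0 ≤ Real.log Ra ^ (1 / 15 : ℝ) := Real.rpow_nonneg hlog0 _
  calc c / 3 * (s * Real.log Ra ^ (1 / 15 : ℝ)) = s * (c * (1 / 3 * Real.log Ra ^ (1 / 15 : ℝ))) := by ring
    _ ≤ _ := mul_le_mul_of_nonneg_left (mul_le_mul_of_nonneg_left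
      (mul_le_mul_of_nonneg_right h13 hL0) hc.le) hs0.le
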